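/- Let $p\ge 2$ be an integer, $\mathfrak q=e^{i\pi/p}$, $\mathfrak q^{x}=e^{i\pi x/p}$ for rational $x$, $[x]=\frac{\mathfrak q^{x}-\mathfrak q^{-x}}{\mathfrak q-\mathfrak q^{-1}}$, $[n]!=[1]\cdots[n]$, $\binom{m}{s}_{\mathfrak q}=\frac{[m]!}{[s]!\,[m-s]!}$. All algebras are over $\mathbb C$; $x'\otimes x''$ denotes a coproduct, and $x'\otimes x''\otimes x'''$ its iterate. **The Taft algebra and its doubles.** Let $B$ be the Hopf algebra generated by $E,k$ with $kE=\mathfrak q Ek$, $E^p=0$, $k^{4p}=1$, $\Delta(E)=1\otimes E+E\otimes k^2$, $\Delta(k)=k\otimes k$, $\epsilon(E)=0$, $\epsilon(k)=1$, $S(E)=-Ek^{-2}$, $S(k)=k^{-1}$. Let $F,\varkappa\in B^*$ be the functionals with $\langle F,E^mk^n\rangle=\delta_{m,1}\frac{\mathfrak q^{-n}}{\mathfrak q-\mathfrak q^{-1}}$ and $\langle\varkappa,E^mk^n\rangle=\delta_{m,0}\,\mathfrak q^{-n/2}$. Write $\langle b\rightharpoonup\beta,x\rangle=\langle\beta,xb\rangle$,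 $\langle\beta\leftharpoonup b,x\rangle=\langle\beta,bx\rangle$, $b\leftharpoonup\beta=\langle\beta,b'\rangle b''$ for $b,x\in B$, $\beta\in B^*$. The Drinfeld double $\mathscr D(B)$ is $B^*\otimes B$ with product $(\mu\otimes m)(\nu\otimes n)=\mu\,(m'\rightharpoonup\nu\leftharpoonup S^{-1}(m'''))\otimes m''n$ and coproduct $\mu\otimes m\mapsto(\mu''\otimes m')\otimes(\mu'\otimes m'')$. The Heisenberg double $\mathscr H(B^*)$ is $B^*\otimes B$ with product $(\alpha\# a)(\beta\# b)=\alpha(a'\rightharpoonup\beta)\# a''b$, with the $\mathscr D(B)$-action $$(\mu\otimes m)\triangleright(\alpha\# a)=\mu'''(m'\rightharpoonup\alpha)S^{*-1}(\mu'')\#\bigl((m''aS(m'''))\leftharpoonup S^{*-1}(\mu')\bigr)$$ and the $\mathscr D(B)$-coaction $\beta\# b\mapsto(\beta''\otimes b')\otimes(\beta'\# b'')$. **The pair $(\overline{\mathscr U}_{\mathfrak q},\overline{\mathscr H}_{\mathfrak q})$.** Let $\overline{\mathscr U}_{\mathfrak q}s\ell(2)$ be the Hopf algebra generated by $E,K,F$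 with $KEK^{-1}=\mathfrak q^2E$, $KFK^{-1}=\mathfrak q^{-2}F$, $[E,F]=\frac{K-K^{-1}}{\mathfrak q-\mathfrak q^{-1}}$, $E^p=F^p=0$, $K^{2p}=1$, $\Delta(E)=E\otimes K+1\otimes E$, $\Delta(K)=K\otimes K$, $\Delta(F)=F\otimes1+K^{-1}\otimes F$, $\epsilon(E)=\epsilon(F)=0$, $\epsilon(K)=1$, $S(E)=-EK^{-1}$, $S(K)=K^{-1}$, $S(F)=-KF$. Let $\mathbb C_{\mathfrak q}[z,\partial]$ be the algebra generated by $z,\partial$ with $z^p=\partial^p=0$, $\partial z=(\mathfrak q-\mathfrak q^{-1})1+\mathfrak q^{-2}z\partial$, and let $\overline{\mathscr H}_{\mathfrak q}s\ell(2)=\mathbb C_{\mathfrak q}[z,\partial]\otimes\mathbb C[\lambda]/(\lambda^{2p}-1)$. **Claim.** 1. $\dim B=4p^2$, $\dim\overline{\mathscr U}_{\mathfrak q}s\ell(2)=2p^3$, $\dim\mathbb C_{\mathfrak q}[z,\partial]=p^2$, $\dim\overline{\mathscr H}_{\mathfrak q}s\ell(2)=2p^3$. 2. There is exactly one structure on $\overline{\mathscr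 H}_{\mathfrak q}s\ell(2)$ of a left–left Yetter–Drinfeld $\overline{\mathscr U}_{\mathfrak q}s\ell(2)$-module algebra (a left module algebra and left comodule algebra with $(M'\triangleright A)_{(-1)}M''\otimes(M'\triangleright A)_{(0)}=M'A_{(-1)}\otimes(M''\triangleright A_{(0)})$) for which, for all $n\ge0$, $$E\triangleright\lambda^n=\mathfrak q^{-n/2}[\tfrac n2]\lambda^nz,\quad K\triangleright\lambda^n=\mathfrak q^{-n}\lambda^n,\quad F\triangleright\lambda^n=-\mathfrak q^{n/2}[\tfrac n2]\lambda^n\partial,$$ $$E\triangleright z^n=-\mathfrak q^n[n]z^{n+1},\quad K\triangleright z^n=\mathfrak q^{2n}z^n,\quad F\triangleright z^n=[n]\mathfrak q^{1-n}z^{n-1},$$ $$E\triangleright\partial^n=\mathfrak q^{1-n}[n]\partial^{n-1},\quad K\triangleright\partial^n=\mathfrak q^{-2n}\partial^n,\quad F\triangleright\partial^n=-\mathfrak q^n[n]\partial^{n+1}$$ (where $[0]z^{-1}$ and $[0]\partial^{-1}$ are read as $0$), and the coaction is given by $\lambda\mapsto1\otimes\lambda$ and, for $0\le m\le p-1$,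 $$z^m\mapsto\sum_{s=0}^m(-1)^s\mathfrak q^{s(1-m)}(\mathfrak q-\mathfrak q^{-1})^s\tbinom{m}{s}_{\mathfrak q}E^sK^{-m}\otimes z^{m-s},\qquad \partial^m\mapsto\sum_{s=0}^m\mathfrak q^{s(m-s)}(\mathfrak q-\mathfrak q^{-1})^s\tbinom{m}{s}_{\mathfrak q}F^sK^{-(m-s)}\otimes\partial^{m-s}.$$ 3. With this action and coaction $\overline{\mathscr H}_{\mathfrak q}s\ell(2)$ is braided commutative: $yx=(y_{(-1)}\triangleright x)\,y_{(0)}$ for all $x,y$. 4. This is a truncation of $(\mathscr D(B),\mathscr H(B^*))$. The Hopf algebra $\overline{\mathscr U}_{\mathfrak q}s\ell(2)$ is identified, with $E\mapsto\varepsilon\otimes E$, $F\mapsto F\otimes1$, $K\mapsto\varepsilon\otimes k^2$, with the span of the classes of $F^\ell\otimes E^mk^{2n}$ ($0\le\ell,m<p$, $0\le n<2p$) in the quotient of $\mathscr D(B)$ by the ideal generated by $\varkappa\otimes k-\varepsilon\otimes1$. The algebra $\overline{\mathscr H}_{\mathfrak q}s\ell(2)$ is the quotient by the ideal generated by $\lambda^{2p}-1$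 of the subalgebra of $\mathscr H(B^*)$ generated by $z=-(\mathfrak q-\mathfrak q^{-1})\,\varepsilon\# Ek^{-2}$, $\partial=(\mathfrak q-\mathfrak q^{-1})F\#1$ and $\lambda=\mathfrak q^{1/4}\varkappa\# k$. The action and coaction in 2 are induced by the $\mathscr D(B)$-action and coaction on $\mathscr H(B^*)$. 5. The subalgebra $\mathbb C_{\mathfrak q}[z,\partial]\subset\overline{\mathscr H}_{\mathfrak q}s\ell(2)$, with the restricted action and coaction, is also a braided commutative Yetter–Drinfeld $\overline{\mathscr U}_{\mathfrak q}s\ell(2)$-module algebra. -/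

import Mathlib

open scoped TensorProduct
noncomputable section
namespace QHeis

/-! ### scalars -/

/-- `𝔮^{1/2} = e^{iπ/(2p)}`. -/
def qh (p : ℕ) : ℂ := Complex.exp (Complex.I * Real.pi / (2 * p))

/-- `𝔮 = e^{iπ/p}`. -/
def q (p : ℕ) : ℂ := Complex.exp (Complex.I * Real.pi / p)

lemma qh_ne_zero (p : ℕ) : qh p ≠ 0 := Complex.exp_ne_zero _
lemma q_ne_zero (p : ℕ) : q p ≠ 0 := Complex.exp_ne_zero _

lemma qh_sq (p : ℕ) : qh p ^ 2 = q p := by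
  rw [qh, q, ← Complex.exp_nat_mul]; congr 1; push_cast; ring

lemma qh_pow (p : ℕ) [Fact (2 ≤ p)] : qh p ^ (4 * p) = 1 := by
  have hp : (p : ℂ) ≠ 0 := by
    have := (Fact.out : 2 ≤ p); exact_mod_cast (by omega : p ≠ 0)
  rw [qh, ← Complex.exp_nat_mul, ← Complex.exp_two_pi_mul_I]; congr 1; push_cast
  field_simp; ring

lemma q_pow (p : ℕ) [Fact (2 ≤ p)] : q p ^ (2 * p) = 1 := by
  rw [← qh_sq, ← pow_mul, ← qh_pow p]; ring_nf

lemma q_sq_pow_ne_one (p : ℕ) [Fact (2 ≤ p)] (k : ℕ) (h0 : k ≠ 0) (hk : k < p) :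
    (q p ^ 2) ^ k ≠ 1 := by
  have hp0 : p ≠ 0 := by have := (Fact.out : 2 ≤ p); omega
  have hp : (p : ℂ) ≠ 0 := by exact_mod_cast hp0
  have h := Complex.isPrimitiveRoot_exp p hp0
  have e : q p ^ 2 = Complex.exp (2 * Real.pi * Complex.I / p) := by
    rw [q, ← Complex.exp_nat_mul]; congr 1; push_cast; ring
  rw [e]; exact h.pow_ne_one_of_pos_of_lt h0 hk

/-- Gaussian binomials at `w` (nonsymmetric normalization). -/
def gaussBinom (w : ℂ) : ℕ → ℕ → ℂ
  | _, 0 => 1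
  | 0, _ + 1 => 0
  | n + 1, k + 1 => gaussBinom w n k + w ^ (k + 1) * gaussBinom w n (k + 1)

lemma gaussBinom_zero (w : ℂ) (n : ℕ) : gaussBinom w n 0 = 1 := by cases n <;> rfl

lemma gaussBinom_of_lt (w : ℂ) : ∀ n k : ℕ, n < k → gaussBinom w n k = 0
  | 0, _ + 1, _ => rfl
  | n + 1, k + 1, h => by
    rw [gaussBinom, gaussBinom_of_lt w n k (by omega), gaussBinom_of_lt w n (k + 1) (by omega)]
    simp

lemma gaussBinom_self (w : ℂ) : ∀ n : ℕ, gaussBinom w n n = 1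
  | 0 => rfl
  | n + 1 => by
    rw [gaussBinom, gaussBinom_self w n, gaussBinom_of_lt w n (n + 1) (by omega)]; simp

lemma gaussBinom_rec (w : ℂ) (n : ℕ) : ∀ k : ℕ,
    (1 - w ^ (k + 1)) * w ^ k * gaussBinom w n (k + 1) = (w ^ k - w ^ n) * gaussBinom w n k := by
  induction n with
  | zero => intro k; cases k <;> simp [gaussBinom]
  | succ n ih =>
    intro k
    cases k with
    | zero =>
      have := ih 0
      simp only [gaussBinom, gaussBinom_zero] at this ⊢
      linear_combination w * this
    | succ k =>
      have h1 := ih (k + 1)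
      have h2 := ih k
      rw [gaussBinom, gaussBinom]
      linear_combination (w ^ (k+2)) * h1 + w * h2

lemma gaussBinom_eq_zero (w : ℂ) (p : ℕ) (hp : w ^ p = 1) (h : ∀ k, k ≠ 0 → k < p → w ^ k ≠ 1)
    (k : ℕ) (hk : k + 1 < p) : gaussBinom w p (k + 1) = 0 := by
  have hw : w ≠ 0 := by rintro rfl; rw [zero_pow (by omega)] at hp; exact zero_ne_one hp
  induction k with
  | zero =>
    have := gaussBinom_rec w p 0
    rw [hp] at this
    have h1 : (1 - w ^ (0 + 1)) ≠ 0 := sub_ne_zero.2 (h _ one_ne_zero hk).symm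
    rw [zero_add, pow_one] at h1
    simpa [h1, hw] using this
  | succ k ih =>
    have := gaussBinom_rec w p (k + 1)
    rw [ih (by omega)] at this
    have h1 : (1 - w ^ (k + 1 + 1)) ≠ 0 := sub_ne_zero.2 (h _ (by omega) hk).symm
    simpa [h1, hw] using this

lemma skew_mul_pow {A : Type*} [Ring A] [Algebra ℂ A] (w : ℂ) (x y : A) (h : y * x = w • (x * y))
    (n : ℕ) : y * x ^ n = w ^ n • (x ^ n * y) := by
  induction n with
  | zero => simp
  | succ n ih =>
    rw [pow_succ, ← mul_assoc, ih, smul_mul_assoc, mul_assoc, h, mul_smul_comm, smul_smul,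
      ← mul_assoc, pow_succ]

lemma skew_pow_mul {A : Type*} [Ring A] [Algebra ℂ A] (w : ℂ) (x y : A) (h : y * x = w • (x * y))
    (n : ℕ) : y ^ n * x = w ^ n • (x * y ^ n) := by
  induction n with
  | zero => simp
  | succ n ih =>
    rw [pow_succ', mul_assoc, ih, mul_smul_comm, ← mul_assoc, h, smul_mul_assoc, smul_smul,
      mul_assoc, pow_succ]

lemma skew_mul_pow_eq_zero {A : Type*} [Ring A] [Algebra ℂ A] (w : ℂ) (x y : A)
    (h : y * x = w • (x * y)) (n : ℕ) (hx : x ^ n = 0) : (x * y) ^ n = 0 := by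
  have : ∀ n : ℕ, ∃ c : ℂ, (x * y) ^ n = c • (x ^ n * y ^ n) := by
    intro n
    induction n with
    | zero => exact ⟨1, by simp⟩
    | succ n ih =>
      obtain ⟨c, hc⟩ := ih
      refine ⟨c * w ^ n, ?_⟩
      rw [pow_succ (x * y), hc, smul_mul_assoc, mul_assoc, ← mul_assoc (y ^ n),
        skew_pow_mul w x y h, smul_mul_assoc, mul_smul_comm, smul_smul, pow_succ, pow_succ]
      simp only [mul_assoc]
  obtain ⟨c, hc⟩ := this n
  rw [hc, hx]; simp

lemma skew_add_pow {A : Type*} [Ring A] [Algebra ℂ A] (w : ℂ) (x y : A) (h : y * x = w • (x * y))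
    (n : ℕ) : (x + y) ^ n
      = ∑ k ∈ Finset.range (n + 1), gaussBinom w n k • (x ^ k * y ^ (n - k)) := by
  induction n with
  | zero => simp [gaussBinom]
  | succ n ih =>
    have e : ∀ k, y * (x ^ k * y ^ (n - k)) = w ^ k • (x ^ k * (y * y ^ (n - k))) := by
      intro k
      rw [← mul_assoc, skew_mul_pow w x y h, smul_mul_assoc, mul_assoc]
    rw [pow_succ', ih, add_mul, Finset.mul_sum, Finset.mul_sum, Finset.sum_range_succ' _ (n + 1)]
    simp only [mul_smul_comm, e, smul_smul, gaussBinom, add_smul, Finset.sum_add_distrib]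
    rw [add_assoc]
    congr 1
    · refine Finset.sum_congr rfl fun k _ => ?_
      rw [← mul_assoc, ← pow_succ', Nat.add_sub_add_right]
    · rw [Finset.sum_range_succ']
      conv_rhs => rw [Finset.sum_range_succ]
      rw [gaussBinom_of_lt w n (n + 1) (by omega)]
      simp only [gaussBinom_zero, mul_zero, zero_smul, add_zero]
      congr 1
      · refine Finset.sum_congr rfl fun k hk => ?_
        have : n - k = n - (k + 1) + 1 := by have := Finset.mem_range.1 hk; omega
        rw [← pow_succ', Nat.add_sub_add_right, this, mul_comm]
      · simp [pow_succ']

lemma skew_add_pow_eq_zero {A : Type*} [Ring A] [Algebra ℂ A] (w : ℂ) (x y : A)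
    (h : y * x = w • (x * y)) (p : ℕ) (hp : w ^ p = 1)
    (hw : ∀ k, k ≠ 0 → k < p → w ^ k ≠ 1) (hx : x ^ p = 0) (hy : y ^ p = 0) :
    (x + y) ^ p = 0 := by
  rw [skew_add_pow w x y h]
  refine Finset.sum_eq_zero fun k hk => ?_
  rcases k with _ | k
  · simp [hy]
  · rcases (Nat.lt_succ_iff.1 (Finset.mem_range.1 hk)).lt_or_eq with hk | hk
    · rw [gaussBinom_eq_zero w p hp hw k hk, zero_smul]
    · rw [hk]; simp [hx]

/-! ### Hopf algebra structures on presented algebras -/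

lemma antipode_left_mul {A : Type*} [Ring A] [Algebra ℂ A] (S : A →ₗ[ℂ] A)
    (hS : ∀ a b, S (a * b) = S b * S a) (t t' : A ⊗[ℂ] A) (c : ℂ)
    (h : LinearMap.mul' ℂ A (S.rTensor A t) = algebraMap ℂ A c) :
    LinearMap.mul' ℂ A (S.rTensor A (t * t')) =
      algebraMap ℂ A c * LinearMap.mul' ℂ A (S.rTensor A t') := by
  induction t' with
  | zero => simp
  | add x y hx hy => simp only [mul_add, map_add, hx, hy]
  | tmul b₁ b₂ =>
    have : ∀ u : A ⊗[ℂ] A, LinearMap.mul' ℂ A (S.rTensor A (u * (b₁ ⊗ₜ b₂)))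
        = S b₁ * LinearMap.mul' ℂ A (S.rTensor A u) * b₂ := by
      intro u
      induction u with
      | zero => simp
      | add x y hx hy => simp only [add_mul, mul_add, map_add, hx, hy]
      | tmul a₁ a₂ => simp [hS, mul_assoc]
    rw [this, h]
    simp [← Algebra.commutes, mul_assoc]

lemma antipode_right_mul {A : Type*} [Ring A] [Algebra ℂ A] (S : A →ₗ[ℂ] A)
    (hS : ∀ a b, S (a * b) = S b * S a) (t t' : A ⊗[ℂ] A) (c : ℂ)
    (h : LinearMap.mul' ℂ A (S.lTensor A t') = algebraMap ℂ A c) :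
    LinearMap.mul' ℂ A (S.lTensor A (t * t')) =
      LinearMap.mul' ℂ A (S.lTensor A t) * algebraMap ℂ A c := by
  induction t with
  | zero => simp
  | add x y hx hy => simp only [add_mul, map_add, hx, hy]
  | tmul b₁ b₂ =>
    have : ∀ u : A ⊗[ℂ] A, LinearMap.mul' ℂ A (S.lTensor A ((b₁ ⊗ₜ b₂) * u))
        = b₁ * LinearMap.mul' ℂ A (S.lTensor A u) * S b₂ := by
      intro u
      induction u with
      | zero => simp
      | add x y hx hy => simp only [add_mul, mul_add, map_add, hx, hy]
      | tmul a₁ a₂ => simp [hS, mul_assoc]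
    rw [this, h]
    simp [← Algebra.commutes, mul_assoc]

/-- A bialgebra generated by a set `s`, with an algebra antihomomorphism `S` that satisfies the
antipode axioms on `s`, is a Hopf algebra with antipode `S`. -/
abbrev hopfOfGenerators {A : Type} [Ring A] [Bialgebra ℂ A] (S : A →ₐ[ℂ] Aᵐᵒᵖ) (s : Set A)
    (hs : Algebra.adjoin ℂ s = ⊤)
    (hl : ∀ a ∈ s, LinearMap.mul' ℂ A
      (((MulOpposite.opLinearEquiv ℂ).symm.toLinearMap ∘ₗ S.toLinearMap).rTensor A
        (Coalgebra.comul (R := ℂ) a)) = algebraMap ℂ A (Coalgebra.counit (R := ℂ) a))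
    (hr : ∀ a ∈ s, LinearMap.mul' ℂ A
      (((MulOpposite.opLinearEquiv ℂ).symm.toLinearMap ∘ₗ S.toLinearMap).lTensor A
        (Coalgebra.comul (R := ℂ) a)) = algebraMap ℂ A (Coalgebra.counit (R := ℂ) a)) :
    HopfAlgebra ℂ A where
  antipode := (MulOpposite.opLinearEquiv ℂ).symm.toLinearMap ∘ₗ S.toLinearMap
  mul_antipode_rTensor_comul := by
    ext a
    have ha : a ∈ Algebra.adjoin ℂ s := hs ▸ Algebra.mem_top
    induction ha using Algebra.adjoin_induction with
    | mem x hx => simpa using hl x hx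
    | algebraMap r => simp [Algebra.algebraMap_eq_smul_one, Algebra.TensorProduct.one_def]
    | add x y _ _ hx hy => simp only [map_add, hx, hy]
    | mul x y _ _ hx hy =>
      simp only [LinearMap.comp_apply] at hx hy ⊢
      rw [Bialgebra.comul_mul, antipode_left_mul _ (by simp) _ _ _ hx, hy]
      simp
  mul_antipode_lTensor_comul := by
    ext a
    have ha : a ∈ Algebra.adjoin ℂ s := hs ▸ Algebra.mem_top
    induction ha using Algebra.adjoin_induction with
    | mem x hx => simpa using hr x hx
    | algebraMap r => simp [Algebra.algebraMap_eq_smul_one, Algebra.TensorProduct.one_def]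
    | add x y _ _ hx hy => simp only [map_add, hx, hy]
    | mul x y _ _ hx hy =>
      simp only [LinearMap.comp_apply] at hx hy ⊢
      rw [Bialgebra.comul_mul, antipode_right_mul _ (by simp) _ _ _ hy, hx]
      simp

lemma adjoin_ringQuot {X : Type} (r : FreeAlgebra ℂ X → FreeAlgebra ℂ X → Prop) :
    Algebra.adjoin ℂ (Set.range fun x => RingQuot.mkAlgHom ℂ r (FreeAlgebra.ι ℂ x)) = ⊤ := by
  have : (Set.range fun x => RingQuot.mkAlgHom ℂ r (FreeAlgebra.ι ℂ x))
      = RingQuot.mkAlgHom ℂ r '' Set.range (FreeAlgebra.ι ℂ) := by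
    rw [← Set.range_comp]; rfl
  rw [this, ← AlgHom.map_adjoin, FreeAlgebra.adjoin_range_ι, Algebra.map_top]
  exact (AlgHom.range_eq_top _).2 (RingQuot.mkAlgHom_surjective ℂ r)

/-! ### The Taft Hopf algebra `B` -/

inductive TaftGen
  | E
  | k

/-- `k E = 𝔮 E k`, `E^p = 0`, `k^{4p} = 1`. -/
inductive TaftRel (p : ℕ) : FreeAlgebra ℂ TaftGen → FreeAlgebra ℂ TaftGen → Prop
  | kE : TaftRel p (FreeAlgebra.ι ℂ .k * FreeAlgebra.ι ℂ .E)
      (q p • (FreeAlgebra.ι ℂ .E * FreeAlgebra.ι ℂ .k))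
  | E_pow : TaftRel p (FreeAlgebra.ι ℂ .E ^ p) 0
  | k_pow : TaftRel p (FreeAlgebra.ι ℂ .k ^ (4 * p)) 1

/-- The algebra generated by `E`, `k` with `k E = 𝔮 E k`, `E^p = 0`, `k^{4p} = 1`. -/
def Taft (p : ℕ) : Type := RingQuot (TaftRel p)

namespace Taft
variable (p : ℕ)

instance : Ring (Taft p) := inferInstanceAs (Ring (RingQuot (TaftRel p)))
instance : Algebra ℂ (Taft p) := inferInstanceAs (Algebra ℂ (RingQuot (TaftRel p)))

def E : Taft p := RingQuot.mkAlgHom ℂ (TaftRel p) (FreeAlgebra.ι ℂ .E)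
def k : Taft p := RingQuot.mkAlgHom ℂ (TaftRel p) (FreeAlgebra.ι ℂ .k)
/-- `k⁻¹ = k^{4p-1}`. -/
def kInv : Taft p := k p ^ (4 * p - 1)

lemma k_mul_E : k p * E p = q p • (E p * k p) := by
  simpa using! RingQuot.mkAlgHom_rel ℂ (TaftRel.kE (p := p))

lemma E_pow : E p ^ p = 0 := by
  simpa using! RingQuot.mkAlgHom_rel ℂ (TaftRel.E_pow (p := p))

lemma k_pow : k p ^ (4 * p) = 1 := by
  simpa using! RingQuot.mkAlgHom_rel ℂ (TaftRel.k_pow (p := p))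

variable {p}

/-- The universal property of the presentation. -/
def lift {A : Type*} [Ring A] [Algebra ℂ A] (e κ : A) (h₁ : κ * e = q p • (e * κ))
    (h₂ : e ^ p = 0) (h₃ : κ ^ (4 * p) = 1) : Taft p →ₐ[ℂ] A :=
  RingQuot.liftAlgHom ℂ ⟨FreeAlgebra.lift ℂ (fun | .E => e | .k => κ), by
    rintro x y (_ | _ | _) <;> simp [h₁, h₂, h₃]⟩

section
variable {A : Type*} [Ring A] [Algebra ℂ A] (e κ : A) (h₁ : κ * e = q p • (e * κ))
    (h₂ : e ^ p = 0) (h₃ : κ ^ (4 * p) = 1)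

@[simp] lemma lift_E : lift e κ h₁ h₂ h₃ (E p) = e :=
  (RingQuot.liftAlgHom_mkAlgHom_apply _ _ _ _).trans (by simp)

@[simp] lemma lift_k : lift e κ h₁ h₂ h₃ (k p) = κ :=
  (RingQuot.liftAlgHom_mkAlgHom_apply _ _ _ _).trans (by simp)

end

lemma adjoin_eq_top : Algebra.adjoin ℂ {E p, k p} = (⊤ : Subalgebra ℂ (Taft p)) := by
  refine top_le_iff.1 ((adjoin_ringQuot (TaftRel p)).ge.trans (Algebra.adjoin_mono ?_))
  rintro _ ⟨_ | _, rfl⟩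
  · exact Or.inl rfl
  · exact Or.inr rfl

lemma hom_ext {A : Type*} [Semiring A] [Algebra ℂ A] {f g : Taft p →ₐ[ℂ] A}
    (hE : f (E p) = g (E p)) (hk : f (k p) = g (k p)) : f = g := by
  refine AlgHom.ext_of_adjoin_eq_top adjoin_eq_top ?_
  rintro _ (rfl | rfl)
  · exact hE
  · exact hk

lemma kInv_pow : kInv p ^ (4 * p) = 1 := by
  rw [kInv, ← pow_mul, mul_comm, pow_mul, k_pow, one_pow]

lemma k_sq_mul_E : k p ^ 2 * E p = q p ^ 2 • (E p * k p ^ 2) :=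
  skew_pow_mul _ _ _ (k_mul_E p) 2

variable [hp : Fact (2 ≤ p)]

lemma kInv_mul : kInv p * k p = 1 := by
  have := hp.out
  rw [kInv, ← pow_succ, show 4 * p - 1 + 1 = 4 * p by omega, k_pow]

lemma mul_kInv : k p * kInv p = 1 := by
  have := hp.out
  rw [kInv, ← pow_succ', show 4 * p - 1 + 1 = 4 * p by omega, k_pow]

lemma E_mul_kInv : E p * kInv p = q p • (kInv p * E p) := by
  have h : kInv p * (k p * E p) * kInv p = kInv p * (q p • (E p * k p)) * kInv p := by
    rw [k_mul_E]
  have h₁ : kInv p * (k p * E p) * kInv p = E p * kInv p := by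
    rw [← mul_assoc, kInv_mul, one_mul]
  have h₂ : kInv p * (q p • (E p * k p)) * kInv p = q p • (kInv p * E p) := by
    rw [mul_smul_comm, smul_mul_assoc, mul_assoc, mul_assoc (E p), mul_kInv, mul_one]
  rw [← h₁, h, h₂]

/-- `Δ(E) = 1 ⊗ E + E ⊗ k²`, `Δ(k) = k ⊗ k`. -/
def comulHom : Taft p →ₐ[ℂ] Taft p ⊗[ℂ] Taft p :=
  lift (1 ⊗ₜ E p + E p ⊗ₜ (k p ^ 2)) (k p ⊗ₜ k p)
    (by simp [mul_add, add_mul, k_mul_E, TensorProduct.tmul_smul, TensorProduct.smul_tmul',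
          ← pow_succ, ← pow_succ'])
    (by
      refine skew_add_pow_eq_zero (q p ^ 2) _ _ ?_ p ?_ (q_sq_pow_ne_one p) ?_ ?_
      · simp [k_sq_mul_E, TensorProduct.tmul_smul]
      · rw [← pow_mul, q_pow]
      · simp [Algebra.TensorProduct.tmul_pow, E_pow]
      · simp [Algebra.TensorProduct.tmul_pow, E_pow])
    (by simp [Algebra.TensorProduct.tmul_pow, k_pow, Algebra.TensorProduct.one_def])

/-- `ε(E) = 0`, `ε(k) = 1`. -/
def counitHom : Taft p →ₐ[ℂ] ℂ :=
  lift 0 1 (by simp) (by have := hp.out; simp; omega) (by simp)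

/-- `S(E) = -E k^{-2}`, `S(k) = k^{-1}`, as an antihomomorphism. -/
def antipodeHom : Taft p →ₐ[ℂ] (Taft p)ᵐᵒᵖ :=
  lift (MulOpposite.op (-(E p * kInv p ^ 2))) (MulOpposite.op (kInv p))
    (by
      rw [← MulOpposite.op_mul, ← MulOpposite.op_mul, ← MulOpposite.op_smul]
      congr 1
      rw [neg_mul, mul_neg, smul_neg, ← mul_assoc, mul_assoc, ← pow_succ, pow_succ', ← mul_assoc,
        E_mul_kInv, smul_mul_assoc])
    (by
      rw [← MulOpposite.op_pow, neg_pow,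
        skew_mul_pow_eq_zero ((q p)⁻¹ ^ 2) _ _ ?_ p (E_pow p)]
      · simp
      · refine skew_pow_mul _ _ _ ?_ 2
        rw [E_mul_kInv, smul_smul, inv_mul_cancel₀ (q_ne_zero p), one_smul])
    (by rw [← MulOpposite.op_pow, kInv_pow]; rfl)

instance : Bialgebra ℂ (Taft p) :=
  Bialgebra.ofAlgHom comulHom counitHom
    (by
      apply hom_ext <;> simp [comulHom, TensorProduct.add_tmul, TensorProduct.tmul_add,
        Algebra.TensorProduct.one_def, Algebra.TensorProduct.tmul_pow, add_assoc])
    (by apply hom_ext <;> simp [comulHom, counitHom])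
    (by apply hom_ext <;> simp [comulHom, counitHom])

@[simp] lemma comul_E : Coalgebra.comul (R := ℂ) (E p) = 1 ⊗ₜ E p + E p ⊗ₜ (k p ^ 2) :=
  lift_E ..
@[simp] lemma comul_k : Coalgebra.comul (R := ℂ) (k p) = k p ⊗ₜ k p := lift_k ..
@[simp] lemma counit_E : Coalgebra.counit (R := ℂ) (E p) = 0 := lift_E ..
@[simp] lemma counit_k : Coalgebra.counit (R := ℂ) (k p) = 1 := lift_k ..

instance : HopfAlgebra ℂ (Taft p) :=
  hopfOfGenerators antipodeHom {E p, k p} adjoin_eq_top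
    (by
      have h : kInv p ^ 2 * k p ^ 2 = 1 := by
        rw [← (show Commute (kInv p) (k p) from kInv_mul.trans mul_kInv.symm).mul_pow, kInv_mul,
          one_pow]
      rintro _ (rfl | rfl)
      · simp [antipodeHom, mul_assoc, h]
      · simp [antipodeHom, kInv_mul])
    (by
      rintro _ (rfl | rfl)
      · simp [antipodeHom]
      · simp [antipodeHom, mul_kInv])

lemma antipode_E : HopfAlgebra.antipode ℂ (E p) = -(E p * kInv p ^ 2) :=
  congrArg MulOpposite.unop (lift_E ..)
lemma antipode_k : HopfAlgebra.antipode ℂ (k p) = kInv p :=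
  congrArg MulOpposite.unop (lift_k ..)

instance : Module.Finite ℂ (Taft p) := by
  let s : Set (Taft p) := Set.range fun x : Fin p × Fin (4 * p) => E p ^ (x.1 : ℕ) * k p ^ (x.2 : ℕ)
  have hs : ∀ m n : ℕ, E p ^ m * k p ^ n ∈ Submodule.span ℂ s := by
    intro m n
    by_cases hm : m < p
    · have h4 : n % (4 * p) < 4 * p := Nat.mod_lt _ (by omega)
      rw [show k p ^ n = k p ^ (n % (4 * p)) by
        conv_lhs => rw [← Nat.div_add_mod n (4 * p), pow_add, pow_mul, k_pow, one_pow, one_mul]]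
      exact Submodule.subset_span ⟨(⟨m, hm⟩, ⟨_, h4⟩), rfl⟩
    · rw [show m = p + (m - p) by omega, pow_add, E_pow]; simp
  have hE : ∀ x ∈ Submodule.span ℂ s, E p * x ∈ Submodule.span ℂ s := by
    intro x hx
    induction hx using Submodule.span_induction with
    | mem x hx =>
      obtain ⟨y, rfl⟩ := hx
      simpa [pow_succ', mul_assoc] using hs (y.1 + 1) y.2
    | zero => simp
    | add x y _ _ hx hy => rw [mul_add]; exact add_mem hx hy
    | smul c x _ hx => rw [mul_smul_comm]; exact Submodule.smul_mem _ _ hx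
  have hk : ∀ x ∈ Submodule.span ℂ s, k p * x ∈ Submodule.span ℂ s := by
    intro x hx
    induction hx using Submodule.span_induction with
    | mem x hx =>
      obtain ⟨y, rfl⟩ := hx
      rw [← mul_assoc, skew_mul_pow _ _ _ (k_mul_E p), smul_mul_assoc, mul_assoc, ← pow_succ']
      exact Submodule.smul_mem _ _ (hs _ _)
    | zero => simp
    | add x y _ _ hx hy => rw [mul_add]; exact add_mem hx hy
    | smul c x _ hx => rw [mul_smul_comm]; exact Submodule.smul_mem _ _ hx
  have key : ∀ a x : Taft p, x ∈ Submodule.span ℂ s → a * x ∈ Submodule.span ℂ s := by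
    intro a
    have ha : a ∈ Algebra.adjoin ℂ {E p, k p} := adjoin_eq_top ▸ Algebra.mem_top
    induction ha using Algebra.adjoin_induction with
    | mem y hy =>
      rcases hy with rfl | rfl
      · exact hE
      · exact hk
    | algebraMap r =>
      intro x hx
      rw [← Algebra.smul_def]; exact Submodule.smul_mem _ _ hx
    | add x y _ _ hx hy => intro z hz; rw [add_mul]; exact add_mem (hx z hz) (hy z hz)
    | mul x y _ _ hx hy => intro z hz; rw [mul_assoc]; exact hx _ (hy z hz)
  have htop : Submodule.span ℂ s = ⊤ := by
    refine top_le_iff.1 fun a _ => ?_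
    simpa using key a 1 (by simpa using hs 0 0)
  exact Module.finite_def.2 (htop ▸ Submodule.fg_span (Set.finite_range _))

/-- The antipode of `B` is bijective. -/
lemma isUnit_antipode :
    IsUnit (HopfAlgebra.antipode ℂ (A := Taft p) : Module.End ℂ (Taft p)) := by
  have hsurj : Function.Surjective (HopfAlgebra.antipode ℂ (A := Taft p)) := by
    intro a
    have ha : a ∈ Algebra.adjoin ℂ {E p, k p} := adjoin_eq_top ▸ Algebra.mem_top
    induction ha using Algebra.adjoin_induction with
    | mem y hy =>
      have hk : HopfAlgebra.antipode ℂ (kInv p) = k p := by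
        have h : HopfAlgebra.antipode ℂ (kInv p) * kInv p = 1 := by
          have h := HopfAlgebra.antipode_mul_antidistrib (R := ℂ) (k p) (kInv p)
          rwa [antipode_k, mul_kInv, HopfAlgebra.antipode_one, eq_comm] at h
        rw [← mul_one (HopfAlgebra.antipode ℂ (kInv p)), ← kInv_mul, ← mul_assoc, h, one_mul]
      rcases hy with rfl | rfl
      · refine ⟨-(kInv p ^ 2 * E p), ?_⟩
        have h2 : kInv p ^ 2 * k p ^ 2 = 1 := by
          rw [← (show Commute (kInv p) (k p) from kInv_mul.trans mul_kInv.symm).mul_pow, kInv_mul,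
            one_pow]
        rw [map_neg, HopfAlgebra.antipode_mul_antidistrib, antipode_E, sq (kInv p),
          HopfAlgebra.antipode_mul_antidistrib, hk, ← sq, ← sq, neg_mul, neg_neg, mul_assoc, h2,
          mul_one]
      · exact ⟨_, hk⟩
    | algebraMap r => 
      exact ⟨algebraMap _ _ r, by simp [Algebra.algebraMap_eq_smul_one]⟩
    | add x y _ _ hx hy =>
      obtain ⟨a, rfl⟩ := hx
      obtain ⟨b, rfl⟩ := hy
      exact ⟨a + b, map_add _ _ _⟩
    | mul x y _ _ hx hy =>
      obtain ⟨a, rfl⟩ := hx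
      obtain ⟨b, rfl⟩ := hy
      exact ⟨b * a, by simp [HopfAlgebra.antipode_mul_antidistrib]⟩
  exact (Module.End.isUnit_iff _).2
    ⟨LinearMap.injective_iff_surjective.2 hsurj, hsurj⟩

/-- The linear functional `F` on `B`, determined by its values on the monomials `E^m k^n` (see `F_apply`): the upper
right matrix entry of a two-dimensional representation. -/
def F : Module.Dual ℂ (Taft p) :=
  Matrix.entryLinearMap ℂ ℂ 0 1 ∘ₗ
    (lift (p := p) (A := Matrix (Fin 2) (Fin 2) ℂ) !![0, (q p - (q p)⁻¹)⁻¹; 0, 0]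
      (Matrix.diagonal ![1, (q p)⁻¹])
      (by
        have := q_ne_zero p
        ext i j
        rw [Matrix.smul_apply, Matrix.diagonal_mul, Matrix.mul_diagonal]
        fin_cases i <;> fin_cases j <;> simp
        field_simp)
      (by
        obtain ⟨r, hr⟩ := Nat.exists_eq_add_of_le hp.out
        conv_lhs => rw [hr, pow_add, sq, ← hr]
        have : (!![0, (q p - (q p)⁻¹)⁻¹; 0, 0] : Matrix (Fin 2) (Fin 2) ℂ)
            * !![0, (q p - (q p)⁻¹)⁻¹; 0, 0] = 0 := by
          ext i j; fin_cases i <;> fin_cases j <;> simp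
        rw [this, zero_mul])
      (by
        have h : (q p)⁻¹ ^ (4 * p) = 1 := by
          rw [inv_pow, show 4 * p = 2 * p * 2 by ring, pow_mul, q_pow, one_pow, inv_one]
        rw [Matrix.diagonal_pow, ← Matrix.diagonal_one]
        congr 1
        ext i
        fin_cases i <;> simp [h, -inv_pow])).toLinearMap

lemma F_apply (m n : ℕ) : F (E p ^ m * k p ^ n) =
    if m = 1 then (q p)⁻¹ ^ n / (q p - (q p)⁻¹) else 0 := by
  simp only [F, LinearMap.comp_apply, AlgHom.toLinearMap_apply, map_mul, map_pow, lift_E, lift_k,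
    Matrix.diagonal_pow, Matrix.entryLinearMap_apply, Matrix.mul_diagonal]
  rcases m with _ | _ | m
  · simp
  · simp [div_eq_inv_mul]
  · have : (!![0, (q p - (q p)⁻¹)⁻¹; 0, 0] : Matrix (Fin 2) (Fin 2) ℂ)
        * !![0, (q p - (q p)⁻¹)⁻¹; 0, 0] = 0 := by
      ext i j; fin_cases i <;> fin_cases j <;> simp
    rw [pow_succ, pow_succ, mul_assoc, this]
    simp

/-- The linear functional `ϰ` on `B`, determined by its values on the monomials `E^m k^n` (see
`kappa_apply`): a one-dimensional representation. -/
def kappa : Module.Dual ℂ (Taft p) :=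
  (lift (p := p) (A := ℂ) 0 (qh p)⁻¹ (by simp) (by have := hp.out; simp; omega)
    (by rw [inv_pow, qh_pow, inv_one])).toLinearMap

lemma kappa_apply (m n : ℕ) : kappa (E p ^ m * k p ^ n) = if m = 0 then (qh p)⁻¹ ^ n else 0 := by
  simp [kappa, zero_pow_eq]
end Taft

/-! ### The restricted quantum group `U_q sl(2)` -/

inductive UqGen
  | E
  | K
  | F

/-- `K E K⁻¹ = 𝔮² E`, `K F K⁻¹ = 𝔮⁻² F`, `[E,F] = (K - K⁻¹)/(𝔮 - 𝔮⁻¹)`, `E^p = F^p = 0`,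
`K^{2p} = 1`; here `K⁻¹ = K^{2p-1}`. -/
inductive UqRel (p : ℕ) : FreeAlgebra ℂ UqGen → FreeAlgebra ℂ UqGen → Prop
  | KE : UqRel p (FreeAlgebra.ι ℂ .K * FreeAlgebra.ι ℂ .E * FreeAlgebra.ι ℂ .K ^ (2 * p - 1))
      (q p ^ 2 • FreeAlgebra.ι ℂ .E)
  | KF : UqRel p (FreeAlgebra.ι ℂ .K * FreeAlgebra.ι ℂ .F * FreeAlgebra.ι ℂ .K ^ (2 * p - 1))
      ((q p ^ 2)⁻¹ • FreeAlgebra.ι ℂ .F)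
  | EF : UqRel p
      (FreeAlgebra.ι ℂ .E * FreeAlgebra.ι ℂ .F - FreeAlgebra.ι ℂ .F * FreeAlgebra.ι ℂ .E)
      ((q p - (q p)⁻¹)⁻¹ • (FreeAlgebra.ι ℂ .K - FreeAlgebra.ι ℂ .K ^ (2 * p - 1)))
  | E_pow : UqRel p (FreeAlgebra.ι ℂ .E ^ p) 0
  | F_pow : UqRel p (FreeAlgebra.ι ℂ .F ^ p) 0
  | K_pow : UqRel p (FreeAlgebra.ι ℂ .K ^ (2 * p)) 1

/-- The restricted quantum group `U_q sl(2)` at `𝔮 = e^{iπ/p}`. -/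
def Uq (p : ℕ) : Type := RingQuot (UqRel p)

namespace Uq
variable (p : ℕ)

instance : Ring (Uq p) := inferInstanceAs (Ring (RingQuot (UqRel p)))
instance : Algebra ℂ (Uq p) := inferInstanceAs (Algebra ℂ (RingQuot (UqRel p)))

def E : Uq p := RingQuot.mkAlgHom ℂ (UqRel p) (FreeAlgebra.ι ℂ .E)
def K : Uq p := RingQuot.mkAlgHom ℂ (UqRel p) (FreeAlgebra.ι ℂ .K)
def F : Uq p := RingQuot.mkAlgHom ℂ (UqRel p) (FreeAlgebra.ι ℂ .F)
/-- `K⁻¹ = K^{2p-1}`. -/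
def KInv : Uq p := K p ^ (2 * p - 1)

lemma K_mul_E_mul_KInv : K p * E p * KInv p = q p ^ 2 • E p := by
  simpa using! RingQuot.mkAlgHom_rel ℂ (UqRel.KE (p := p))

lemma K_mul_F_mul_KInv : K p * F p * KInv p = (q p ^ 2)⁻¹ • F p := by
  simpa using! RingQuot.mkAlgHom_rel ℂ (UqRel.KF (p := p))

lemma E_mul_F_sub : E p * F p - F p * E p = (q p - (q p)⁻¹)⁻¹ • (K p - KInv p) := by
  simpa using! RingQuot.mkAlgHom_rel ℂ (UqRel.EF (p := p))

lemma E_pow : E p ^ p = 0 := by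
  simpa using! RingQuot.mkAlgHom_rel ℂ (UqRel.E_pow (p := p))

lemma F_pow : F p ^ p = 0 := by
  simpa using! RingQuot.mkAlgHom_rel ℂ (UqRel.F_pow (p := p))

lemma K_pow : K p ^ (2 * p) = 1 := by
  simpa using! RingQuot.mkAlgHom_rel ℂ (UqRel.K_pow (p := p))

variable {p}

/-- The universal property of the presentation. -/
def lift {A : Type*} [Ring A] [Algebra ℂ A] (e κ f κ' : A) (h : κ ^ (2 * p - 1) = κ')
    (h₁ : κ * e * κ' = q p ^ 2 • e) (h₂ : κ * f * κ' = (q p ^ 2)⁻¹ • f)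
    (h₃ : e * f - f * e = (q p - (q p)⁻¹)⁻¹ • (κ - κ'))
    (h₄ : e ^ p = 0) (h₅ : f ^ p = 0) (h₆ : κ ^ (2 * p) = 1) : Uq p →ₐ[ℂ] A :=
  RingQuot.liftAlgHom ℂ ⟨FreeAlgebra.lift ℂ (fun | .E => e | .K => κ | .F => f), by
    rintro x y (_ | _ | _ | _ | _ | _) <;> simp [h, h₁, h₂, h₃, h₄, h₅, h₆]⟩

section
variable {A : Type*} [Ring A] [Algebra ℂ A] (e κ f κ' : A) (h : κ ^ (2 * p - 1) = κ')
    (h₁ : κ * e * κ' = q p ^ 2 • e) (h₂ : κ * f * κ' = (q p ^ 2)⁻¹ • f)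
    (h₃ : e * f - f * e = (q p - (q p)⁻¹)⁻¹ • (κ - κ'))
    (h₄ : e ^ p = 0) (h₅ : f ^ p = 0) (h₆ : κ ^ (2 * p) = 1)

@[simp] lemma lift_E : lift e κ f κ' h h₁ h₂ h₃ h₄ h₅ h₆ (E p) = e :=
  (RingQuot.liftAlgHom_mkAlgHom_apply _ _ _ _).trans (by simp)

@[simp] lemma lift_K : lift e κ f κ' h h₁ h₂ h₃ h₄ h₅ h₆ (K p) = κ :=
  (RingQuot.liftAlgHom_mkAlgHom_apply _ _ _ _).trans (by simp)

@[simp] lemma lift_F : lift e κ f κ' h h₁ h₂ h₃ h₄ h₅ h₆ (F p) = f :=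
  (RingQuot.liftAlgHom_mkAlgHom_apply _ _ _ _).trans (by simp)

@[simp] lemma lift_KInv : lift e κ f κ' h h₁ h₂ h₃ h₄ h₅ h₆ (KInv p) = κ' := by
  rw [KInv, map_pow, lift_K, h]

end

lemma adjoin_eq_top : Algebra.adjoin ℂ {E p, K p, F p} = (⊤ : Subalgebra ℂ (Uq p)) := by
  refine top_le_iff.1 ((adjoin_ringQuot (UqRel p)).ge.trans (Algebra.adjoin_mono ?_))
  rintro _ ⟨_ | _ | _, rfl⟩
  · exact Or.inl rfl
  · exact Or.inr (Or.inl rfl)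
  · exact Or.inr (Or.inr rfl)

lemma hom_ext {A : Type*} [Semiring A] [Algebra ℂ A] {f g : Uq p →ₐ[ℂ] A}
    (hE : f (E p) = g (E p)) (hK : f (K p) = g (K p)) (hF : f (F p) = g (F p)) : f = g := by
  refine AlgHom.ext_of_adjoin_eq_top adjoin_eq_top ?_
  rintro _ (rfl | rfl | rfl)
  · exact hE
  · exact hK
  · exact hF

lemma q_sq_ne_zero : q p ^ 2 ≠ 0 := pow_ne_zero _ (q_ne_zero p)

variable [hp : Fact (2 ≤ p)]

lemma KInv_mul : KInv p * K p = 1 := by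
  have := hp.out
  rw [KInv, ← pow_succ, show 2 * p - 1 + 1 = 2 * p by omega, K_pow]

lemma mul_KInv : K p * KInv p = 1 := by
  have := hp.out
  rw [KInv, ← pow_succ', show 2 * p - 1 + 1 = 2 * p by omega, K_pow]

lemma KInv_pow : KInv p ^ (2 * p - 1) = K p := by
  have h : KInv p ^ (2 * p) = 1 := by
    rw [KInv, ← pow_mul, mul_comm, pow_mul, K_pow, one_pow]
  have := hp.out
  rw [show 2 * p = 2 * p - 1 + 1 by omega, pow_succ] at h
  rw [← mul_one (KInv p ^ (2 * p - 1)), ← KInv_mul, ← mul_assoc, h, one_mul]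

lemma K_mul_E : K p * E p = q p ^ 2 • (E p * K p) := by
  rw [← smul_mul_assoc, ← K_mul_E_mul_KInv, mul_assoc _ (KInv p), KInv_mul, mul_one]

lemma K_mul_F : K p * F p = (q p ^ 2)⁻¹ • (F p * K p) := by
  rw [← smul_mul_assoc, ← K_mul_F_mul_KInv, mul_assoc _ (KInv p), KInv_mul, mul_one]

lemma E_mul_KInv : E p * KInv p = q p ^ 2 • (KInv p * E p) := by
  rw [← mul_smul_comm, ← K_mul_E_mul_KInv, ← mul_assoc, ← mul_assoc, KInv_mul, one_mul]

lemma F_mul_KInv : F p * KInv p = (q p ^ 2)⁻¹ • (KInv p * F p) := by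
  rw [← mul_smul_comm, ← K_mul_F_mul_KInv, ← mul_assoc, ← mul_assoc, KInv_mul, one_mul]

lemma KInv_mul_E : KInv p * E p = (q p ^ 2)⁻¹ • (E p * KInv p) := by
  rw [E_mul_KInv, smul_smul, inv_mul_cancel₀ q_sq_ne_zero, one_smul]

lemma KInv_mul_F : KInv p * F p = q p ^ 2 • (F p * KInv p) := by
  rw [F_mul_KInv, smul_smul, mul_inv_cancel₀ q_sq_ne_zero, one_smul]

/-- `Δ(E) = E ⊗ K + 1 ⊗ E`, `Δ(K) = K ⊗ K`, `Δ(F) = F ⊗ 1 + K⁻¹ ⊗ F`. -/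
def comulHom : Uq p →ₐ[ℂ] Uq p ⊗[ℂ] Uq p :=
  lift (E p ⊗ₜ K p + 1 ⊗ₜ E p) (K p ⊗ₜ K p) (F p ⊗ₜ 1 + KInv p ⊗ₜ F p) (KInv p ⊗ₜ KInv p)
    (by simp [Algebra.TensorProduct.tmul_pow, KInv])
    (by simp [mul_add, add_mul, mul_KInv, K_mul_E_mul_KInv, TensorProduct.smul_tmul', mul_assoc (K p) (K p)])
    (by simp [mul_add, add_mul, mul_KInv, K_mul_F_mul_KInv, TensorProduct.smul_tmul'])
    (by
      have h : E p * F p = F p * E p + (q p - (q p)⁻¹)⁻¹ • (K p - KInv p) := by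
        rw [← E_mul_F_sub]; abel
      have h0 := q_ne_zero p
      simp only [mul_add, add_mul, Algebra.TensorProduct.tmul_mul_tmul, mul_one, one_mul, h,
        E_mul_KInv, K_mul_F, TensorProduct.add_tmul, TensorProduct.tmul_add,
        TensorProduct.smul_tmul', TensorProduct.tmul_smul, smul_smul, smul_sub,
        TensorProduct.sub_tmul, TensorProduct.tmul_sub]
      rw [inv_mul_cancel₀ q_sq_ne_zero, one_smul]
      abel)
    (by
      rw [add_comm]
      refine skew_add_pow_eq_zero (q p ^ 2) _ _ ?_ p ?_ (q_sq_pow_ne_one p) ?_ ?_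
      · simp [K_mul_E, TensorProduct.tmul_smul]
      · rw [← pow_mul, q_pow]
      · simp [Algebra.TensorProduct.tmul_pow, E_pow]
      · simp [Algebra.TensorProduct.tmul_pow, E_pow])
    (by
      refine skew_add_pow_eq_zero (q p ^ 2) _ _ ?_ p ?_ (q_sq_pow_ne_one p) ?_ ?_
      · simp [KInv_mul_F, TensorProduct.smul_tmul']
      · rw [← pow_mul, q_pow]
      · simp [Algebra.TensorProduct.tmul_pow, F_pow]
      · simp [Algebra.TensorProduct.tmul_pow, F_pow])
    (by simp [Algebra.TensorProduct.tmul_pow, K_pow, Algebra.TensorProduct.one_def])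

/-- `ε(E) = ε(F) = 0`, `ε(K) = 1`. -/
def counitHom : Uq p →ₐ[ℂ] ℂ :=
  lift 0 1 0 1 (by simp) (by simp) (by simp) (by simp) (by have := hp.out; simp; omega)
    (by have := hp.out; simp; omega) (by simp)

/-- `S(E) = -E K⁻¹`, `S(K) = K⁻¹`, `S(F) = -K F`, as an antihomomorphism. -/
def antipodeHom : Uq p →ₐ[ℂ] (Uq p)ᵐᵒᵖ :=
  lift (MulOpposite.op (-(E p * KInv p))) (MulOpposite.op (KInv p))
    (MulOpposite.op (-(K p * F p))) (MulOpposite.op (K p))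
    (by rw [← MulOpposite.op_pow, KInv_pow])
    (by
      rw [← MulOpposite.op_mul, ← MulOpposite.op_mul, ← MulOpposite.op_smul]
      congr 1
      simp only [neg_mul, mul_neg, smul_neg, ← mul_assoc]
      rw [K_mul_E_mul_KInv, smul_mul_assoc])
    (by
      rw [← MulOpposite.op_mul, ← MulOpposite.op_mul, ← MulOpposite.op_smul]
      congr 1
      simp only [neg_mul, mul_neg, smul_neg]
      rw [K_mul_F_mul_KInv, mul_smul_comm])
    (by
      rw [← MulOpposite.op_mul, ← MulOpposite.op_mul, ← MulOpposite.op_sub, ← MulOpposite.op_sub,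
        ← MulOpposite.op_smul]
      congr 1
      have h1 : -(K p * F p) * -(E p * KInv p) = F p * E p := by
        rw [neg_mul_neg, K_mul_F, smul_mul_assoc, mul_assoc, ← mul_assoc (K p), K_mul_E_mul_KInv,
          mul_smul_comm, smul_smul, inv_mul_cancel₀ q_sq_ne_zero, one_smul]
      have h2 : -(E p * KInv p) * -(K p * F p) = E p * F p := by
        rw [neg_mul_neg, mul_assoc, ← mul_assoc (KInv p), KInv_mul, one_mul]
      rw [h1, h2, ← neg_sub, E_mul_F_sub, ← smul_neg, neg_sub])
    (by
      rw [← MulOpposite.op_pow, neg_pow,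
        skew_mul_pow_eq_zero ((q p ^ 2)⁻¹) _ _ KInv_mul_E p (E_pow p)]
      simp)
    (by
      have h : (K p * F p) = (q p ^ 2)⁻¹ • (F p * K p) := K_mul_F
      rw [← MulOpposite.op_pow, neg_pow, h, smul_pow,
        skew_mul_pow_eq_zero ((q p ^ 2)⁻¹) _ _ K_mul_F p (F_pow p)]
      simp)
    (by
      rw [← MulOpposite.op_pow, KInv, ← pow_mul, mul_comm, pow_mul, K_pow, one_pow]; rfl)

lemma comulHom_E : comulHom (E p) = E p ⊗ₜ K p + 1 ⊗ₜ E p := lift_E ..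
lemma comulHom_K : comulHom (K p) = K p ⊗ₜ K p := lift_K ..
lemma comulHom_F : comulHom (F p) = F p ⊗ₜ 1 + KInv p ⊗ₜ F p := lift_F ..
lemma comulHom_KInv : comulHom (KInv p) = KInv p ⊗ₜ KInv p := lift_KInv ..
lemma counitHom_E : counitHom (E p) = 0 := lift_E ..
lemma counitHom_K : counitHom (K p) = 1 := lift_K ..
lemma counitHom_F : counitHom (F p) = 0 := lift_F ..
lemma counitHom_KInv : counitHom (KInv p) = 1 := lift_KInv ..

instance : Bialgebra ℂ (Uq p) :=
  Bialgebra.ofAlgHom comulHom counitHom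
    (by
      apply hom_ext <;> simp [comulHom_E, comulHom_K, comulHom_F, comulHom_KInv,
        TensorProduct.add_tmul, TensorProduct.tmul_add, Algebra.TensorProduct.one_def, add_assoc])
    (by apply hom_ext <;> simp [comulHom_E, comulHom_K, comulHom_F, counitHom_E, counitHom_K,
          counitHom_F, counitHom_KInv])
    (by apply hom_ext <;> simp [comulHom_E, comulHom_K, comulHom_F, counitHom_E, counitHom_K,
          counitHom_F])

@[simp] lemma comul_E : Coalgebra.comul (R := ℂ) (E p) = E p ⊗ₜ K p + 1 ⊗ₜ E p := comulHom_E
@[simp] lemma comul_K : Coalgebra.comul (R := ℂ) (K p) = K p ⊗ₜ K p := comulHom_K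
@[simp] lemma comul_F : Coalgebra.comul (R := ℂ) (F p) = F p ⊗ₜ 1 + KInv p ⊗ₜ F p := comulHom_F
@[simp] lemma counit_E : Coalgebra.counit (R := ℂ) (E p) = 0 := counitHom_E
@[simp] lemma counit_K : Coalgebra.counit (R := ℂ) (K p) = 1 := counitHom_K
@[simp] lemma counit_F : Coalgebra.counit (R := ℂ) (F p) = 0 := counitHom_F

lemma antipodeHom_E : antipodeHom (E p) = MulOpposite.op (-(E p * KInv p)) := lift_E ..
lemma antipodeHom_K : antipodeHom (K p) = MulOpposite.op (KInv p) := lift_K ..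
lemma antipodeHom_F : antipodeHom (F p) = MulOpposite.op (-(K p * F p)) := lift_F ..
lemma antipodeHom_KInv : antipodeHom (KInv p) = MulOpposite.op (K p) := lift_KInv ..

instance : HopfAlgebra ℂ (Uq p) :=
  hopfOfGenerators antipodeHom {E p, K p, F p} adjoin_eq_top
    (by
      rintro _ (rfl | rfl | rfl)
      · simp [antipodeHom_E, mul_assoc, KInv_mul]
      · simp [antipodeHom_K, KInv_mul]
      · simp [antipodeHom_F, antipodeHom_KInv])
    (by
      rintro _ (rfl | rfl | rfl)
      · simp [antipodeHom_E, antipodeHom_K]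
      · simp [antipodeHom_K, mul_KInv]
      · simp [antipodeHom_F, ← mul_assoc, KInv_mul])

lemma antipode_E : HopfAlgebra.antipode ℂ (E p) = -(E p * KInv p) :=
  congrArg MulOpposite.unop antipodeHom_E
lemma antipode_K : HopfAlgebra.antipode ℂ (K p) = KInv p :=
  congrArg MulOpposite.unop antipodeHom_K
lemma antipode_F : HopfAlgebra.antipode ℂ (F p) = -(K p * F p) :=
  congrArg MulOpposite.unop antipodeHom_F

end Uq

/-! ### The algebras `ℂ_𝔮[z,∂]` and `H_q sl(2)` -/

inductive CqGen
  | z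
  | d

/-- `z^p = 0`, `∂^p = 0`, `∂ z = (𝔮 - 𝔮⁻¹) 1 + 𝔮⁻² z ∂`. -/
inductive CqRel (p : ℕ) : FreeAlgebra ℂ CqGen → FreeAlgebra ℂ CqGen → Prop
  | z_pow : CqRel p (FreeAlgebra.ι ℂ .z ^ p) 0
  | d_pow : CqRel p (FreeAlgebra.ι ℂ .d ^ p) 0
  | dz : CqRel p (FreeAlgebra.ι ℂ .d * FreeAlgebra.ι ℂ .z)
      ((q p - (q p)⁻¹) • 1 + (q p ^ 2)⁻¹ • (FreeAlgebra.ι ℂ .z * FreeAlgebra.ι ℂ .d))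

/-- `ℂ_𝔮[z,∂]`. -/
def Cq (p : ℕ) : Type := RingQuot (CqRel p)

namespace Cq
variable (p : ℕ)
instance : Ring (Cq p) := inferInstanceAs (Ring (RingQuot (CqRel p)))
instance : Algebra ℂ (Cq p) := inferInstanceAs (Algebra ℂ (RingQuot (CqRel p)))
def z : Cq p := RingQuot.mkAlgHom ℂ (CqRel p) (FreeAlgebra.ι ℂ .z)
def d : Cq p := RingQuot.mkAlgHom ℂ (CqRel p) (FreeAlgebra.ι ℂ .d)
end Cq

/-- `H_q sl(2) = ℂ_𝔮[z,∂] ⊗ ℂ[λ]/(λ^{2p} - 1)`. -/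
abbrev Hq (p : ℕ) : Type :=
  Cq p ⊗[ℂ] AdjoinRoot (Polynomial.X ^ (2 * p) - 1 : Polynomial ℂ)

namespace Hq
variable (p : ℕ)
/-- The inclusion of `ℂ_𝔮[z,∂]` into `H_q sl(2)`. -/
def incl : Cq p →ₐ[ℂ] Hq p := Algebra.TensorProduct.includeLeft
def z : Hq p := incl p (Cq.z p)
/-- `∂` -/
def d : Hq p := incl p (Cq.d p)
/-- `λ` -/
def lam : Hq p := 1 ⊗ₜ AdjoinRoot.root _
end Hq
/-! ### Yetter–Drinfeld module algebras -/

section YetterDrinfeld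
variable (H X : Type*) [Ring H] [HopfAlgebra ℂ H] [Ring X] [Algebra ℂ X]

/-- A (left–left) Yetter–Drinfeld `H`-module algebra structure on the algebra `X`: an action
`h ▷ x = act h x` and a coaction `coact x = x₍₋₁₎ ⊗ x₍₀₎` such that `X` is a left module algebra,
a left comodule algebra, and
`(h' ▷ x)₍₋₁₎ h'' ⊗ (h' ▷ x)₍₀₎ = h' x₍₋₁₎ ⊗ (h'' ▷ x₍₀₎)`. -/
@[ext]
structure YDModuleAlgebra where
  /-- the action `H ⊗ X → X` -/
  act : H →ₐ[ℂ] Module.End ℂ X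
  /-- the coaction; being an algebra morphism, it makes `X` a comodule algebra -/
  coact : X →ₐ[ℂ] H ⊗[ℂ] X
  /-- `h ▷ 1 = ε(h) 1` -/
  act_one : ∀ h, act h 1 = algebraMap ℂ X (Coalgebra.counit h)
  /-- `h ▷ (x y) = (h' ▷ x) (h'' ▷ y)` -/
  act_mul : ∀ h x y, act h (x * y) =
    TensorProduct.lift
      ((LinearMap.mul ℂ X).compl₁₂ (act.toLinearMap.flip x) (act.toLinearMap.flip y))
      (Coalgebra.comul (R := ℂ) h)
  /-- `ε(x₍₋₁₎) x₍₀₎ = x` -/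
  counit_coact : ∀ x, TensorProduct.lid ℂ X (Coalgebra.counit.rTensor X (coact x)) = x
  /-- `x₍₋₁₎' ⊗ x₍₋₁₎'' ⊗ x₍₀₎ = x₍₋₁₎ ⊗ x₍₀₎₍₋₁₎ ⊗ x₍₀₎₍₀₎` -/
  coassoc_coact : ∀ x, TensorProduct.assoc ℂ H H X (Coalgebra.comul.rTensor X (coact x)) =
    coact.toLinearMap.lTensor H (coact x)
  /-- the Yetter–Drinfeld condition; the left side is the value on `h' ⊗ h''` of
  `h₁ ⊗ h₂ ↦ (h₁ ▷ x)₍₋₁₎ h₂ ⊗ (h₁ ▷ x)₍₀₎`, and the right side that of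
  `h₁ ⊗ h₂ ↦ h₁ x₍₋₁₎ ⊗ (h₂ ▷ x₍₀₎)` -/
  yetter_drinfeld : ∀ h x,
    TensorProduct.lift
      ((LinearMap.rTensorHom X ∘ₗ (LinearMap.mul ℂ H).flip).flip ∘ₗ
        coact.toLinearMap ∘ₗ act.toLinearMap.flip x)
      (Coalgebra.comul (R := ℂ) h) =
    TensorProduct.lift
      ((TensorProduct.mapBilinear (.id ℂ) H X H X).compl₁₂ (LinearMap.mul ℂ H) act.toLinearMap)
      (Coalgebra.comul (R := ℂ) h) (coact x)

variable {H X}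

/-- Braided commutativity: `y x = (y₍₋₁₎ ▷ x) y₍₀₎`. -/
def YDModuleAlgebra.BraidedCommutative (Y : YDModuleAlgebra H X) : Prop :=
  ∀ x y : X, y * x =
    TensorProduct.lift (LinearMap.mul ℂ X ∘ₗ Y.act.toLinearMap.flip x) (Y.coact y)

end YetterDrinfeld

/-! ### The Drinfeld double and the Heisenberg double -/

section Doubles
open Module TensorProduct Coalgebra
variable (B : Type) [Ring B] [HopfAlgebra ℂ B]

/-- `B* ⊗ B`, the underlying space of `𝒟(B)` and of `ℋ(B*)`. -/
abbrev DualTensor : Type := Dual ℂ B ⊗[ℂ] B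

/-- `S⁻¹`, for a bijective antipode `S`. -/
def antipodeInv : Module.End ℂ B := Ring.inverse (HopfAlgebra.antipode ℂ (A := B))

/-- `⟨S*⁻¹(μ), x⟩ = ⟨μ, S⁻¹(x)⟩`. -/
def dualAntipodeInv : Module.End ℂ (Dual ℂ B) := (antipodeInv B).dualMap

/-- The product of `B*`: `⟨μ ν, x⟩ = ⟨μ, x'⟩ ⟨ν, x''⟩`. -/
def dualMul : Dual ℂ B →ₗ[ℂ] Dual ℂ B →ₗ[ℂ] Dual ℂ B :=
  (TensorProduct.mk ℂ (Dual ℂ B) (Dual ℂ B)).compr₂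
    ((comul (R := ℂ) (A := B)).dualMap ∘ₗ dualDistrib ℂ B B)

/-- The coproduct of `B*`: `⟨μ', x⟩ ⟨μ'', y⟩ = ⟨μ, x y⟩`. -/
def dualComul [Module.Finite ℂ B] : Dual ℂ B →ₗ[ℂ] Dual ℂ B ⊗[ℂ] Dual ℂ B :=
  (dualDistribEquiv ℂ B B).symm.toLinearMap ∘ₗ (LinearMap.mul' ℂ B).dualMap

/-- `b ⇀ β = ⟨β'', b⟩ β'`, i.e. `⟨b ⇀ β, x⟩ = ⟨β, x b⟩`. -/
def lReg : B →ₗ[ℂ] Module.End ℂ (Dual ℂ B) := Dual.transpose ∘ₗ (LinearMap.mul ℂ B).flip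

/-- `β ↼ b = ⟨β', b⟩ β''`, i.e. `⟨β ↼ b, x⟩ = ⟨β, b x⟩`. -/
def rReg : B →ₗ[ℂ] Module.End ℂ (Dual ℂ B) := Dual.transpose ∘ₗ LinearMap.mul ℂ B

/-- `b ↼ β = ⟨β, b'⟩ b''`, as `β ↦ (b ↦ b ↼ β)`. -/
def rRegDual : Dual ℂ B →ₗ[ℂ] Module.End ℂ B :=
  (LinearMap.llcomp ℂ B (ℂ ⊗[ℂ] B) B (TensorProduct.lid ℂ B).toLinearMap) ∘ₗ
    (comul (R := ℂ) (A := B)).lcomp ℂ (ℂ ⊗[ℂ] B) ∘ₗ LinearMap.rTensorHom B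

/-- `x ↦ f(x', x'')` for a coproduct `Δ(x) = x' ⊗ x''`. -/
def sweedler {V P : Type} [AddCommMonoid V] [Module ℂ V] [AddCommMonoid P] [Module ℂ P]
    (Δ : V →ₗ[ℂ] V ⊗[ℂ] V) (f : V →ₗ[ℂ] V →ₗ[ℂ] P) : V →ₗ[ℂ] P := TensorProduct.lift f ∘ₗ Δ

/-- `(f, g) ↦ f ⊗ g` on `B* ⊗ B`. -/
def mapDT : End ℂ (Dual ℂ B) →ₗ[ℂ] End ℂ B →ₗ[ℂ] End ℂ (DualTensor B) :=
  TensorProduct.mapBilinear (.id ℂ) (Dual ℂ B) B (Dual ℂ B) B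

/-- `μ ↦ (ν ⊗ n ↦ μ ν ⊗ n)`. -/
def dualLeft : Dual ℂ B →ₗ[ℂ] End ℂ (DualTensor B) := LinearMap.rTensorHom B ∘ₗ dualMul B

/-- The unit `ε ⊗ 1` of `𝒟(B)` and of `ℋ(B*)`. -/
def dtOne : DualTensor B := (counit (R := ℂ) (A := B)) ⊗ₜ[ℂ] (1 : B)

/-- `a ↦ (β ⊗ b ↦ (a' ⇀ β) ⊗ a'' b)`. -/
def heisLeft : B →ₗ[ℂ] End ℂ (DualTensor B) :=
  sweedler comul ((mapDT B).compl₁₂ (lReg B) (LinearMap.mul ℂ B))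

/-- The product of the Heisenberg double `ℋ(B*) = B* # B`:
`(α # a)(β # b) = α (a' ⇀ β) # a'' b`. -/
def heisMul : DualTensor B →ₗ[ℂ] DualTensor B →ₗ[ℂ] DualTensor B :=
  TensorProduct.lift
    ((LinearMap.mul ℂ (End ℂ (DualTensor B))).compl₁₂ (dualLeft B) (heisLeft B))

/-- `m ↦ (ν ⊗ n ↦ (ν ↼ S⁻¹(m'')) ⊗ m' n)`. -/
def doubleRight : B →ₗ[ℂ] End ℂ (DualTensor B) :=
  sweedler comul ((mapDT B).compl₁₂ (rReg B ∘ₗ antipodeInv B) (LinearMap.mul ℂ B)).flip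

/-- `m ↦ (ν ⊗ n ↦ (m' ⇀ ν ↼ S⁻¹(m''')) ⊗ m'' n)`. -/
def doubleLeft : B →ₗ[ℂ] End ℂ (DualTensor B) :=
  sweedler comul ((LinearMap.mul ℂ (End ℂ (DualTensor B))).compl₁₂
    (LinearMap.rTensorHom B ∘ₗ lReg B) (doubleRight B))

/-- The product of the Drinfeld double `𝒟(B)`:
`(μ ⊗ m)(ν ⊗ n) = μ (m' ⇀ ν ↼ S⁻¹(m''')) ⊗ m'' n`. -/
def doubleMul : DualTensor B →ₗ[ℂ] DualTensor B →ₗ[ℂ] DualTensor B :=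
  TensorProduct.lift
    ((LinearMap.mul ℂ (End ℂ (DualTensor B))).compl₁₂ (dualLeft B) (doubleLeft B))

/-- The counit of `𝒟(B)`: `μ ⊗ m ↦ ⟨μ, 1⟩ ε(m)`. -/
def doubleCounit : DualTensor B →ₗ[ℂ] ℂ :=
  TensorProduct.lid ℂ ℂ ∘ₗ TensorProduct.map (Dual.eval ℂ B 1) counit

/-- `m ↦ (a ↦ m' a S(m''))`. -/
def adj : B →ₗ[ℂ] End ℂ B :=
  sweedler comul ((LinearMap.mul ℂ (End ℂ B)).compl₁₂ (LinearMap.mul ℂ B)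
    ((LinearMap.mul ℂ B).flip ∘ₗ HopfAlgebra.antipode ℂ))

/-- `(ε ⊗ m) ▷ (α # a) = (m' ⇀ α) # m'' a S(m''')`. -/
def actB : B →ₗ[ℂ] End ℂ (DualTensor B) := sweedler comul ((mapDT B).compl₁₂ (lReg B) (adj B))

variable [Module.Finite ℂ B]

/-- The coproduct of `𝒟(B)`, which is also the coaction `ℋ(B*) → 𝒟(B) ⊗ ℋ(B*)`:
`μ ⊗ m ↦ (μ'' ⊗ m') ⊗ (μ' ⊗ m'')`. -/
def doubleComul : DualTensor B →ₗ[ℂ] DualTensor B ⊗[ℂ] DualTensor B :=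
  (TensorProduct.tensorTensorTensorComm ℂ (Dual ℂ B) (Dual ℂ B) B B).toLinearMap ∘ₗ
    TensorProduct.map ((TensorProduct.comm ℂ (Dual ℂ B) (Dual ℂ B)).toLinearMap ∘ₗ dualComul B)
      comul

/-- `μ ↦ (α ↦ μ'' α S*⁻¹(μ'))`. -/
def dualAdj : Dual ℂ B →ₗ[ℂ] End ℂ (Dual ℂ B) :=
  sweedler (dualComul B) ((LinearMap.mul ℂ (End ℂ (Dual ℂ B))).compl₁₂
    ((dualMul B).flip ∘ₗ dualAntipodeInv B) (dualMul B))

/-- `(μ ⊗ 1) ▷ (α # a) = μ''' α S*⁻¹(μ'') # (a ↼ S*⁻¹(μ'))`. -/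
def actDual : Dual ℂ B →ₗ[ℂ] End ℂ (DualTensor B) :=
  sweedler (dualComul B)
    ((mapDT B).flip.compl₁₂ (rRegDual B ∘ₗ dualAntipodeInv B) (dualAdj B))

/-- The action of `𝒟(B)` on `ℋ(B*)`:
`(μ ⊗ m) ▷ (α # a) = μ''' (m' ⇀ α) S*⁻¹(μ'') # ((m'' a S(m''')) ↼ S*⁻¹(μ'))`. -/
def doubleAct : DualTensor B →ₗ[ℂ] DualTensor B →ₗ[ℂ] DualTensor B :=
  TensorProduct.lift
    ((LinearMap.mul ℂ (End ℂ (DualTensor B))).compl₁₂ (actDual B) (actB B))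

end Doubles

/-- The subalgebra generated by `s`, for a product `mul` with unit `one`. -/
def genSubalgebra {V : Type} [AddCommGroup V] [Module ℂ V] (mul : V →ₗ[ℂ] V →ₗ[ℂ] V) (one : V)
    (s : Set V) : Submodule ℂ V :=
  sInf {N | one ∈ N ∧ s ⊆ N ∧ ∀ x ∈ N, ∀ y ∈ N, mul x y ∈ N}

/-- The two-sided ideal generated by `s` in the subalgebra `A`, for a product `mul`. -/
def genIdeal {V : Type} [AddCommGroup V] [Module ℂ V] (mul : V →ₗ[ℂ] V →ₗ[ℂ] V)
    (A : Submodule ℂ V) (s : Set V) : Submodule ℂ V :=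
  sInf {N | s ⊆ N ∧ ∀ a ∈ A, ∀ x ∈ N, mul a x ∈ N ∧ mul x a ∈ N}

/-! ### The truncation of `(𝒟(B), ℋ(B*))` for the Taft Hopf algebra -/

section Truncation
open Module
variable (p : ℕ) [Fact (2 ≤ p)]

/-- The ideal of `𝒟(B)` generated by `ϰ ⊗ k - ε ⊗ 1`. -/
def truncIdeal : Submodule ℂ (DualTensor (Taft p)) :=
  genIdeal (doubleMul (Taft p)) ⊤ {Taft.kappa ⊗ₜ[ℂ] Taft.k p - dtOne (Taft p)}

/-- `𝒟(B) / (ϰ k - 1)`. -/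
abbrev DoubleQuot : Type := DualTensor (Taft p) ⧸ truncIdeal p

/-- `z = -(𝔮 - 𝔮⁻¹) ε # E k⁻²`. -/
def zHeis : DualTensor (Taft p) :=
  (-(q p - (q p)⁻¹)) • (Coalgebra.counit (R := ℂ) (A := Taft p)) ⊗ₜ[ℂ] (Taft.E p * Taft.kInv p ^ 2)

/-- `∂ = (𝔮 - 𝔮⁻¹) F # 1`. -/
def dHeis : DualTensor (Taft p) := (q p - (q p)⁻¹) • Taft.F ⊗ₜ[ℂ] (1 : Taft p)

/-- `λ = 𝔮^{1/4} ϰ # k`; the scalar `𝔮^{1/4} = e^{iπ/(4p)}` makes `λ^{4p} = 1`. -/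
def lamHeis : DualTensor (Taft p) :=
  Complex.exp (Complex.I * Real.pi / (4 * p)) • Taft.kappa ⊗ₜ[ℂ] Taft.k p

/-- The subalgebra of `ℋ(B*)` generated by `z`, `∂`, `λ`. -/
def heisSub : Submodule ℂ (DualTensor (Taft p)) :=
  genSubalgebra (heisMul (Taft p)) (dtOne (Taft p)) {zHeis p, dHeis p, lamHeis p}

/-- The ideal generated by `λ^{2p} - 1` in the subalgebra generated by `z`, `∂`, `λ`. -/
def heisIdeal : Submodule ℂ (DualTensor (Taft p)) :=
  genIdeal (heisMul (Taft p)) (heisSub p)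
    {(heisMul (Taft p) (lamHeis p))^[2 * p] (dtOne (Taft p)) - dtOne (Taft p)}

/-- Identification of a Yetter–Drinfeld module algebra `(U_q sl(2), H_q sl(2))` with the truncation
of `(𝒟(B), ℋ(B*))`: `U_q sl(2)` is the Hopf subalgebra of `𝒟(B)/(ϰk-1)` spanned by the
`F^ℓ E^m k^{2n}`, `H_q sl(2)` is the quotient by `λ^{2p} = 1` of the subalgebra of `ℋ(B*)` generated
by `z`, `∂`, `λ`, and the action and coaction are those induced from `𝒟(B)` and `ℋ(B*)`. -/
structure Truncation (Y : YDModuleAlgebra (Uq p) (Hq p)) where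
  /-- the embedding of `U_q sl(2)` into `𝒟(B)/(ϰk-1)` -/
  j : Uq p →ₗ[ℂ] DoubleQuot p
  j_injective : Function.Injective j
  range_j : LinearMap.range j = Submodule.span ℂ {v | ∃ l < p, ∃ m < p, ∃ n < 2 * p,
    v = (truncIdeal p).mkQ (((dualMul (Taft p) Taft.F)^[l] Coalgebra.counit) ⊗ₜ[ℂ]
      (Taft.E p ^ m * Taft.k p ^ (2 * n)))}
  j_one : j 1 = (truncIdeal p).mkQ (dtOne (Taft p))
  j_E : j (Uq.E p) = (truncIdeal p).mkQ (Coalgebra.counit (R := ℂ) (A := Taft p) ⊗ₜ[ℂ] Taft.E p)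
  j_F : j (Uq.F p) = (truncIdeal p).mkQ (Taft.F ⊗ₜ[ℂ] 1)
  j_K : j (Uq.K p) = (truncIdeal p).mkQ (Coalgebra.counit (R := ℂ) (A := Taft p) ⊗ₜ[ℂ] (Taft.k p ^ 2))
  /-- `j` is multiplicative -/
  j_mul : ∀ u v x y, (truncIdeal p).mkQ x = j u → (truncIdeal p).mkQ y = j v →
    (truncIdeal p).mkQ (doubleMul (Taft p) x y) = j (u * v)
  /-- `j` is comultiplicative -/
  j_comul : ∀ u x, (truncIdeal p).mkQ x = j u →
    TensorProduct.map (truncIdeal p).mkQ (truncIdeal p).mkQ (doubleComul (Taft p) x) =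
      TensorProduct.map j j (Coalgebra.comul u)
  j_counit : ∀ u x, (truncIdeal p).mkQ x = j u →
    doubleCounit (Taft p) x = Coalgebra.counit (R := ℂ) u
  /-- the projection of the subalgebra generated by `z`, `∂`, `λ` onto `H_q sl(2)` -/
  ρ : heisSub p →ₗ[ℂ] Hq p
  ρ_surjective : Function.Surjective ρ
  ker_ρ : LinearMap.ker ρ = (heisIdeal p).comap (heisSub p).subtype
  ρ_one : ∀ a : heisSub p, (a : DualTensor (Taft p)) = dtOne (Taft p) → ρ a = 1
  ρ_z : ∀ a : heisSub p, (a : DualTensor (Taft p)) = zHeis p → ρ a = Hq.z p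
  ρ_d : ∀ a : heisSub p, (a : DualTensor (Taft p)) = dHeis p → ρ a = Hq.d p
  ρ_lam : ∀ a : heisSub p, (a : DualTensor (Taft p)) = lamHeis p → ρ a = Hq.lam p
  /-- `ρ` is multiplicative -/
  ρ_mul : ∀ a b c : heisSub p,
    (c : DualTensor (Taft p)) = heisMul (Taft p) a b → ρ c = ρ a * ρ b
  /-- the action of `U_q sl(2)` on `H_q sl(2)` is induced by that of `𝒟(B)` on `ℋ(B*)` -/
  act_compat : ∀ (u : Uq p) (x : DualTensor (Taft p)), (truncIdeal p).mkQ x = j u →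
    ∀ a : heisSub p, ∃ c : heisSub p,
      (c : DualTensor (Taft p)) = doubleAct (Taft p) x a ∧ ρ c = Y.act u (ρ a)
  /-- the coaction of `U_q sl(2)` on `H_q sl(2)` is induced by that of `𝒟(B)` on `ℋ(B*)` -/
  coact_compat : ∀ a : heisSub p, ∃ t : DualTensor (Taft p) ⊗[ℂ] heisSub p,
    (heisSub p).subtype.lTensor (DualTensor (Taft p)) t = doubleComul (Taft p) a ∧
    TensorProduct.map (truncIdeal p).mkQ ρ t = j.rTensor (Hq p) (Y.coact (ρ a))

end Truncation

/-! ### The explicit action and coaction -/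

/-- `[n] = (𝔮^n - 𝔮^{-n}) / (𝔮 - 𝔮⁻¹)`. -/
def qInt (p n : ℕ) : ℂ := (q p ^ n - (q p)⁻¹ ^ n) / (q p - (q p)⁻¹)

/-- `[n/2] = (𝔮^{n/2} - 𝔮^{-n/2}) / (𝔮 - 𝔮⁻¹)`. -/
def qIntHalf (p n : ℕ) : ℂ := (qh p ^ n - (qh p)⁻¹ ^ n) / (q p - (q p)⁻¹)

/-- `[n]! = [1] ⋯ [n]`. -/
def qFact (p n : ℕ) : ℂ := ∏ i ∈ Finset.range n, qInt p (i + 1)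

/-- `[m choose s] = [m]! / ([s]! [m - s]!)`. -/
def qBinom (p m s : ℕ) : ℂ := qFact p m / (qFact p s * qFact p (m - s))

/-- The explicit formulas for the action and coaction of `U_q sl(2)` on `H_q sl(2)`. -/
structure ExplicitFormulas (p : ℕ) [Fact (2 ≤ p)] (Y : YDModuleAlgebra (Uq p) (Hq p)) : Prop where
  E_lam : ∀ n : ℕ, Y.act (Uq.E p) (Hq.lam p ^ n) =
    ((qh p)⁻¹ ^ n * qIntHalf p n) • (Hq.lam p ^ n * Hq.z p)
  K_lam : ∀ n : ℕ, Y.act (Uq.K p) (Hq.lam p ^ n) = (q p)⁻¹ ^ n • Hq.lam p ^ n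
  F_lam : ∀ n : ℕ, Y.act (Uq.F p) (Hq.lam p ^ n) =
    (-(qh p ^ n * qIntHalf p n)) • (Hq.lam p ^ n * Hq.d p)
  E_z : ∀ n : ℕ, Y.act (Uq.E p) (Hq.z p ^ n) = (-(q p ^ n * qInt p n)) • Hq.z p ^ (n + 1)
  K_z : ∀ n : ℕ, Y.act (Uq.K p) (Hq.z p ^ n) = q p ^ (2 * n) • Hq.z p ^ n
  F_z : ∀ n : ℕ, Y.act (Uq.F p) (Hq.z p ^ n) =
    (qInt p n * q p ^ (1 - n : ℤ)) • Hq.z p ^ (n - 1)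
  E_d : ∀ n : ℕ, Y.act (Uq.E p) (Hq.d p ^ n) =
    (q p ^ (1 - n : ℤ) * qInt p n) • Hq.d p ^ (n - 1)
  K_d : ∀ n : ℕ, Y.act (Uq.K p) (Hq.d p ^ n) = (q p)⁻¹ ^ (2 * n) • Hq.d p ^ n
  F_d : ∀ n : ℕ, Y.act (Uq.F p) (Hq.d p ^ n) = (-(q p ^ n * qInt p n)) • Hq.d p ^ (n + 1)
  coact_lam : Y.coact (Hq.lam p) = 1 ⊗ₜ Hq.lam p
  /-- the powers `z^m` with `m ≥ p` vanish -/
  coact_z : ∀ m : ℕ, m < p → Y.coact (Hq.z p ^ m) = ∑ s ∈ Finset.range (m + 1),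
    ((-1) ^ s * q p ^ (s * (1 - m) : ℤ) * (q p - (q p)⁻¹) ^ s * qBinom p m s) •
      (Uq.E p ^ s * Uq.KInv p ^ m) ⊗ₜ[ℂ] (Hq.z p ^ (m - s))
  /-- the powers `∂^m` with `m ≥ p` vanish -/
  coact_d : ∀ m : ℕ, m < p → Y.coact (Hq.d p ^ m) = ∑ s ∈ Finset.range (m + 1),
    (q p ^ (s * (m - s)) * (q p - (q p)⁻¹) ^ s * qBinom p m s) •
      (Uq.F p ^ s * Uq.KInv p ^ (m - s)) ⊗ₜ[ℂ] (Hq.d p ^ (m - s))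

end QHeis

end

open scoped TensorProduct
noncomputable section
namespace QHeis

/-! ### Scalars -/

section Scalars
variable (p : ℕ) [Fact (2 ≤ p)]

/-! The action is forced by the coaction. Let κ be the automorphism by which K acts. Since z ↦ K⁻¹ ⊗
z − (𝔮−𝔮⁻¹) EK⁻¹ ⊗ 1 and ∂ ↦ K⁻¹ ⊗ ∂ + (𝔮−𝔮⁻¹) F ⊗ 1, braided commutativity for y = z and y = ∂ says
exactly that E ▷ x = (xz − zκ(x))/(𝔮−𝔮⁻¹) and F ▷ x = (∂x − κ⁻¹(x)∂)/(𝔮−𝔮⁻¹). These inner formulas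
are taken as the definition of the action. The relation for [E,F] is then the relation between ∂ and
z (`opE_opF`). The vanishing of E^p and F^p is the q-binomial theorem at the primitive p-th root of
unity 𝔮², because each operator is a sum of two skew-commuting nilpotent ones; the coaction respects
z^p = ∂^p = 0 for the same reason. The remaining axioms are stable under products, so they need only
be checked on generators (`act_mul_of_generators`, `yetter_drinfeld_of_generators`,
`braidedCommutative_of_generators`). The argument runs for any `WeylAlgebra`, and ℂ_𝔮[z,∂] and H_q
sl(2) are both instances with compatible formulas. Uniqueness holds because a Yetter–Drinfeld module
algebra is determined by its structure maps on generators.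

For the dimension of B and the structure of B*, the pairing of F^l ϰ^i with E^m k^n is δ_{lm} times
a nonzero constant times a character of ℤ/4p in n (`pairing`), so it is nondegenerate and B* ≅ B as
an algebra. Both doubles are treated as B* ⊗ B with a product (μ ⊗ m)(ν ⊗ n) = μ T(m)(ν ⊗ n), where
T(k) and T(E) have the form of an Ore extension (`SkewTwist`). Associativity and a universal
property by exchange relations on generators follow once for both. The coproduct, the counit, the
coaction and the action thereby become algebra homomorphisms that can be compared on generators.

In 𝒟(B) the element ϰk is central and group-like. Modulo ϰk − 1 one has ϰ² = k⁻², and the elements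
E, k², F satisfy the relations of U_q sl(2). The images of the ordered monomials stay independent in
the quotient, as the linear map `triangular` into B ⊗ B shows: it is invariant under multiplication
by ϰk and sends the monomials to distinct basis vectors. This yields the dimension of U_q sl(2) and
the embedding at once.

In ℋ(B*) the action of 𝒟(B) is inner: k and ϰ act by conjugation, E by x ↦ (Ex − xE)k⁻², and F by a
similar commutator with ϰ⁻²F. Rewritten through z and ∂ these are the inner formulas above, with κ
the conjugation by k². The subalgebra generated by z, ∂, λ is ℂ_𝔮[z,∂] ⊗ ℂ[λ]/(λ^{4p} − 1), with λ
central. As λ is proportional to ϰk, the element ϰk of 𝒟(B) acts trivially on this subalgebra, so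
the action descends to the truncation. The coaction sends λ to ϰk ⊗ λ, hence to 1 ⊗ λ. -/

lemma q_sq_ne_one : q p ^ 2 ≠ 1 := by
  have h := q_sq_pow_ne_one p 1 one_ne_zero (lt_of_lt_of_le one_lt_two Fact.out)
  rwa [pow_one] at h

lemma q_sub_inv_ne_zero : q p - (q p)⁻¹ ≠ 0 := by
  intro h
  have h0 := q_ne_zero p
  apply q_sq_ne_one p
  rw [sub_eq_zero] at h
  rw [sq]
  nth_rewrite 1 [h]
  exact inv_mul_cancel₀ h0

end Scalars

/-! ### Inner Yetter–Drinfeld structures -/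

/-- An algebra `X` containing `ℂ_𝔮[z,∂]`, generated by it together with central elements on which
`K` acts by scalars and which are coinvariant. -/
structure WeylAlgebra (p : ℕ) [Fact (2 ≤ p)] (X : Type*) [Ring X] [Algebra ℂ X] where
  z : X
  d : X
  kap : X →ₐ[ℂ] X
  kapInv : X →ₐ[ℂ] X
  cent : Set X
  coact : X →ₐ[ℂ] Uq p ⊗[ℂ] X
  z_pow : z ^ p = 0
  d_pow : d ^ p = 0
  d_mul_z : d * z = (q p - (q p)⁻¹) • 1 + (q p ^ 2)⁻¹ • (z * d)
  kap_z : kap z = q p ^ 2 • z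
  kap_d : kap d = (q p ^ 2)⁻¹ • d
  kap_cent : ∀ t ∈ cent, ∃ c : ℂ, kap t = c • t
  kap_pow : kap.toLinearMap ^ (2 * p) = (1 : Module.End ℂ X)
  kapInv_eq : kap.toLinearMap ^ (2 * p - 1) = (kapInv.toLinearMap : Module.End ℂ X)
  cent_comm : ∀ t ∈ cent, ∀ x, t * x = x * t
  coact_z : coact z = Uq.KInv p ⊗ₜ z - (q p - (q p)⁻¹) • (Uq.E p * Uq.KInv p) ⊗ₜ 1
  coact_d : coact d = Uq.KInv p ⊗ₜ d + (q p - (q p)⁻¹) • Uq.F p ⊗ₜ 1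
  coact_cent : ∀ t ∈ cent, coact t = 1 ⊗ₜ t
  adjoin_eq_top : Algebra.adjoin ℂ ({z, d} ∪ cent) = ⊤

namespace WeylAlgebra
variable {p : ℕ} [hp : Fact (2 ≤ p)] {X : Type*} [Ring X] [Algebra ℂ X] (W : WeylAlgebra p X)

lemma kap_kapInv (x : X) : W.kap (W.kapInv x) = x := by
  have h := W.kap_pow
  have := hp.out
  rw [show 2 * p = 2 * p - 1 + 1 by omega, pow_succ', W.kapInv_eq] at h
  exact LinearMap.congr_fun h x

lemma kapInv_kap (x : X) : W.kapInv (W.kap x) = x := by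
  have h := W.kap_pow
  have := hp.out
  rw [show 2 * p = 2 * p - 1 + 1 by omega, pow_succ, W.kapInv_eq] at h
  exact LinearMap.congr_fun h x

lemma kapInv_z : W.kapInv W.z = (q p ^ 2)⁻¹ • W.z := by
  rw [← W.kapInv_kap ((q p ^ 2)⁻¹ • W.z), map_smul W.kap, W.kap_z, smul_smul,
    inv_mul_cancel₀ Uq.q_sq_ne_zero, one_smul]

lemma kapInv_d : W.kapInv W.d = q p ^ 2 • W.d := by
  rw [← W.kapInv_kap (q p ^ 2 • W.d), map_smul W.kap, W.kap_d, smul_smul,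
    mul_inv_cancel₀ Uq.q_sq_ne_zero, one_smul]

/-- `x ↦ (x z - z κ(x)) / (𝔮 - 𝔮⁻¹)` -/
def opE : Module.End ℂ X := (q p - (q p)⁻¹)⁻¹ •
  (LinearMap.mulRight ℂ W.z + LinearMap.mulLeft ℂ (-W.z) * W.kap.toLinearMap)

/-- `x ↦ (∂ x - κ⁻¹(x) ∂) / (𝔮 - 𝔮⁻¹)` -/
def opF : Module.End ℂ X := (q p - (q p)⁻¹)⁻¹ •
  (LinearMap.mulLeft ℂ W.d + LinearMap.mulRight ℂ (-W.d) * W.kapInv.toLinearMap)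

lemma opE_apply (x : X) : W.opE x = (q p - (q p)⁻¹)⁻¹ • (x * W.z - W.z * W.kap x) := by
  simp [opE, sub_eq_add_neg]

lemma opF_apply (x : X) : W.opF x = (q p - (q p)⁻¹)⁻¹ • (W.d * x - W.kapInv x * W.d) := by
  simp [opF, sub_eq_add_neg]

lemma kap_opE_kapInv (x : X) : W.kap (W.opE (W.kapInv x)) = q p ^ 2 • W.opE x := by
  simp only [opE_apply, map_smul, map_sub, map_mul, kap_kapInv, kap_z, mul_smul_comm,
    smul_mul_assoc, ← smul_sub, smul_smul]
  rw [mul_comm]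

lemma kap_opF_kapInv (x : X) : W.kap (W.opF (W.kapInv x)) = (q p ^ 2)⁻¹ • W.opF x := by
  simp only [opF_apply, map_smul, map_sub, map_mul, kap_kapInv, kap_d, mul_smul_comm,
    smul_mul_assoc, ← smul_sub, smul_smul]
  rw [mul_comm]

/-- Left multiplication by ∂ commutes with right multiplication by z, and the terms in zx∂ cancel.
What survives is the scalar ∂z − 𝔮⁻²z∂ = 𝔮 − 𝔮⁻¹, multiplied by κ(x) − κ⁻¹(x). -/
lemma opE_opF (x : X) : W.opE (W.opF x) - W.opF (W.opE x) =
    (q p - (q p)⁻¹)⁻¹ • (W.kap x - W.kapInv x) := by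
  have hw := q_sub_inv_ne_zero p
  have h0 := Uq.q_sq_ne_zero (p := p)
  have h1 : ∀ y, W.d * (W.z * y) =
      (q p - (q p)⁻¹) • y + (q p ^ 2)⁻¹ • (W.z * (W.d * y)) := by
    intro y
    rw [← mul_assoc, W.d_mul_z, add_mul]
    simp [mul_assoc]
  simp only [opE_apply, opF_apply, map_smul, map_sub, map_mul, kap_kapInv, kapInv_kap, kap_d,
    kapInv_z, mul_smul_comm, smul_mul_assoc, mul_sub, mul_assoc, h1, W.d_mul_z, mul_add,
    smul_sub, smul_add, smul_smul, mul_one]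
  match_scalars <;> field_simp
  all_goals ring

/-- Right multiplication by z and x ↦ −zκ(x) skew-commute with factor 𝔮², a primitive p-th root of
unity. So the p-th power of their sum is the sum of their p-th powers, and both vanish because z^p =
0. -/
lemma opE_pow : W.opE ^ p = 0 := by
  rw [opE, smul_pow, skew_add_pow_eq_zero (q p ^ 2) _ _ ?_ p ?_ (q_sq_pow_ne_one p) ?_ ?_,
    smul_zero]
  · ext x
    simp [kap_z, mul_assoc]
  · rw [← pow_mul, q_pow]
  · rw [LinearMap.pow_mulRight, W.z_pow]; ext; simp
  · refine skew_mul_pow_eq_zero (q p ^ 2) _ _ ?_ p ?_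
    · ext x
      simp [kap_z]
    · rw [LinearMap.pow_mulLeft, neg_pow, W.z_pow, mul_zero]; ext; simp

lemma opF_pow : W.opF ^ p = 0 := by
  rw [opF, smul_pow, skew_add_pow_eq_zero (q p ^ 2) _ _ ?_ p ?_ (q_sq_pow_ne_one p) ?_ ?_,
    smul_zero]
  · ext x
    simp [kapInv_d, mul_assoc]
  · rw [← pow_mul, q_pow]
  · rw [LinearMap.pow_mulLeft, W.d_pow]; ext; simp
  · refine skew_mul_pow_eq_zero (q p ^ 2) _ _ ?_ p ?_
    · ext x
      simp [kapInv_d]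
    · rw [LinearMap.pow_mulRight, neg_pow, W.d_pow, mul_zero]; ext; simp

def act : Uq p →ₐ[ℂ] Module.End ℂ X :=
  Uq.lift W.opE W.kap.toLinearMap W.opF W.kapInv.toLinearMap W.kapInv_eq
    (LinearMap.ext W.kap_opE_kapInv) (LinearMap.ext W.kap_opF_kapInv) (LinearMap.ext W.opE_opF)
    W.opE_pow W.opF_pow W.kap_pow

@[simp] lemma act_E : W.act (Uq.E p) = W.opE := Uq.lift_E ..
@[simp] lemma act_K : W.act (Uq.K p) = W.kap.toLinearMap := Uq.lift_K ..
@[simp] lemma act_F : W.act (Uq.F p) = W.opF := Uq.lift_F ..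
@[simp] lemma act_KInv : W.act (Uq.KInv p) = W.kapInv.toLinearMap := Uq.lift_KInv ..

end WeylAlgebra

/-! ### Checking the Yetter–Drinfeld axioms on generators -/

section Generators
variable {H X : Type*} [Ring H] [HopfAlgebra ℂ H] [Ring X] [Algebra ℂ X]

/-- `h ⊗ g ↦ (h ▷ x) (g ▷ y)` -/
def actPair (act : H →ₐ[ℂ] Module.End ℂ X) (x y : X) : H ⊗[ℂ] H →ₗ[ℂ] X :=
  TensorProduct.lift
    ((LinearMap.mul ℂ X).compl₁₂ (act.toLinearMap.flip x) (act.toLinearMap.flip y))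

@[simp] lemma actPair_tmul (act : H →ₐ[ℂ] Module.End ℂ X) (x y : X) (a b : H) :
    actPair act x y (a ⊗ₜ b) = act a x * act b y := rfl

/-- Peels the right factor off a product of coproducts and lets it act on the arguments; this makes
the module algebra axiom multiplicative in the acting element. -/
lemma actPair_mul_tmul (act : H →ₐ[ℂ] Module.End ℂ X) (x y : X) (s : H ⊗[ℂ] H) (a b : H) :
    actPair act x y (s * a ⊗ₜ b) = actPair act (act a x) (act b y) s := by
  induction s with
  | zero => simp
  | add s t hs ht => simp only [add_mul, map_add, hs, ht]
  | tmul c e => simp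

lemma act_one_of_generators (act : H →ₐ[ℂ] Module.End ℂ X) {s : Set H}
    (hs : Algebra.adjoin ℂ s = ⊤)
    (h : ∀ a ∈ s, act a 1 = algebraMap ℂ X (Coalgebra.counit (R := ℂ) a)) (a : H) :
    act a 1 = algebraMap ℂ X (Coalgebra.counit (R := ℂ) a) := by
  have ha : a ∈ Algebra.adjoin ℂ s := hs ▸ Algebra.mem_top
  induction ha using Algebra.adjoin_induction with
  | mem x hx => exact h x hx
  | algebraMap r => simp [Algebra.algebraMap_eq_smul_one]
  | add x y _ _ hx hy => simp only [map_add, LinearMap.add_apply, hx, hy]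
  | mul x y _ _ hx hy =>
    rw [map_mul, Module.End.mul_apply, hy, Algebra.algebraMap_eq_smul_one, map_smul, hx]
    simp [Algebra.algebraMap_eq_smul_one, smul_smul, mul_comm]

/-- The elements that satisfy the axiom for all x and y form a subalgebra: for a product ab, the
rule for b produces the pairs b′ ▷ x, b″ ▷ y, to which the rule for a is applied. This is why x and
y stay quantified in the induction. -/
lemma act_mul_of_generators (act : H →ₐ[ℂ] Module.End ℂ X) {s : Set H}
    (hs : Algebra.adjoin ℂ s = ⊤)
    (h : ∀ a ∈ s, ∀ x y, act a (x * y) = actPair act x y (Coalgebra.comul (R := ℂ) a))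
    (a : H) : ∀ x y, act a (x * y) = actPair act x y (Coalgebra.comul (R := ℂ) a) := by
  have ha : a ∈ Algebra.adjoin ℂ s := hs ▸ Algebra.mem_top
  induction ha using Algebra.adjoin_induction with
  | mem x hx => exact h x hx
  | algebraMap r => 
    intro x y
    simp [Algebra.algebraMap_eq_smul_one, Algebra.TensorProduct.one_def]
  | add a b _ _ ha hb => intro x y; simp only [map_add, LinearMap.add_apply, ha, hb]
  | mul a b _ _ ha hb =>
    intro x y
    rw [map_mul act, Module.End.mul_apply, hb, Bialgebra.comul_mul]
    generalize Coalgebra.comul (R := ℂ) b = t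
    induction t with
    | zero => simp
    | add s t hs ht => simp only [mul_add, map_add, hs, ht]
    | tmul c e => rw [actPair_mul_tmul, actPair_tmul, ha]

/-- `h ⊗ g ↦ (h ▷ x)₍₋₁₎ g ⊗ (h ▷ x)₍₀₎` -/
def ydLeft (act : H →ₐ[ℂ] Module.End ℂ X) (coact : X →ₐ[ℂ] H ⊗[ℂ] X) (x : X) :
    H ⊗[ℂ] H →ₗ[ℂ] H ⊗[ℂ] X :=
  TensorProduct.lift
    ((LinearMap.rTensorHom X ∘ₗ (LinearMap.mul ℂ H).flip).flip ∘ₗ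
      coact.toLinearMap ∘ₗ act.toLinearMap.flip x)

/-- `h ⊗ g ↦ (a ⊗ x ↦ h a ⊗ (g ▷ x))` -/
def ydRight (act : H →ₐ[ℂ] Module.End ℂ X) : H ⊗[ℂ] H →ₗ[ℂ] Module.End ℂ (H ⊗[ℂ] X) :=
  TensorProduct.lift
    ((TensorProduct.mapBilinear (.id ℂ) H X H X).compl₁₂ (LinearMap.mul ℂ H) act.toLinearMap)

lemma rTensor_mul_flip (g : H) (u : H ⊗[ℂ] X) :
    ((LinearMap.mul ℂ H).flip g).rTensor X u = u * g ⊗ₜ 1 := by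
  induction u with
  | zero => simp
  | add s t hs ht => simp only [add_mul, map_add, hs, ht]
  | tmul c e => simp

@[simp] lemma ydLeft_tmul (act : H →ₐ[ℂ] Module.End ℂ X) (coact : X →ₐ[ℂ] H ⊗[ℂ] X) (x : X)
    (a b : H) : ydLeft act coact x (a ⊗ₜ b) = coact (act a x) * b ⊗ₜ 1 := by
  rw [← rTensor_mul_flip, ydLeft, TensorProduct.lift.tmul]
  rfl

@[simp] lemma ydRight_tmul_tmul (act : H →ₐ[ℂ] Module.End ℂ X) (a b c : H) (x : X) :
    ydRight act (a ⊗ₜ b) (c ⊗ₜ x) = (a * c) ⊗ₜ act b x := rfl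

lemma ydRight_mul (act : H →ₐ[ℂ] Module.End ℂ X) (s t : H ⊗[ℂ] H) (u : H ⊗[ℂ] X) :
    ydRight act (s * t) u = ydRight act s (ydRight act t u) := by
  induction s with
  | zero => simp
  | add s s' hs hs' => simp only [add_mul, map_add, LinearMap.add_apply, hs, hs']
  | tmul a b =>
    induction t with
    | zero => simp
    | add s s' hs hs' => simp only [mul_add, map_add, LinearMap.add_apply, hs, hs']
    | tmul c e =>
      induction u with
      | zero => simp
      | add s s' hs hs' => simp only [map_add, hs, hs']
      | tmul f x => simp [mul_assoc]

/-- The operator multiplies the factor from H on the left only, so it commutes with right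
multiplication there. -/
lemma ydRight_mul_tmul_one (act : H →ₐ[ℂ] Module.End ℂ X) (s : H ⊗[ℂ] H) (u : H ⊗[ℂ] X) (b : H) :
    ydRight act s (u * b ⊗ₜ 1) = ydRight act s u * b ⊗ₜ 1 := by
  induction s with
  | zero => simp
  | add s s' hs hs' => simp only [add_mul, map_add, LinearMap.add_apply, hs, hs']
  | tmul a c =>
    induction u with
    | zero => simp
    | add s s' hs hs' => simp only [add_mul, map_add, hs, hs']
    | tmul f x => simp [mul_assoc]

lemma ydLeft_mul_tmul (act : H →ₐ[ℂ] Module.End ℂ X) (coact : X →ₐ[ℂ] H ⊗[ℂ] X) (x : X)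
    (s : H ⊗[ℂ] H) (a b : H) :
    ydLeft act coact x (s * a ⊗ₜ b) = ydLeft act coact (act a x) s * b ⊗ₜ 1 := by
  induction s with
  | zero => simp
  | add s t hs ht => simp only [add_mul, map_add, hs, ht]
  | tmul c e => simp [mul_assoc]

/-- The condition passes from a and b to ab: the condition for b at x rewrites the inner part of the
right side as a sum of terms δ(b′ ▷ x)(b″ ⊗ 1), and the condition for a is then used at each b′ ▷ x.
-/
lemma yetter_drinfeld_of_generators (act : H →ₐ[ℂ] Module.End ℂ X) (coact : X →ₐ[ℂ] H ⊗[ℂ] X)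
    {s : Set H} (hs : Algebra.adjoin ℂ s = ⊤)
    (h : ∀ a ∈ s, ∀ x, ydLeft act coact x (Coalgebra.comul (R := ℂ) a) =
      ydRight act (Coalgebra.comul (R := ℂ) a) (coact x)) (a : H) :
    ∀ x, ydLeft act coact x (Coalgebra.comul (R := ℂ) a) =
      ydRight act (Coalgebra.comul (R := ℂ) a) (coact x) := by
  have ha : a ∈ Algebra.adjoin ℂ s := hs ▸ Algebra.mem_top
  induction ha using Algebra.adjoin_induction with
  | mem x hx => exact h x hx
  | algebraMap r => 
    intro x
    have : ∀ u : H ⊗[ℂ] X, ydRight act (1 ⊗ₜ 1) u = u := by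
      intro u
      induction u with
      | zero => simp
      | add s s' hs hs' => simp only [map_add, hs, hs']
      | tmul f x => simp
    simp only [Algebra.algebraMap_eq_smul_one, map_smul, Bialgebra.comul_one,
      Algebra.TensorProduct.one_def, LinearMap.smul_apply, this, ydLeft_tmul, map_one,
      Module.End.one_apply]
    rw [← Algebra.TensorProduct.one_def, mul_one]
  | add a b _ _ ha hb => intro x; simp only [map_add, LinearMap.add_apply, ha, hb]
  | mul a b _ _ ha hb =>
    intro x
    rw [Bialgebra.comul_mul, ydRight_mul, ← hb]
    generalize Coalgebra.comul (R := ℂ) b = t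
    induction t with
    | zero => simp
    | add s t hs ht => simp only [mul_add, map_add, hs, ht]
    | tmul c e => rw [ydLeft_mul_tmul, ydLeft_tmul, ydRight_mul_tmul_one, ha]

/-- `a ⊗ y ↦ (a ▷ x) y` -/
def braid (act : H →ₐ[ℂ] Module.End ℂ X) (x : X) : H ⊗[ℂ] X →ₗ[ℂ] X :=
  TensorProduct.lift (LinearMap.mul ℂ X ∘ₗ act.toLinearMap.flip x)

@[simp] lemma braid_tmul (act : H →ₐ[ℂ] Module.End ℂ X) (x y : X) (a : H) :
    braid act x (a ⊗ₜ y) = act a x * y := rfl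

/-- The admissible y form a subalgebra, since yy′x = y (y′₍₋₁₎ ▷ x) y′₍₀₎ = (y₍₋₁₎ y′₍₋₁₎ ▷ x) y₍₀₎
y′₍₀₎ and the coaction is multiplicative. The element x must remain arbitrary throughout. -/
lemma braidedCommutative_of_generators (Y : YDModuleAlgebra H X) {s : Set X}
    (hs : Algebra.adjoin ℂ s = ⊤) (h : ∀ y ∈ s, ∀ x, y * x = braid Y.act x (Y.coact y)) :
    Y.BraidedCommutative := by
  intro x y
  change y * x = braid Y.act x (Y.coact y)
  have hy : y ∈ Algebra.adjoin ℂ s := hs ▸ Algebra.mem_top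
  induction hy using Algebra.adjoin_induction generalizing x with
  | mem y hy => exact h y hy x
  | algebraMap r => simp [Algebra.algebraMap_eq_smul_one, Algebra.TensorProduct.one_def]
  | add y y' _ _ hy hy' => rw [add_mul, map_add, map_add, hy, hy']
  | mul y y' _ _ hy hy' =>
    rw [mul_assoc, hy', map_mul]
    generalize Y.coact y' = t
    induction t with
    | zero => simp
    | add s t hs ht => simp only [mul_add, map_add, hs, ht]
    | tmul a x' =>
      rw [braid_tmul, ← mul_assoc, hy]
      generalize Y.coact y = t
      induction t with
      | zero => simp
      | add s t hs ht => simp only [add_mul, map_add, hs, ht]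
      | tmul b y => simp [mul_assoc]

end Generators

/-- A Yetter–Drinfeld `U_q sl(2)`-module algebra is determined by its structure on generators. -/
lemma YDModuleAlgebra.eq_of_generators {p : ℕ} [Fact (2 ≤ p)] {X : Type*} [Ring X] [Algebra ℂ X]
    {Y Y' : YDModuleAlgebra (Uq p) X} {t : Set X} (ht : Algebra.adjoin ℂ t = ⊤)
    (hE : ∀ x ∈ t, Y.act (Uq.E p) x = Y'.act (Uq.E p) x)
    (hK : ∀ x ∈ t, Y.act (Uq.K p) x = Y'.act (Uq.K p) x)
    (hF : ∀ x ∈ t, Y.act (Uq.F p) x = Y'.act (Uq.F p) x)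
    (hcoact : ∀ x ∈ t, Y.coact x = Y'.coact x) : Y = Y' := by
  have hm : ∀ Y : YDModuleAlgebra (Uq p) X, ∀ h x y, Y.act h (x * y) =
    actPair Y.act x y (Coalgebra.comul (R := ℂ) h) := fun Y => Y.act_mul
  have key : ∀ h : Uq p, (∀ x ∈ t, Y.act h x = Y'.act h x) →
      (∀ x y, (∀ s ∈ ({x, y} : Set X), Y.act h s = Y'.act h s) →
        Y.act h (x * y) = Y'.act h (x * y)) → Y.act h = Y'.act h := by
    intro h hg hmul
    ext x
    have hx : x ∈ Algebra.adjoin ℂ t := ht ▸ Algebra.mem_top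
    induction hx using Algebra.adjoin_induction with
    | mem x hx => exact hg x hx
    | algebraMap r => rw [Algebra.algebraMap_eq_smul_one, map_smul, map_smul, Y.act_one, Y'.act_one]
    | add x y _ _ hx hy => rw [map_add, map_add, hx, hy]
    | mul x y _ _ hx hy => exact hmul x y (by simp [hx, hy])
  -- K comes first: the coproducts of E and F contain K and K⁻¹, so their twisted Leibniz rules
  -- determine E and F on products only once these operators are known to agree.
  have eK : Y.act (Uq.K p) = Y'.act (Uq.K p) :=
    key _ hK fun x y h => by simp [hm, h]
  have eKI : Y.act (Uq.KInv p) = Y'.act (Uq.KInv p) := by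
    rw [Uq.KInv, map_pow, map_pow, eK]
  have eE : Y.act (Uq.E p) = Y'.act (Uq.E p) :=
    key _ hE fun x y h => by simp [hm, h, eK]
  have eF : Y.act (Uq.F p) = Y'.act (Uq.F p) :=
    key _ hF fun x y h => by simp [hm, h, eKI]
  refine YDModuleAlgebra.ext (Uq.hom_ext eE eK eF) (AlgHom.ext_of_adjoin_eq_top ht hcoact)

lemma Uq.comul_KInv {p : ℕ} [Fact (2 ≤ p)] :
    Coalgebra.comul (R := ℂ) (Uq.KInv p) = Uq.KInv p ⊗ₜ Uq.KInv p := Uq.comulHom_KInv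

lemma Uq.counit_KInv {p : ℕ} [Fact (2 ≤ p)] :
    Coalgebra.counit (R := ℂ) (Uq.KInv p) = 1 := Uq.counitHom_KInv

/-! ### The Yetter–Drinfeld axioms for the inner structure -/

namespace WeylAlgebra
variable {p : ℕ} [hp : Fact (2 ≤ p)] {X : Type*} [Ring X] [Algebra ℂ X] (W : WeylAlgebra p X)

lemma act_one_eq (h : Uq p) : W.act h 1 = algebraMap ℂ X (Coalgebra.counit (R := ℂ) h) := by
  refine act_one_of_generators W.act Uq.adjoin_eq_top ?_ h
  rintro _ (rfl | rfl | rfl)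
  · simp [opE_apply]
  · simp
  · simp [opF_apply]

lemma act_mul_eq (h : Uq p) (x y : X) :
    W.act h (x * y) = actPair W.act x y (Coalgebra.comul (R := ℂ) h) := by
  refine act_mul_of_generators W.act Uq.adjoin_eq_top ?_ h x y
  rintro _ (rfl | rfl | rfl) x y
  · simp only [act_E, opE_apply, Uq.comul_E, map_add, actPair_tmul, act_K, map_one,
      Module.End.one_apply, AlgHom.toLinearMap_apply, map_mul, smul_mul_assoc, mul_smul_comm,
      ← smul_add, sub_mul, mul_sub, mul_assoc]
    congr 1; abel
  · simp
  · simp only [act_F, opF_apply, Uq.comul_F, map_add, actPair_tmul, act_KInv, map_one,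
      Module.End.one_apply, AlgHom.toLinearMap_apply, map_mul, smul_mul_assoc, mul_smul_comm,
      ← smul_add, sub_mul, mul_sub, mul_assoc]
    congr 1; abel

lemma counit_coact (x : X) :
    TensorProduct.lid ℂ X ((Coalgebra.counit (R := ℂ)).rTensor X (W.coact x)) = x := by
  have h : ((Algebra.TensorProduct.lid ℂ X).toAlgHom.comp
      (Algebra.TensorProduct.map (Bialgebra.counitAlgHom ℂ (Uq p)) (AlgHom.id ℂ X))).comp W.coact =
      AlgHom.id ℂ X := by
    refine AlgHom.ext_of_adjoin_eq_top W.adjoin_eq_top ?_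
    rintro x ((rfl | rfl) | hx)
    · simp [W.coact_z, Uq.counit_KInv]
    · simp [W.coact_d, Uq.counit_KInv]
    · simp [W.coact_cent x hx]
  exact DFunLike.congr_fun h x

lemma coassoc_coact (x : X) :
    TensorProduct.assoc ℂ (Uq p) (Uq p) X ((Coalgebra.comul (R := ℂ)).rTensor X (W.coact x)) =
      W.coact.toLinearMap.lTensor (Uq p) (W.coact x) := by
  have h : ((Algebra.TensorProduct.assoc ℂ ℂ ℂ (Uq p) (Uq p) X).toAlgHom.comp
      (Algebra.TensorProduct.map (Bialgebra.comulAlgHom ℂ (Uq p)) (AlgHom.id ℂ X))).comp W.coact =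
      (Algebra.TensorProduct.map (AlgHom.id ℂ (Uq p)) W.coact).comp W.coact := by
    refine AlgHom.ext_of_adjoin_eq_top W.adjoin_eq_top ?_
    rintro x ((rfl | rfl) | hx)
    · simp [W.coact_z, Uq.comul_KInv, TensorProduct.tmul_sub, add_mul, TensorProduct.add_tmul,
        Uq.mul_KInv, Algebra.TensorProduct.one_def, smul_add]
      abel
    · simp [W.coact_d, Uq.comul_KInv,
        TensorProduct.add_tmul, TensorProduct.tmul_add,
        Algebra.TensorProduct.one_def, smul_add]
      abel
    · simp [W.coact_cent x hx, Algebra.TensorProduct.one_def]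
  exact DFunLike.congr_fun h x

/-- This is the Yetter–Drinfeld condition for K: the coaction intertwines κ with conjugation by K
tensored with κ. Both maps are multiplicative, and the two terms in the coaction of z, and likewise
of ∂, have the same weight. -/
lemma coact_kap (x : X) : W.coact (W.kap x) * Uq.K p ⊗ₜ 1 =
    Uq.K p ⊗ₜ 1 * W.kap.toLinearMap.lTensor (Uq p) (W.coact x) := by
  have hx : x ∈ Algebra.adjoin ℂ ({W.z, W.d} ∪ W.cent) := W.adjoin_eq_top ▸ Algebra.mem_top
  have hl : ∀ u v : Uq p ⊗[ℂ] X, W.kap.toLinearMap.lTensor (Uq p) (u * v) =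
      W.kap.toLinearMap.lTensor (Uq p) u * W.kap.toLinearMap.lTensor (Uq p) v :=
    fun u v => map_mul (Algebra.TensorProduct.map (AlgHom.id ℂ (Uq p)) W.kap) u v
  have h1 : W.kap.toLinearMap.lTensor (Uq p) 1 = 1 :=
    map_one (Algebra.TensorProduct.map (AlgHom.id ℂ (Uq p)) W.kap)
  induction hx using Algebra.adjoin_induction with
  | mem x hx =>
    rcases hx with (rfl | rfl) | hx
    · have hE : Uq.K p * (Uq.E p * Uq.KInv p) = q p ^ 2 • Uq.E p := by
        rw [← mul_assoc, Uq.K_mul_E_mul_KInv]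
      simp [W.kap_z, W.coact_z, mul_sub, sub_mul, smul_sub, mul_assoc, Uq.KInv_mul, Uq.mul_KInv,
        ← TensorProduct.smul_tmul', hE, smul_comm (q p ^ 2)]
    · simp [W.kap_d, W.coact_d, mul_add, add_mul, smul_add, Uq.KInv_mul, Uq.mul_KInv,
        TensorProduct.smul_tmul', TensorProduct.tmul_smul, Uq.K_mul_F, smul_smul, mul_comm]
    · obtain ⟨c, hc⟩ := W.kap_cent x hx
      simp [hc, W.coact_cent x hx]
  | algebraMap r => simp [Algebra.algebraMap_eq_smul_one, h1]
  | add x y _ _ hx hy => simp only [map_add, add_mul, mul_add, hx, hy]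
  | mul x y _ _ hx hy =>
    rw [map_mul, map_mul, map_mul, hl, mul_assoc, hy, ← mul_assoc, hx, mul_assoc]

/-- Follows from `coact_kap` at κ⁻¹(x) by applying κ⁻¹ to the second tensor factor. -/
lemma coact_kapInv (x : X) : Uq.K p ⊗ₜ 1 * W.coact (W.kapInv x) =
    W.kapInv.toLinearMap.lTensor (Uq p) (W.coact x) * Uq.K p ⊗ₜ 1 := by
  have h := congrArg (W.kapInv.toLinearMap.lTensor (Uq p)) (W.coact_kap (W.kapInv x))
  rw [W.kap_kapInv] at h
  have e : ∀ u : Uq p ⊗[ℂ] X, W.kapInv.toLinearMap.lTensor (Uq p) (u * Uq.K p ⊗ₜ 1) =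
      W.kapInv.toLinearMap.lTensor (Uq p) u * Uq.K p ⊗ₜ 1 := by
    intro u
    induction u with
    | zero => simp
    | add s t hs ht => simp only [add_mul, map_add, hs, ht]
    | tmul a x => simp
  have e' : ∀ u : Uq p ⊗[ℂ] X, W.kapInv.toLinearMap.lTensor (Uq p)
      (Uq.K p ⊗ₜ 1 * W.kap.toLinearMap.lTensor (Uq p) u) = Uq.K p ⊗ₜ 1 * u := by
    intro u
    induction u with
    | zero => simp
    | add s t hs ht => simp only [mul_add, map_add, hs, ht]
    | tmul a x => simp [W.kapInv_kap]
  rw [e, e'] at h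
  exact h.symm

/-- Write δ for the coaction. After δ(E ▷ x) and δ(F ▷ x) are expanded by multiplicativity and
δ(κ^{±1}(x)) is expressed through δ(x), both sides depend linearly on δ(x). It may then be replaced
by an arbitrary tensor, and the check is made on pure tensors. -/
lemma coact_yd (h : Uq p) (x : X) :
    ydLeft W.act W.coact x (Coalgebra.comul (R := ℂ) h) =
      ydRight W.act (Coalgebra.comul (R := ℂ) h) (W.coact x) := by
  have hw := q_sub_inv_ne_zero p
  refine yetter_drinfeld_of_generators W.act W.coact Uq.adjoin_eq_top ?_ h x
  rintro _ (rfl | rfl | rfl) x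
  · have e1 : W.coact (W.opE x) * Uq.K p ⊗ₜ 1 = (q p - (q p)⁻¹)⁻¹ •
        (W.coact x * (W.coact W.z * Uq.K p ⊗ₜ 1) -
          W.coact W.z * (Uq.K p ⊗ₜ 1 * W.kap.toLinearMap.lTensor (Uq p) (W.coact x))) := by
      rw [opE_apply, ← coact_kap]
      simp only [map_smul, map_sub, map_mul, smul_mul_assoc, sub_mul, mul_assoc (W.coact x),
        mul_assoc (W.coact W.z)]
    -- The factor K from the coproduct of E removes the K⁻¹ in both terms of the coaction of z.
    have e2 : W.coact W.z * Uq.K p ⊗ₜ 1 = 1 ⊗ₜ W.z - (q p - (q p)⁻¹) • Uq.E p ⊗ₜ 1 := by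
      simp [W.coact_z, sub_mul, mul_assoc, Uq.KInv_mul]
    rw [← mul_assoc (W.coact W.z), e2] at e1
    simp only [Uq.comul_E, map_add, ydLeft_tmul, act_E, map_one, Module.End.one_apply, e1,
      LinearMap.add_apply]
    generalize W.coact x = u
    induction u with
    | zero => simp
    | add s t hs ht =>
      simp only [map_add, add_mul, mul_add, smul_add, smul_sub, smul_mul_assoc, sub_mul,
        mul_sub] at hs ht ⊢
      linear_combination (norm := abel) hs + ht
    | tmul a y =>
      simp [mul_sub, sub_mul, opE_apply, TensorProduct.tmul_sub, smul_sub, smul_smul, hw,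
        TensorProduct.smul_tmul']
      abel
  · simp only [Uq.comul_K, ydLeft_tmul, act_K, AlgHom.toLinearMap_apply, coact_kap]
    generalize W.coact x = u
    induction u with
    | zero => simp
    | add s t hs ht => simp only [map_add, mul_add, hs, ht]
    | tmul a y => simp
  · have e1 : W.coact (W.opF x) = (q p - (q p)⁻¹)⁻¹ •
        (W.coact W.d * W.coact x - W.coact (W.kapInv x) * W.coact W.d) := by
      rw [opF_apply]
      simp only [map_smul, map_sub, map_mul]
    have e2 : W.coact (W.kapInv x) = Uq.KInv p ⊗ₜ 1 *
        (W.kapInv.toLinearMap.lTensor (Uq p) (W.coact x) * Uq.K p ⊗ₜ 1) := by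
      rw [← coact_kapInv, ← mul_assoc]
      simp [Uq.KInv_mul, ← Algebra.TensorProduct.one_def]
    simp only [Uq.comul_F, map_add, ydLeft_tmul, act_F, act_KInv, AlgHom.toLinearMap_apply, e1, e2,
      LinearMap.add_apply]
    generalize W.coact x = u
    induction u with
    | zero => simp
    | add s t hs ht =>
      simp only [map_add, add_mul, mul_add, smul_add, smul_sub, smul_mul_assoc,
        sub_mul] at hs ht ⊢
      linear_combination (norm := abel) hs + ht
    | tmul a y =>
      simp [W.coact_d, mul_add, add_mul, opF_apply, TensorProduct.tmul_sub, smul_sub, smul_add,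
        smul_smul, hw, mul_assoc, Uq.mul_KInv,
        ← Algebra.TensorProduct.one_def]
      abel

/-- The Yetter–Drinfeld module algebra structure with `E` and `F` acting by inner formulas. -/
def yd : YDModuleAlgebra (Uq p) X where
  act := W.act
  coact := W.coact
  act_one := W.act_one_eq
  act_mul := W.act_mul_eq
  counit_coact := W.counit_coact
  coassoc_coact := W.coassoc_coact
  yetter_drinfeld := W.coact_yd

/-- For z the identity reads zx = κ⁻¹(x)z − (𝔮−𝔮⁻¹) E ▷ κ⁻¹(x), for ∂ it reads ∂x = κ⁻¹(x)∂ +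
(𝔮−𝔮⁻¹) F ▷ x: the inner definitions of E and F solved for zx and ∂x. A coinvariant element only has
to be central. -/
lemma yd_braidedCommutative : W.yd.BraidedCommutative := by
  have hw := q_sub_inv_ne_zero p
  refine braidedCommutative_of_generators _ W.adjoin_eq_top ?_
  rintro y ((rfl | rfl) | hy) x
  · simp [yd, W.coact_z, opE_apply, hw, W.kap_kapInv]
  · simp [yd, W.coact_d, opF_apply, hw]
  · simp [yd, W.coact_cent y hy, W.cent_comm y hy]

end WeylAlgebra

/-! ### Universal properties of `ℂ_𝔮[z,∂]` and of `ℂ_𝔮[z,∂] ⊗ ℂ[λ]/(λ^N - 1)` -/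

namespace Cq
variable (p : ℕ)

lemma z_pow : z p ^ p = 0 := by
  simpa using! RingQuot.mkAlgHom_rel ℂ (CqRel.z_pow (p := p))

lemma d_pow : d p ^ p = 0 := by
  simpa using! RingQuot.mkAlgHom_rel ℂ (CqRel.d_pow (p := p))

lemma d_mul_z : d p * z p = (q p - (q p)⁻¹) • 1 + (q p ^ 2)⁻¹ • (z p * d p) := by
  simpa using! RingQuot.mkAlgHom_rel ℂ (CqRel.dz (p := p))

variable {p}

/-- The universal property of the presentation. -/
def lift {A : Type*} [Ring A] [Algebra ℂ A] (a b : A) (h₁ : a ^ p = 0) (h₂ : b ^ p = 0)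
    (h₃ : b * a = (q p - (q p)⁻¹) • 1 + (q p ^ 2)⁻¹ • (a * b)) : Cq p →ₐ[ℂ] A :=
  RingQuot.liftAlgHom ℂ ⟨FreeAlgebra.lift ℂ (fun | .z => a | .d => b), by
    rintro x y (_ | _ | _) <;> simp [h₁, h₂, h₃]⟩

section
variable {A : Type*} [Ring A] [Algebra ℂ A] (a b : A) (h₁ : a ^ p = 0) (h₂ : b ^ p = 0)
    (h₃ : b * a = (q p - (q p)⁻¹) • 1 + (q p ^ 2)⁻¹ • (a * b))

@[simp] lemma lift_z : lift a b h₁ h₂ h₃ (z p) = a :=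
  (RingQuot.liftAlgHom_mkAlgHom_apply _ _ _ _).trans (by simp)

@[simp] lemma lift_d : lift a b h₁ h₂ h₃ (d p) = b :=
  (RingQuot.liftAlgHom_mkAlgHom_apply _ _ _ _).trans (by simp)

end

lemma adjoin_eq_top : Algebra.adjoin ℂ {z p, d p} = (⊤ : Subalgebra ℂ (Cq p)) := by
  refine top_le_iff.1 ((adjoin_ringQuot (CqRel p)).ge.trans (Algebra.adjoin_mono ?_))
  rintro _ ⟨_ | _, rfl⟩
  · exact Or.inl rfl
  · exact Or.inr rfl

end Cq

/-- `ℂ[λ]/(λ^N - 1)` -/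
abbrev Cyc (N : ℕ) : Type := AdjoinRoot (Polynomial.X ^ N - 1 : Polynomial ℂ)

namespace Cyc
variable {N : ℕ}

lemma root_pow : (AdjoinRoot.root (Polynomial.X ^ N - 1 : Polynomial ℂ)) ^ N = 1 := by
  have h := AdjoinRoot.eval₂_root (Polynomial.X ^ N - 1 : Polynomial ℂ)
  simpa [sub_eq_zero] using h

/-- The target may be noncommutative; it will be a Heisenberg double or a tensor product with U_q
sl(2). -/
def lift {A : Type*} [Ring A] [Algebra ℂ A] (t : A) (ht : t ^ N = 1) : Cyc N →ₐ[ℂ] A :=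
  Ideal.Quotient.liftₐ (Ideal.span {(Polynomial.X ^ N - 1 : Polynomial ℂ)})
    (Polynomial.aeval t) (by
    intro a ha
    obtain ⟨b, rfl⟩ := Ideal.mem_span_singleton.1 ha
    simp [ht])

@[simp] lemma lift_root {A : Type*} [Ring A] [Algebra ℂ A] (t : A) (ht : t ^ N = 1) :
    lift t ht (AdjoinRoot.root _) = t :=
  (Ideal.Quotient.lift_mk ..).trans (by simp)

lemma adjoin_eq_top : Algebra.adjoin ℂ {AdjoinRoot.root (Polynomial.X ^ N - 1 : Polynomial ℂ)} = ⊤ :=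
  AdjoinRoot.adjoinRoot_eq_top

end Cyc

/-- `ℂ_𝔮[z,∂] ⊗ ℂ[λ]/(λ^N - 1)` -/
abbrev HqCyc (p N : ℕ) : Type := Cq p ⊗[ℂ] Cyc N

namespace HqCyc
variable {p N : ℕ}

def z : HqCyc p N := Cq.z p ⊗ₜ 1
def d : HqCyc p N := Cq.d p ⊗ₜ 1
def lam : HqCyc p N := 1 ⊗ₜ AdjoinRoot.root _

lemma adjoin_eq_top : Algebra.adjoin ℂ ({z, d} ∪ {lam}) = (⊤ : Subalgebra ℂ (HqCyc p N)) := by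
  refine top_le_iff.1 fun x _ => ?_
  set S := Algebra.adjoin ℂ ({z, d} ∪ {lam} : Set (HqCyc p N)) with hS
  have h1 : (⊤ : Subalgebra ℂ (Cq p)) ≤ S.comap Algebra.TensorProduct.includeLeft := by
    rw [← Cq.adjoin_eq_top, Algebra.adjoin_le_iff]
    rintro _ (rfl | rfl)
    · exact Algebra.subset_adjoin (Or.inl (Or.inl rfl))
    · exact Algebra.subset_adjoin (Or.inl (Or.inr rfl))
  have h2 : (⊤ : Subalgebra ℂ (Cyc N)) ≤ S.comap Algebra.TensorProduct.includeRight := by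
    rw [← Cyc.adjoin_eq_top, Algebra.adjoin_le_iff]
    rintro _ rfl
    exact Algebra.subset_adjoin (Or.inr rfl)
  induction x using TensorProduct.induction_on with
  | zero => exact zero_mem _
  | add x y hx hy => exact add_mem (hx trivial) (hy trivial)
  | tmul a b =>
    have h : (a ⊗ₜ 1 * 1 ⊗ₜ b : HqCyc p N) ∈ S :=
      mul_mem (h1 (Algebra.mem_top (R := ℂ) (x := a))) (h2 (Algebra.mem_top (R := ℂ) (x := b)))
    rwa [Algebra.TensorProduct.tmul_mul_tmul, mul_one, one_mul] at h

lemma z_pow : (z : HqCyc p N) ^ p = 0 := by simp [z, Algebra.TensorProduct.tmul_pow, Cq.z_pow]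
lemma d_pow : (d : HqCyc p N) ^ p = 0 := by simp [d, Algebra.TensorProduct.tmul_pow, Cq.d_pow]
lemma lam_pow : (lam : HqCyc p N) ^ N = 1 := by
  rw [lam, Algebra.TensorProduct.tmul_pow, Cyc.root_pow, one_pow, Algebra.TensorProduct.one_def]
lemma d_mul_z : (d : HqCyc p N) * z =
    (q p - (q p)⁻¹) • 1 + (q p ^ 2)⁻¹ • (z * d) := by
  simp [z, d, Cq.d_mul_z, TensorProduct.add_tmul, TensorProduct.smul_tmul',
    Algebra.TensorProduct.one_def]

lemma lam_comm (x : HqCyc p N) : lam * x = x * lam := by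
  induction x using TensorProduct.induction_on with
  | zero => simp
  | add x y hx hy => rw [mul_add, add_mul, hx, hy]
  | tmul a b => simp [lam, mul_comm]

section
variable {A : Type*} [Ring A] [Algebra ℂ A] (f : Cq p →ₐ[ℂ] A) (t : A) (ht : t ^ N = 1)
  (hz : t * f (Cq.z p) = f (Cq.z p) * t) (hd : t * f (Cq.d p) = f (Cq.d p) * t)

/-- Commutation of t with the images of z and ∂ is enough, because centralizers are subalgebras;
this is used once for each tensor factor. -/
def lift : HqCyc p N →ₐ[ℂ] A :=
  Algebra.TensorProduct.lift f (Cyc.lift t ht) (by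
    have h1 : ∀ x, f x ∈ Subalgebra.centralizer ℂ {t} := by
      intro x
      have hx : x ∈ Algebra.adjoin ℂ {Cq.z p, Cq.d p} := Cq.adjoin_eq_top ▸ Algebra.mem_top
      have : Algebra.adjoin ℂ {Cq.z p, Cq.d p} ≤ (Subalgebra.centralizer ℂ {t}).comap f := by
        rw [Algebra.adjoin_le_iff]
        rintro _ (rfl | rfl)
        · rintro _ rfl; exact hz
        · rintro _ rfl; exact hd
      exact this hx
    intro x y
    have hy : y ∈ Algebra.adjoin ℂ {AdjoinRoot.root (Polynomial.X ^ N - 1 : Polynomial ℂ)} :=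
      Cyc.adjoin_eq_top ▸ Algebra.mem_top
    have : Algebra.adjoin ℂ {AdjoinRoot.root (Polynomial.X ^ N - 1 : Polynomial ℂ)} ≤
        (Subalgebra.centralizer ℂ {f x}).comap (Cyc.lift t ht) := by
      rw [Algebra.adjoin_le_iff]
      rintro _ rfl
      rintro _ rfl
      simpa using (h1 x t rfl).symm
    exact this hy (f x) rfl)

@[simp] lemma lift_tmul (a : Cq p) (b : Cyc N) :
    lift f t ht hz hd (a ⊗ₜ b) = f a * Cyc.lift t ht b := rfl
@[simp] lemma lift_z : lift f t ht hz hd z = f (Cq.z p) := by simp [z]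
@[simp] lemma lift_d : lift f t ht hz hd d = f (Cq.d p) := by simp [d]
@[simp] lemma lift_lam : lift f t ht hz hd lam = t := by simp [lam]

end
end HqCyc

/-! ### The coaction on the generators -/

section CoactRelations
variable {p : ℕ} [hp : Fact (2 ≤ p)] {X : Type*} [Ring X] [Algebra ℂ X] (z d : X)

/-- The coaction on `z`. -/
def coactZ : Uq p ⊗[ℂ] X := (-(q p - (q p)⁻¹)) • (Uq.E p * Uq.KInv p) ⊗ₜ 1 + Uq.KInv p ⊗ₜ z

/-- The coaction on `∂`. -/
def coactD : Uq p ⊗[ℂ] X := (q p - (q p)⁻¹) • Uq.F p ⊗ₜ 1 + Uq.KInv p ⊗ₜ d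

/-- Puts the coaction of z in the range of the q-binomial theorem, which serves twice: for the
vanishing of its p-th power and for the explicit coaction on z^m. -/
lemma coactZ_skew : (Uq.KInv p ⊗ₜ[ℂ] z) * ((-(q p - (q p)⁻¹)) • (Uq.E p * Uq.KInv p) ⊗ₜ[ℂ] (1 : X)) =
    ((q p)⁻¹ ^ 2) • (((-(q p - (q p)⁻¹)) • (Uq.E p * Uq.KInv p) ⊗ₜ[ℂ] (1 : X)) *
      (Uq.KInv p ⊗ₜ[ℂ] z)) := by
  rw [mul_smul_comm, smul_mul_assoc, smul_comm]
  congr 1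
  simp [← mul_assoc, Uq.KInv_mul_E, TensorProduct.smul_tmul']

lemma coactD_skew : (Uq.KInv p ⊗ₜ[ℂ] d) * ((q p - (q p)⁻¹) • Uq.F p ⊗ₜ[ℂ] (1 : X)) =
    (q p ^ 2) • (((q p - (q p)⁻¹) • Uq.F p ⊗ₜ[ℂ] (1 : X)) * (Uq.KInv p ⊗ₜ[ℂ] d)) := by
  rw [mul_smul_comm, smul_mul_assoc, smul_comm]
  congr 1
  simp [Uq.KInv_mul_F, TensorProduct.smul_tmul']

lemma E_KInv_pow : (Uq.E p * Uq.KInv p) ^ p = 0 :=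
  skew_mul_pow_eq_zero ((q p ^ 2)⁻¹) _ _ Uq.KInv_mul_E p (Uq.E_pow p)

lemma q_inv_sq_pow_ne_one (k : ℕ) (h0 : k ≠ 0) (hk : k < p) : ((q p)⁻¹ ^ 2) ^ k ≠ 1 := by
  rw [inv_pow, inv_pow, ne_eq, inv_eq_one]
  exact q_sq_pow_ne_one p k h0 hk

lemma coactZ_pow (hz : z ^ p = 0) : (coactZ z : Uq p ⊗[ℂ] X) ^ p = 0 := by
  refine skew_add_pow_eq_zero ((q p)⁻¹ ^ 2) _ _ (coactZ_skew z) p ?_ q_inv_sq_pow_ne_one ?_ ?_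
  · rw [← pow_mul, inv_pow, q_pow, inv_one]
  · rw [smul_pow, Algebra.TensorProduct.tmul_pow, E_KInv_pow]; simp
  · simp [Algebra.TensorProduct.tmul_pow, hz]

lemma coactD_pow (hd : d ^ p = 0) : (coactD d : Uq p ⊗[ℂ] X) ^ p = 0 := by
  refine skew_add_pow_eq_zero (q p ^ 2) _ _ (coactD_skew d) p ?_ (q_sq_pow_ne_one p) ?_ ?_
  · rw [← pow_mul, q_pow]
  · rw [smul_pow, Algebra.TensorProduct.tmul_pow, Uq.F_pow]; simp
  · simp [Algebra.TensorProduct.tmul_pow, hd]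

/-- Exchanging F with EK⁻¹ yields a multiple of (1 − K⁻²) ⊗ 1, exchanging ∂ with z yields one of K⁻²
⊗ 1. The normalizations by 𝔮 − 𝔮⁻¹ are such that the K⁻² terms cancel and (𝔮−𝔮⁻¹) 1 ⊗ 1 remains. -/
lemma coactD_mul_coactZ (h : d * z = (q p - (q p)⁻¹) • 1 + (q p ^ 2)⁻¹ • (z * d)) :
    (coactD d : Uq p ⊗[ℂ] X) * coactZ z =
      (q p - (q p)⁻¹) • 1 + (q p ^ 2)⁻¹ • (coactZ z * coactD d) := by
  have hw := q_sub_inv_ne_zero p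
  have h0 := q_ne_zero p
  have hEF : Uq.F p * Uq.E p = Uq.E p * Uq.F p - (q p - (q p)⁻¹)⁻¹ • (Uq.K p - Uq.KInv p) := by
    rw [← Uq.E_mul_F_sub]; abel
  have hFE : Uq.F p * (Uq.E p * Uq.KInv p) = Uq.E p * (Uq.F p * Uq.KInv p) -
      (q p - (q p)⁻¹)⁻¹ • (1 - Uq.KInv p * Uq.KInv p) := by
    rw [← mul_assoc, hEF, sub_mul, smul_mul_assoc, sub_mul, Uq.mul_KInv, mul_assoc]
  have hKE : Uq.KInv p * (Uq.E p * Uq.KInv p) =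
      (q p ^ 2)⁻¹ • (Uq.E p * (Uq.KInv p * Uq.KInv p)) := by
    rw [← mul_assoc, Uq.KInv_mul_E, smul_mul_assoc, mul_assoc]
  simp only [coactD, coactZ, mul_add, add_mul, smul_mul_assoc, mul_smul_comm,
    Algebra.TensorProduct.tmul_mul_tmul, mul_one, one_mul, mul_assoc, hFE, Uq.KInv_mul_F, h, TensorProduct.tmul_add, TensorProduct.tmul_smul, TensorProduct.sub_tmul,
    ← TensorProduct.smul_tmul', Algebra.TensorProduct.one_def, smul_add, smul_sub, smul_smul, hKE]
  match_scalars <;> field_simp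
  all_goals ring

end CoactRelations

/-! ### The Yetter–Drinfeld module algebras -/

lemma AlgHom.toLinearMap_pow_apply {X : Type*} [Ring X] [Algebra ℂ X] (f : X →ₐ[ℂ] X) (n : ℕ)
    (x : X) : (f.toLinearMap ^ n : Module.End ℂ X) x = (f ^ n) x := by
  induction n generalizing x with
  | zero => rfl
  | succ n ih => rw [pow_succ, pow_succ, Module.End.mul_apply, ih]; rfl

lemma AlgHom.pow_apply_of_smul {X : Type*} [Ring X] [Algebra ℂ X] (f : X →ₐ[ℂ] X) (c : ℂ) (x : X)
    (h : f x = c • x) (n : ℕ) : (f ^ n) x = c ^ n • x := by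
  induction n with
  | zero => simp
  | succ n ih => rw [pow_succ, AlgHom.mul_apply, h, map_smul, ih, smul_smul, pow_succ']

section Instances
variable (p : ℕ) [hp : Fact (2 ≤ p)]

lemma q_zpow_sub_one {c : ℂ} (hc : c ^ (2 * p) = 1) : c ^ (2 * p - 1) = c⁻¹ := by
  have := hp.out
  have h0 : c ≠ 0 := by rintro rfl; rw [zero_pow (by omega)] at hc; exact zero_ne_one hc
  rw [← mul_right_inj' h0, ← pow_succ', show 2 * p - 1 + 1 = 2 * p by omega, hc,
    mul_inv_cancel₀ h0]

lemma q_sq_pow_two_mul : (q p ^ 2) ^ (2 * p) = 1 := by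
  rw [← pow_mul, mul_comm, pow_mul, q_pow, one_pow]

/-- The algebra endomorphism `z ↦ c z`, `∂ ↦ c⁻¹ ∂`. -/
def Cq.scale (c : ℂ) (hc : c ≠ 0) : Cq p →ₐ[ℂ] Cq p :=
  Cq.lift (c • Cq.z p) (c⁻¹ • Cq.d p) (by rw [smul_pow, Cq.z_pow, smul_zero])
    (by rw [smul_pow, Cq.d_pow, smul_zero])
    (by simp only [smul_mul_smul_comm, Cq.d_mul_z, inv_mul_cancel₀ hc, mul_inv_cancel₀ hc,
          one_smul])

/-- `ℂ_𝔮[z,∂]` -/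
def Cq.weyl : WeylAlgebra p (Cq p) where
  z := Cq.z p
  d := Cq.d p
  kap := Cq.scale p (q p ^ 2) Uq.q_sq_ne_zero
  kapInv := Cq.scale p (q p ^ 2)⁻¹ (inv_ne_zero Uq.q_sq_ne_zero)
  cent := ∅
  coact := Cq.lift (coactZ (Cq.z p)) (coactD (Cq.d p)) (coactZ_pow _ (Cq.z_pow p))
    (coactD_pow _ (Cq.d_pow p)) (coactD_mul_coactZ _ _ (Cq.d_mul_z p))
  z_pow := Cq.z_pow p
  d_pow := Cq.d_pow p
  d_mul_z := Cq.d_mul_z p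
  kap_z := by simp [Cq.scale]
  kap_d := by simp [Cq.scale]
  kap_cent := by simp
  kap_pow := by
    refine LinearMap.ext fun x => ?_
    rw [AlgHom.toLinearMap_pow_apply]
    refine DFunLike.congr_fun (AlgHom.ext_of_adjoin_eq_top (φ₂ := AlgHom.id ℂ _) Cq.adjoin_eq_top ?_) x
    rintro _ (rfl | rfl)
    · rw [AlgHom.pow_apply_of_smul _ (q p ^ 2) _ (by simp [Cq.scale]), q_sq_pow_two_mul]; simp
    · rw [AlgHom.pow_apply_of_smul _ (q p ^ 2)⁻¹ _ (by simp [Cq.scale]), inv_pow,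
        q_sq_pow_two_mul]; simp
  kapInv_eq := by
    refine LinearMap.ext fun x => ?_
    rw [AlgHom.toLinearMap_pow_apply]
    refine DFunLike.congr_fun (AlgHom.ext_of_adjoin_eq_top Cq.adjoin_eq_top ?_) x
    rintro _ (rfl | rfl)
    · rw [AlgHom.pow_apply_of_smul _ (q p ^ 2) _ (by simp [Cq.scale]),
        q_zpow_sub_one p (q_sq_pow_two_mul p)]
      simp [Cq.scale]
    · rw [AlgHom.pow_apply_of_smul _ (q p ^ 2)⁻¹ _ (by simp [Cq.scale]), inv_pow,
        q_zpow_sub_one p (q_sq_pow_two_mul p)]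
      simp [Cq.scale]
  cent_comm := by simp
  coact_z := by rw [Cq.lift_z, coactZ, neg_smul]; abel
  coact_d := by rw [Cq.lift_d, coactD]; abel
  coact_cent := by simp
  adjoin_eq_top := by rw [Set.union_empty, Cq.adjoin_eq_top]

/-- The algebra endomorphism `z ↦ c z`, `∂ ↦ c⁻¹ ∂`, `λ ↦ b λ`. -/
def Hq.scale (c : ℂ) (hc : c ≠ 0) (b : ℂ) (hb : b ^ (2 * p) = 1) : Hq p →ₐ[ℂ] Hq p :=
  HqCyc.lift ((Hq.incl p).comp (Cq.scale p c hc)) (b • Hq.lam p)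
    (by rw [smul_pow, hb, one_smul]; exact HqCyc.lam_pow)
    (by rw [smul_mul_assoc, mul_smul_comm]; exact congrArg _ (HqCyc.lam_comm _))
    (by rw [smul_mul_assoc, mul_smul_comm]; exact congrArg _ (HqCyc.lam_comm _))

section
variable {p} (c : ℂ) (hc : c ≠ 0) (b : ℂ) (hb : b ^ (2 * p) = 1)
omit hp in
lemma Hq.scale_z : Hq.scale p c hc b hb (Hq.z p) = c • Hq.z p := by
  refine (HqCyc.lift_z ..).trans ?_
  simp [Cq.scale, Hq.z]
omit hp in
lemma Hq.scale_d : Hq.scale p c hc b hb (Hq.d p) = c⁻¹ • Hq.d p := by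
  refine (HqCyc.lift_d ..).trans ?_
  simp [Cq.scale, Hq.d]
omit hp in
lemma Hq.scale_lam : Hq.scale p c hc b hb (Hq.lam p) = b • Hq.lam p := HqCyc.lift_lam ..
end

omit hp in
lemma Hq.adjoin_eq_top :
    Algebra.adjoin ℂ ({Hq.z p, Hq.d p} ∪ {Hq.lam p}) = (⊤ : Subalgebra ℂ (Hq p)) :=
  HqCyc.adjoin_eq_top

lemma q_inv_pow : (q p)⁻¹ ^ (2 * p) = 1 := by rw [inv_pow, q_pow, inv_one]

def Hq.coact : Hq p →ₐ[ℂ] Uq p ⊗[ℂ] Hq p :=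
  HqCyc.lift ((Algebra.TensorProduct.map (AlgHom.id ℂ (Uq p)) (Hq.incl p)).comp (Cq.weyl p).coact)
    (1 ⊗ₜ Hq.lam p)
    (by rw [Algebra.TensorProduct.tmul_pow, one_pow, Algebra.TensorProduct.one_def]
        exact congrArg _ HqCyc.lam_pow)
    (by
      have h : ∀ x, Hq.lam p * x = x * Hq.lam p := HqCyc.lam_comm
      have e : ((Algebra.TensorProduct.map (AlgHom.id ℂ (Uq p)) (Hq.incl p)).comp (Cq.weyl p).coact)
          (Cq.z p) = coactZ (Hq.z p) := by
        simp [Cq.weyl, coactZ, Hq.z]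
      rw [e, coactZ, mul_add, add_mul, mul_smul_comm, smul_mul_assoc]
      simp [h])
    (by
      have h : ∀ x, Hq.lam p * x = x * Hq.lam p := HqCyc.lam_comm
      have e : ((Algebra.TensorProduct.map (AlgHom.id ℂ (Uq p)) (Hq.incl p)).comp (Cq.weyl p).coact)
          (Cq.d p) = coactD (Hq.d p) := by
        simp [Cq.weyl, coactD, Hq.d]
      rw [e, coactD, mul_add, add_mul, mul_smul_comm, smul_mul_assoc]
      simp [h])

lemma Hq.coact_incl (x : Cq p) : Hq.coact p (Hq.incl p x) =
    Algebra.TensorProduct.map (AlgHom.id ℂ (Uq p)) (Hq.incl p) ((Cq.weyl p).coact x) := by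
  change Hq.coact p (x ⊗ₜ 1) = _
  rw [Hq.coact, HqCyc.lift_tmul, map_one, mul_one]
  rfl

/-- `H_q sl(2)` -/
def Hq.weyl : WeylAlgebra p (Hq p) where
  z := Hq.z p
  d := Hq.d p
  kap := Hq.scale p (q p ^ 2) Uq.q_sq_ne_zero (q p)⁻¹ (q_inv_pow p)
  kapInv := Hq.scale p (q p ^ 2)⁻¹ (inv_ne_zero Uq.q_sq_ne_zero) (q p) (q_pow p)
  cent := {Hq.lam p}
  coact := Hq.coact p
  z_pow := HqCyc.z_pow
  d_pow := HqCyc.d_pow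
  d_mul_z := HqCyc.d_mul_z
  kap_z := Hq.scale_z ..
  kap_d := Hq.scale_d ..
  kap_cent := by rintro _ rfl; exact ⟨_, Hq.scale_lam ..⟩
  kap_pow := by
    refine LinearMap.ext fun x => ?_
    rw [AlgHom.toLinearMap_pow_apply]
    refine DFunLike.congr_fun
      (AlgHom.ext_of_adjoin_eq_top (φ₂ := AlgHom.id ℂ _) (Hq.adjoin_eq_top p) ?_) x
    rintro _ ((rfl | rfl) | rfl)
    · rw [AlgHom.pow_apply_of_smul _ _ _ (Hq.scale_z ..), q_sq_pow_two_mul]; simp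
    · rw [AlgHom.pow_apply_of_smul _ _ _ (Hq.scale_d ..), inv_pow, q_sq_pow_two_mul]; simp
    · rw [AlgHom.pow_apply_of_smul _ _ _ (Hq.scale_lam ..), q_inv_pow]; simp
  kapInv_eq := by
    refine LinearMap.ext fun x => ?_
    rw [AlgHom.toLinearMap_pow_apply]
    refine DFunLike.congr_fun (AlgHom.ext_of_adjoin_eq_top
      (φ₂ := Hq.scale p (q p ^ 2)⁻¹ (inv_ne_zero Uq.q_sq_ne_zero) (q p) (q_pow p))
      (Hq.adjoin_eq_top p) ?_) x
    rintro _ ((rfl | rfl) | rfl)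
    · rw [AlgHom.pow_apply_of_smul _ _ _ (Hq.scale_z ..), q_zpow_sub_one p (q_sq_pow_two_mul p)]
      exact (Hq.scale_z ..).symm
    · rw [AlgHom.pow_apply_of_smul _ _ _ (Hq.scale_d ..), inv_pow,
        q_zpow_sub_one p (q_sq_pow_two_mul p)]
      exact (Hq.scale_d ..).symm
    · rw [AlgHom.pow_apply_of_smul _ _ _ (Hq.scale_lam ..),
        q_zpow_sub_one p (q_inv_pow p), inv_inv]
      exact (Hq.scale_lam ..).symm
  cent_comm := by rintro _ rfl x; exact HqCyc.lam_comm x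
  coact_z := by
    rw [Hq.z, Hq.coact_incl]
    simp only [Cq.weyl, coactZ, Cq.lift_z, map_add, map_smul, Algebra.TensorProduct.map_tmul,
      AlgHom.id_apply, map_one]
    module
  coact_d := by
    rw [Hq.d, Hq.coact_incl]
    simp [Cq.weyl, coactD]
    abel
  coact_cent := by rintro _ rfl; exact HqCyc.lift_lam ..
  adjoin_eq_top := Hq.adjoin_eq_top p

lemma Hq.kap_incl (x : Cq p) :
    (Hq.weyl p).kap (Hq.incl p x) = Hq.incl p ((Cq.weyl p).kap x) := by
  change Hq.scale p (q p ^ 2) Uq.q_sq_ne_zero (q p)⁻¹ (q_inv_pow p) (x ⊗ₜ 1) = _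
  rw [Hq.scale, HqCyc.lift_tmul, map_one, mul_one]
  rfl

lemma Hq.kapInv_incl (x : Cq p) :
    (Hq.weyl p).kapInv (Hq.incl p x) = Hq.incl p ((Cq.weyl p).kapInv x) := by
  change Hq.scale p (q p ^ 2)⁻¹ (inv_ne_zero Uq.q_sq_ne_zero) (q p) (q_pow p) (x ⊗ₜ 1) = _
  rw [Hq.scale, HqCyc.lift_tmul, map_one, mul_one]
  rfl

/-- The inner formulas involve only z, ∂ and κ^{±1}, all of which restrict to ℂ_𝔮[z,∂]; agreement on
the generators of U_q sl(2) then propagates to sums and products. -/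
lemma Hq.act_incl (u : Uq p) (x : Cq p) :
    Hq.incl p ((Cq.weyl p).yd.act u x) = (Hq.weyl p).yd.act u (Hq.incl p x) := by
  have hu : u ∈ Algebra.adjoin ℂ {Uq.E p, Uq.K p, Uq.F p} := Uq.adjoin_eq_top ▸ Algebra.mem_top
  have hz : (Hq.weyl p).z = Hq.incl p (Cq.weyl p).z := rfl
  have hd : (Hq.weyl p).d = Hq.incl p (Cq.weyl p).d := rfl
  induction hu using Algebra.adjoin_induction generalizing x with
  | mem u hu =>
    simp only [WeylAlgebra.yd]
    rcases hu with rfl | rfl | rfl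
    · simp only [WeylAlgebra.act_E, WeylAlgebra.opE_apply, Hq.kap_incl, map_smul, map_sub,
        map_mul, hz]
    · simp only [WeylAlgebra.act_K, AlgHom.toLinearMap_apply, Hq.kap_incl]
    · simp only [WeylAlgebra.act_F, WeylAlgebra.opF_apply, Hq.kapInv_incl, map_smul, map_sub,
        map_mul, hd]
  | algebraMap r => simp [Algebra.algebraMap_eq_smul_one]
  | add a b _ _ ha hb => simp only [map_add, LinearMap.add_apply, ha, hb]
  | mul a b _ _ ha hb => rw [map_mul, map_mul, Module.End.mul_apply, Module.End.mul_apply, ha, hb]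

end Instances

/-! ### The explicit formulas -/

section Binomials
variable (p : ℕ) [hp : Fact (2 ≤ p)]

lemma qInt_mul (n : ℕ) : qInt p n * (q p - (q p)⁻¹) = q p ^ n - (q p)⁻¹ ^ n :=
  div_mul_cancel₀ _ (q_sub_inv_ne_zero p)

lemma qInt_ne_zero (n : ℕ) (h0 : n ≠ 0) (hn : n < p) : qInt p n ≠ 0 := by
  intro h
  have h1 := qInt_mul p n
  rw [h, zero_mul, eq_comm, sub_eq_zero, inv_pow] at h1
  apply q_sq_pow_ne_one p n h0 hn
  rw [← pow_mul, mul_comm, pow_mul, sq]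
  nth_rewrite 1 [h1]
  exact inv_mul_cancel₀ (pow_ne_zero _ (q_ne_zero p))

omit hp in
lemma qFact_succ (n : ℕ) : qFact p (n + 1) = qFact p n * qInt p (n + 1) :=
  Finset.prod_range_succ ..

lemma qFact_ne_zero (n : ℕ) (hn : n < p) : qFact p n ≠ 0 :=
  Finset.prod_ne_zero_iff.2 fun i hi => qInt_ne_zero p _ (by omega)
    (by have := Finset.mem_range.1 hi; omega)

omit hp in
-- Induction on k by the two-term recursion `gaussBinom_rec`, stated without division since
-- factorials vanish from p on. The parameters v = 𝔮, c = 𝔮 − 𝔮⁻¹ and v = 𝔮⁻¹, c = −(𝔮 − 𝔮⁻¹) both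
-- satisfy the hypothesis because [n] is invariant under 𝔮 ↦ 𝔮⁻¹.
lemma gaussBinom_sq_mul (v c : ℂ) (hv : v ≠ 0) (hc : c ≠ 0)
    (hq : ∀ n, qInt p n * c * v ^ n = (v ^ 2) ^ n - 1) (k r : ℕ) :
    gaussBinom (v ^ 2) (k + r) k * (qFact p k * qFact p r) = v ^ (k * r) * qFact p (k + r) := by
  induction k generalizing r with
  | zero => simp [gaussBinom_zero, qFact]
  | succ k ih =>
    have h := gaussBinom_rec (v ^ 2) (k + (r + 1)) k
    have e : (v ^ 2) ^ k - (v ^ 2) ^ (k + (r + 1)) =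
        - ((v ^ 2) ^ k * (qInt p (r + 1) * c * v ^ (r + 1))) := by rw [hq, pow_add]; ring
    have e' : (1 - (v ^ 2) ^ (k + 1)) = - (qInt p (k + 1) * c * v ^ (k + 1)) := by rw [hq]; ring
    rw [e, e'] at h
    have h2 : qInt p (k + 1) * v ^ (k + 1) * gaussBinom (v ^ 2) (k + (r + 1)) (k + 1) =
        qInt p (r + 1) * v ^ (r + 1) * gaussBinom (v ^ 2) (k + (r + 1)) k := by
      have h0 : c * (v ^ 2) ^ k ≠ 0 := by positivity
      apply mul_left_cancel₀ h0
      linear_combination -h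
    have h3 := ih (r + 1)
    rw [qFact_succ] at h3
    rw [show k + 1 + r = k + (r + 1) by ring, qFact_succ p k]
    apply mul_left_cancel₀ (pow_ne_zero (k + 1) hv)
    calc v ^ (k + 1) * (gaussBinom (v ^ 2) (k + (r + 1)) (k + 1) *
          (qFact p k * qInt p (k + 1) * qFact p r))
        = (qInt p (k + 1) * v ^ (k + 1) * gaussBinom (v ^ 2) (k + (r + 1)) (k + 1)) *
          (qFact p k * qFact p r) := by ring
      _ = v ^ (r + 1) * (gaussBinom (v ^ 2) (k + (r + 1)) k *
          (qFact p k * (qFact p r * qInt p (r + 1)))) := by rw [h2]; ring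
      _ = v ^ (k + 1) * (v ^ ((k + 1) * r) * qFact p (k + (r + 1))) := by rw [h3]; ring

lemma gaussBinom_q_sq {m s : ℕ} (hs : s ≤ m) (hm : m < p) :
    gaussBinom (q p ^ 2) m s = q p ^ (s * (m - s)) * qBinom p m s := by
  obtain ⟨r, rfl⟩ := Nat.exists_eq_add_of_le hs
  have h := gaussBinom_sq_mul p (q p) (q p - (q p)⁻¹) (q_ne_zero p) (q_sub_inv_ne_zero p)
    (fun n => by
      have := q_ne_zero p
      rw [qInt_mul, sub_mul, inv_pow, inv_mul_cancel₀ (pow_ne_zero _ this)]; ring) s r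
  have h1 := qFact_ne_zero p s (by omega)
  have h2 := qFact_ne_zero p r (by omega)
  rw [Nat.add_sub_cancel_left, qBinom, Nat.add_sub_cancel_left, ← mul_div_assoc, ← h]
  field_simp

lemma gaussBinom_q_inv_sq {m s : ℕ} (hs : s ≤ m) (hm : m < p) :
    gaussBinom ((q p)⁻¹ ^ 2) m s = (q p)⁻¹ ^ (s * (m - s)) * qBinom p m s := by
  obtain ⟨r, rfl⟩ := Nat.exists_eq_add_of_le hs
  have h := gaussBinom_sq_mul p (q p)⁻¹ (-(q p - (q p)⁻¹)) (inv_ne_zero (q_ne_zero p))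
    (neg_ne_zero.2 (q_sub_inv_ne_zero p))
    (fun n => by
      have h0 := pow_ne_zero n (q_ne_zero p)
      rw [mul_neg, qInt_mul, neg_mul, sub_mul, inv_pow, mul_inv_cancel₀ h0]; ring) s r
  have h1 := qFact_ne_zero p s (by omega)
  have h2 := qFact_ne_zero p r (by omega)
  rw [Nat.add_sub_cancel_left, qBinom, Nat.add_sub_cancel_left, ← mul_div_assoc, ← h]
  field_simp

end Binomials

/-! ### Powers of the coaction, powers of z, ∂, λ, and uniqueness -/

section Explicit
variable {p : ℕ} [hp : Fact (2 ≤ p)] {X : Type*} [Ring X] [Algebra ℂ X]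

lemma coactD_pow_eq (d : X) {m : ℕ} (hm : m < p) : (coactD d : Uq p ⊗[ℂ] X) ^ m =
    ∑ s ∈ Finset.range (m + 1),
    (q p ^ (s * (m - s)) * (q p - (q p)⁻¹) ^ s * qBinom p m s) •
      (Uq.F p ^ s * Uq.KInv p ^ (m - s)) ⊗ₜ[ℂ] (d ^ (m - s)) := by
  rw [coactD, skew_add_pow _ _ _ (coactD_skew d)]
  refine Finset.sum_congr rfl fun s hs => ?_
  have hs : s ≤ m := by have := Finset.mem_range.1 hs; omega
  rw [gaussBinom_q_sq p hs hm, smul_pow, smul_mul_assoc, smul_smul]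
  simp only [Algebra.TensorProduct.tmul_pow, Algebra.TensorProduct.tmul_mul_tmul, one_pow, one_mul]
  congr 1
  ring

/-- Moving E to the left past K⁻ⁱ costs 𝔮^{−2i}, and the exponents for i < n add up to −n(n−1). The
truncated n − 1 at n = 0 is multiplied by 0. -/
lemma E_KInv_pow_eq (n : ℕ) : (Uq.E p * Uq.KInv p) ^ n =
    (q p)⁻¹ ^ (n * (n - 1)) • (Uq.E p ^ n * Uq.KInv p ^ n) := by
  have h0 := q_ne_zero p
  induction n with
  | zero => simp
  | succ n ih =>
    have h := skew_pow_mul _ _ _ (Uq.KInv_mul_E (p := p)) n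
    rw [pow_succ, ih, smul_mul_assoc, mul_assoc, ← mul_assoc (Uq.KInv p ^ n), h, smul_mul_assoc,
      mul_smul_comm, smul_smul, pow_succ (Uq.E p), pow_succ (Uq.KInv p)]
    simp only [mul_assoc]
    congr 1
    rw [← inv_pow, ← pow_mul, ← pow_add]
    congr 1
    rcases n with _ | n
    · rfl
    · simp only [Nat.add_sub_cancel]; ring

lemma coactZ_pow_eq (z : X) {m : ℕ} (hm : m < p) : (coactZ z : Uq p ⊗[ℂ] X) ^ m =
    ∑ s ∈ Finset.range (m + 1),
    ((-1) ^ s * q p ^ (s * (1 - m) : ℤ) * (q p - (q p)⁻¹) ^ s * qBinom p m s) •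
      (Uq.E p ^ s * Uq.KInv p ^ m) ⊗ₜ[ℂ] (z ^ (m - s)) := by
  have h0 := q_ne_zero p
  rw [coactZ, skew_add_pow _ _ _ (coactZ_skew z)]
  refine Finset.sum_congr rfl fun s hs => ?_
  have hs : s ≤ m := by have := Finset.mem_range.1 hs; omega
  rw [gaussBinom_q_inv_sq p hs hm, smul_pow, smul_mul_assoc, smul_smul]
  simp only [Algebra.TensorProduct.tmul_pow, Algebra.TensorProduct.tmul_mul_tmul, one_pow, one_mul,
    E_KInv_pow_eq, smul_mul_assoc, ← TensorProduct.smul_tmul', smul_smul, mul_assoc, ← pow_add,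
    Nat.add_sub_cancel' hs]
  congr 1
  -- The exponent s(1−m) collects −s(m−s) from the Gaussian binomial at 𝔮⁻² and −s(s−1) from
  -- reordering (EK⁻¹)^s.
  have e : q p ^ (s * (1 - m) : ℤ) = (q p)⁻¹ ^ (s * (m - s)) * (q p)⁻¹ ^ (s * (s - 1)) := by
    rw [← pow_add, ← zpow_natCast, inv_zpow, ← zpow_neg]
    congr 1
    rcases s with _ | s
    · simp
    · obtain ⟨r, rfl⟩ := Nat.exists_eq_add_of_le hs
      rw [Nat.add_sub_cancel_left, Nat.add_sub_cancel]
      push_cast; ring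
  rw [e, neg_pow]
  ring

namespace WeylAlgebra
variable (W : WeylAlgebra p X)

/-- The n exchanges of ∂ with z contribute the geometric sum (𝔮−𝔮⁻¹)(1 + 𝔮⁻² + ⋯ + 𝔮^{−2(n−1)}) =
𝔮(1 − 𝔮^{−2n}). For n = 0 the coefficient is 0, so the truncated exponent n − 1 does no harm. -/
lemma d_mul_z_pow (n : ℕ) : W.d * W.z ^ n = (qInt p n * q p ^ (1 - n : ℤ) * (q p - (q p)⁻¹)) •
    W.z ^ (n - 1) + (q p)⁻¹ ^ (2 * n) • (W.z ^ n * W.d) := by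
  have h0 := q_ne_zero p
  induction n with
  | zero => simp [qInt]
  | succ n ih =>
    have h : ∀ m : ℕ, qInt p m * q p ^ (1 - m : ℤ) * (q p - (q p)⁻¹) =
        q p * (1 - (q p)⁻¹ ^ (2 * m)) := by
      intro m
      rw [mul_right_comm, qInt_mul, zpow_sub₀ h0, zpow_one, zpow_natCast, pow_mul', inv_pow, inv_pow]
      field_simp
    rw [pow_succ, ← mul_assoc, ih, add_mul, smul_mul_assoc, smul_mul_assoc, mul_assoc _ W.d, W.d_mul_z,
      mul_add, h, h]
    rcases n with _ | n
    · simp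
      congr 1; field_simp
    · simp only [Nat.add_sub_cancel, ← pow_succ, mul_smul_comm, mul_one, ← mul_assoc, inv_pow]
      match_scalars <;> field_simp
      all_goals ring

lemma d_pow_mul_z (n : ℕ) : W.d ^ n * W.z = (qInt p n * q p ^ (1 - n : ℤ) * (q p - (q p)⁻¹)) •
    W.d ^ (n - 1) + (q p)⁻¹ ^ (2 * n) • (W.z * W.d ^ n) := by
  have h0 := q_ne_zero p
  induction n with
  | zero => simp [qInt]
  | succ n ih =>
    have h : ∀ m : ℕ, qInt p m * q p ^ (1 - m : ℤ) * (q p - (q p)⁻¹) =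
        q p * (1 - (q p)⁻¹ ^ (2 * m)) := by
      intro m
      rw [mul_right_comm, qInt_mul, zpow_sub₀ h0, zpow_one, zpow_natCast, pow_mul', inv_pow, inv_pow]
      field_simp
    rw [pow_succ', mul_assoc, ih, mul_add, mul_smul_comm, mul_smul_comm, ← mul_assoc, W.d_mul_z,
      add_mul, h, h]
    rcases n with _ | n
    · simp
      congr 1; field_simp
    · simp only [Nat.add_sub_cancel, ← pow_succ', smul_mul_assoc, one_mul, mul_assoc, inv_pow]
      match_scalars <;> field_simp
      all_goals ring

end WeylAlgebra

/-- On a power of a generator κ is a scalar. Where z or ∂ commutes with the power, the inner formula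
leaves one minus that scalar; in the two mixed cases the scalar matches the factor in the exchange
relation, and only its lower-order term survives. The coaction formulas are q-binomial expansions.
-/
lemma Hq.explicitFormulas (p : ℕ) [Fact (2 ≤ p)] : ExplicitFormulas p (Hq.weyl p).yd := by
  have h0 := q_ne_zero p
  have hw := q_sub_inv_ne_zero p
  have hh := qh_sq p
  have hh0 := qh_ne_zero p
  have hEE : ∀ x, (Hq.weyl p).yd.act (Uq.E p) x = (Hq.weyl p).opE x := fun x => by
    simp [WeylAlgebra.yd]
  have hFF : ∀ x, (Hq.weyl p).yd.act (Uq.F p) x = (Hq.weyl p).opF x := fun x => by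
    simp [WeylAlgebra.yd]
  have hKK : ∀ x, (Hq.weyl p).yd.act (Uq.K p) x = (Hq.weyl p).kap x := fun x => by
    simp [WeylAlgebra.yd]
  have ez : (Hq.weyl p).z = Hq.z p := rfl
  have ed : (Hq.weyl p).d = Hq.d p := rfl
  have kz : (Hq.weyl p).kap (Hq.z p) = q p ^ 2 • Hq.z p := (Hq.weyl p).kap_z
  have kd : (Hq.weyl p).kap (Hq.d p) = (q p ^ 2)⁻¹ • Hq.d p := (Hq.weyl p).kap_d
  have kl : (Hq.weyl p).kap (Hq.lam p) = (q p)⁻¹ • Hq.lam p :=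
    Hq.scale_lam (p := p) _ Uq.q_sq_ne_zero _ (q_inv_pow p)
  have kz' : (Hq.weyl p).kapInv (Hq.z p) = (q p ^ 2)⁻¹ • Hq.z p := (Hq.weyl p).kapInv_z
  have kd' : (Hq.weyl p).kapInv (Hq.d p) = q p ^ 2 • Hq.d p := (Hq.weyl p).kapInv_d
  have kl' : (Hq.weyl p).kapInv (Hq.lam p) = q p • Hq.lam p :=
    Hq.scale_lam (p := p) _ (inv_ne_zero Uq.q_sq_ne_zero) _ (q_pow p)
  have hlam : ∀ (n : ℕ) x, x * Hq.lam p ^ n = Hq.lam p ^ n * x := fun n x =>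
    ((show Commute (Hq.lam p) x from HqCyc.lam_comm x).pow_left n).symm
  -- The half-integers enter through 1 − 𝔮^{−n} = 𝔮^{−n/2}(𝔮^{n/2} − 𝔮^{−n/2}), the factor left on
  -- λⁿ.
  have hh' : ∀ n : ℕ, q p ^ n = qh p ^ n * qh p ^ n := fun n => by rw [← hh]; ring
  have hi : ∀ n : ℕ, qInt p n = (q p - (q p)⁻¹)⁻¹ * (q p ^ n - (q p)⁻¹ ^ n) := fun n => by
    rw [qInt, div_eq_inv_mul]
  have hih : ∀ n : ℕ, qIntHalf p n = (q p - (q p)⁻¹)⁻¹ * (qh p ^ n - (qh p)⁻¹ ^ n) := fun n => by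
    rw [qIntHalf, div_eq_inv_mul]
  have one_sub : ∀ (c : ℂ) (x : Hq p), x - c • x = (1 - c) • x := fun c x => by
    rw [sub_smul, one_smul]
  have hZ : coactZ (Hq.z p) = (Hq.weyl p).coact (Hq.z p) := by
    rw [← ez, (Hq.weyl p).coact_z, coactZ, neg_smul]; abel
  have hD : coactD (Hq.d p) = (Hq.weyl p).coact (Hq.d p) := by
    rw [← ed, (Hq.weyl p).coact_d, coactD]; abel
  refine ⟨fun n => ?_, fun n => ?_, fun n => ?_, fun n => ?_, fun n => ?_, fun n => ?_,
    fun n => ?_, fun n => ?_, fun n => ?_, ?_, fun m hm => ?_, fun m hm => ?_⟩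
  · rw [hEE, WeylAlgebra.opE_apply, map_pow, kl, smul_pow, ez, mul_smul_comm, hlam, one_sub,
      smul_smul, hih, inv_pow (qh p), inv_pow (q p), hh']
    congr 1
    field_simp
  · rw [hKK, map_pow, kl, smul_pow]
  · rw [hFF, WeylAlgebra.opF_apply, map_pow, kl', smul_pow, ed, smul_mul_assoc, hlam,
      one_sub, smul_smul, hih, hh']
    congr 1
    rw [inv_pow]
    field_simp
    ring
  · rw [hEE, WeylAlgebra.opE_apply, map_pow, kz, smul_pow, ez, mul_smul_comm, ← pow_succ,
      ← pow_succ', one_sub, smul_smul, hi]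
    congr 1
    rw [inv_pow]
    field_simp
    ring
  · rw [hKK, map_pow, kz, smul_pow, ← pow_mul]
  · rw [hFF, WeylAlgebra.opF_apply, map_pow, kz', smul_pow, ed, ← ez, ← ed,
      WeylAlgebra.d_mul_z_pow, smul_mul_assoc, inv_pow, inv_pow, ← pow_mul, add_sub_cancel_right,
      smul_smul, mul_comm (q p - (q p)⁻¹)⁻¹, mul_assoc _ (q p - (q p)⁻¹), mul_inv_cancel₀ hw, mul_one]
  · rw [hEE, WeylAlgebra.opE_apply, map_pow, kd, smul_pow, ez, ← ez, ← ed,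
      WeylAlgebra.d_pow_mul_z, mul_smul_comm, inv_pow, inv_pow, ← pow_mul, add_sub_cancel_right,
      smul_smul, mul_comm (q p - (q p)⁻¹)⁻¹, mul_assoc _ (q p - (q p)⁻¹), mul_inv_cancel₀ hw, mul_one,
      mul_comm (qInt p n)]
  · rw [hKK, map_pow, kd, smul_pow, ← inv_pow, ← pow_mul]
  · rw [hFF, WeylAlgebra.opF_apply, map_pow, kd', smul_pow, ed, smul_mul_assoc, ← pow_succ,
      ← pow_succ', one_sub, smul_smul, hi]
    congr 1
    rw [inv_pow]
    field_simp
    ring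
  · exact (Hq.weyl p).coact_cent _ rfl
  · exact ((map_pow (Hq.weyl p).coact _ _).trans (by rw [hZ])).trans (coactZ_pow_eq _ hm)
  · exact ((map_pow (Hq.weyl p).coact _ _).trans (by rw [hD])).trans (coactD_pow_eq _ hm)

/-- Only the formulas with exponent 1 are needed, since z, ∂, λ generate; p ≥ 2 makes exponent 1
admissible in the coaction formulas. -/
lemma ExplicitFormulas.eq {p : ℕ} [hp : Fact (2 ≤ p)] {Y Y' : YDModuleAlgebra (Uq p) (Hq p)}
    (h : ExplicitFormulas p Y) (h' : ExplicitFormulas p Y') : Y = Y' := by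
  have h1 : 1 < p := hp.out
  refine YDModuleAlgebra.eq_of_generators (Hq.adjoin_eq_top p) ?_ ?_ ?_ ?_
  · rintro _ ((rfl | rfl) | rfl)
    · simpa using (h.E_z 1).trans (h'.E_z 1).symm
    · simpa using (h.E_d 1).trans (h'.E_d 1).symm
    · simpa using (h.E_lam 1).trans (h'.E_lam 1).symm
  · rintro _ ((rfl | rfl) | rfl)
    · simpa using (h.K_z 1).trans (h'.K_z 1).symm
    · simpa using (h.K_d 1).trans (h'.K_d 1).symm
    · simpa using (h.K_lam 1).trans (h'.K_lam 1).symm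
  · rintro _ ((rfl | rfl) | rfl)
    · simpa using (h.F_z 1).trans (h'.F_z 1).symm
    · simpa using (h.F_d 1).trans (h'.F_d 1).symm
    · simpa using (h.F_lam 1).trans (h'.F_lam 1).symm
  · rintro _ ((rfl | rfl) | rfl)
    · simpa only [pow_one] using (h.coact_z 1 h1).trans (h'.coact_z 1 h1).symm
    · simpa only [pow_one] using (h.coact_d 1 h1).trans (h'.coact_d 1 h1).symm
    · exact h.coact_lam.trans h'.coact_lam.symm

end Explicit

/-! ### The dual of the Taft algebra -/

section DualHopf
variable {B : Type} [Ring B] [HopfAlgebra ℂ B]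

lemma dualMul_apply (μ ν : Module.Dual ℂ B) (x : B) : dualMul B μ ν x =
    TensorProduct.dualDistrib ℂ B B (μ ⊗ₜ ν) (Coalgebra.comul (R := ℂ) x) := rfl

/-- Recognizes the product of B* as a convolution product, so that associativity and the unit laws
are inherited. -/
lemma dualMul_eq_conv (μ ν : Module.Dual ℂ B) :
    dualMul B μ ν = (WithConv.toConv μ * WithConv.toConv ν).ofConv := by
  ext x
  rw [dualMul_apply]
  change _ = LinearMap.mul' ℂ ℂ (TensorProduct.map μ ν (Coalgebra.comul (R := ℂ) x))
  generalize Coalgebra.comul (R := ℂ) x = t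
  induction t with
  | zero => simp
  | add s t hs ht => simp only [map_add, hs, ht]
  | tmul a b => simp

lemma dualMul_assoc (μ ν ρ : Module.Dual ℂ B) :
    dualMul B (dualMul B μ ν) ρ = dualMul B μ (dualMul B ν ρ) := by
  simp only [dualMul_eq_conv, WithConv.toConv_ofConv, mul_assoc]

lemma counit_dualMul (μ : Module.Dual ℂ B) : dualMul B (Coalgebra.counit (R := ℂ)) μ = μ := by
  rw [dualMul_eq_conv]
  exact congrArg WithConv.ofConv (one_mul (WithConv.toConv μ))

lemma dualMul_counit (μ : Module.Dual ℂ B) : dualMul B μ (Coalgebra.counit (R := ℂ)) = μ := by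
  rw [dualMul_eq_conv]
  exact congrArg WithConv.ofConv (mul_one (WithConv.toConv μ))

lemma lReg_apply (b : B) (β : Module.Dual ℂ B) (x : B) : lReg B b β x = β (x * b) := rfl
lemma rReg_apply (b : B) (β : Module.Dual ℂ B) (x : B) : rReg B b β x = β (b * x) := rfl

lemma dualDistrib_mul_tmul (μ ν : Module.Dual ℂ B) (a b : B) (t : B ⊗[ℂ] B) :
    TensorProduct.dualDistrib ℂ B B (μ ⊗ₜ ν) (t * a ⊗ₜ b) =
      TensorProduct.dualDistrib ℂ B B (lReg B a μ ⊗ₜ lReg B b ν) t := by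
  induction t with
  | zero => simp
  | add s t hs ht => simp only [add_mul, map_add, hs, ht]
  | tmul c e => simp [lReg_apply]

lemma dualDistrib_tmul_mul (μ ν : Module.Dual ℂ B) (a b : B) (t : B ⊗[ℂ] B) :
    TensorProduct.dualDistrib ℂ B B (μ ⊗ₜ ν) (a ⊗ₜ b * t) =
      TensorProduct.dualDistrib ℂ B B (rReg B a μ ⊗ₜ rReg B b ν) t := by
  induction t with
  | zero => simp
  | add s t hs ht => simp only [mul_add, map_add, hs, ht]
  | tmul c e => simp [rReg_apply]

lemma lReg_mul (a b : B) (β : Module.Dual ℂ B) : lReg B (a * b) β = lReg B a (lReg B b β) := by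
  ext x; simp [lReg_apply, mul_assoc]

lemma rReg_mul (a b : B) (β : Module.Dual ℂ B) : rReg B (a * b) β = rReg B b (rReg B a β) := by
  ext x; simp [rReg_apply, mul_assoc]

lemma lReg_one (β : Module.Dual ℂ B) : lReg B 1 β = β := by ext x; simp [lReg_apply]
lemma rReg_one (β : Module.Dual ℂ B) : rReg B 1 β = β := by ext x; simp [rReg_apply]

lemma lReg_rReg (a b : B) (β : Module.Dual ℂ B) :
    lReg B a (rReg B b β) = rReg B b (lReg B a β) := by
  ext x; simp [lReg_apply, rReg_apply, mul_assoc]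

end DualHopf

/-- Linear independence of the characters of a cyclic group. -/
lemma eq_zero_of_sum_mul_pow {N : ℕ} {ω : ℂ} (hω : IsPrimitiveRoot ω N) (c : Fin N → ℂ)
    (h : ∀ n : Fin N, ∑ i, c i * (ω ^ (n : ℕ)) ^ (i : ℕ) = 0) : c = 0 := by
  refine Matrix.eq_zero_of_forall_index_sum_pow_mul_eq_zero (f := fun n : Fin N => ω ^ (n : ℕ))
    (fun a b hab => Fin.ext (hω.pow_inj a.2 b.2 hab)) fun j => ?_
  rw [← h j]
  exact Finset.sum_congr rfl fun i _ => mul_comm _ _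

lemma injective_of_linearIndependent_basis {ι V V' : Type*} [AddCommGroup V] [Module ℂ V]
    [AddCommGroup V'] [Module ℂ V'] (b : Module.Basis ι ℂ V) (f : V →ₗ[ℂ] V')
    (h : LinearIndependent ℂ (f ∘ b)) : Function.Injective f := by
  rw [← b.constr_self ℂ f]
  exact b.injective_constr_of_linearIndependent h

lemma qh_isPrimitiveRoot (p : ℕ) [hp : Fact (2 ≤ p)] : IsPrimitiveRoot (qh p) (4 * p) := by
  have hp0 : (p : ℂ) ≠ 0 := by have := hp.out; exact_mod_cast (by omega : p ≠ 0)
  have h := Complex.isPrimitiveRoot_exp (4 * p) (by have := hp.out; omega)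
  convert h using 1
  rw [qh]; congr 1; push_cast; field_simp; ring

/-! ### The convolution algebra B*, its pairing with B, and the dimension of B -/

namespace Taft
variable {p : ℕ}

lemma span_monomials : Submodule.span ℂ
    (Set.range fun x : ℕ × ℕ => E p ^ x.1 * k p ^ x.2) = ⊤ := by
  set s := Submodule.span ℂ (Set.range fun x : ℕ × ℕ => E p ^ x.1 * k p ^ x.2) with hs
  have key : ∀ a x : Taft p, x ∈ s → a * x ∈ s := by
    intro a
    have ha : a ∈ Algebra.adjoin ℂ {E p, k p} := adjoin_eq_top ▸ Algebra.mem_top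
    induction ha using Algebra.adjoin_induction with
    | mem y hy =>
      intro x hx
      induction hx using Submodule.span_induction with
      | mem x hx =>
        obtain ⟨⟨m, n⟩, rfl⟩ := hx
        rcases hy with rfl | rfl
        · exact Submodule.subset_span ⟨(m + 1, n), by simp [pow_succ', mul_assoc]⟩
        · rw [← mul_assoc, skew_mul_pow _ _ _ (k_mul_E p), smul_mul_assoc, mul_assoc, ← pow_succ']
          exact Submodule.smul_mem _ _ (Submodule.subset_span ⟨(m, n + 1), rfl⟩)
      | zero => simp
      | add x y _ _ hx hy => rw [mul_add]; exact add_mem hx hy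
      | smul c x _ hx => rw [mul_smul_comm]; exact Submodule.smul_mem _ _ hx
    | algebraMap r =>
      intro x hx
      rw [← Algebra.smul_def]; exact Submodule.smul_mem _ _ hx
    | add x y _ _ hx hy => intro z hz; rw [add_mul]; exact add_mem (hx z hz) (hy z hz)
    | mul x y _ _ hx hy => intro z hz; rw [mul_assoc]; exact hx _ (hy z hz)
  exact top_le_iff.1 fun a _ => by
    simpa using key a 1 (Submodule.subset_span ⟨(0, 0), by simp⟩)

lemma linearMap_ext {V : Type*} [AddCommMonoid V] [Module ℂ V] {f g : Taft p →ₗ[ℂ] V}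
    (h : ∀ m n, f (E p ^ m * k p ^ n) = g (E p ^ m * k p ^ n)) : f = g :=
  LinearMap.ext_on_range span_monomials fun x => h x.1 x.2

/-- The dual `B*` -/
abbrev Dl (p : ℕ) := Module.Dual ℂ (Taft p)

lemma monomial_mul_E (m n : ℕ) :
    E p ^ m * k p ^ n * E p = q p ^ n • (E p ^ (m + 1) * k p ^ n) := by
  rw [mul_assoc, skew_pow_mul _ _ _ (k_mul_E p), mul_smul_comm, pow_succ, mul_assoc]

lemma k_mul_monomial (m n : ℕ) :
    k p * (E p ^ m * k p ^ n) = q p ^ m • (E p ^ m * k p ^ (n + 1)) := by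
  rw [← mul_assoc, skew_mul_pow _ _ _ (k_mul_E p), smul_mul_assoc, mul_assoc, ← pow_succ']

variable [hp : Fact (2 ≤ p)]

instance : Ring (Module.Dual ℂ (Taft p)) :=
  { (inferInstance : AddCommGroup (Module.Dual ℂ (Taft p))) with
    mul := fun μ ν => dualMul (Taft p) μ ν
    one := Coalgebra.counit (R := ℂ)
    mul_assoc := dualMul_assoc
    one_mul := counit_dualMul
    mul_one := dualMul_counit
    left_distrib := fun a b c => map_add (dualMul (Taft p) a) b c
    right_distrib := fun a b c => by
      change dualMul (Taft p) (a + b) c = dualMul (Taft p) a c + dualMul (Taft p) b c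
      rw [map_add]; rfl
    zero_mul := fun a => by
      change dualMul (Taft p) 0 a = 0
      rw [map_zero]; rfl
    mul_zero := fun a => map_zero (dualMul (Taft p) a) }

lemma dual_mul_def (μ ν : Module.Dual ℂ (Taft p)) : μ * ν = dualMul (Taft p) μ ν := rfl
lemma dual_one_def : (1 : Module.Dual ℂ (Taft p)) = Coalgebra.counit (R := ℂ) := rfl

instance : Algebra ℂ (Module.Dual ℂ (Taft p)) :=
  Algebra.ofModule
    (fun r x y => by
      change dualMul (Taft p) (r • x) y = r • dualMul (Taft p) x y
      rw [map_smul]; rfl)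
    (fun r x y => map_smul (dualMul (Taft p) x) r y)

lemma one_apply (x : Taft p) : (1 : Dl p) x = Coalgebra.counit (R := ℂ) x := rfl

lemma mul_apply_one (μ ν : Dl p) : (μ * ν) 1 = μ 1 * ν 1 := by
  rw [dual_mul_def, dualMul_apply, Bialgebra.comul_one, Algebra.TensorProduct.one_def,
    TensorProduct.dualDistrib_apply]

lemma lReg_k_mul (μ ν : Dl p) : lReg _ (k p) (μ * ν) = lReg _ (k p) μ * lReg _ (k p) ν := by
  ext x
  rw [lReg_apply, dual_mul_def, dualMul_apply, Bialgebra.comul_mul, comul_k, dualDistrib_mul_tmul]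
  rfl

lemma rReg_k_mul (μ ν : Dl p) : rReg _ (k p) (μ * ν) = rReg _ (k p) μ * rReg _ (k p) ν := by
  ext x
  rw [rReg_apply, dual_mul_def, dualMul_apply, Bialgebra.comul_mul, comul_k, dualDistrib_tmul_mul]
  rfl

/-- Since Δ(E) = 1 ⊗ E + E ⊗ k², the operator E ⇀ is a skew derivation of B*, twisted by k² ⇀. The
same holds for ↼ E. -/
lemma lReg_E_mul (μ ν : Dl p) : lReg _ (E p) (μ * ν) =
    μ * lReg _ (E p) ν + lReg _ (E p) μ * lReg _ (k p ^ 2) ν := by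
  ext x
  rw [lReg_apply, dual_mul_def, dualMul_apply, Bialgebra.comul_mul, comul_E, mul_add, map_add,
    dualDistrib_mul_tmul, dualDistrib_mul_tmul, lReg_one]
  rfl

lemma rReg_E_mul (μ ν : Dl p) : rReg _ (E p) (μ * ν) =
    μ * rReg _ (E p) ν + rReg _ (E p) μ * rReg _ (k p ^ 2) ν := by
  ext x
  rw [rReg_apply, dual_mul_def, dualMul_apply, Bialgebra.comul_mul, comul_E, add_mul, map_add,
    dualDistrib_tmul_mul, dualDistrib_tmul_mul, rReg_one]
  rfl

lemma counit_monomial (m n : ℕ) :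
    Coalgebra.counit (R := ℂ) (E p ^ m * k p ^ n) = if m = 0 then 1 else 0 := by
  rw [Bialgebra.counit_mul, Bialgebra.counit_pow, Bialgebra.counit_pow, counit_E, counit_k]
  simp [zero_pow_eq]

lemma lReg_k_kappa : lReg _ (k p) (kappa : Dl p) = (qh p)⁻¹ • kappa := by
  refine linearMap_ext fun m n => ?_
  rw [lReg_apply, mul_assoc, ← pow_succ, LinearMap.smul_apply, kappa_apply, kappa_apply]
  split_ifs <;> simp [pow_succ']

lemma rReg_k_kappa : rReg _ (k p) (kappa : Dl p) = (qh p)⁻¹ • kappa := by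
  refine linearMap_ext fun m n => ?_
  rw [rReg_apply, k_mul_monomial, map_smul, LinearMap.smul_apply, kappa_apply, kappa_apply]
  split_ifs with h <;> simp [pow_succ', h]

lemma lReg_E_kappa : lReg _ (E p) (kappa : Dl p) = 0 := by
  refine linearMap_ext fun m n => ?_
  rw [lReg_apply, monomial_mul_E, map_smul, kappa_apply]
  simp

lemma rReg_E_kappa : rReg _ (E p) (kappa : Dl p) = 0 := by
  refine linearMap_ext fun m n => ?_
  rw [rReg_apply, ← mul_assoc, ← pow_succ', kappa_apply]
  simp

lemma lReg_k_F : lReg _ (k p) (F : Dl p) = (q p)⁻¹ • F := by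
  refine linearMap_ext fun m n => ?_
  rw [lReg_apply, mul_assoc, ← pow_succ, LinearMap.smul_apply, F_apply, F_apply]
  split_ifs <;> simp [pow_succ']
  ring

lemma rReg_k_F : rReg _ (k p) (F : Dl p) = F := by
  have h0 := q_ne_zero p
  refine linearMap_ext fun m n => ?_
  rw [rReg_apply, k_mul_monomial, map_smul, F_apply, F_apply]
  split_ifs with h
  · simp [h, pow_succ']
    field_simp
  · simp

lemma lReg_E_F : lReg _ (E p) (F : Dl p) = (q p - (q p)⁻¹)⁻¹ • (1 : Dl p) := by
  have h0 := fun n => pow_ne_zero n (q_ne_zero p)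
  refine linearMap_ext fun m n => ?_
  rw [lReg_apply, monomial_mul_E, map_smul, F_apply, LinearMap.smul_apply, one_apply,
    counit_monomial]
  split_ifs with h h' h'
  · rw [inv_pow, smul_eq_mul, mul_div_assoc', mul_inv_cancel₀ (h0 n), one_div]; simp
  · omega
  · omega
  · simp

lemma rReg_k_pow_kappa_pow (i : ℕ) : rReg _ (k p) (kappa ^ i : Dl p) = (qh p)⁻¹ ^ i • kappa ^ i := by
  induction i with
  | zero =>
    rw [pow_zero, pow_zero, one_smul]
    ext x
    rw [rReg_apply, one_apply, one_apply, Bialgebra.counit_mul, counit_k, one_mul]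
  | succ i ih => rw [pow_succ, rReg_k_mul, ih, rReg_k_kappa, smul_mul_smul_comm, ← pow_succ]

lemma lReg_k_pow_kappa_pow (i : ℕ) : lReg _ (k p) (kappa ^ i : Dl p) = (qh p)⁻¹ ^ i • kappa ^ i := by
  induction i with
  | zero =>
    rw [pow_zero, pow_zero, one_smul]
    ext x
    rw [lReg_apply, one_apply, one_apply, Bialgebra.counit_mul, counit_k, mul_one]
  | succ i ih => rw [pow_succ, lReg_k_mul, ih, lReg_k_kappa, smul_mul_smul_comm, ← pow_succ]

lemma rReg_E_one : rReg _ (E p) (1 : Dl p) = 0 := by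
  ext x
  rw [rReg_apply, one_apply, Bialgebra.counit_mul, counit_E, zero_mul]; rfl

lemma lReg_E_one : lReg _ (E p) (1 : Dl p) = 0 := by
  ext x
  rw [lReg_apply, one_apply, Bialgebra.counit_mul, counit_E, mul_zero]; rfl

lemma rReg_E_kappa_pow (i : ℕ) : rReg _ (E p) (kappa ^ i : Dl p) = 0 := by
  induction i with
  | zero => rw [pow_zero, rReg_E_one]
  | succ i ih => rw [pow_succ, rReg_E_mul, ih, rReg_E_kappa, mul_zero, zero_mul, add_zero]

lemma kappa_one : (kappa : Dl p) 1 = 1 := by simpa using kappa_apply (p := p) 0 0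
lemma F_one : (F : Dl p) 1 = 0 := by simpa using F_apply (p := p) 0 0

lemma kappa_pow_apply_one (i : ℕ) : (kappa ^ i : Dl p) 1 = 1 := by
  induction i with
  | zero => rw [pow_zero, one_apply, Bialgebra.counit_one]
  | succ i ih => rw [pow_succ, mul_apply_one, ih, kappa_one, one_mul]

/-- A functional `ν` with `ν ↼ k = c ν` is determined by `ν(1)` and `ν ↼ E`. -/
lemma functional_ext {ν ν' : Dl p} (c : ℂ) (h1 : ν 1 = ν' 1)
    (hE : rReg _ (E p) ν = rReg _ (E p) ν') (hk : rReg _ (k p) ν = c • ν)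
    (hk' : rReg _ (k p) ν' = c • ν') : ν = ν' := by
  refine linearMap_ext fun m n => ?_
  rcases m with _ | m
  · have : ∀ ν : Dl p, rReg _ (k p) ν = c • ν → ν (k p ^ n) = c ^ n * ν 1 := by
      intro ν hν
      induction n with
      | zero => simp
      | succ n ih =>
        rw [pow_succ', ← rReg_apply, hν, LinearMap.smul_apply, ih, smul_eq_mul, pow_succ', mul_assoc]
    rw [pow_zero, one_mul, this ν hk, this ν' hk', h1]
  · rw [pow_succ', mul_assoc, ← rReg_apply, hE, rReg_apply]

/-- Both sides are eigenvectors of ↼ k with eigenvalue 𝔮⁻¹, agree at 1, and are annihilated by ↼ E,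
so `functional_ext` identifies them. -/
lemma rReg_E_F : rReg _ (E p) (F : Dl p) = (q p - (q p)⁻¹)⁻¹ • (kappa ^ 2 : Dl p) := by
  have h0 := q_ne_zero p
  refine functional_ext ((q p)⁻¹) ?_ ?_ ?_ ?_
  · rw [rReg_apply, LinearMap.smul_apply, kappa_pow_apply_one]
    simpa using F_apply (p := p) 1 0
  · rw [map_smul, rReg_E_kappa_pow, smul_zero]
    refine linearMap_ext fun m n => ?_
    rw [rReg_apply, rReg_apply, ← mul_assoc, ← mul_assoc, ← sq, ← pow_add, F_apply,
      if_neg (by omega)]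
    rfl
  · rw [← rReg_mul, show E p * k p = (q p)⁻¹ • (k p * E p) by
      rw [k_mul_E, smul_smul, inv_mul_cancel₀ h0, one_smul], map_smul, LinearMap.smul_apply,
      rReg_mul, rReg_k_F]
  · rw [map_smul, rReg_k_pow_kappa_pow, smul_comm, ← qh_sq, inv_pow]

/-- Both products vanish at 1 and have the same eigenvalue under ↼ k. Their images under ↼ E are
multiples of ϰ³, and the factor 𝔮 comes from ϰ ↼ k² = 𝔮⁻¹ϰ. -/
lemma kappa_mul_F : (kappa * F : Dl p) = q p • (F * kappa) := by
  have hh := qh_sq p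
  have h0 := qh_ne_zero p
  refine functional_ext ((qh p)⁻¹) ?_ ?_ ?_ ?_
  · rw [LinearMap.smul_apply, mul_apply_one, mul_apply_one, F_one]; simp
  · have e : (rReg _ (k p ^ 2) kappa : Dl p) = (q p)⁻¹ • kappa := by
      rw [sq, rReg_mul, rReg_k_kappa, map_smul, rReg_k_kappa, smul_smul, ← hh]; ring_nf
    rw [map_smul, rReg_E_mul, rReg_E_mul, rReg_E_kappa, rReg_E_F, e, zero_mul, mul_zero, add_zero,
      zero_add, smul_mul_smul_comm, mul_smul_comm, smul_smul, ← pow_succ, ← pow_succ']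
    congr 1
    have := q_ne_zero p
    field_simp
  · rw [rReg_k_mul, rReg_k_F, rReg_k_kappa, smul_mul_assoc]
  · rw [map_smul, rReg_k_mul, rReg_k_F, rReg_k_kappa, mul_smul_comm, smul_comm]

lemma kappa_pow : (kappa ^ (4 * p) : Dl p) = 1 := by
  refine functional_ext 1 ?_ ?_ ?_ ?_
  · rw [kappa_pow_apply_one, one_apply, Bialgebra.counit_one]
  · rw [rReg_E_kappa_pow, rReg_E_one]
  · rw [rReg_k_pow_kappa_pow, inv_pow, qh_pow, inv_one]
  · simpa using rReg_k_pow_kappa_pow (p := p) 0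

lemma rReg_k_F_pow (l : ℕ) : rReg _ (k p) (F ^ l : Dl p) = F ^ l := by
  induction l with
  | zero => simpa using rReg_k_pow_kappa_pow (p := p) 0
  | succ l ih => rw [pow_succ, rReg_k_mul, ih, rReg_k_F]

/-- `F^l ↼ E = derivCoeff l F^{l-1} ϰ²` -/
def derivCoeff (p l : ℕ) : ℂ := (q p - (q p)⁻¹)⁻¹ * ((q p ^ 2) ^ l - 1) / (q p ^ 2 - 1)

lemma derivCoeff_ne_zero (l : ℕ) (h0 : l ≠ 0) (hl : l < p) : derivCoeff p l ≠ 0 :=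
  div_ne_zero (mul_ne_zero (inv_ne_zero (q_sub_inv_ne_zero p))
    (sub_ne_zero.2 (q_sq_pow_ne_one p l h0 hl))) (sub_ne_zero.2 (q_sq_ne_one p))

lemma derivCoeff_self : derivCoeff p p = 0 := by
  rw [derivCoeff, ← pow_mul, q_pow, sub_self, mul_zero, zero_div]

lemma rReg_E_F_pow (l : ℕ) : rReg _ (E p) (F ^ (l + 1) : Dl p) =
    derivCoeff p (l + 1) • (F ^ l * kappa ^ 2 : Dl p) := by
  have h1 : q p ^ 2 - 1 ≠ 0 := sub_ne_zero.2 (q_sq_ne_one p)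
  induction l with
  | zero =>
    rw [zero_add, pow_one, rReg_E_F, derivCoeff, pow_one, pow_zero, one_mul,
      mul_div_assoc, div_self h1, mul_one]
  | succ l ih =>
    have e : (kappa ^ 2 * F ^ (l + 1) : Dl p) = (q p ^ 2) ^ (l + 1) • (F ^ (l + 1) * kappa ^ 2) :=
      skew_mul_pow _ _ _ (skew_pow_mul _ _ _ kappa_mul_F 2) _
    rw [pow_succ', rReg_E_mul, ih, rReg_E_F, sq (k p), rReg_mul, rReg_k_F_pow, rReg_k_F_pow,
      smul_mul_assoc, e, mul_smul_comm, ← mul_assoc, ← pow_succ', smul_smul, ← add_smul]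
    congr 1
    rw [derivCoeff, derivCoeff]
    field_simp
    ring

lemma F_pow_apply_one (l : ℕ) : (F ^ (l + 1) : Dl p) 1 = 0 := by
  rw [pow_succ', mul_apply_one, F_one, zero_mul]

/-- F^p vanishes at 1, is fixed by ↼ k, and F^p ↼ E carries the factor 𝔮^{2p} − 1 = 0. -/
lemma F_pow : (F ^ p : Dl p) = 0 := by
  obtain ⟨r, hr⟩ := Nat.exists_eq_add_of_le' (le_trans one_le_two hp.out)
  rw [congrArg (fun n => (F : Dl p) ^ n) hr]
  refine functional_ext 1 ?_ ?_ ?_ ?_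
  · rw [F_pow_apply_one]; rfl
  · rw [rReg_E_F_pow, ← congrArg (derivCoeff p) hr, derivCoeff_self, zero_smul, map_zero]
  · rw [rReg_k_F_pow, one_smul]
  · rw [map_zero, smul_zero]

lemma rReg_E_F_pow_mul_kappa_pow (l i : ℕ) : rReg _ (E p) (F ^ (l + 1) * kappa ^ i : Dl p) =
    (derivCoeff p (l + 1) * (q p)⁻¹ ^ i) • (F ^ l * kappa ^ (i + 2) : Dl p) := by
  have e : (rReg _ (k p ^ 2) (kappa ^ i) : Dl p) = (q p)⁻¹ ^ i • kappa ^ i := by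
    rw [sq, rReg_mul, rReg_k_pow_kappa_pow, map_smul, rReg_k_pow_kappa_pow, smul_smul, ← qh_sq,
      ← inv_pow, ← pow_mul, ← pow_add]
    congr 2; ring
  rw [rReg_E_mul, rReg_E_kappa_pow, mul_zero, zero_add, rReg_E_F_pow, e, smul_mul_smul_comm,
    mul_assoc, ← pow_add, add_comm 2 i]

lemma rReg_k_F_pow_mul_kappa_pow (l i : ℕ) : rReg _ (k p) (F ^ l * kappa ^ i : Dl p) =
    (qh p)⁻¹ ^ i • (F ^ l * kappa ^ i : Dl p) := by
  rw [rReg_k_mul, rReg_k_F_pow, rReg_k_pow_kappa_pow, mul_smul_comm]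

/-- `⟨F^l ϰ^i, E^l⟩` -/
def pairCoeff (p : ℕ) : ℕ → ℕ → ℂ
  | 0, _ => 1
  | l + 1, i => derivCoeff p (l + 1) * (q p)⁻¹ ^ i * pairCoeff p l (i + 2)

lemma pairCoeff_ne_zero : ∀ (l i : ℕ), l < p → pairCoeff p l i ≠ 0
  | 0, _, _ => one_ne_zero
  | l + 1, i, h => mul_ne_zero (mul_ne_zero (derivCoeff_ne_zero _ (Nat.succ_ne_zero l) h)
      (pow_ne_zero _ (inv_ne_zero (q_ne_zero p)))) (pairCoeff_ne_zero l (i + 2) (by omega))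

/-- Each E split off on the left acts by ↼ E, which lowers l by one and raises i by two; this
accounts for the exponent i + 2l once F is used up. Unequal numbers of E and F end in ϰ^i ↼ E = 0 or
in F(1) = 0. -/
lemma pairing (l i m n : ℕ) : (F ^ l * kappa ^ i : Dl p) (E p ^ m * k p ^ n) =
    if l = m then pairCoeff p l i * (qh p)⁻¹ ^ ((i + 2 * l) * n) else 0 := by
  induction m generalizing l i with
  | zero =>
    rw [pow_zero, one_mul]
    have h : (F ^ l * kappa ^ i : Dl p) (k p ^ n) =
        (qh p)⁻¹ ^ (i * n) * (F ^ l * kappa ^ i : Dl p) 1 := by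
      induction n with
      | zero => simp
      | succ n ih =>
        rw [pow_succ', ← rReg_apply, rReg_k_F_pow_mul_kappa_pow, LinearMap.smul_apply, ih,
          smul_eq_mul, ← mul_assoc, ← pow_add]
        congr 2; ring
    rw [h, mul_apply_one, kappa_pow_apply_one]
    rcases l with _ | l
    · rw [pow_zero, one_apply, Bialgebra.counit_one, if_pos rfl, pairCoeff]; simp
    · rw [F_pow_apply_one, if_neg (Nat.succ_ne_zero l)]; simp
  | succ m ih =>
    rw [pow_succ', mul_assoc, ← rReg_apply]
    rcases l with _ | l
    · rw [pow_zero, one_mul, rReg_E_kappa_pow, if_neg (Nat.succ_ne_zero m).symm]; rfl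
    · rw [rReg_E_F_pow_mul_kappa_pow, LinearMap.smul_apply, ih, pairCoeff]
      simp only [Nat.add_right_cancel_iff]
      split_ifs with h
      · rw [smul_eq_mul, ← mul_assoc]
        congr 2; ring
      · rw [smul_zero]

/-- Pairing a relation with F^l ϰ^i, for fixed l, leaves only the terms with E^l and turns them into
a Fourier sum over ℤ/4p in the exponent of k with frequency i. Independence of characters makes the
coefficients vanish. -/
lemma linearIndependent_monomials :
    LinearIndependent ℂ fun x : Fin p × Fin (4 * p) => E p ^ (x.1 : ℕ) * k p ^ (x.2 : ℕ) := by
  rw [Fintype.linearIndependent_iff]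
  rintro c hc ⟨l, n⟩
  have hq := inv_ne_zero (qh_ne_zero p)
  have h : (fun n : Fin (4 * p) => c (l, n) * (qh p)⁻¹ ^ (2 * (l : ℕ) * n)) = 0 := by
    refine eq_zero_of_sum_mul_pow (qh_isPrimitiveRoot p).inv _ fun i => ?_
    have h := congrArg (F ^ (l : ℕ) * kappa ^ (i : ℕ) : Dl p) hc
    rw [map_sum, map_zero, Fintype.sum_prod_type, Finset.sum_eq_single l] at h
    · have h1 := pairCoeff_ne_zero (p := p) l i l.2
      apply mul_left_cancel₀ h1
      rw [mul_zero, ← h, Finset.mul_sum]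
      refine Finset.sum_congr rfl fun n _ => ?_
      rw [map_smul, pairing, if_pos rfl, smul_eq_mul, add_mul, pow_add, pow_mul _ (i : ℕ)]
      ring
    · intro m _ hm
      refine Finset.sum_eq_zero fun n _ => ?_
      rw [map_smul, pairing, if_neg (fun h => hm (Fin.ext h.symm)), smul_zero]
    · simp
  exact (mul_eq_zero.1 (congrFun h n)).resolve_right (pow_ne_zero _ hq)

/-- The same pairing read the other way: the relation is evaluated on E^l k^n, and the exponent of ϰ
becomes the summation variable. -/
lemma linearIndependent_dual_monomials : LinearIndependent ℂ
    fun x : Fin p × Fin (4 * p) => (F ^ (x.1 : ℕ) * kappa ^ (x.2 : ℕ) : Dl p) := by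
  rw [Fintype.linearIndependent_iff]
  rintro c hc ⟨l, i⟩
  have hq := inv_ne_zero (qh_ne_zero p)
  have h : (fun i : Fin (4 * p) => c (l, i) * pairCoeff p l i) = 0 := by
    refine eq_zero_of_sum_mul_pow (qh_isPrimitiveRoot p).inv _ fun n => ?_
    have h := LinearMap.congr_fun hc (E p ^ (l : ℕ) * k p ^ (n : ℕ))
    rw [LinearMap.sum_apply, LinearMap.zero_apply, Fintype.sum_prod_type,
      Finset.sum_eq_single l] at h
    · apply mul_left_cancel₀ (pow_ne_zero (2 * (l : ℕ) * n) hq)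
      rw [mul_zero, ← h, Finset.mul_sum]
      refine Finset.sum_congr rfl fun i _ => ?_
      rw [LinearMap.smul_apply, pairing, if_pos rfl, smul_eq_mul, add_mul, pow_add, ← pow_mul,
        mul_comm (n : ℕ)]
      ring
    · intro m _ hm
      refine Finset.sum_eq_zero fun n _ => ?_
      rw [LinearMap.smul_apply, pairing, if_neg (fun h => hm (Fin.ext h)), smul_zero]
    · simp
  exact (mul_eq_zero.1 (congrFun h i)).resolve_right (pairCoeff_ne_zero _ _ l.2)

lemma span_finite_monomials : Submodule.span ℂ
    (Set.range fun x : Fin p × Fin (4 * p) => E p ^ (x.1 : ℕ) * k p ^ (x.2 : ℕ)) = ⊤ := by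
  have h0 := hp.out
  rw [← top_le_iff, ← span_monomials, Submodule.span_le]
  rintro _ ⟨⟨m, n⟩, rfl⟩
  by_cases hm : m < p
  · refine Submodule.subset_span ⟨(⟨m, hm⟩, ⟨n % (4 * p), Nat.mod_lt _ (by omega)⟩), ?_⟩
    dsimp only
    conv_rhs => rw [← Nat.div_add_mod n (4 * p), pow_add, pow_mul, k_pow, one_pow, one_mul]
  · dsimp only
    rw [show m = p + (m - p) by omega, pow_add, E_pow, zero_mul, zero_mul]
    exact zero_mem _

/-- The monomials `E^m k^n`. -/
def basis (p : ℕ) [Fact (2 ≤ p)] : Module.Basis (Fin p × Fin (4 * p)) ℂ (Taft p) :=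
  .mk linearIndependent_monomials span_finite_monomials.ge

lemma basis_apply (x : Fin p × Fin (4 * p)) :
    basis p x = E p ^ (x.1 : ℕ) * k p ^ (x.2 : ℕ) := Module.Basis.mk_apply ..

lemma finrank_eq : Module.finrank ℂ (Taft p) = 4 * p ^ 2 := by
  rw [Module.finrank_eq_card_basis (basis p), Fintype.card_prod, Fintype.card_fin, Fintype.card_fin]
  ring

/-- The Taft algebra is self-dual as an algebra. -/
def toDual (p : ℕ) [Fact (2 ≤ p)] : Taft p →ₐ[ℂ] Dl p := lift F kappa kappa_mul_F F_pow kappa_pow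

lemma toDual_E : toDual p (E p) = F := lift_E ..
lemma toDual_k : toDual p (k p) = kappa := lift_k ..

lemma toDual_monomial (m n : ℕ) : toDual p (E p ^ m * k p ^ n) = F ^ m * kappa ^ n := by
  rw [map_mul, map_pow, map_pow, toDual_E, toDual_k]

/-- A basis goes to an independent family, and the dimensions agree. -/
lemma toDual_bijective : Function.Bijective (toDual p) := by
  have hinj : Function.Injective (toDual p).toLinearMap := by
    refine injective_of_linearIndependent_basis (basis p) _ ?_
    have e : (toDual p).toLinearMap ∘ basis p =
        fun x => (F ^ (x.1 : ℕ) * kappa ^ (x.2 : ℕ) : Dl p) := by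
      funext x
      rw [Function.comp_apply, basis_apply]
      exact toDual_monomial ..
    rw [e]
    exact linearIndependent_dual_monomials
  exact ⟨hinj, (LinearMap.injective_iff_surjective_of_finrank_eq_finrank
    (f := (toDual p).toLinearMap) Subspace.dual_finrank_eq.symm).1 hinj⟩

/-- The dual of the Taft algebra is isomorphic to the Taft algebra. -/
def dualEquiv (p : ℕ) [Fact (2 ≤ p)] : Taft p ≃ₐ[ℂ] Dl p :=
  AlgEquiv.ofBijective (toDual p) toDual_bijective

lemma adjoin_dual_eq_top : Algebra.adjoin ℂ {F, kappa} = (⊤ : Subalgebra ℂ (Dl p)) := by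
  have h : ({F, kappa} : Set (Dl p)) = toDual p '' {E p, k p} := by
    rw [Set.image_pair, toDual_E, toDual_k]
  rw [h, ← AlgHom.map_adjoin, adjoin_eq_top, Algebra.map_top]
  exact (AlgHom.range_eq_top _).2 toDual_bijective.2

end Taft

/-! ### The inverse antipode and the coproduct of the dual -/

namespace Taft
variable {p : ℕ} [hp : Fact (2 ≤ p)]

lemma antipodeInv_antipode (x : Taft p) :
    antipodeInv (Taft p) (HopfAlgebra.antipode ℂ x) = x :=
  LinearMap.congr_fun (Ring.inverse_mul_cancel _ isUnit_antipode) x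

lemma antipode_antipodeInv (x : Taft p) :
    HopfAlgebra.antipode ℂ (antipodeInv (Taft p) x) = x :=
  LinearMap.congr_fun (Ring.mul_inverse_cancel _ isUnit_antipode) x

lemma antipode_injective : Function.Injective (HopfAlgebra.antipode ℂ (A := Taft p)) :=
  Function.LeftInverse.injective antipodeInv_antipode

lemma antipodeInv_mul (x y : Taft p) : antipodeInv (Taft p) (x * y) =
    antipodeInv (Taft p) y * antipodeInv (Taft p) x := by
  apply antipode_injective
  rw [HopfAlgebra.antipode_mul_antidistrib, antipode_antipodeInv, antipode_antipodeInv,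
    antipode_antipodeInv]

lemma antipodeInv_one : antipodeInv (Taft p) 1 = 1 := by
  apply antipode_injective
  rw [antipode_antipodeInv, HopfAlgebra.antipode_one]

lemma antipode_kInv : HopfAlgebra.antipode ℂ (kInv p) = k p := by
  have h := HopfAlgebra.antipode_mul_antidistrib (R := ℂ) (k p) (kInv p)
  rw [antipode_k, mul_kInv, HopfAlgebra.antipode_one] at h
  rw [← mul_one (HopfAlgebra.antipode ℂ (kInv p)), ← kInv_mul, ← mul_assoc, ← h, one_mul]

lemma antipodeInv_k : antipodeInv (Taft p) (k p) = kInv p := by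
  rw [← antipode_kInv, antipodeInv_antipode]

lemma kInv_sq_mul : kInv p ^ 2 * k p ^ 2 = 1 := by
  rw [← (show Commute (kInv p) (k p) from kInv_mul.trans mul_kInv.symm).mul_pow, kInv_mul, one_pow]

lemma antipodeInv_E : antipodeInv (Taft p) (E p) = -(kInv p ^ 2 * E p) := by
  apply antipode_injective
  rw [antipode_antipodeInv, map_neg, HopfAlgebra.antipode_mul_antidistrib, antipode_E, sq (kInv p),
    HopfAlgebra.antipode_mul_antidistrib, antipode_kInv, ← sq, ← sq, neg_mul, neg_neg, mul_assoc,
    kInv_sq_mul, mul_one]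

lemma comul_kInv : Coalgebra.comul (R := ℂ) (kInv p) = kInv p ⊗ₜ kInv p := by
  rw [kInv, Bialgebra.comul_pow, comul_k, Algebra.TensorProduct.tmul_pow]

lemma k_sq_comul : Coalgebra.comul (R := ℂ) (k p ^ 2) = (k p ^ 2) ⊗ₜ (k p ^ 2) := by
  rw [Bialgebra.comul_pow, comul_k, Algebra.TensorProduct.tmul_pow]

lemma kInv_sq_comul : Coalgebra.comul (R := ℂ) (kInv p ^ 2) = (kInv p ^ 2) ⊗ₜ (kInv p ^ 2) := by
  rw [Bialgebra.comul_pow, comul_kInv, Algebra.TensorProduct.tmul_pow]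

omit hp in
lemma adjoin_induction {P : Taft p → Prop} (hE : P (E p)) (hk : P (k p)) (h1 : P 1)
    (hs : ∀ (c : ℂ) x, P x → P (c • x)) (ha : ∀ x y, P x → P y → P (x + y))
    (hm : ∀ x y, P x → P y → P (x * y)) (x : Taft p) : P x := by
  have hx : x ∈ Algebra.adjoin ℂ {E p, k p} := adjoin_eq_top ▸ Algebra.mem_top
  induction hx using Algebra.adjoin_induction with
  | mem x hx =>
    rcases hx with rfl | rfl
    · exact hE
    · exact hk
  | algebraMap r => rw [Algebra.algebraMap_eq_smul_one]; exact hs _ _ h1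
  | add x y _ _ hx hy => exact ha x y hx hy
  | mul x y _ _ hx hy => exact hm x y hx hy

lemma dual_adjoin_induction {P : Dl p → Prop} (hF : P F) (hk : P kappa) (h1 : P 1)
    (hs : ∀ (c : ℂ) x, P x → P (c • x)) (ha : ∀ x y, P x → P y → P (x + y))
    (hm : ∀ x y, P x → P y → P (x * y)) (x : Dl p) : P x := by
  have hx : x ∈ Algebra.adjoin ℂ ({F, kappa} : Set (Dl p)) :=
    adjoin_dual_eq_top (p := p) ▸ Algebra.mem_top
  induction hx using Algebra.adjoin_induction with
  | mem x hx =>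
    rcases hx with rfl | rfl
    · exact hF
    · exact hk
  | algebraMap r => rw [Algebra.algebraMap_eq_smul_one]; exact hs _ _ h1
  | add x y _ _ hx hy => exact ha x y hx hy
  | mul x y _ _ hx hy => exact hm x y hx hy

lemma map_antipodeInv_mul (s t : Taft p ⊗[ℂ] Taft p) :
    TensorProduct.map (antipodeInv (Taft p)) (antipodeInv (Taft p)) (s * t) =
    TensorProduct.map (antipodeInv (Taft p)) (antipodeInv (Taft p)) t *
      TensorProduct.map (antipodeInv (Taft p)) (antipodeInv (Taft p)) s := by
  induction s with
  | zero => simp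
  | add s t hs ht => simp only [add_mul, mul_add, map_add, hs, ht]
  | tmul a b =>
    induction t with
    | zero => simp
    | add s t hs ht => simp only [add_mul, mul_add, map_add, hs, ht]
    | tmul c e => simp [antipodeInv_mul]

/-- `S⁻¹` is an anti-homomorphism of coalgebras. -/
lemma comul_antipodeInv (x : Taft p) : Coalgebra.comul (R := ℂ) (antipodeInv (Taft p) x) =
    TensorProduct.comm ℂ (Taft p) (Taft p)
      (TensorProduct.map (antipodeInv (Taft p)) (antipodeInv (Taft p)) (Coalgebra.comul (R := ℂ) x)) := by
  have hc : ∀ s t : Taft p ⊗[ℂ] Taft p, TensorProduct.comm ℂ _ _ (s * t) =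
      TensorProduct.comm ℂ _ _ s * TensorProduct.comm ℂ _ _ t :=
    fun s t => map_mul (Algebra.TensorProduct.comm ℂ (Taft p) (Taft p)) s t
  induction x using adjoin_induction with
  | hE =>
    have h2 : antipodeInv (Taft p) (k p ^ 2) = kInv p ^ 2 := by
      rw [sq, antipodeInv_mul, antipodeInv_k, ← sq]
    rw [antipodeInv_E, map_neg, Bialgebra.comul_mul, kInv_sq_comul, comul_E]
    simp [mul_add, antipodeInv_E, antipodeInv_one, h2, kInv_sq_mul, TensorProduct.neg_tmul,
      TensorProduct.tmul_neg]
  | hk => simp [antipodeInv_k, comul_kInv]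
  | h1 => simp [antipodeInv_one, Algebra.TensorProduct.one_def]
  | hs c x hx => simp only [map_smul, hx]
  | ha x y hx hy => simp only [map_add, hx, hy]
  | hm x y hx hy =>
    rw [antipodeInv_mul, Bialgebra.comul_mul, hx, hy, Bialgebra.comul_mul, map_antipodeInv_mul, hc]

lemma dualAntipodeInv_apply (μ : Dl p) (x : Taft p) :
    dualAntipodeInv (Taft p) μ x = μ (antipodeInv (Taft p) x) := rfl

lemma dualAntipodeInv_mul (μ ν : Dl p) : dualAntipodeInv (Taft p) (μ * ν) =
    (dualAntipodeInv (Taft p) ν * dualAntipodeInv (Taft p) μ : Dl p) := by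
  ext x
  rw [dualAntipodeInv_apply, dual_mul_def, dualMul_apply, comul_antipodeInv, dual_mul_def,
    dualMul_apply]
  generalize Coalgebra.comul (R := ℂ) x = t
  induction t with
  | zero => simp
  | add s t hs ht => simp only [map_add, hs, ht]
  | tmul a b => simp [dualAntipodeInv_apply, mul_comm]

lemma counit_antipodeInv (x : Taft p) :
    Coalgebra.counit (R := ℂ) (antipodeInv (Taft p) x) = Coalgebra.counit (R := ℂ) x := by
  induction x using adjoin_induction with
  | hE => rw [antipodeInv_E, map_neg, Bialgebra.counit_mul, counit_E, mul_zero, neg_zero]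
  | hk => rw [antipodeInv_k, kInv, Bialgebra.counit_pow, counit_k, one_pow]
  | h1 => rw [antipodeInv_one]
  | hs c x hx => simp only [map_smul, hx]
  | ha x y hx hy => simp only [map_add, hx, hy]
  | hm x y hx hy => rw [antipodeInv_mul, Bialgebra.counit_mul, hx, hy, Bialgebra.counit_mul, mul_comm]

lemma dualAntipodeInv_one : dualAntipodeInv (Taft p) 1 = (1 : Dl p) := by
  ext x
  rw [dualAntipodeInv_apply, one_apply, one_apply, counit_antipodeInv]

/-- `ϰ⁻¹ = ϰ^{4p-1}` -/
def kappaInv (p : ℕ) [Fact (2 ≤ p)] : Dl p := kappa ^ (4 * p - 1)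

lemma kappaInv_mul : (kappaInv p * kappa : Dl p) = 1 := by
  have := hp.out
  rw [kappaInv, ← pow_succ, show 4 * p - 1 + 1 = 4 * p by omega, kappa_pow]

lemma mul_kappaInv : (kappa * kappaInv p : Dl p) = 1 := by
  have := hp.out
  rw [kappaInv, ← pow_succ', show 4 * p - 1 + 1 = 4 * p by omega, kappa_pow]

lemma qh_inv_pow_pred : (qh p)⁻¹ ^ (4 * p - 1) = qh p := by
  have := hp.out
  have h := qh_pow p
  have h0 := pow_ne_zero (4 * p - 1) (qh_ne_zero p)
  rw [show 4 * p = 4 * p - 1 + 1 by omega, pow_succ] at h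
  rw [inv_pow]
  field_simp
  rw [← h, mul_comm]

lemma rReg_k_kappaInv : rReg _ (k p) (kappaInv p) = qh p • kappaInv p := by
  rw [kappaInv, rReg_k_pow_kappa_pow, qh_inv_pow_pred]

lemma lReg_k_kappaInv : lReg _ (k p) (kappaInv p) = qh p • kappaInv p := by
  rw [kappaInv, lReg_k_pow_kappa_pow, qh_inv_pow_pred]

lemma rReg_kInv_of (ν : Dl p) (c : ℂ) (hc : c ≠ 0) (h : rReg _ (k p) ν = c • ν) :
    rReg _ (kInv p) ν = c⁻¹ • ν := by
  rw [← smul_right_inj hc, smul_smul, mul_inv_cancel₀ hc, one_smul, ← map_smul, ← h, ← rReg_mul,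
    mul_kInv, rReg_one]

lemma lReg_kInv_of (ν : Dl p) (c : ℂ) (hc : c ≠ 0) (h : lReg _ (k p) ν = c • ν) :
    lReg _ (kInv p) ν = c⁻¹ • ν := by
  rw [← smul_right_inj hc, smul_smul, mul_inv_cancel₀ hc, one_smul, ← map_smul, ← h, ← lReg_mul,
    kInv_mul, lReg_one]

lemma lReg_kInv_kappa : lReg _ (kInv p) (kappa : Dl p) = qh p • kappa := by
  rw [lReg_kInv_of _ _ (inv_ne_zero (qh_ne_zero p)) lReg_k_kappa, inv_inv]

lemma rReg_kInv_kappa : rReg _ (kInv p) (kappa : Dl p) = qh p • kappa := by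
  rw [rReg_kInv_of _ _ (inv_ne_zero (qh_ne_zero p)) rReg_k_kappa, inv_inv]

lemma lReg_kInv_F : lReg _ (kInv p) (F : Dl p) = q p • F := by
  rw [lReg_kInv_of _ _ (inv_ne_zero (q_ne_zero p)) lReg_k_F, inv_inv]

lemma rReg_kInv_F : rReg _ (kInv p) (F : Dl p) = F := by
  rw [rReg_kInv_of _ 1 one_ne_zero (by rw [rReg_k_F, one_smul]), inv_one, one_smul]

lemma lReg_kInv_one : lReg _ (kInv p) (1 : Dl p) = 1 := by
  rw [lReg_kInv_of _ 1 one_ne_zero (by simpa using lReg_k_pow_kappa_pow (p := p) 0), inv_one,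
    one_smul]

lemma dualAntipodeInv_kappa : dualAntipodeInv (Taft p) (kappa : Dl p) = kappaInv p := by
  refine functional_ext (qh p) ?_ ?_ ?_ rReg_k_kappaInv
  · rw [dualAntipodeInv_apply, antipodeInv_one, kappa_one, kappaInv, kappa_pow_apply_one]
  · rw [kappaInv, rReg_E_kappa_pow]
    ext x
    rw [rReg_apply, dualAntipodeInv_apply, antipodeInv_mul, antipodeInv_E, mul_neg, map_neg,
      ← lReg_apply, lReg_mul, lReg_E_kappa, map_zero]
    simp
  · ext x
    rw [rReg_apply, dualAntipodeInv_apply, antipodeInv_mul, antipodeInv_k, ← lReg_apply,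
      lReg_kInv_kappa]
    rfl

lemma kappaInv_sq_mul : (kappaInv p ^ 2 * kappa ^ 2 : Dl p) = 1 := by
  rw [← (show Commute (kappaInv p) kappa from kappaInv_mul.trans mul_kappaInv.symm).mul_pow,
    kappaInv_mul, one_pow]

lemma kappa_sq_mul : (kappa ^ 2 * kappaInv p ^ 2 : Dl p) = 1 := by
  rw [← (show Commute kappa (kappaInv p) from mul_kappaInv.trans kappaInv_mul.symm).mul_pow,
    mul_kappaInv, one_pow]

/-- Both functionals vanish at 1, have eigenvalue 𝔮 under ↼ k, and are mapped by ↼ E to the same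
multiple of ε. -/
lemma dualAntipodeInv_F : dualAntipodeInv (Taft p) (F : Dl p) = -(kappaInv p ^ 2 * F) := by
  have hi : kappaInv p ^ 2 = (kappa ^ ((4 * p - 1) * 2) : Dl p) := by rw [kappaInv, ← pow_mul]
  have hs : rReg _ (k p) (kappaInv p ^ 2) = q p • kappaInv p ^ 2 := by
    rw [sq, rReg_k_mul, rReg_k_kappaInv, smul_mul_smul_comm, ← sq, qh_sq]
  refine functional_ext (q p) ?_ ?_ ?_ ?_
  · rw [dualAntipodeInv_apply, antipodeInv_one, LinearMap.neg_apply, mul_apply_one, F_one]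
    simp
  · have e : rReg _ (E p) (kappaInv p ^ 2) = 0 := by rw [hi, rReg_E_kappa_pow]
    rw [map_neg, rReg_E_mul, e, zero_mul, add_zero, rReg_E_F, mul_smul_comm, kappaInv_sq_mul]
    ext x
    rw [rReg_apply, dualAntipodeInv_apply, antipodeInv_mul, antipodeInv_E, mul_neg, map_neg,
      ← lReg_apply, lReg_mul, lReg_E_F, map_smul, sq, lReg_mul, lReg_kInv_one, lReg_kInv_one,
      LinearMap.neg_apply, LinearMap.smul_apply, LinearMap.smul_apply, one_apply, one_apply,
      counit_antipodeInv]
  · ext x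
    rw [rReg_apply, dualAntipodeInv_apply, antipodeInv_mul, antipodeInv_k, ← lReg_apply,
      lReg_kInv_F]
    rfl
  · rw [map_neg, rReg_k_mul, hs, rReg_k_F, smul_mul_assoc, smul_neg]

/-! ### The coproduct of the dual -/

omit hp in
lemma dualDistrib_injective :
    Function.Injective (TensorProduct.dualDistrib ℂ (Taft p) (Taft p)) :=
  (TensorProduct.dualDistribEquiv ℂ (Taft p) (Taft p)).injective

lemma dualDistrib_dualComul (μ : Dl p) (x y : Taft p) :
    TensorProduct.dualDistrib ℂ (Taft p) (Taft p) (dualComul (Taft p) μ) (x ⊗ₜ y) = μ (x * y) :=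
  LinearMap.congr_fun
    ((TensorProduct.dualDistribEquiv ℂ (Taft p) (Taft p)).apply_symm_apply _) (x ⊗ₜ y)

/-- Finite dimension of B makes B* ⊗ B* the full dual of B ⊗ B, so a coproduct is determined by its
values on pairs. -/
lemma dualComul_eq {μ : Dl p} {t : Dl p ⊗[ℂ] Dl p}
    (h : ∀ x y, TensorProduct.dualDistrib ℂ (Taft p) (Taft p) t (x ⊗ₜ y) = μ (x * y)) :
    dualComul (Taft p) μ = t := by
  apply dualDistrib_injective
  ext x y
  exact (dualDistrib_dualComul μ x y).trans (h x y).symm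

lemma dualComul_kappa : dualComul (Taft p) (kappa : Dl p) = kappa ⊗ₜ kappa := by
  refine dualComul_eq fun x y => ?_
  rw [TensorProduct.dualDistrib_apply, kappa]
  exact (map_mul (lift (p := p) (A := ℂ) 0 (qh p)⁻¹ _ _ _) x y).symm

lemma dualComul_one : dualComul (Taft p) (1 : Dl p) = 1 := by
  rw [Algebra.TensorProduct.one_def]
  refine dualComul_eq fun x y => ?_
  rw [TensorProduct.dualDistrib_apply, one_apply, one_apply, one_apply, Bialgebra.counit_mul]

/-- The pairing of `(B* ⊗ B*) ⊗ (B ⊗ B)` with products on the left and coproducts on the right. -/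
lemma dualDistrib_mul (s t : Dl p ⊗[ℂ] Dl p) (x y : Taft p) :
    TensorProduct.dualDistrib ℂ (Taft p) (Taft p) (s * t) (x ⊗ₜ y) =
    LinearMap.mul' ℂ ℂ (TensorProduct.map (TensorProduct.dualDistrib ℂ (Taft p) (Taft p) s)
      (TensorProduct.dualDistrib ℂ (Taft p) (Taft p) t)
      (TensorProduct.tensorTensorTensorComm ℂ _ _ _ _
        (Coalgebra.comul (R := ℂ) x ⊗ₜ Coalgebra.comul (R := ℂ) y))) := by
  induction s with
  | zero => simp
  | add s s' hs hs' =>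
    simp only [add_mul, map_add, hs, hs', LinearMap.add_apply, TensorProduct.map_add_left]
  | tmul a b =>
    induction t with
    | zero => simp
    | add t t' ht ht' =>
      simp only [mul_add, map_add, ht, ht', LinearMap.add_apply, TensorProduct.map_add_right]
    | tmul c e =>
      rw [Algebra.TensorProduct.tmul_mul_tmul, TensorProduct.dualDistrib_apply, dual_mul_def,
        dual_mul_def, dualMul_apply, dualMul_apply]
      generalize Coalgebra.comul (R := ℂ) x = u
      generalize Coalgebra.comul (R := ℂ) y = v
      induction u with
      | zero => simp
      | add s t hs ht => simp only [map_add, add_mul, TensorProduct.add_tmul, hs, ht]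
      | tmul u u' =>
        induction v with
        | zero => simp
        | add s t hs ht => simp only [map_add, mul_add, TensorProduct.tmul_add, hs, ht]
        | tmul v v' => simp; ring

lemma dualComul_mul (μ ν : Dl p) :
    dualComul (Taft p) (μ * ν) = dualComul (Taft p) μ * dualComul (Taft p) ν := by
  refine dualComul_eq fun x y => ?_
  rw [dualDistrib_mul, dual_mul_def, dualMul_apply, Bialgebra.comul_mul]
  generalize Coalgebra.comul (R := ℂ) x = u
  generalize Coalgebra.comul (R := ℂ) y = v
  induction u with
  | zero => simp
  | add s t hs ht => simp only [map_add, add_mul, TensorProduct.add_tmul, hs, ht]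
  | tmul u u' =>
    induction v with
    | zero => simp
    | add s t hs ht => simp only [map_add, mul_add, TensorProduct.tmul_add, hs, ht]
    | tmul v v' => simp [dualDistrib_dualComul]

/-- The coproduct of `B*` as a homomorphism of algebras. -/
def dualComulHom (p : ℕ) [Fact (2 ≤ p)] : Dl p →ₐ[ℂ] Dl p ⊗[ℂ] Dl p :=
  AlgHom.ofLinearMap (dualComul (Taft p)) dualComul_one dualComul_mul

lemma dualComulHom_apply (μ : Dl p) : dualComulHom p μ = dualComul (Taft p) μ := rfl

lemma kappa_sq_mul_apply (x y : Taft p) :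
    (kappa ^ 2 : Dl p) (x * y) = (kappa ^ 2 : Dl p) x * (kappa ^ 2 : Dl p) y := by
  rw [← dualDistrib_dualComul, sq, dualComul_mul, dualComul_kappa,
    Algebra.TensorProduct.tmul_mul_tmul, TensorProduct.dualDistrib_apply]

/-- Amounts to F(xy) = ε(x)F(y) + F(x)ϰ²(y): F is a skew derivation from B to ℂ. For arbitrary y the
condition is stable under sums and products in x, and at x = E and x = k it is the value of F ↼ E
and F ↼ k. -/
lemma dualComul_F : dualComul (Taft p) (F : Dl p) = 1 ⊗ₜ F + F ⊗ₜ (kappa ^ 2) := by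
  refine dualComul_eq fun x y => ?_
  rw [map_add, LinearMap.add_apply, TensorProduct.dualDistrib_apply,
    TensorProduct.dualDistrib_apply]
  symm
  induction x using adjoin_induction generalizing y with
  | hE =>
    rw [← rReg_apply, rReg_E_F, one_apply, counit_E, LinearMap.smul_apply, zero_mul, zero_add]
    congr 1
    have h := F_apply (p := p) 1 0
    simpa using h.symm
  | hk =>
    have h := F_apply (p := p) 0 1
    simp only [pow_zero, one_mul, pow_one, zero_ne_one, if_false] at h
    rw [← rReg_apply, rReg_k_F, one_apply, counit_k, h, one_mul, zero_mul, add_zero]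
  | h1 => rw [one_mul, one_apply, Bialgebra.counit_one, F_one, one_mul, zero_mul, add_zero]
  | hs c x hx => rw [smul_mul_assoc, map_smul, hx, map_smul, map_smul, smul_add, smul_mul_assoc,
      smul_mul_assoc]
  | ha x x' hx hx' => rw [add_mul, map_add, hx, hx', map_add, map_add]; ring
  | hm x x' hx hx' =>
    rw [mul_assoc, hx, hx', hx x', kappa_sq_mul_apply, one_apply, one_apply, one_apply,
      Bialgebra.counit_mul]
    ring

end Taft

/-! ### Twisted products on `B* ⊗ B` -/

open Taft in
/-- The data of an algebra structure on `B* ⊗ B` with product `(μ ⊗ m)(ν ⊗ n) = μ T(m)(ν ⊗ n)`,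
where `T(k)` and `T(E)` have the form of an Ore extension. -/
structure SkewTwist (p : ℕ) [Fact (2 ≤ p)] where
  /-- left multiplication by elements of `B` -/
  T : Taft p →ₐ[ℂ] Module.End ℂ (DualTensor (Taft p))
  /-- conjugation by `k` -/
  conj : Dl p →ₐ[ℂ] Dl p
  /-- the twist in the commutation relation with `E` -/
  twist : Dl p →ₐ[ℂ] Dl p
  /-- the skew derivation without a factor from `B` -/
  derL : Dl p →ₗ[ℂ] Dl p
  /-- the skew derivation with the factor `k²` -/
  derR : Dl p →ₗ[ℂ] Dl p
  derL_mul : ∀ μ ν, derL (μ * ν) = derL μ * ν + twist μ * derL ν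
  derR_mul : ∀ μ ν, derR (μ * ν) = twist μ * derR ν + derR μ * conj (conj ν)
  derL_one : derL 1 = 0
  derR_one : derR 1 = 0
  T_k : ∀ (ν : Dl p) (n : Taft p), T (k p) (ν ⊗ₜ n) = conj ν ⊗ₜ (k p * n)
  T_E : ∀ (ν : Dl p) (n : Taft p), T (E p) (ν ⊗ₜ n) =
    derL ν ⊗ₜ n + twist ν ⊗ₜ (E p * n) + derR ν ⊗ₜ (k p ^ 2 * n)

namespace SkewTwist
open Taft
variable {p : ℕ} [hp : Fact (2 ≤ p)] (S : SkewTwist p)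

lemma T_k_sq (ν : Dl p) (n : Taft p) :
    S.T (k p ^ 2) (ν ⊗ₜ n) = S.conj (S.conj ν) ⊗ₜ (k p ^ 2 * n) := by
  rw [sq, map_mul, Module.End.mul_apply, S.T_k, S.T_k, mul_assoc]

lemma dualLeft_tmul (μ ν : Dl p) (n : Taft p) :
    dualLeft (Taft p) μ (ν ⊗ₜ n) = (μ * ν) ⊗ₜ n := rfl

lemma dualLeft_one : dualLeft (Taft p) (1 : Dl p) = 1 := by
  ext ν n : 3
  exact (dualLeft_tmul _ _ _).trans (by rw [one_mul]; rfl)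

lemma dualLeft_mul (μ ν : Dl p) :
    dualLeft (Taft p) (μ * ν) = dualLeft (Taft p) μ * dualLeft (Taft p) ν := by
  ext ρ n : 3
  change dualLeft (Taft p) (μ * ν) (ρ ⊗ₜ n) =
    dualLeft (Taft p) μ (dualLeft (Taft p) ν (ρ ⊗ₜ n))
  rw [dualLeft_tmul, dualLeft_tmul, dualLeft_tmul, mul_assoc]

/-- Right multiplication on the factor `B`. -/
def rightMul (n : Taft p) : Module.End ℂ (DualTensor (Taft p)) :=
  (LinearMap.mulRight ℂ n).lTensor (Dl p)

lemma rightMul_tmul (ν : Dl p) (m n : Taft p) :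
    rightMul n (ν ⊗ₜ m) = ν ⊗ₜ[ℂ] (m * n) := rfl

/-- On generators T multiplies the factor from B on the left only, so right multiplication commutes
with it. -/
lemma T_rightMul (m n : Taft p) (t : DualTensor (Taft p)) :
    S.T m (rightMul n t) = rightMul n (S.T m t) := by
  induction m using adjoin_induction generalizing t with
  | hE =>
    induction t using TensorProduct.induction_on with
    | zero => simp
    | add s t hs ht => simp only [map_add, hs, ht]
    | tmul ν b => simp only [rightMul_tmul, S.T_E, map_add, mul_assoc]
  | hk =>
    induction t using TensorProduct.induction_on with
    | zero => simp
    | add s t hs ht => simp only [map_add, hs, ht]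
    | tmul ν b => simp only [rightMul_tmul, S.T_k, mul_assoc]
  | h1 => simp
  | hs c x hx => simp only [map_smul, LinearMap.smul_apply, hx]
  | ha x y hx hy => simp only [map_add, LinearMap.add_apply, hx, hy]
  | hm x y hx hy => simp only [map_mul, Module.End.mul_apply, hx, hy]

/-- The skew derivations kill 1 and the automorphisms fix it, which settles the generators;
compatibility with right multiplication gives products. This is the right unit law of the twisted
product. -/
lemma T_one_tmul_one (m : Taft p) : S.T m ((1 : Dl p) ⊗ₜ 1) = (1 : Dl p) ⊗ₜ m := by
  induction m using adjoin_induction with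
  | hE => simp [S.T_E, S.derL_one, S.derR_one]
  | hk => simp [S.T_k]
  | h1 => simp
  | hs c x hx => simp only [map_smul, LinearMap.smul_apply, hx, TensorProduct.tmul_smul]
  | ha x y hx hy => simp only [map_add, LinearMap.add_apply, hx, hy, TensorProduct.tmul_add]
  | hm x y hx hy =>
    rw [map_mul, Module.End.mul_apply, hy, ← one_mul y, ← rightMul_tmul, T_rightMul, hx,
      rightMul_tmul, one_mul]

/-- Left multiplication. -/
def leftMul : DualTensor (Taft p) →ₗ[ℂ] Module.End ℂ (DualTensor (Taft p)) :=
  TensorProduct.lift ((LinearMap.mul ℂ (Module.End ℂ (DualTensor (Taft p)))).compl₁₂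
    (dualLeft (Taft p)) S.T.toLinearMap)

lemma leftMul_tmul (μ : Dl p) (m : Taft p) :
    S.leftMul (μ ⊗ₜ m) = dualLeft (Taft p) μ * S.T m := rfl

lemma leftMul_dualLeft (μ : Dl p) (t : DualTensor (Taft p)) :
    S.leftMul (dualLeft (Taft p) μ t) = dualLeft (Taft p) μ * S.leftMul t := by
  induction t using TensorProduct.induction_on with
  | zero => simp
  | add s t hs ht => simp only [map_add, mul_add, hs, ht]
  | tmul ν n => rw [dualLeft_tmul, leftMul_tmul, leftMul_tmul, dualLeft_mul, mul_assoc]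

lemma T_k_dualLeft (μ : Dl p) :
    S.T (k p) * dualLeft (Taft p) μ = dualLeft (Taft p) (S.conj μ) * S.T (k p) := by
  ext ν n : 3
  change S.T (k p) (dualLeft (Taft p) μ (ν ⊗ₜ n)) =
    dualLeft (Taft p) (S.conj μ) (S.T (k p) (ν ⊗ₜ n))
  rw [dualLeft_tmul, S.T_k, S.T_k, dualLeft_tmul, map_mul]

/-- The exchange relation of E with μ, as an identity of operators. It is equivalent to the two
twisted Leibniz rules being applied to the product of μ with the argument. -/
lemma T_E_dualLeft (μ : Dl p) :
    S.T (E p) * dualLeft (Taft p) μ = dualLeft (Taft p) (S.derL μ) +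
      dualLeft (Taft p) (S.twist μ) * S.T (E p) +
      dualLeft (Taft p) (S.derR μ) * S.T (k p ^ 2) := by
  ext ν n : 3
  change S.T (E p) (dualLeft (Taft p) μ (ν ⊗ₜ n)) =
    dualLeft (Taft p) (S.derL μ) (ν ⊗ₜ n) +
      dualLeft (Taft p) (S.twist μ) (S.T (E p) (ν ⊗ₜ n)) +
      dualLeft (Taft p) (S.derR μ) (S.T (k p ^ 2) (ν ⊗ₜ n))
  rw [dualLeft_tmul, S.T_E, S.T_E, S.T_k_sq, S.derL_mul, S.derR_mul, map_mul, map_add, map_add]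
  simp only [dualLeft_tmul, TensorProduct.add_tmul]
  abel

/-- For m = k and m = E, evaluation on ν ⊗ n reduces this to the exchange relations; since T is
multiplicative, it extends to all m. It is the part of associativity that is not built into the
definition. -/
lemma leftMul_T (m : Taft p) (t : DualTensor (Taft p)) :
    S.leftMul (S.T m t) = S.T m * S.leftMul t := by
  induction m using adjoin_induction generalizing t with
  | hE =>
    induction t using TensorProduct.induction_on with
    | zero => simp
    | add s t hs ht => simp only [map_add, mul_add, hs, ht]
    | tmul ν n =>
      simp only [S.T_E, map_add, leftMul_tmul, map_mul S.T, ← mul_assoc, T_E_dualLeft, add_mul]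
  | hk =>
    induction t using TensorProduct.induction_on with
    | zero => simp
    | add s t hs ht => simp only [map_add, mul_add, hs, ht]
    | tmul ν n => simp only [S.T_k, leftMul_tmul, map_mul S.T, ← mul_assoc, T_k_dualLeft]
  | h1 => simp
  | hs c x hx => simp only [map_smul, LinearMap.smul_apply, hx, smul_mul_assoc]
  | ha x y hx hy => simp only [map_add, LinearMap.add_apply, hx, hy, add_mul]
  | hm x y hx hy => simp only [map_mul S.T, Module.End.mul_apply, hx, hy, mul_assoc]

/-- Associativity: left multiplication by μ ⊗ m factors as L_μ T(m), and each factor is absorbed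
separately. -/
lemma leftMul_leftMul (s t : DualTensor (Taft p)) :
    S.leftMul (S.leftMul s t) = S.leftMul s * S.leftMul t := by
  induction s using TensorProduct.induction_on with
  | zero => simp
  | add s s' hs hs' => simp only [map_add, add_mul, LinearMap.add_apply, hs, hs']
  | tmul μ m =>
    rw [leftMul_tmul, Module.End.mul_apply, leftMul_dualLeft, leftMul_T, mul_assoc]

/-- `B* ⊗ B` with the twisted product. -/
@[nolint unusedArguments]
def Carrier (_ : SkewTwist p) : Type := DualTensor (Taft p)

instance : AddCommGroup S.Carrier := inferInstanceAs (AddCommGroup (DualTensor (Taft p)))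

lemma leftMul_one (x : DualTensor (Taft p)) : S.leftMul ((1 : Dl p) ⊗ₜ[ℂ] (1 : Taft p)) x = x := by
  rw [leftMul_tmul, dualLeft_one, map_one, one_mul, Module.End.one_apply]

lemma leftMul_apply_one (x : DualTensor (Taft p)) :
    S.leftMul x ((1 : Dl p) ⊗ₜ[ℂ] (1 : Taft p)) = x := by
  induction x using TensorProduct.induction_on with
  | zero => rw [map_zero, LinearMap.zero_apply]
  | add s t hs ht => rw [map_add, LinearMap.add_apply, hs, ht]
  | tmul μ m => rw [leftMul_tmul, Module.End.mul_apply, T_one_tmul_one, dualLeft_tmul, mul_one]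

instance : Ring S.Carrier :=
  { (inferInstance : AddCommGroup S.Carrier) with
    mul := fun x y => S.leftMul x y
    one := (1 : Dl p) ⊗ₜ[ℂ] (1 : Taft p)
    mul_assoc := fun x y z => LinearMap.congr_fun (S.leftMul_leftMul x y) z
    one_mul := S.leftMul_one
    mul_one := S.leftMul_apply_one
    left_distrib := fun x y z => map_add (S.leftMul x) y z
    right_distrib := fun x y z => LinearMap.congr_fun (map_add S.leftMul x y) z
    zero_mul := fun x => LinearMap.congr_fun (map_zero S.leftMul) x
    mul_zero := fun x => map_zero (S.leftMul x) }

instance : Algebra ℂ S.Carrier :=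
  letI : Module ℂ S.Carrier := inferInstanceAs (Module ℂ (DualTensor (Taft p)))
  Algebra.ofModule (fun c x y => LinearMap.congr_fun (map_smul S.leftMul c x) y)
    (fun c x y => map_smul (S.leftMul x) c y)

/-- The identification of `B* ⊗ B` with the twisted algebra. -/
def of : DualTensor (Taft p) ≃ₗ[ℂ] S.Carrier := LinearEquiv.refl ℂ (DualTensor (Taft p))

lemma of_mul (s t : DualTensor (Taft p)) : S.of s * S.of t = S.of (S.leftMul s t) := rfl

/-- The inclusion of `B*`. -/
def inl : Dl p →ₐ[ℂ] S.Carrier :=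
  AlgHom.ofLinearMap (S.of.toLinearMap ∘ₗ (TensorProduct.mk ℂ (Dl p) (Taft p)).flip 1) rfl
    fun μ ν => by
      change S.of ((μ * ν) ⊗ₜ 1) = S.of (μ ⊗ₜ 1) * S.of (ν ⊗ₜ 1)
      rw [of_mul, leftMul_tmul, map_one, mul_one, dualLeft_tmul]

/-- The inclusion of `B`. -/
def inr : Taft p →ₐ[ℂ] S.Carrier :=
  AlgHom.ofLinearMap (S.of.toLinearMap ∘ₗ TensorProduct.mk ℂ (Dl p) (Taft p) 1) rfl
    fun m n => by
      change S.of (1 ⊗ₜ (m * n)) = S.of (1 ⊗ₜ m) * S.of (1 ⊗ₜ n)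
      rw [of_mul, leftMul_tmul, dualLeft_one, one_mul, show (1 : Dl p) ⊗ₜ[ℂ] n =
        rightMul n (1 ⊗ₜ 1) by rw [rightMul_tmul, one_mul], T_rightMul, T_one_tmul_one,
        rightMul_tmul]

lemma inl_apply (μ : Dl p) : S.inl μ = S.of (μ ⊗ₜ 1) := rfl
lemma inr_apply (m : Taft p) : S.inr m = S.of (1 ⊗ₜ m) := rfl

lemma inl_mul_inr (μ : Dl p) (m : Taft p) : S.inl μ * S.inr m = S.of (μ ⊗ₜ m) := by
  rw [inl_apply, inr_apply, of_mul, leftMul_tmul, map_one, mul_one, dualLeft_tmul, mul_one]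

lemma k_mul_inl (μ : Dl p) : S.inr (k p) * S.inl μ = S.inl (S.conj μ) * S.inr (k p) := by
  rw [inl_mul_inr, inl_apply, inr_apply, of_mul, leftMul_tmul, dualLeft_one, one_mul, S.T_k,
    mul_one]

lemma E_mul_inl (μ : Dl p) : S.inr (E p) * S.inl μ =
    S.inl (S.derL μ) + S.inl (S.twist μ) * S.inr (E p) + S.inl (S.derR μ) * S.inr (k p ^ 2) := by
  rw [inl_mul_inr, inl_mul_inr, inl_apply, inl_apply, inr_apply, of_mul, leftMul_tmul,
    dualLeft_one, one_mul, S.T_E, mul_one, mul_one, map_add, map_add]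

lemma induction {P : S.Carrier → Prop} (h : ∀ μ m, P (S.inl μ * S.inr m))
    (ha : ∀ x y, P x → P y → P (x + y)) (x : S.Carrier) : P x := by
  induction x using TensorProduct.induction_on with
  | zero =>
    have h0 := h 0 0
    rwa [map_zero, zero_mul] at h0
  | tmul μ m => simpa only [inl_mul_inr] using! h μ m
  | add x y hx hy => exact ha x y hx hy

variable {C : Type*} [Ring C] [Algebra ℂ C]

/-- The linear map `μ ⊗ m ↦ f(μ) g(m)`. -/
def linearLift (f : Dl p →ₐ[ℂ] C) (g : Taft p →ₐ[ℂ] C) : S.Carrier →ₗ[ℂ] C :=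
  TensorProduct.lift ((LinearMap.mul ℂ C).compl₁₂ f.toLinearMap g.toLinearMap) ∘ₗ
    S.of.symm.toLinearMap

lemma linearLift_apply (f : Dl p →ₐ[ℂ] C) (g : Taft p →ₐ[ℂ] C) (μ : Dl p) (m : Taft p) :
    S.linearLift f g (S.inl μ * S.inr m) = f μ * g m := by
  rw [inl_mul_inr]; rfl

section
variable (f : Dl p →ₐ[ℂ] C) (g : Taft p →ₐ[ℂ] C)
  (hkF : g (k p) * f F = f (S.conj F) * g (k p))
  (hkk : g (k p) * f kappa = f (S.conj kappa) * g (k p))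
  (hEF : g (E p) * f F =
    f (S.derL F) + f (S.twist F) * g (E p) + f (S.derR F) * g (k p) ^ 2)
  (hEk : g (E p) * f kappa =
    f (S.derL kappa) + f (S.twist kappa) * g (E p) + f (S.derR kappa) * g (k p) ^ 2)

include hkF hkk in
lemma exchange_k (μ : Dl p) : g (k p) * f μ = f (S.conj μ) * g (k p) := by
  induction μ using dual_adjoin_induction with
  | hF => exact hkF
  | hk => exact hkk
  | h1 => simp
  | hs c x hx => simp only [map_smul, mul_smul_comm, smul_mul_assoc, hx]
  | ha x y hx hy => simp only [map_add, mul_add, add_mul, hx, hy]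
  | hm x y hx hy => rw [map_mul, ← mul_assoc, hx, mul_assoc, hy, map_mul, map_mul, mul_assoc]

include hkF hkk hEF hEk in
-- The relation passes from x and y to xy because the twisted Leibniz rules record what happens when
-- g(E) is moved first past f(x) and then past f(y); the term with k² needs the exchange relation
-- for k twice.
lemma exchange_E (μ : Dl p) : g (E p) * f μ =
    f (S.derL μ) + f (S.twist μ) * g (E p) + f (S.derR μ) * g (k p) ^ 2 := by
  have hk2 : ∀ μ, g (k p) ^ 2 * f μ = f (S.conj (S.conj μ)) * g (k p) ^ 2 := fun μ => by
    rw [sq, mul_assoc, S.exchange_k f g hkF hkk, ← mul_assoc, S.exchange_k f g hkF hkk, mul_assoc]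
  induction μ using dual_adjoin_induction with
  | hF => exact hEF
  | hk => exact hEk
  | h1 => simp [S.derL_one, S.derR_one]
  | hs c x hx => simp only [map_smul, mul_smul_comm, smul_mul_assoc, hx, smul_add]
  | ha x y hx hy => simp only [map_add, mul_add, add_mul, hx, hy]; abel
  | hm x y hx hy =>
    rw [map_mul, ← mul_assoc, hx, add_mul, add_mul, mul_assoc, hy, mul_assoc _ _ (f y), hk2,
      S.derL_mul, S.derR_mul]
    simp only [map_add, map_mul, mul_add, add_mul, mul_assoc]
    abel

include hkF hkk hEF hEk in
-- Multiplicativity of the lift reduces to left multiplication by B, since left multiplication by B*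
-- is visible from the definition.
lemma linearLift_inr_mul (m : Taft p) (x : S.Carrier) :
    S.linearLift f g (S.inr m * x) = g m * S.linearLift f g x := by
  induction m using adjoin_induction generalizing x with
  | hE =>
    induction x using S.induction with
    | ha x y hx hy => simp only [mul_add, map_add, hx, hy]
    | h μ m =>
      rw [← mul_assoc, S.E_mul_inl, add_mul, add_mul, map_add, map_add, mul_assoc _ _ (S.inr m),
        mul_assoc _ _ (S.inr m), ← map_mul, ← map_mul]
      simp only [linearLift_apply]
      rw [← mul_assoc, S.exchange_E f g hkF hkk hEF hEk, map_mul, map_mul, map_pow]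
      simp only [add_mul, mul_assoc]
  | hk =>
    induction x using S.induction with
    | ha x y hx hy => simp only [mul_add, map_add, hx, hy]
    | h μ m =>
      rw [← mul_assoc, S.k_mul_inl, mul_assoc, ← map_mul, linearLift_apply, linearLift_apply,
        ← mul_assoc, S.exchange_k f g hkF hkk, map_mul, mul_assoc]
  | h1 => simp
  | hs c x hx => simp only [map_smul, smul_mul_assoc, hx]
  | ha x y hx hy => simp only [map_add, add_mul, hx, hy]
  | hm x y hx hy => rw [map_mul S.inr, mul_assoc, hx, hy, map_mul g, mul_assoc]

/-- The algebra homomorphism `μ ⊗ m ↦ f(μ) g(m)`, for `f` and `g` that satisfy the exchange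
relations on generators. -/
def lift : S.Carrier →ₐ[ℂ] C :=
  AlgHom.ofLinearMap (S.linearLift f g)
    (by
      have h := S.linearLift_apply f g 1 1
      simpa using h)
    (fun x y => by
      induction x using S.induction with
      | ha x x' hx hx' => simp only [add_mul, map_add, hx, hx']
      | h μ m =>
        rw [linearLift_apply, mul_assoc, mul_assoc,
          ← S.linearLift_inr_mul f g hkF hkk hEF hEk]
        generalize S.inr m * y = z
        induction z using S.induction with
        | ha x y hx hy => simp only [mul_add, map_add, hx, hy]
        | h ν n =>
          rw [← mul_assoc, ← map_mul, linearLift_apply, linearLift_apply, map_mul, mul_assoc])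

lemma lift_apply (μ : Dl p) (m : Taft p) :
    S.lift f g hkF hkk hEF hEk (S.inl μ * S.inr m) = f μ * g m := S.linearLift_apply f g μ m

end
end SkewTwist

/-! ### The Drinfeld double and the Heisenberg double as algebras -/

/-- The common reason why the operators x ↦ f(x′, x″) that build the doubles and the actions are
multiplicative: the coproduct is, and f respects products of pairs. The order reversals from ↼ and
from the antipodes cancel inside f. -/
lemma sweedler_apply_mul {V C : Type} [Semiring V] [Algebra ℂ V] [Semiring C] [Algebra ℂ C]
    (Δ : V →ₗ[ℂ] V ⊗[ℂ] V) (f : V →ₗ[ℂ] V →ₗ[ℂ] C) {x y : V} (hΔ : Δ (x * y) = Δ x * Δ y)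
    (hf : ∀ a b a' b', f (a * a') (b * b') = f a b * f a' b') :
    sweedler Δ f (x * y) = sweedler Δ f x * sweedler Δ f y := by
  change TensorProduct.lift f (Δ (x * y)) = TensorProduct.lift f (Δ x) * TensorProduct.lift f (Δ y)
  rw [hΔ]
  generalize Δ x = s
  generalize Δ y = t
  induction s with
  | zero => simp
  | add s s' hs hs' => simp only [add_mul, map_add, hs, hs']
  | tmul a b =>
    induction t with
    | zero => simp
    | add t t' ht ht' => simp only [mul_add, map_add, ht, ht']
    | tmul a' b' => simp [hf]

lemma sweedler_apply {V P : Type} [AddCommMonoid V] [Module ℂ V] [AddCommMonoid P] [Module ℂ P]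
    (Δ : V →ₗ[ℂ] V ⊗[ℂ] V) (f : V →ₗ[ℂ] V →ₗ[ℂ] P) (x : V) :
    sweedler Δ f x = TensorProduct.lift f (Δ x) := rfl

/-- A statement about `f(x', x'')` that is linear holds if it holds for all `f(a, b)`. -/
lemma sweedler_induction {V P : Type} [AddCommMonoid V] [Module ℂ V] [AddCommMonoid P]
    [Module ℂ P] (Δ : V →ₗ[ℂ] V ⊗[ℂ] V) (f : V →ₗ[ℂ] V →ₗ[ℂ] P) {Q : P → Prop}
    (h0 : Q 0) (ha : ∀ x y, Q x → Q y → Q (x + y)) (h : ∀ a b, Q (f a b)) (x : V) :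
    Q (sweedler Δ f x) := by
  rw [sweedler_apply]
  generalize Δ x = t
  induction t with
  | zero => rwa [map_zero]
  | add s t hs ht => rw [map_add]; exact ha _ _ hs ht
  | tmul a b => exact h a b

namespace Taft
variable {p : ℕ} [hp : Fact (2 ≤ p)]

/-- The automorphism `g ⇀ ·` for a group-like `g`. -/
def lRegHom (g : Taft p) (hg : Coalgebra.comul (R := ℂ) g = g ⊗ₜ g)
    (h1 : Coalgebra.counit (R := ℂ) g = 1) : Dl p →ₐ[ℂ] Dl p :=
  AlgHom.ofLinearMap (lReg _ g)
    (by ext x; rw [lReg_apply, one_apply, Bialgebra.counit_mul, h1, mul_one, one_apply])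
    (fun μ ν => by
      ext x
      rw [lReg_apply, dual_mul_def, dualMul_apply, Bialgebra.comul_mul, hg, dualDistrib_mul_tmul]
      rfl)

/-- The automorphism `· ↼ g` for a group-like `g`. -/
def rRegHom (g : Taft p) (hg : Coalgebra.comul (R := ℂ) g = g ⊗ₜ g)
    (h1 : Coalgebra.counit (R := ℂ) g = 1) : Dl p →ₐ[ℂ] Dl p :=
  AlgHom.ofLinearMap (rReg _ g)
    (by ext x; rw [rReg_apply, one_apply, Bialgebra.counit_mul, h1, one_mul, one_apply])
    (fun μ ν => by
      ext x
      rw [rReg_apply, dual_mul_def, dualMul_apply, Bialgebra.comul_mul, hg, dualDistrib_tmul_mul]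
      rfl)

lemma counit_kInv : Coalgebra.counit (R := ℂ) (kInv p) = 1 := by
  rw [kInv, Bialgebra.counit_pow, counit_k, one_pow]

lemma counit_kInv_sq : Coalgebra.counit (R := ℂ) (kInv p ^ 2) = 1 := by
  rw [Bialgebra.counit_pow, counit_kInv, one_pow]

lemma rReg_kInv_sq_mul (μ ν : Dl p) : rReg _ (kInv p ^ 2) (μ * ν) =
    rReg _ (kInv p ^ 2) μ * rReg _ (kInv p ^ 2) ν :=
  map_mul (rRegHom (kInv p ^ 2) kInv_sq_comul counit_kInv_sq) μ ν

lemma rReg_kInv_sq_one : rReg _ (kInv p ^ 2) (1 : Dl p) = 1 :=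
  map_one (rRegHom (kInv p ^ 2) kInv_sq_comul counit_kInv_sq)

lemma antipodeInv_k_sq : antipodeInv (Taft p) (k p ^ 2) = kInv p ^ 2 := by
  rw [sq, antipodeInv_mul, antipodeInv_k, ← sq]

/-- `heisLeft` as a homomorphism of algebras. -/
def heisLeftHom (p : ℕ) [Fact (2 ≤ p)] : Taft p →ₐ[ℂ] Module.End ℂ (DualTensor (Taft p)) :=
  AlgHom.ofLinearMap (heisLeft (Taft p))
    (by
      rw [heisLeft, sweedler_apply, Bialgebra.comul_one, Algebra.TensorProduct.one_def]
      ext ν n : 3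
      change lReg _ 1 ν ⊗ₜ (1 * n) = ν ⊗ₜ n
      rw [lReg_one, one_mul])
    (fun x y => by
      rw [heisLeft]
      refine sweedler_apply_mul _ _ (Bialgebra.comul_mul x y) fun a b a' b' => ?_
      ext ν n : 3
      change lReg _ (a * a') ν ⊗ₜ (b * b' * n) = lReg _ a (lReg _ a' ν) ⊗ₜ (b * (b' * n))
      rw [lReg_mul, mul_assoc])

/-- The twist that defines the Heisenberg double. -/
def heisTwist (p : ℕ) [Fact (2 ≤ p)] : SkewTwist p where
  T := heisLeftHom p
  conj := lRegHom (k p) comul_k counit_k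
  twist := AlgHom.id ℂ _
  derL := 0
  derR := lReg _ (E p)
  derL_mul μ ν := by simp
  derR_mul μ ν := by
    rw [lReg_E_mul, sq, lReg_mul]; rfl
  derL_one := rfl
  derR_one := lReg_E_one
  T_k ν n := by
    change heisLeft (Taft p) (k p) (ν ⊗ₜ n) = _
    rw [heisLeft, sweedler_apply, comul_k]
    rfl
  T_E ν n := by
    change heisLeft (Taft p) (E p) (ν ⊗ₜ n) = _
    rw [heisLeft, sweedler_apply, comul_E, map_add]
    change lReg _ 1 ν ⊗ₜ (E p * n) + lReg _ (E p) ν ⊗ₜ (k p ^ 2 * n) = _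
    rw [lReg_one, LinearMap.zero_apply, TensorProduct.zero_tmul, zero_add]
    rfl

/-- `doubleRight` as a homomorphism of algebras. -/
def doubleRightHom (p : ℕ) [Fact (2 ≤ p)] : Taft p →ₐ[ℂ] Module.End ℂ (DualTensor (Taft p)) :=
  AlgHom.ofLinearMap (doubleRight (Taft p))
    (by
      rw [doubleRight, sweedler_apply, Bialgebra.comul_one, Algebra.TensorProduct.one_def]
      ext ν n : 3
      change rReg _ (antipodeInv _ 1) ν ⊗ₜ (1 * n) = ν ⊗ₜ n
      rw [antipodeInv_one, rReg_one, one_mul])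
    (fun x y => by
      rw [doubleRight]
      refine sweedler_apply_mul _ _ (Bialgebra.comul_mul x y) fun a b a' b' => ?_
      ext ν n : 3
      change rReg _ (antipodeInv _ (b * b')) ν ⊗ₜ (a * a' * n) =
        rReg _ (antipodeInv _ b) (rReg _ (antipodeInv _ b') ν) ⊗ₜ (a * (a' * n))
      rw [antipodeInv_mul, rReg_mul, mul_assoc])

/-- The left and right regular actions on B* commute. This lets m′ ⇀ and ↼ S⁻¹(m‴) be collected when
two elements of B act in succession. -/
lemma doubleRight_lReg (a b : Taft p) : (lReg _ a).rTensor (Taft p) * doubleRight (Taft p) b =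
    doubleRight (Taft p) b * (lReg _ a).rTensor (Taft p) := by
  refine sweedler_induction _ _
    (Q := fun x => (lReg _ a).rTensor (Taft p) * x = x * (lReg _ a).rTensor (Taft p))
    ?_ ?_ ?_ b
  · rw [mul_zero, zero_mul]
  · intro x y hx hy
    rw [mul_add, add_mul, hx, hy]
  · intro c e
    ext ν n : 3
    change lReg _ a (rReg _ (antipodeInv _ e) ν) ⊗ₜ (c * n) =
      rReg _ (antipodeInv _ e) (lReg _ a ν) ⊗ₜ (c * n)
    rw [lReg_rReg]

/-- `doubleLeft` as a homomorphism of algebras. -/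
def doubleLeftHom (p : ℕ) [Fact (2 ≤ p)] : Taft p →ₐ[ℂ] Module.End ℂ (DualTensor (Taft p)) :=
  AlgHom.ofLinearMap (doubleLeft (Taft p))
    (by
      rw [doubleLeft, sweedler_apply, Bialgebra.comul_one, Algebra.TensorProduct.one_def]
      change (lReg _ 1).rTensor (Taft p) * doubleRightHom p 1 = 1
      rw [map_one (doubleRightHom p), mul_one]
      ext ν n : 3
      change lReg _ 1 ν ⊗ₜ n = ν ⊗ₜ n
      rw [lReg_one])
    (fun x y => by
      rw [doubleLeft]
      refine sweedler_apply_mul _ _ (Bialgebra.comul_mul x y) fun a b a' b' => ?_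
      change (lReg _ (a * a')).rTensor (Taft p) * doubleRightHom p (b * b') =
        (lReg _ a).rTensor (Taft p) * doubleRight _ b *
          ((lReg _ a').rTensor (Taft p) * doubleRight _ b')
      have h : (lReg _ (a * a')).rTensor (Taft p) =
          (lReg _ a).rTensor (Taft p) * (lReg _ a').rTensor (Taft p) := by
        ext ν n : 3
        change lReg _ (a * a') ν ⊗ₜ n = lReg _ a (lReg _ a' ν) ⊗ₜ n
        rw [lReg_mul]
      rw [h, map_mul, mul_assoc, mul_assoc, ← mul_assoc (doubleRight _ b), ← doubleRight_lReg,
        mul_assoc]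
      rfl)

lemma doubleRight_k (ν : Dl p) (n : Taft p) : doubleRight _ (k p) (ν ⊗ₜ n) =
    rReg _ (kInv p) ν ⊗ₜ (k p * n) := by
  rw [doubleRight, sweedler_apply, comul_k, ← antipodeInv_k]
  rfl

lemma doubleRight_k_sq (ν : Dl p) (n : Taft p) : doubleRight _ (k p ^ 2) (ν ⊗ₜ n) =
    rReg _ (kInv p ^ 2) ν ⊗ₜ (k p ^ 2 * n) := by
  rw [doubleRight, sweedler_apply, k_sq_comul, ← antipodeInv_k_sq]
  rfl

lemma doubleRight_E (ν : Dl p) (n : Taft p) : doubleRight _ (E p) (ν ⊗ₜ n) =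
    rReg _ (antipodeInv _ (E p)) ν ⊗ₜ n + rReg _ (kInv p ^ 2) ν ⊗ₜ (E p * n) := by
  rw [doubleRight, sweedler_apply, comul_E, map_add, ← antipodeInv_k_sq]
  change rReg _ (antipodeInv _ (E p)) ν ⊗ₜ (1 * n) + _ = _
  rw [one_mul]
  rfl

lemma rReg_antipodeInv_E (ν : Dl p) :
    rReg _ (antipodeInv _ (E p)) ν = -rReg _ (E p) (rReg _ (kInv p ^ 2) ν) := by
  rw [antipodeInv_E, map_neg, LinearMap.neg_apply, rReg_mul]

lemma rReg_k_sq_kInv_sq (ν : Dl p) : rReg _ (k p ^ 2) (rReg _ (kInv p ^ 2) ν) = ν := by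
  rw [← rReg_mul, kInv_sq_mul, rReg_one]

/-- The twist that defines the Drinfeld double. -/
def doubleTwist (p : ℕ) [Fact (2 ≤ p)] : SkewTwist p where
  T := doubleLeftHom p
  conj := (lRegHom (k p) comul_k counit_k).comp (rRegHom (kInv p) comul_kInv counit_kInv)
  twist := rRegHom (kInv p ^ 2) kInv_sq_comul counit_kInv_sq
  derL := rReg _ (antipodeInv _ (E p))
  derR := lReg _ (E p) ∘ₗ rReg _ (kInv p ^ 2)
  derL_mul μ ν := by
    change _ = _ + rReg _ (kInv p ^ 2) μ * _
    simp only [rReg_antipodeInv_E]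
    rw [rReg_kInv_sq_mul, rReg_E_mul, rReg_k_sq_kInv_sq, neg_add, neg_mul, mul_neg, add_comm]
  derR_mul μ ν := by
    change lReg _ (E p) (rReg _ (kInv p ^ 2) (μ * ν)) = rReg _ (kInv p ^ 2) μ * _ +
      _ * lReg _ (k p) (rReg _ (kInv p) (lReg _ (k p) (rReg _ (kInv p) ν)))
    rw [rReg_kInv_sq_mul, lReg_E_mul, ← lReg_rReg (k p) (kInv p), ← rReg_mul, ← lReg_mul, ← sq,
      ← sq]
    rfl
  derL_one := by rw [rReg_antipodeInv_E, rReg_kInv_sq_one, rReg_E_one, neg_zero]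
  derR_one := by
    rw [LinearMap.comp_apply, rReg_kInv_sq_one, lReg_E_one]
  T_k ν n := by
    change doubleLeft (Taft p) (k p) (ν ⊗ₜ n) = _
    rw [doubleLeft, sweedler_apply, comul_k]
    change (lReg _ (k p)).rTensor (Taft p) (doubleRight _ (k p) (ν ⊗ₜ n)) = _
    rw [doubleRight_k]
    rfl
  T_E ν n := by
    change doubleLeft (Taft p) (E p) (ν ⊗ₜ n) = _
    rw [doubleLeft, sweedler_apply, comul_E, map_add]
    change (lReg _ 1).rTensor (Taft p) (doubleRight _ (E p) (ν ⊗ₜ n)) +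
      (lReg _ (E p)).rTensor (Taft p) (doubleRight _ (k p ^ 2) (ν ⊗ₜ n)) = _
    rw [doubleRight_k_sq, doubleRight_E, map_add]
    simp only [LinearMap.rTensor_tmul, lReg_one]
    rfl

/-- The Drinfeld double `𝒟(B)`. -/
abbrev DD (p : ℕ) [Fact (2 ≤ p)] : Type := (doubleTwist p).Carrier

/-- The Heisenberg double `ℋ(B*)`. -/
abbrev HH (p : ℕ) [Fact (2 ≤ p)] : Type := (heisTwist p).Carrier

/-- Definitional: `leftMul` for this twist unfolds to the product of the double, so the ring built
from the twist is 𝒟(B) itself. -/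
lemma doubleMul_eq (x y : DualTensor (Taft p)) : (doubleTwist p).of (doubleMul _ x y) =
    (doubleTwist p).of x * (doubleTwist p).of y := rfl

lemma heisMul_eq (x y : DualTensor (Taft p)) : (heisTwist p).of (heisMul _ x y) =
    (heisTwist p).of x * (heisTwist p).of y := rfl

lemma heisTwist_conj (μ : Dl p) : (heisTwist p).conj μ = lReg _ (k p) μ := rfl
lemma heisTwist_twist (μ : Dl p) : (heisTwist p).twist μ = μ := rfl
lemma heisTwist_derL (μ : Dl p) : (heisTwist p).derL μ = 0 := rfl
lemma heisTwist_derR (μ : Dl p) : (heisTwist p).derR μ = lReg _ (E p) μ := rfl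

lemma rReg_kInv_sq_kappa : rReg _ (kInv p ^ 2) (kappa : Dl p) = q p • kappa := by
  rw [sq, rReg_mul, rReg_kInv_kappa, map_smul, rReg_kInv_kappa, smul_smul, ← sq, qh_sq]

lemma rReg_kInv_sq_F : rReg _ (kInv p ^ 2) (F : Dl p) = F := by
  rw [sq, rReg_mul, rReg_kInv_F, rReg_kInv_F]

lemma doubleTwist_conj_kappa : (doubleTwist p).conj kappa = kappa := by
  change lReg _ (k p) (rReg _ (kInv p) kappa) = _
  rw [rReg_kInv_kappa, map_smul, lReg_k_kappa, smul_smul, mul_inv_cancel₀ (qh_ne_zero p), one_smul]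

lemma doubleTwist_conj_F : (doubleTwist p).conj F = (q p)⁻¹ • F := by
  change lReg _ (k p) (rReg _ (kInv p) F) = _
  rw [rReg_kInv_F, lReg_k_F]

lemma doubleTwist_twist_kappa : (doubleTwist p).twist kappa = q p • kappa := rReg_kInv_sq_kappa
lemma doubleTwist_twist_F : (doubleTwist p).twist F = F := rReg_kInv_sq_F

lemma doubleTwist_derL_kappa : (doubleTwist p).derL kappa = 0 := by
  change rReg _ (antipodeInv _ (E p)) kappa = 0
  rw [rReg_antipodeInv_E, rReg_kInv_sq_kappa, map_smul, rReg_E_kappa, smul_zero, neg_zero]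

lemma doubleTwist_derL_F : (doubleTwist p).derL F = -((q p - (q p)⁻¹)⁻¹ • kappa ^ 2) := by
  change rReg _ (antipodeInv _ (E p)) F = _
  rw [rReg_antipodeInv_E, rReg_kInv_sq_F, rReg_E_F]

lemma doubleTwist_derR_kappa : (doubleTwist p).derR kappa = 0 := by
  change lReg _ (E p) (rReg _ (kInv p ^ 2) kappa) = 0
  rw [rReg_kInv_sq_kappa, map_smul, lReg_E_kappa, smul_zero]

lemma doubleTwist_derR_F : (doubleTwist p).derR F = (q p - (q p)⁻¹)⁻¹ • 1 := by
  change lReg _ (E p) (rReg _ (kInv p ^ 2) F) = _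
  rw [rReg_kInv_sq_F, lReg_E_F]

variable {C : Type*} [Ring C] [Algebra ℂ C]

/-- Homomorphisms from the Drinfeld double. -/
def doubleLift (f : Dl p →ₐ[ℂ] C) (g : Taft p →ₐ[ℂ] C)
    (hkF : g (k p) * f F = (q p)⁻¹ • (f F * g (k p)))
    (hkk : g (k p) * f kappa = f kappa * g (k p))
    (hEF : g (E p) * f F =
      f F * g (E p) + (q p - (q p)⁻¹)⁻¹ • (g (k p) ^ 2 - f kappa ^ 2))
    (hEk : g (E p) * f kappa = q p • (f kappa * g (E p))) : DD p →ₐ[ℂ] C :=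
  (doubleTwist p).lift f g
    (by rw [doubleTwist_conj_F, map_smul, smul_mul_assoc, hkF])
    (by rw [doubleTwist_conj_kappa, hkk])
    (by
      rw [doubleTwist_derL_F, doubleTwist_twist_F, doubleTwist_derR_F, hEF, map_neg, map_smul,
        map_smul, map_pow, map_one, smul_mul_assoc, one_mul, smul_sub]
      abel)
    (by
      rw [doubleTwist_derL_kappa, doubleTwist_twist_kappa, doubleTwist_derR_kappa, hEk, map_smul,
        map_zero, smul_mul_assoc, zero_mul, zero_add, add_zero])

/-- Homomorphisms from the Heisenberg double. -/
def heisLift (f : Dl p →ₐ[ℂ] C) (g : Taft p →ₐ[ℂ] C)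
    (hkF : g (k p) * f F = (q p)⁻¹ • (f F * g (k p)))
    (hkk : g (k p) * f kappa = (qh p)⁻¹ • (f kappa * g (k p)))
    (hEF : g (E p) * f F = f F * g (E p) + (q p - (q p)⁻¹)⁻¹ • g (k p) ^ 2)
    (hEk : g (E p) * f kappa = f kappa * g (E p)) : HH p →ₐ[ℂ] C :=
  (heisTwist p).lift f g
    (by rw [heisTwist_conj, lReg_k_F, map_smul, smul_mul_assoc, hkF])
    (by rw [heisTwist_conj, lReg_k_kappa, map_smul, smul_mul_assoc, hkk])
    (by
      rw [heisTwist_derL, heisTwist_twist, heisTwist_derR, lReg_E_F, hEF, map_zero, zero_add,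
        map_smul, map_one, smul_mul_assoc, one_mul])
    (by
      rw [heisTwist_derL, heisTwist_twist, heisTwist_derR, lReg_E_kappa, hEk, map_zero, zero_add,
        zero_mul, add_zero])

/-! The relations in the Drinfeld double. -/

namespace DD

def E (p : ℕ) [Fact (2 ≤ p)] : DD p := (doubleTwist p).inr (Taft.E p)
def k (p : ℕ) [Fact (2 ≤ p)] : DD p := (doubleTwist p).inr (Taft.k p)
def F (p : ℕ) [Fact (2 ≤ p)] : DD p := (doubleTwist p).inl Taft.F
def kappa (p : ℕ) [Fact (2 ≤ p)] : DD p := (doubleTwist p).inl Taft.kappa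

lemma k_mul_kappa : k p * kappa p = kappa p * k p := by
  rw [k, kappa, SkewTwist.k_mul_inl, doubleTwist_conj_kappa]

lemma k_mul_F : k p * F p = (q p)⁻¹ • (F p * k p) := by
  rw [k, F, SkewTwist.k_mul_inl, doubleTwist_conj_F, map_smul, smul_mul_assoc]

lemma k_mul_E : k p * E p = q p • (E p * k p) := by
  rw [k, E, ← map_mul, Taft.k_mul_E, map_smul, map_mul]

lemma kappa_mul_F : kappa p * F p = q p • (F p * kappa p) := by
  rw [kappa, F, ← map_mul, Taft.kappa_mul_F, map_smul, map_mul]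

lemma E_mul_kappa : E p * kappa p = q p • (kappa p * E p) := by
  rw [E, kappa, SkewTwist.E_mul_inl, doubleTwist_derL_kappa, doubleTwist_twist_kappa,
    doubleTwist_derR_kappa, map_zero, zero_mul, zero_add, add_zero, map_smul, smul_mul_assoc]

lemma E_mul_F : E p * F p = F p * E p + (q p - (q p)⁻¹)⁻¹ • (k p ^ 2 - kappa p ^ 2) := by
  rw [E, F, SkewTwist.E_mul_inl, doubleTwist_derL_F, doubleTwist_twist_F, doubleTwist_derR_F,
    map_neg, map_smul, map_smul, map_pow, map_one, map_pow, smul_mul_assoc, one_mul, smul_sub]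
  rw [kappa, k]
  abel

lemma k_pow : k p ^ (4 * p) = 1 := by rw [k, ← map_pow, Taft.k_pow, map_one]
lemma E_pow : E p ^ p = 0 := by rw [E, ← map_pow, Taft.E_pow, map_zero]
lemma F_pow : F p ^ p = 0 := by rw [F, ← map_pow, Taft.F_pow, map_zero]

lemma tmul_eq (l m n : ℕ) : (doubleTwist p).of ((Taft.F ^ l : Dl p) ⊗ₜ (Taft.E p ^ m * Taft.k p ^ n)) =
    F p ^ l * (E p ^ m * k p ^ n) := by
  rw [← SkewTwist.inl_mul_inr, map_mul, map_pow, map_pow, map_pow]; rfl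

lemma adjoin_eq_top : Algebra.adjoin ℂ {E p, k p, F p, kappa p} = ⊤ := by
  have hl : ∀ μ, (doubleTwist p).inl μ ∈ Algebra.adjoin ℂ {E p, k p, F p, kappa p} := fun μ => by
    induction μ using dual_adjoin_induction with
    | hF => exact Algebra.subset_adjoin (by simp [F])
    | hk => exact Algebra.subset_adjoin (by simp [kappa])
    | h1 => rw [map_one]; exact one_mem _
    | hs c x hx => rw [map_smul]; exact Subalgebra.smul_mem _ hx c
    | ha x y hx hy => rw [map_add]; exact add_mem hx hy
    | hm x y hx hy => rw [map_mul]; exact mul_mem hx hy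
  have hr : ∀ m, (doubleTwist p).inr m ∈ Algebra.adjoin ℂ {E p, k p, F p, kappa p} := fun m => by
    induction m using adjoin_induction with
    | hE => exact Algebra.subset_adjoin (by simp [E])
    | hk => exact Algebra.subset_adjoin (by simp [k])
    | h1 => rw [map_one]; exact one_mem _
    | hs c x hx => rw [map_smul]; exact Subalgebra.smul_mem _ hx c
    | ha x y hx hy => rw [map_add]; exact add_mem hx hy
    | hm x y hx hy => rw [map_mul]; exact mul_mem hx hy
  refine top_le_iff.1 fun x _ => ?_
  induction x using (doubleTwist p).induction with
  | ha x y hx hy => exact add_mem (hx trivial) (hy trivial)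
  | h μ m => exact mul_mem (hl μ) (hr m)

end DD

/-! The relations in the Heisenberg double. -/

namespace HH

def E (p : ℕ) [Fact (2 ≤ p)] : HH p := (heisTwist p).inr (Taft.E p)
def k (p : ℕ) [Fact (2 ≤ p)] : HH p := (heisTwist p).inr (Taft.k p)
def F (p : ℕ) [Fact (2 ≤ p)] : HH p := (heisTwist p).inl Taft.F
def kappa (p : ℕ) [Fact (2 ≤ p)] : HH p := (heisTwist p).inl Taft.kappa

lemma k_mul_kappa : k p * kappa p = (qh p)⁻¹ • (kappa p * k p) := by
  rw [k, kappa, SkewTwist.k_mul_inl, heisTwist_conj, lReg_k_kappa, map_smul, smul_mul_assoc]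

lemma k_mul_F : k p * F p = (q p)⁻¹ • (F p * k p) := by
  rw [k, F, SkewTwist.k_mul_inl, heisTwist_conj, lReg_k_F, map_smul, smul_mul_assoc]

lemma k_mul_E : k p * E p = q p • (E p * k p) := by
  rw [k, E, ← map_mul, Taft.k_mul_E, map_smul, map_mul]

lemma kappa_mul_F : kappa p * F p = q p • (F p * kappa p) := by
  rw [kappa, F, ← map_mul, Taft.kappa_mul_F, map_smul, map_mul]

lemma E_mul_kappa : E p * kappa p = kappa p * E p := by
  rw [E, kappa, SkewTwist.E_mul_inl, heisTwist_derL, heisTwist_twist, heisTwist_derR,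
    lReg_E_kappa, map_zero, zero_mul, zero_add, add_zero]

lemma E_mul_F : E p * F p = F p * E p + (q p - (q p)⁻¹)⁻¹ • k p ^ 2 := by
  rw [E, F, SkewTwist.E_mul_inl, heisTwist_derL, heisTwist_twist, heisTwist_derR, lReg_E_F,
    map_zero, map_smul, map_one, map_pow, smul_mul_assoc, one_mul, zero_add]
  rfl

end HH
end Taft

/-! ### Subalgebras and ideals for a bilinear product -/

section
variable {V : Type} [AddCommGroup V] [Module ℂ V] {mul : V →ₗ[ℂ] V →ₗ[ℂ] V} {A : Submodule ℂ V}
  {s : Set V}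

lemma subset_genIdeal : s ⊆ genIdeal mul A s := fun _ hx =>
  Submodule.mem_sInf.2 fun _ hN => hN.1 hx

lemma mul_mem_genIdeal {a x : V} (ha : a ∈ A) (hx : x ∈ genIdeal mul A s) :
    mul a x ∈ genIdeal mul A s :=
  Submodule.mem_sInf.2 fun N hN => (hN.2 a ha x (Submodule.mem_sInf.1 hx N hN)).1

lemma mem_genIdeal_mul {a x : V} (ha : a ∈ A) (hx : x ∈ genIdeal mul A s) :
    mul x a ∈ genIdeal mul A s :=
  Submodule.mem_sInf.2 fun N hN => (hN.2 a ha x (Submodule.mem_sInf.1 hx N hN)).2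

lemma genIdeal_le {N : Submodule ℂ V} (hs : s ⊆ N)
    (h : ∀ a ∈ A, ∀ x ∈ N, mul a x ∈ N ∧ mul x a ∈ N) : genIdeal mul A s ≤ N :=
  sInf_le ⟨hs, h⟩

end

/-! ### The truncated Drinfeld double -/

open Taft
variable {p : ℕ} [hp : Fact (2 ≤ p)]

namespace Taft.DD

/-- The central element `ϰ k`. -/
def c (p : ℕ) [Fact (2 ≤ p)] : DD p := kappa p * k p

/-- Conjugation by k scales E and F by 𝔮 and 𝔮⁻¹, conjugation by ϰ by 𝔮⁻¹ and 𝔮, and k commutes with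
ϰ. -/
lemma c_commute (x : DD p) : c p * x = x * c p := by
  have hq := q_ne_zero p
  have hx : x ∈ Algebra.adjoin ℂ {E p, k p, F p, kappa p} := adjoin_eq_top (p := p) ▸ Algebra.mem_top
  induction hx using Algebra.adjoin_induction with
  | mem x hx =>
    rcases hx with rfl | rfl | rfl | rfl
    · rw [c, mul_assoc, k_mul_E, ← mul_assoc, E_mul_kappa, mul_smul_comm, smul_mul_assoc, mul_assoc]
    · rw [c, ← mul_assoc, k_mul_kappa]
    · rw [c, mul_assoc, k_mul_F, mul_smul_comm, ← mul_assoc, kappa_mul_F, smul_mul_assoc, smul_smul,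
        inv_mul_cancel₀ hq, one_smul, mul_assoc]
    · rw [c, mul_assoc, k_mul_kappa]
  | algebraMap r => exact (Algebra.commutes r _).symm
  | add x y _ _ hx hy => rw [mul_add, add_mul, hx, hy]
  | mul x y _ _ hx hy => rw [← mul_assoc, hx, mul_assoc, hy, mul_assoc]

lemma one_eq_dtOne : (1 : DD p) = (doubleTwist p).of (dtOne (Taft p)) := rfl

lemma c_sub_one : (doubleTwist p).of (Taft.kappa ⊗ₜ[ℂ] Taft.k p - dtOne (Taft p)) = c p - 1 := by
  rw [map_sub, ← SkewTwist.inl_mul_inr, ← one_eq_dtOne]; rfl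

lemma c_sub_one_mem :
    Taft.kappa ⊗ₜ[ℂ] Taft.k p - dtOne (Taft p) ∈ truncIdeal p := subset_genIdeal rfl

/-- `truncIdeal` as a left ideal. -/
def truncI (p : ℕ) [Fact (2 ≤ p)] : Ideal (DD p) where
  carrier := {x | (doubleTwist p).of.symm x ∈ truncIdeal p}
  add_mem' := (truncIdeal p).add_mem
  zero_mem' := (truncIdeal p).zero_mem
  smul_mem' _ _ hx := mul_mem_genIdeal (mul := doubleMul (Taft p)) Submodule.mem_top hx

instance : (truncI p).IsTwoSided :=
  ⟨fun _ hx => mem_genIdeal_mul (mul := doubleMul (Taft p)) Submodule.mem_top hx⟩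

lemma c_sub_one_mem_truncI : c p - 1 ∈ truncI p := by
  rw [← c_sub_one]; exact c_sub_one_mem (p := p)

/-- A linear map vanishing on multiples of `ϰ k - 1` vanishes on the ideal. -/
lemma map_eq_zero_of_mem {V : Type*} [AddCommGroup V] [Module ℂ V] (f : DD p →ₗ[ℂ] V)
    (hf : ∀ x, f (x * c p) = f x) {x : DD p} (hx : x ∈ truncI p) : f x = 0 := by
  -- Because ϰk is central, the multiples y(ϰk − 1) already form a two-sided ideal, which therefore
  -- contains the generated one.
  let N : Submodule ℂ (DualTensor (Taft p)) :=
    (LinearMap.range (LinearMap.mulRight ℂ (c p - 1))).comap (doubleTwist p).of.toLinearMap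
  have h : truncIdeal p ≤ N := by
    refine genIdeal_le ?_ ?_
    · rintro _ rfl
      exact ⟨1, by rw [LinearMap.mulRight_apply, one_mul]; exact c_sub_one.symm⟩
    · rintro a - x ⟨y, hy⟩
      rw [LinearMap.mulRight_apply] at hy
      refine ⟨⟨(doubleTwist p).of a * y, ?_⟩, ⟨y * (doubleTwist p).of a, ?_⟩⟩
      · rw [LinearMap.mulRight_apply, mul_assoc, hy]; rfl
      · have hc : (c p - 1) * (doubleTwist p).of a = (doubleTwist p).of a * (c p - 1) := by
          rw [sub_mul, mul_sub, c_commute, one_mul, mul_one]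
        rw [LinearMap.mulRight_apply, mul_assoc, ← hc, ← mul_assoc, hy]; rfl
  obtain ⟨y, hy⟩ := h hx
  have hy' : y * (c p - 1) = x := hy
  rw [← hy', mul_sub, mul_one, map_sub, hf, sub_self]

lemma algHom_eq_zero_of_mem {C : Type*} [Ring C] [Algebra ℂ C] (f : DD p →ₐ[ℂ] C)
    (hf : f (c p) = 1) {x : DD p} (hx : x ∈ truncI p) : f x = 0 :=
  map_eq_zero_of_mem f.toLinearMap (fun x => by simp [hf]) hx

end Taft.DD

/-- The truncated Drinfeld double as an algebra. -/
abbrev TruncDD (p : ℕ) [Fact (2 ≤ p)] : Type := DD p ⧸ DD.truncI p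

namespace TruncDD

/-- The projection onto the truncated double. -/
def mk (p : ℕ) [Fact (2 ≤ p)] : DD p →ₐ[ℂ] TruncDD p := Ideal.Quotient.mkₐ ℂ (DD.truncI p)

lemma mk_c : mk p (DD.c p) = 1 := by
  rw [← sub_eq_zero, ← map_one (mk p), ← map_sub]
  exact Ideal.Quotient.eq_zero_iff_mem.2 DD.c_sub_one_mem_truncI

/-- The comparison with the quotient as a vector space. -/
def equiv (p : ℕ) [Fact (2 ≤ p)] : TruncDD p ≃ₗ[ℂ] DoubleQuot p :=
  (Submodule.Quotient.restrictScalarsEquiv ℂ (DD.truncI p)).symm.trans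
    (Submodule.Quotient.equiv _ _ (doubleTwist p).of.symm (by
      ext x
      constructor
      · rintro ⟨y, hy, rfl⟩
        exact hy
      · intro hx
        exact ⟨(doubleTwist p).of x, hx, rfl⟩))

lemma equiv_mk (x : DualTensor (Taft p)) :
    equiv p (mk p ((doubleTwist p).of x)) = (truncIdeal p).mkQ x := rfl

lemma kappa_sq_mul_k_sq : mk p (DD.kappa p) ^ 2 * mk p (DD.k p) ^ 2 = 1 := by
  have h : Commute (mk p (DD.kappa p)) (mk p (DD.k p)) := by
    rw [commute_iff_eq, ← map_mul, ← map_mul, DD.k_mul_kappa]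
  rw [← h.mul_pow, ← map_mul]
  exact (congrArg (· ^ 2) mk_c).trans (one_pow 2)

lemma k_sq_pow : (mk p (DD.k p) ^ 2) ^ (2 * p) = 1 := by
  rw [← pow_mul, show 2 * (2 * p) = 4 * p by ring, ← map_pow, DD.k_pow, map_one]

/-- Modulo ϰk − 1 the inverse of k² is ϰ². With K = k² and K⁻¹ = ϰ² the commutator of E and F in
𝒟(B) becomes that of U_q sl(2). -/
lemma k_sq_pow_pred : (mk p (DD.k p) ^ 2) ^ (2 * p - 1) = mk p (DD.kappa p) ^ 2 := by
  have h := hp.out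
  rw [← one_mul ((mk p (DD.k p) ^ 2) ^ (2 * p - 1)), ← kappa_sq_mul_k_sq, mul_assoc, ← pow_succ',
    show 2 * p - 1 + 1 = 2 * p by omega, k_sq_pow, mul_one]

lemma k_sq_mul_kappa_sq : mk p (DD.k p) ^ 2 * mk p (DD.kappa p) ^ 2 = 1 := by
  have h := hp.out
  rw [← k_sq_pow_pred, ← pow_succ', show 2 * p - 1 + 1 = 2 * p by omega, k_sq_pow]

/-- The homomorphism from `U_q sl(2)` to the truncated double. -/
def ofUq (p : ℕ) [Fact (2 ≤ p)] : Uq p →ₐ[ℂ] TruncDD p :=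
  Uq.lift (mk p (DD.E p)) (mk p (DD.k p) ^ 2) (mk p (DD.F p)) (mk p (DD.kappa p) ^ 2)
    k_sq_pow_pred
    (by
      have h : mk p (DD.k p) ^ 2 * mk p (DD.E p) = q p ^ 2 • (mk p (DD.E p) * mk p (DD.k p) ^ 2) :=
        skew_pow_mul _ _ _ (by rw [← map_mul, DD.k_mul_E, map_smul, map_mul]) 2
      rw [h, smul_mul_assoc, mul_assoc, k_sq_mul_kappa_sq, mul_one])
    (by
      have h : mk p (DD.k p) ^ 2 * mk p (DD.F p) =
          (q p)⁻¹ ^ 2 • (mk p (DD.F p) * mk p (DD.k p) ^ 2) :=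
        skew_pow_mul _ _ _ (by rw [← map_mul, DD.k_mul_F, map_smul, map_mul]) 2
      rw [h, smul_mul_assoc, mul_assoc, k_sq_mul_kappa_sq, mul_one, inv_pow])
    (by
      rw [← map_mul, DD.E_mul_F, map_add, map_mul, add_sub_cancel_left, map_smul, map_sub, map_pow,
        map_pow])
    (by rw [← map_pow, DD.E_pow, map_zero])
    (by rw [← map_pow, DD.F_pow, map_zero])
    k_sq_pow

@[simp] lemma ofUq_E : ofUq p (Uq.E p) = mk p (DD.E p) := Uq.lift_E ..
@[simp] lemma ofUq_K : ofUq p (Uq.K p) = mk p (DD.k p) ^ 2 := Uq.lift_K ..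
@[simp] lemma ofUq_F : ofUq p (Uq.F p) = mk p (DD.F p) := Uq.lift_F ..
@[simp] lemma ofUq_KInv : ofUq p (Uq.KInv p) = mk p (DD.kappa p) ^ 2 := Uq.lift_KInv ..

lemma ofUq_monomial (l m n : ℕ) : ofUq p (Uq.F p ^ l * (Uq.E p ^ m * Uq.K p ^ n)) =
    mk p ((doubleTwist p).of ((Taft.F ^ l : Dl p) ⊗ₜ (Taft.E p ^ m * Taft.k p ^ (2 * n)))) := by
  rw [DD.tmul_eq]
  simp only [map_mul, map_pow, ofUq_E, ofUq_F, ofUq_K, pow_mul]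

/-! The triangular decomposition. -/

/-- `F ↦ 1 ⊗ E`, `ϰ ↦ k⁻¹ ⊗ k` -/
def triangularL (p : ℕ) [Fact (2 ≤ p)] : Dl p →ₐ[ℂ] Taft p ⊗[ℂ] Taft p :=
  (Taft.lift (1 ⊗ₜ Taft.E p) (kInv p ⊗ₜ Taft.k p)
    (by simp [Taft.k_mul_E, TensorProduct.tmul_smul])
    (by simp [Algebra.TensorProduct.tmul_pow, Taft.E_pow])
    (by simp [Algebra.TensorProduct.tmul_pow, Taft.k_pow, Taft.kInv_pow,
      Algebra.TensorProduct.one_def])).comp (dualEquiv p).symm.toAlgHom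

/-- `E ↦ E ⊗ 1`, `k ↦ k ⊗ k⁻¹` -/
def triangularR (p : ℕ) [Fact (2 ≤ p)] : Taft p →ₐ[ℂ] Taft p ⊗[ℂ] Taft p :=
  Taft.lift (Taft.E p ⊗ₜ 1) (Taft.k p ⊗ₜ kInv p)
    (by simp [Taft.k_mul_E, TensorProduct.smul_tmul'])
    (by simp [Algebra.TensorProduct.tmul_pow, Taft.E_pow])
    (by simp [Algebra.TensorProduct.tmul_pow, Taft.k_pow, Taft.kInv_pow,
      Algebra.TensorProduct.one_def])

lemma triangularL_F : triangularL p Taft.F = 1 ⊗ₜ Taft.E p := by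
  have h : (dualEquiv p).symm Taft.F = Taft.E p := by
    rw [AlgEquiv.symm_apply_eq]; exact toDual_E.symm
  exact (congrArg _ h).trans (Taft.lift_E ..)

lemma triangularL_kappa : triangularL p Taft.kappa = kInv p ⊗ₜ Taft.k p := by
  have h : (dualEquiv p).symm Taft.kappa = Taft.k p := by
    rw [AlgEquiv.symm_apply_eq]; exact toDual_k.symm
  exact (congrArg _ h).trans (Taft.lift_k ..)

/-- The linear map `𝒟(B) → B ⊗ B` that identifies the truncated double with a subspace. -/
def triangular (p : ℕ) [Fact (2 ≤ p)] : DD p →ₗ[ℂ] Taft p ⊗[ℂ] Taft p :=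
  (doubleTwist p).linearLift (triangularL p) (triangularR p)

/-- Centrality moves ϰk between the two factors of μ ⊗ m, where the images k⁻¹ ⊗ k of ϰ and k ⊗ k⁻¹
of k cancel. No multiplicativity of the map on 𝒟(B) is used. -/
lemma triangular_mul_c (x : DD p) : triangular p (x * DD.c p) = triangular p x := by
  induction x using (doubleTwist p).induction with
  | ha x y hx hy => rw [add_mul, map_add, hx, hy, map_add]
  | h μ m =>
    rw [mul_assoc, ← DD.c_commute, DD.c, DD.kappa, DD.k, ← mul_assoc, ← mul_assoc, ← map_mul,
      mul_assoc, ← map_mul, triangular, SkewTwist.linearLift_apply, SkewTwist.linearLift_apply,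
      map_mul, map_mul, triangularL_kappa, triangularR, Taft.lift_k, mul_assoc, ← mul_assoc _ _ (Taft.lift _ _ _ _ _ m),
      Algebra.TensorProduct.tmul_mul_tmul, Taft.kInv_mul, Taft.mul_kInv,
      ← Algebra.TensorProduct.one_def, one_mul]

/-- The map induced by `triangular` on the quotient. -/
def triangularQ (p : ℕ) [Fact (2 ≤ p)] : DoubleQuot p →ₗ[ℂ] Taft p ⊗[ℂ] Taft p :=
  (truncIdeal p).liftQ (triangular p ∘ₗ (doubleTwist p).of.toLinearMap) fun _ hx =>
    DD.map_eq_zero_of_mem (triangular p) triangular_mul_c hx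

lemma triangularQ_mkQ (x : DualTensor (Taft p)) :
    triangularQ p ((truncIdeal p).mkQ x) = triangular p ((doubleTwist p).of x) := rfl

/-- The embedding of `U_q sl(2)` into the quotient of the Drinfeld double. -/
def j (p : ℕ) [Fact (2 ≤ p)] : Uq p →ₗ[ℂ] DoubleQuot p :=
  (equiv p).toLinearMap ∘ₗ (ofUq p).toLinearMap

lemma j_apply (u : Uq p) : j p u = equiv p (ofUq p u) := rfl

lemma mkQ_eq_j_iff (u : Uq p) (x : DualTensor (Taft p)) :
    (truncIdeal p).mkQ x = j p u ↔ mk p ((doubleTwist p).of x) = ofUq p u := by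
  rw [j_apply, ← equiv_mk, (equiv p).injective.eq_iff]

lemma j_monomial (l m n : ℕ) : j p (Uq.F p ^ l * (Uq.E p ^ m * Uq.K p ^ n)) =
    (truncIdeal p).mkQ ((Taft.F ^ l : Dl p) ⊗ₜ (Taft.E p ^ m * Taft.k p ^ (2 * n))) := by
  rw [j_apply, ofUq_monomial, equiv_mk]

lemma triangularQ_j_monomial (l m n : ℕ) :
    triangularQ p (j p (Uq.F p ^ l * (Uq.E p ^ m * Uq.K p ^ n))) =
    (Taft.E p ^ m * Taft.k p ^ (2 * n)) ⊗ₜ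
      (Taft.E p ^ l * Taft.k p ^ ((4 * p - 1) * (2 * n) % (4 * p))) := by
  rw [j_monomial, triangularQ_mkQ, ← SkewTwist.inl_mul_inr, triangular,
    SkewTwist.linearLift_apply, map_pow, triangularL_F, map_mul, map_pow, map_pow, triangularR, Taft.lift_E, Taft.lift_k]
  simp only [Algebra.TensorProduct.tmul_pow, Algebra.TensorProduct.tmul_mul_tmul, one_pow,
    one_mul]
  -- Here k⁻¹ is k^{4p−1}; the exponent is reduced modulo 4p so that the result is a member of the
  -- tensor product basis.
  rw [kInv, ← pow_mul, ← pow_eq_pow_mod _ (Taft.k_pow p)]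

end TruncDD

/-! ### The Poincaré–Birkhoff–Witt basis of U_q sl(2) -/

namespace Uq

/-- The Poincaré–Birkhoff–Witt monomials. -/
def monomial (p : ℕ) (x : Fin p × Fin p × Fin (2 * p)) : Uq p :=
  F p ^ (x.1 : ℕ) * (E p ^ (x.2.1 : ℕ) * K p ^ (x.2.2 : ℕ))

/-- The span contains 1 and is stable under left multiplication by the generators. For E this goes
by induction on the power of F: the commutator contributes only K and K⁻¹ = K^{2p−1} acting on a
shorter monomial. -/
lemma span_nat_monomials : Submodule.span ℂ
    (Set.range fun x : ℕ × ℕ × ℕ => F p ^ x.1 * (E p ^ x.2.1 * K p ^ x.2.2)) = ⊤ := by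
  set s := Submodule.span ℂ (Set.range fun x : ℕ × ℕ × ℕ =>
    F p ^ x.1 * (E p ^ x.2.1 * K p ^ x.2.2)) with hs
  have hm : ∀ l m n : ℕ, F p ^ l * (E p ^ m * K p ^ n) ∈ s := fun l m n =>
    Submodule.subset_span ⟨(l, m, n), rfl⟩
  have ext : ∀ a : Uq p, (∀ l m n : ℕ, a * (F p ^ l * (E p ^ m * K p ^ n)) ∈ s) →
      ∀ x ∈ s, a * x ∈ s := by
    intro a ha x hx
    induction hx using Submodule.span_induction with
    | mem x hx => obtain ⟨y, rfl⟩ := hx; exact ha _ _ _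
    | zero => rw [mul_zero]; exact zero_mem _
    | add x y _ _ hx hy => rw [mul_add]; exact add_mem hx hy
    | smul c x _ hx => rw [mul_smul_comm]; exact Submodule.smul_mem _ _ hx
  have hF : ∀ x ∈ s, F p * x ∈ s := ext _ fun l m n => by
    rw [← mul_assoc, ← pow_succ']; exact hm _ _ _
  have hK : ∀ x ∈ s, K p * x ∈ s := ext _ fun l m n => by
    rw [← mul_assoc, skew_mul_pow _ _ _ K_mul_F, smul_mul_assoc, mul_assoc, ← mul_assoc (K p),
      skew_mul_pow _ _ _ K_mul_E, smul_mul_assoc, mul_assoc, ← pow_succ', mul_smul_comm]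
    exact Submodule.smul_mem _ _ (Submodule.smul_mem _ _ (hm _ _ _))
  have hKn : ∀ n : ℕ, ∀ x ∈ s, K p ^ n * x ∈ s := by
    intro n
    induction n with
    | zero => intro x hx; rwa [pow_zero, one_mul]
    | succ n ih => intro x hx; rw [pow_succ, mul_assoc]; exact ih _ (hK x hx)
  have hE : ∀ x ∈ s, E p * x ∈ s := by
    refine ext _ fun l => ?_
    induction l with
    | zero => intro m n; rw [pow_zero, one_mul, ← mul_assoc, ← pow_succ']; simpa using hm 0 (m + 1) n
    | succ l ih =>
      intro m n
      have h : E p * F p = F p * E p + (q p - (q p)⁻¹)⁻¹ • (K p - KInv p) := by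
        rw [← E_mul_F_sub]; abel
      rw [pow_succ', mul_assoc, ← mul_assoc (E p), h, add_mul, mul_assoc, smul_mul_assoc, sub_mul]
      exact add_mem (hF _ (ih m n))
        (Submodule.smul_mem _ _ (sub_mem (hK _ (hm _ _ _)) (hKn _ _ (hm _ _ _))))
  have key : ∀ a x : Uq p, x ∈ s → a * x ∈ s := by
    intro a
    have ha : a ∈ Algebra.adjoin ℂ {E p, K p, F p} := adjoin_eq_top ▸ Algebra.mem_top
    induction ha using Algebra.adjoin_induction with
    | mem y hy =>
      rcases hy with rfl | rfl | rfl
      · exact hE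
      · exact hK
      · exact hF
    | algebraMap r =>
      intro x hx
      rw [← Algebra.smul_def]; exact Submodule.smul_mem _ _ hx
    | add x y _ _ hx hy => intro z hz; rw [add_mul]; exact add_mem (hx z hz) (hy z hz)
    | mul x y _ _ hx hy => intro z hz; rw [mul_assoc]; exact hx _ (hy z hz)
  refine top_le_iff.1 fun a _ => ?_
  simpa using key a 1 (by simpa using hm 0 0 0)

lemma span_monomial : Submodule.span ℂ (Set.range (monomial p)) = ⊤ := by
  rw [← top_le_iff, ← span_nat_monomials, Submodule.span_le]
  rintro _ ⟨⟨l, m, n⟩, rfl⟩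
  have h0 := hp.out
  dsimp only
  by_cases hl : l < p
  · by_cases hm : m < p
    · rw [pow_eq_pow_mod n (K_pow p)]
      exact Submodule.subset_span
        ⟨(⟨l, hl⟩, ⟨m, hm⟩, ⟨n % (2 * p), Nat.mod_lt _ (by omega)⟩), rfl⟩
    · rw [pow_eq_zero_of_le (not_lt.1 hm) (E_pow p)]; simp
  · rw [pow_eq_zero_of_le (not_lt.1 hl) (F_pow p)]; simp

/-- The images are distinct members of the tensor product basis of B ⊗ B: m and n are read off from
E^m k^{2n} in the first factor, where 2n < 4p, and l from E^l in the second. -/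
lemma linearIndependent_triangular :
    LinearIndependent ℂ ((TruncDD.triangularQ p ∘ₗ TruncDD.j p) ∘ monomial p) := by
  have h0 := hp.out
  let e : Fin p × Fin p × Fin (2 * p) → (Fin p × Fin (4 * p)) × (Fin p × Fin (4 * p)) :=
    fun x => ((x.2.1, ⟨2 * x.2.2, by omega⟩),
      (x.1, ⟨(4 * p - 1) * (2 * x.2.2) % (4 * p), Nat.mod_lt _ (by omega)⟩))
  have he : Function.Injective e := by
    rintro ⟨l, m, n⟩ ⟨l', m', n'⟩ h
    simp only [e, Prod.mk.injEq, Fin.mk.injEq] at h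
    obtain ⟨⟨h1, h2⟩, h3, -⟩ := h
    rw [h1, h3, Fin.ext (by omega : (n : ℕ) = n')]
  convert! ((Taft.basis p).tensorProduct (Taft.basis p)).linearIndependent.comp e he using 1
  ext x
  rw [Function.comp_apply, Function.comp_apply, Module.Basis.tensorProduct_apply, Taft.basis_apply,
    Taft.basis_apply]
  exact TruncDD.triangularQ_j_monomial _ _ _

lemma linearIndependent_monomial : LinearIndependent ℂ (monomial p) :=
  linearIndependent_triangular.of_comp _

/-- The Poincaré–Birkhoff–Witt basis. -/
def basis (p : ℕ) [Fact (2 ≤ p)] : Module.Basis (Fin p × Fin p × Fin (2 * p)) ℂ (Uq p) :=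
  .mk linearIndependent_monomial span_monomial.ge

lemma finrank_eq : Module.finrank ℂ (Uq p) = 2 * p ^ 3 := by
  rw [Module.finrank_eq_card_basis (basis p)]
  simp only [Fintype.card_prod, Fintype.card_fin]
  ring

end Uq

/-! ### The image of U_q sl(2) in the truncated double -/

namespace TruncDD

lemma j_injective : Function.Injective (j p) := by
  have h : Function.Injective (triangularQ p ∘ₗ j p) :=
    injective_of_linearIndependent_basis (Uq.basis p) _ (by
      have e : ⇑(Uq.basis p) = Uq.monomial p := Module.Basis.coe_mk ..
      rw [e]; exact Uq.linearIndependent_triangular)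
  exact Function.Injective.of_comp h

lemma iterate_dualMul (l : ℕ) :
    (dualMul (Taft p) Taft.F)^[l] Coalgebra.counit = (Taft.F ^ l : Dl p) := by
  induction l with
  | zero => rw [pow_zero]; rfl
  | succ l ih => rw [Function.iterate_succ_apply', ih, pow_succ']; rfl

lemma range_j : LinearMap.range (j p) = Submodule.span ℂ {v | ∃ l < p, ∃ m < p, ∃ n < 2 * p,
    v = (truncIdeal p).mkQ (((dualMul (Taft p) Taft.F)^[l] Coalgebra.counit) ⊗ₜ[ℂ]
      (Taft.E p ^ m * Taft.k p ^ (2 * n)))} := by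
  rw [LinearMap.range_eq_map, ← Uq.span_monomial, Submodule.map_span, ← Set.range_comp]
  congr 1
  ext v
  simp only [Set.mem_range, Set.mem_ofPred_eq, iterate_dualMul, Function.comp_apply, Uq.monomial,
    j_monomial]
  constructor
  · rintro ⟨⟨l, m, n⟩, rfl⟩
    exact ⟨l, l.2, m, m.2, n, n.2, rfl⟩
  · rintro ⟨l, hl, m, hm, n, hn, rfl⟩
    exact ⟨(⟨l, hl⟩, ⟨m, hm⟩, ⟨n, hn⟩), rfl⟩

end TruncDD

/-! ### The coproduct of the Drinfeld double and the coaction on the Heisenberg double -/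

open Taft
variable {p : ℕ} [hp : Fact (2 ≤ p)]

namespace SkewTwist
variable (S : SkewTwist p)

/-- `μ ↦ μ'' ⊗ μ'` -/
def coactL : Dl p →ₐ[ℂ] DD p ⊗[ℂ] S.Carrier :=
  ((Algebra.TensorProduct.map (doubleTwist p).inl S.inl).comp
    (Algebra.TensorProduct.comm ℂ (Dl p) (Dl p)).toAlgHom).comp (dualComulHom p)

/-- `m ↦ m' ⊗ m''` -/
def coactR : Taft p →ₐ[ℂ] DD p ⊗[ℂ] S.Carrier :=
  (Algebra.TensorProduct.map (doubleTwist p).inr S.inr).comp (Bialgebra.comulAlgHom ℂ (Taft p))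

-- One formula gives both the coproduct of 𝒟(B) and the coaction on ℋ(B*), so it is factored for an
-- arbitrary twist; multiplicativity is then a matter of exchange relations on generators.
set_option synthInstance.maxHeartbeats 100000 in
lemma doubleComul_tmul (μ : Dl p) (m : Taft p) :
    TensorProduct.map (doubleTwist p).of.toLinearMap S.of.toLinearMap
      (doubleComul (Taft p) (μ ⊗ₜ m)) = S.coactL μ * S.coactR m := by
  change TensorProduct.map (doubleTwist p).of.toLinearMap S.of.toLinearMap
    (TensorProduct.tensorTensorTensorComm ℂ _ _ _ _
      (TensorProduct.comm ℂ _ _ (dualComul (Taft p) μ) ⊗ₜ Coalgebra.comul m)) =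
    Algebra.TensorProduct.map (doubleTwist p).inl S.inl
      (TensorProduct.comm ℂ _ _ (dualComul (Taft p) μ)) *
    Algebra.TensorProduct.map (doubleTwist p).inr S.inr (Coalgebra.comul m)
  generalize dualComul (Taft p) μ = s
  generalize Coalgebra.comul (R := ℂ) m = t
  induction s with
  | zero => simp
  | add s s' hs hs' => simp only [map_add, TensorProduct.add_tmul, add_mul, hs, hs']
  | tmul a b =>
    induction t with
    | zero => simp
    | add s s' hs hs' => simp only [map_add, TensorProduct.tmul_add, mul_add, hs, hs']
    | tmul c e => simp [inl_mul_inr]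

lemma coactL_kappa : S.coactL kappa = DD.kappa p ⊗ₜ S.inl kappa := by
  change Algebra.TensorProduct.map (doubleTwist p).inl S.inl
      (TensorProduct.comm ℂ _ _ (dualComul (Taft p) kappa)) = _
  rw [dualComul_kappa]
  rfl

lemma coactL_F : S.coactL F = DD.F p ⊗ₜ 1 + (DD.kappa p ^ 2) ⊗ₜ S.inl F := by
  change Algebra.TensorProduct.map (doubleTwist p).inl S.inl
      (TensorProduct.comm ℂ _ _ (dualComul (Taft p) F)) = _
  rw [dualComul_F, map_add, TensorProduct.comm_tmul, TensorProduct.comm_tmul, map_add,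
    Algebra.TensorProduct.map_tmul, Algebra.TensorProduct.map_tmul, map_one, map_pow]
  rfl

lemma coactR_k : S.coactR (k p) = DD.k p ⊗ₜ S.inr (k p) := by
  change Algebra.TensorProduct.map (doubleTwist p).inr S.inr (Coalgebra.comul (k p)) = _
  rw [comul_k]
  rfl

lemma coactR_E : S.coactR (E p) = 1 ⊗ₜ S.inr (E p) + DD.E p ⊗ₜ (S.inr (k p) ^ 2) := by
  change Algebra.TensorProduct.map (doubleTwist p).inr S.inr (Coalgebra.comul (E p)) = _
  rw [comul_E, map_add, Algebra.TensorProduct.map_tmul, Algebra.TensorProduct.map_tmul, map_one,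
    map_pow]
  rfl

end SkewTwist

namespace Taft

namespace DD

lemma E_mul_kappa_sq : E p * kappa p ^ 2 = q p ^ 2 • (kappa p ^ 2 * E p) :=
  skew_mul_pow _ _ _ E_mul_kappa 2

lemma k_sq_mul_F : k p ^ 2 * F p = (q p)⁻¹ ^ 2 • (F p * k p ^ 2) :=
  skew_pow_mul _ _ _ k_mul_F 2

lemma k_mul_kappa_sq : k p * kappa p ^ 2 = kappa p ^ 2 * k p := by
  rw [sq, ← mul_assoc, k_mul_kappa, mul_assoc, k_mul_kappa, mul_assoc]

end DD

namespace HH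

lemma k_sq_mul_F : k p ^ 2 * F p = (q p)⁻¹ ^ 2 • (F p * k p ^ 2) :=
  skew_pow_mul _ _ _ k_mul_F 2

end HH

/-- The coproduct of the Drinfeld double as a homomorphism of algebras. -/
def doubleComulHom (p : ℕ) [Fact (2 ≤ p)] : DD p →ₐ[ℂ] DD p ⊗[ℂ] DD p :=
  doubleLift (doubleTwist p).coactL (doubleTwist p).coactR
    (by
      rw [SkewTwist.coactL_F, SkewTwist.coactR_k]
      change DD.k p ⊗ₜ DD.k p * (DD.F p ⊗ₜ 1 + (DD.kappa p ^ 2) ⊗ₜ DD.F p) =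
        (q p)⁻¹ • ((DD.F p ⊗ₜ 1 + (DD.kappa p ^ 2) ⊗ₜ DD.F p) * DD.k p ⊗ₜ DD.k p)
      simp only [mul_add, add_mul, Algebra.TensorProduct.tmul_mul_tmul, DD.k_mul_F,
        DD.k_mul_kappa_sq, one_mul, mul_one, TensorProduct.smul_tmul', TensorProduct.tmul_smul,
        smul_add])
    (by
      rw [SkewTwist.coactL_kappa, SkewTwist.coactR_k]
      change DD.k p ⊗ₜ DD.k p * DD.kappa p ⊗ₜ DD.kappa p =
        DD.kappa p ⊗ₜ DD.kappa p * DD.k p ⊗ₜ DD.k p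
      simp only [Algebra.TensorProduct.tmul_mul_tmul, DD.k_mul_kappa])
    (by
      rw [SkewTwist.coactL_F, SkewTwist.coactR_k, SkewTwist.coactL_kappa, SkewTwist.coactR_E]
      change (1 ⊗ₜ DD.E p + DD.E p ⊗ₜ (DD.k p ^ 2)) * (DD.F p ⊗ₜ 1 + (DD.kappa p ^ 2) ⊗ₜ DD.F p) =
        (DD.F p ⊗ₜ 1 + (DD.kappa p ^ 2) ⊗ₜ DD.F p) * (1 ⊗ₜ DD.E p + DD.E p ⊗ₜ (DD.k p ^ 2)) +
          (q p - (q p)⁻¹)⁻¹ • ((DD.k p ⊗ₜ DD.k p) ^ 2 - (DD.kappa p ⊗ₜ DD.kappa p) ^ 2)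
      have h0 := q_ne_zero p
      -- In the product of E ⊗ k² with ϰ² ⊗ F the exchange factors 𝔮² and 𝔮⁻² cancel, so this term
      -- agrees with the product in the opposite order.
      have h1 : (q p)⁻¹ ^ 2 * q p ^ 2 = 1 := by
        rw [← mul_pow, inv_mul_cancel₀ h0, one_pow]
      simp only [mul_add, add_mul, Algebra.TensorProduct.tmul_mul_tmul, DD.E_mul_F, one_mul,
        mul_one, DD.E_mul_kappa_sq, DD.k_sq_mul_F, Algebra.TensorProduct.tmul_pow,
        TensorProduct.tmul_add, TensorProduct.add_tmul, TensorProduct.tmul_smul,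
        ← TensorProduct.smul_tmul', TensorProduct.tmul_sub, TensorProduct.sub_tmul, smul_sub,
        smul_smul, h1, one_smul]
      abel)
    (by
      rw [SkewTwist.coactL_kappa, SkewTwist.coactR_E]
      change (1 ⊗ₜ DD.E p + DD.E p ⊗ₜ (DD.k p ^ 2)) * DD.kappa p ⊗ₜ DD.kappa p =
        q p • (DD.kappa p ⊗ₜ DD.kappa p * (1 ⊗ₜ DD.E p + DD.E p ⊗ₜ (DD.k p ^ 2)))
      have hc : DD.k p ^ 2 * DD.kappa p = DD.kappa p * DD.k p ^ 2 := by
        rw [sq, mul_assoc, DD.k_mul_kappa, ← mul_assoc, DD.k_mul_kappa, mul_assoc]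
      simp only [mul_add, add_mul, Algebra.TensorProduct.tmul_mul_tmul, DD.E_mul_kappa, hc, one_mul,
        mul_one, TensorProduct.smul_tmul', TensorProduct.tmul_smul, smul_add])

lemma doubleComulHom_apply (x : DualTensor (Taft p)) :
    doubleComulHom p ((doubleTwist p).of x) =
    TensorProduct.map (doubleTwist p).of.toLinearMap (doubleTwist p).of.toLinearMap
      (doubleComul (Taft p) x) := by
  induction x using TensorProduct.induction_on with
  | zero => simp
  | add x y hx hy => simp only [map_add, hx, hy]
  | tmul μ m =>
    rw [SkewTwist.doubleComul_tmul, ← SkewTwist.inl_mul_inr, doubleComulHom, doubleLift,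
      SkewTwist.lift_apply]

/-- The coaction of the Drinfeld double on the Heisenberg double as a homomorphism of algebras. -/
def heisCoact (p : ℕ) [Fact (2 ≤ p)] : HH p →ₐ[ℂ] DD p ⊗[ℂ] HH p :=
  heisLift (heisTwist p).coactL (heisTwist p).coactR
    (by
      rw [SkewTwist.coactL_F, SkewTwist.coactR_k]
      change DD.k p ⊗ₜ HH.k p * (DD.F p ⊗ₜ 1 + (DD.kappa p ^ 2) ⊗ₜ HH.F p) =
        (q p)⁻¹ • ((DD.F p ⊗ₜ 1 + (DD.kappa p ^ 2) ⊗ₜ HH.F p) * DD.k p ⊗ₜ HH.k p)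
      simp only [mul_add, add_mul, Algebra.TensorProduct.tmul_mul_tmul, DD.k_mul_F, HH.k_mul_F,
        DD.k_mul_kappa_sq, one_mul, mul_one, TensorProduct.smul_tmul', TensorProduct.tmul_smul,
        smul_add])
    (by
      rw [SkewTwist.coactL_kappa, SkewTwist.coactR_k]
      change DD.k p ⊗ₜ HH.k p * DD.kappa p ⊗ₜ HH.kappa p =
        (qh p)⁻¹ • (DD.kappa p ⊗ₜ HH.kappa p * DD.k p ⊗ₜ HH.k p)
      simp only [Algebra.TensorProduct.tmul_mul_tmul, DD.k_mul_kappa, HH.k_mul_kappa,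
        TensorProduct.tmul_smul])
    (by
      rw [SkewTwist.coactL_F, SkewTwist.coactR_k, SkewTwist.coactR_E]
      change (1 ⊗ₜ HH.E p + DD.E p ⊗ₜ (HH.k p ^ 2)) * (DD.F p ⊗ₜ 1 + (DD.kappa p ^ 2) ⊗ₜ HH.F p) =
        (DD.F p ⊗ₜ 1 + (DD.kappa p ^ 2) ⊗ₜ HH.F p) * (1 ⊗ₜ HH.E p + DD.E p ⊗ₜ (HH.k p ^ 2)) +
          (q p - (q p)⁻¹)⁻¹ • (DD.k p ⊗ₜ HH.k p) ^ 2
      have h0 := q_ne_zero p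
      -- Besides the cancellation of exchange factors, the term −ϰ² ⊗ k² from [E,F] in 𝒟(B) cancels
      -- against ϰ² ⊗ k² from [E,F] in ℋ(B*), which leaves k² ⊗ k².
      have h1 : (q p)⁻¹ ^ 2 * q p ^ 2 = 1 := by
        rw [← mul_pow, inv_mul_cancel₀ h0, one_pow]
      simp only [mul_add, add_mul, Algebra.TensorProduct.tmul_mul_tmul, DD.E_mul_F, HH.E_mul_F,
        one_mul, mul_one, DD.E_mul_kappa_sq, HH.k_sq_mul_F, Algebra.TensorProduct.tmul_pow,
        TensorProduct.tmul_add, TensorProduct.add_tmul, TensorProduct.tmul_smul,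
        ← TensorProduct.smul_tmul', TensorProduct.sub_tmul, smul_sub, smul_smul, h1, one_smul]
      abel)
    (by
      rw [SkewTwist.coactL_kappa, SkewTwist.coactR_E]
      change (1 ⊗ₜ HH.E p + DD.E p ⊗ₜ (HH.k p ^ 2)) * DD.kappa p ⊗ₜ HH.kappa p =
        DD.kappa p ⊗ₜ HH.kappa p * (1 ⊗ₜ HH.E p + DD.E p ⊗ₜ (HH.k p ^ 2))
      have hc : HH.k p ^ 2 * HH.kappa p = (qh p)⁻¹ ^ 2 • (HH.kappa p * HH.k p ^ 2) :=
        skew_pow_mul _ _ _ HH.k_mul_kappa 2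
      -- E commutes with ϰ in ℋ(B*) but not in 𝒟(B); the factor 𝔮 from the latter is compensated by
      -- k²ϰ = 𝔮⁻¹ϰk² in the former.
      have h1 : (qh p)⁻¹ ^ 2 * q p = 1 := by
        rw [← qh_sq, ← mul_pow, inv_mul_cancel₀ (qh_ne_zero p), one_pow]
      simp only [mul_add, add_mul, Algebra.TensorProduct.tmul_mul_tmul, DD.E_mul_kappa,
        HH.E_mul_kappa, hc, one_mul, mul_one, ← TensorProduct.smul_tmul', TensorProduct.tmul_smul,
        smul_smul, h1, one_smul])

lemma heisCoact_apply (x : DualTensor (Taft p)) :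
    heisCoact p ((heisTwist p).of x) =
    TensorProduct.map (doubleTwist p).of.toLinearMap (heisTwist p).of.toLinearMap
      (doubleComul (Taft p) x) := by
  induction x using TensorProduct.induction_on with
  | zero => simp
  | add x y hx hy => simp only [map_add, hx, hy]
  | tmul μ m =>
    rw [SkewTwist.doubleComul_tmul, ← SkewTwist.inl_mul_inr, heisCoact, heisLift,
      SkewTwist.lift_apply]

/-- Evaluation at `1` as a homomorphism of algebras. -/
def dualCounit (p : ℕ) [Fact (2 ≤ p)] : Dl p →ₐ[ℂ] ℂ :=
  AlgHom.ofLinearMap (Module.Dual.eval ℂ (Taft p) 1)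
    (by change (1 : Dl p) 1 = 1; rw [one_apply, Bialgebra.counit_one])
    mul_apply_one

/-- The counit of the Drinfeld double as a homomorphism of algebras. -/
def doubleCounitHom (p : ℕ) [Fact (2 ≤ p)] : DD p →ₐ[ℂ] ℂ :=
  doubleLift (dualCounit p) (Bialgebra.counitAlgHom ℂ (Taft p))
    (by
      change _ * (F : Dl p) 1 = (q p)⁻¹ • ((F : Dl p) 1 * _)
      rw [F_one, mul_zero, zero_mul, smul_zero])
    (mul_comm _ _)
    (by
      change _ * (F : Dl p) 1 = (F : Dl p) 1 * _ + (q p - (q p)⁻¹)⁻¹ •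
        (Coalgebra.counit (R := ℂ) (k p) ^ 2 - (kappa : Dl p) 1 ^ 2)
      rw [F_one, mul_zero, zero_mul, kappa_one, counit_k, sub_self, smul_zero, add_zero])
    (by
      change Coalgebra.counit (R := ℂ) (E p) * _ = q p • (_ * Coalgebra.counit (R := ℂ) (E p))
      rw [counit_E, mul_zero, zero_mul, smul_zero])

lemma doubleCounitHom_apply (x : DualTensor (Taft p)) :
    doubleCounitHom p ((doubleTwist p).of x) = doubleCounit (Taft p) x := by
  induction x using TensorProduct.induction_on with
  | zero => rw [map_zero, map_zero, map_zero]
  | add x y hx hy => simp only [map_add, hx, hy]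
  | tmul μ m =>
    rw [← SkewTwist.inl_mul_inr, doubleCounitHom, doubleLift, SkewTwist.lift_apply]
    rfl

lemma doubleComulHom_kappa : doubleComulHom p (DD.kappa p) = DD.kappa p ⊗ₜ DD.kappa p := by
  have h := SkewTwist.linearLift_apply (doubleTwist p) (doubleTwist p).coactL
    (doubleTwist p).coactR kappa 1
  rw [map_one, map_one, mul_one, mul_one] at h
  exact h.trans (SkewTwist.coactL_kappa _)

lemma doubleComulHom_F :
    doubleComulHom p (DD.F p) = DD.F p ⊗ₜ 1 + (DD.kappa p ^ 2) ⊗ₜ DD.F p := by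
  have h := SkewTwist.linearLift_apply (doubleTwist p) (doubleTwist p).coactL
    (doubleTwist p).coactR F 1
  rw [map_one, map_one, mul_one, mul_one] at h
  exact h.trans (SkewTwist.coactL_F _)

lemma doubleComulHom_k : doubleComulHom p (DD.k p) = DD.k p ⊗ₜ DD.k p := by
  have h := SkewTwist.linearLift_apply (doubleTwist p) (doubleTwist p).coactL
    (doubleTwist p).coactR 1 (k p)
  rw [map_one, map_one, one_mul, one_mul] at h
  exact h.trans (SkewTwist.coactR_k _)

lemma doubleComulHom_E :
    doubleComulHom p (DD.E p) = 1 ⊗ₜ DD.E p + DD.E p ⊗ₜ (DD.k p ^ 2) := by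
  have h := SkewTwist.linearLift_apply (doubleTwist p) (doubleTwist p).coactL
    (doubleTwist p).coactR 1 (E p)
  rw [map_one, map_one, one_mul, one_mul] at h
  exact h.trans (SkewTwist.coactR_E _)

lemma heisCoact_kappa : heisCoact p (HH.kappa p) = DD.kappa p ⊗ₜ HH.kappa p := by
  have h := SkewTwist.linearLift_apply (heisTwist p) (heisTwist p).coactL
    (heisTwist p).coactR kappa 1
  rw [map_one, map_one, mul_one, mul_one] at h
  exact h.trans (SkewTwist.coactL_kappa _)

lemma heisCoact_F : heisCoact p (HH.F p) = DD.F p ⊗ₜ 1 + (DD.kappa p ^ 2) ⊗ₜ HH.F p := by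
  have h := SkewTwist.linearLift_apply (heisTwist p) (heisTwist p).coactL
    (heisTwist p).coactR F 1
  rw [map_one, map_one, mul_one, mul_one] at h
  exact h.trans (SkewTwist.coactL_F _)

lemma heisCoact_k : heisCoact p (HH.k p) = DD.k p ⊗ₜ HH.k p := by
  have h := SkewTwist.linearLift_apply (heisTwist p) (heisTwist p).coactL
    (heisTwist p).coactR 1 (k p)
  rw [map_one, map_one, one_mul, one_mul] at h
  exact h.trans (SkewTwist.coactR_k _)

lemma heisCoact_E : heisCoact p (HH.E p) = 1 ⊗ₜ HH.E p + DD.E p ⊗ₜ (HH.k p ^ 2) := by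
  have h := SkewTwist.linearLift_apply (heisTwist p) (heisTwist p).coactL
    (heisTwist p).coactR 1 (E p)
  rw [map_one, map_one, one_mul, one_mul] at h
  exact h.trans (SkewTwist.coactR_E _)

lemma doubleCounitHom_of (μ : Dl p) (m : Taft p) :
    doubleCounitHom p ((doubleTwist p).inl μ * (doubleTwist p).inr m) =
      μ 1 * Coalgebra.counit (R := ℂ) m := SkewTwist.linearLift_apply ..

end Taft

/-! ### The coproduct and counit on the truncated double -/

namespace TruncDD
open Taft

/-- The coproduct of the truncated double. -/
def comul (p : ℕ) [Fact (2 ≤ p)] : TruncDD p →ₐ[ℂ] TruncDD p ⊗[ℂ] TruncDD p :=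
  Ideal.Quotient.liftₐ (DD.truncI p)
    ((Algebra.TensorProduct.map (mk p) (mk p)).comp (doubleComulHom p))
    -- The coproduct descends because ϰk is group-like.
    fun _ hx => DD.algHom_eq_zero_of_mem _ (by
      rw [AlgHom.comp_apply, DD.c, map_mul, doubleComulHom_kappa, doubleComulHom_k,
        Algebra.TensorProduct.tmul_mul_tmul]
      change mk p (DD.c p) ⊗ₜ mk p (DD.c p) = 1
      rw [mk_c]
      rfl) hx

lemma comul_mk (x : DD p) : comul p (mk p x) =
    Algebra.TensorProduct.map (mk p) (mk p) (doubleComulHom p x) := rfl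

/-- The counit of the truncated double. -/
def counit (p : ℕ) [Fact (2 ≤ p)] : TruncDD p →ₐ[ℂ] ℂ :=
  Ideal.Quotient.liftₐ (DD.truncI p) (doubleCounitHom p)
    fun _ hx => DD.algHom_eq_zero_of_mem _ (by
      rw [DD.c, DD.kappa, DD.k, doubleCounitHom_of, kappa_one, counit_k, one_mul]) hx

lemma counit_mk (x : DD p) : counit p (mk p x) = doubleCounitHom p x := rfl

lemma comul_ofUq (u : Uq p) : comul p (ofUq p u) =
    Algebra.TensorProduct.map (ofUq p) (ofUq p) (Coalgebra.comul (R := ℂ) u) := by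
  have h : (comul p).comp (ofUq p) = (Algebra.TensorProduct.map (ofUq p) (ofUq p)).comp
      (Bialgebra.comulAlgHom ℂ (Uq p)) := by
    apply Uq.hom_ext
    · simp [comul_mk, doubleComulHom_E, add_comm]
    · simp [comul_mk, doubleComulHom_k, Algebra.TensorProduct.tmul_pow]
    · simp [comul_mk, doubleComulHom_F]
  exact AlgHom.congr_fun h u

lemma counit_ofUq (u : Uq p) : counit p (ofUq p u) = Coalgebra.counit (R := ℂ) u := by
  have h : (counit p).comp (ofUq p) = Bialgebra.counitAlgHom ℂ (Uq p) := by
    apply Uq.hom_ext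
    · have h := doubleCounitHom_of (p := p) 1 (Taft.E p)
      rw [map_one, one_mul, Taft.counit_E, mul_zero] at h
      have h' : doubleCounitHom p (DD.E p) = 0 := h
      simp [counit_mk, h']
    · have h := doubleCounitHom_of (p := p) 1 (Taft.k p)
      rw [map_one, one_mul, Taft.counit_k, mul_one, one_apply, Bialgebra.counit_one] at h
      have h' : doubleCounitHom p (DD.k p) = 1 := h
      simp [counit_mk, h']
    · have h := doubleCounitHom_of (p := p) Taft.F 1
      rw [map_one, mul_one, F_one, zero_mul] at h
      have h' : doubleCounitHom p (DD.F p) = 0 := h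
      simp [counit_mk, h']
  exact AlgHom.congr_fun h u

lemma j_mul (u v : Uq p) (x y : DualTensor (Taft p)) (hx : (truncIdeal p).mkQ x = j p u)
    (hy : (truncIdeal p).mkQ y = j p v) :
    (truncIdeal p).mkQ (doubleMul (Taft p) x y) = j p (u * v) := by
  rw [mkQ_eq_j_iff] at hx hy ⊢
  rw [doubleMul_eq, map_mul, hx, hy, map_mul]

lemma j_comul (u : Uq p) (x : DualTensor (Taft p)) (hx : (truncIdeal p).mkQ x = j p u) :
    TensorProduct.map (truncIdeal p).mkQ (truncIdeal p).mkQ (doubleComul (Taft p) x) =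
      TensorProduct.map (j p) (j p) (Coalgebra.comul u) := by
  rw [mkQ_eq_j_iff] at hx
  have h := comul_ofUq u
  rw [← hx, comul_mk, doubleComulHom_apply] at h
  have h' := congrArg (TensorProduct.map (equiv p).toLinearMap (equiv p).toLinearMap) h
  have e1 : ∀ t : DualTensor (Taft p) ⊗[ℂ] DualTensor (Taft p),
      TensorProduct.map (equiv p).toLinearMap (equiv p).toLinearMap
        (Algebra.TensorProduct.map (mk p) (mk p) (TensorProduct.map (doubleTwist p).of.toLinearMap
          (doubleTwist p).of.toLinearMap t)) =
      TensorProduct.map (truncIdeal p).mkQ (truncIdeal p).mkQ t := by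
    intro t
    induction t with
    | zero => simp only [map_zero]
    | add s t hs ht => simp only [map_add, hs, ht]
    | tmul a b => rfl
  have e2 : ∀ t : Uq p ⊗[ℂ] Uq p,
      TensorProduct.map (equiv p).toLinearMap (equiv p).toLinearMap
        (Algebra.TensorProduct.map (ofUq p) (ofUq p) t) = TensorProduct.map (j p) (j p) t := by
    intro t
    induction t with
    | zero => simp only [map_zero]
    | add s t hs ht => simp only [map_add, hs, ht]
    | tmul a b => rfl
  rwa [e1, e2] at h'

lemma j_counit (u : Uq p) (x : DualTensor (Taft p)) (hx : (truncIdeal p).mkQ x = j p u) :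
    doubleCounit (Taft p) x = Coalgebra.counit (R := ℂ) u := by
  rw [mkQ_eq_j_iff] at hx
  rw [← counit_ofUq, ← hx, counit_mk, doubleCounitHom_apply]

lemma j_one : j p 1 = (truncIdeal p).mkQ (dtOne (Taft p)) := by
  rw [eq_comm, mkQ_eq_j_iff, map_one]; exact map_one (mk p)

lemma j_E : j p (Uq.E p) =
    (truncIdeal p).mkQ (Coalgebra.counit (R := ℂ) (A := Taft p) ⊗ₜ[ℂ] Taft.E p) := by
  rw [eq_comm, mkQ_eq_j_iff, ofUq_E]; rfl

lemma j_F : j p (Uq.F p) = (truncIdeal p).mkQ (Taft.F ⊗ₜ[ℂ] 1) := by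
  rw [eq_comm, mkQ_eq_j_iff, ofUq_F]; rfl

lemma j_K : j p (Uq.K p) = (truncIdeal p).mkQ
    (Coalgebra.counit (R := ℂ) (A := Taft p) ⊗ₜ[ℂ] (Taft.k p ^ 2)) := by
  rw [eq_comm, mkQ_eq_j_iff, ofUq_K, ← map_pow, DD.k, ← map_pow]; rfl

end TruncDD

/-! ### The action of the Drinfeld double on the Heisenberg double -/

namespace Taft
variable {p : ℕ} [hp : Fact (2 ≤ p)]

lemma rRegDual_apply (β : Dl p) (b : Taft p) : rRegDual (Taft p) β b =
    TensorProduct.lid ℂ (Taft p) (LinearMap.rTensor (Taft p) β (Coalgebra.comul (R := ℂ) b)) := rfl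

lemma rRegDual_one (b : Taft p) : rRegDual (Taft p) (1 : Dl p) b = b := by
  rw [rRegDual_apply, dual_one_def, Coalgebra.rTensor_counit_comul, TensorProduct.lid_tmul,
    one_smul]

/-- `(b ↼ β) ↼ γ = b ↼ (β γ)` -/
lemma rRegDual_mul (β γ : Dl p) (b : Taft p) :
    rRegDual (Taft p) (β * γ) b = rRegDual (Taft p) γ (rRegDual (Taft p) β b) := by
  let Φ : Taft p ⊗[ℂ] (Taft p ⊗[ℂ] Taft p) →ₗ[ℂ] Taft p :=
    TensorProduct.lid ℂ (Taft p) ∘ₗ TensorProduct.map β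
      ((TensorProduct.lid ℂ (Taft p)).toLinearMap ∘ₗ LinearMap.rTensor (Taft p) γ)
  have h1 : ∀ t : Taft p ⊗[ℂ] Taft p,
      TensorProduct.lid ℂ (Taft p) (LinearMap.rTensor (Taft p) (β * γ : Dl p) t) =
      Φ (TensorProduct.assoc ℂ _ _ _ (LinearMap.rTensor (Taft p) Coalgebra.comul t)) := by
    intro t
    induction t with
    | zero => simp only [map_zero]
    | add s t hs ht => simp only [map_add, hs, ht]
    | tmul x y =>
      rw [LinearMap.rTensor_tmul, LinearMap.rTensor_tmul, dual_mul_def, dualMul_apply]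
      generalize Coalgebra.comul (R := ℂ) x = u
      induction u with
      | zero => simp
      | add s t hs ht => simp only [map_add, TensorProduct.add_tmul, hs, ht]
      | tmul a c => simp [Φ, smul_smul, mul_comm]
  have h2 : ∀ t : Taft p ⊗[ℂ] Taft p, rRegDual (Taft p) γ
      (TensorProduct.lid ℂ (Taft p) (LinearMap.rTensor (Taft p) β t)) =
      Φ (LinearMap.lTensor (Taft p) Coalgebra.comul t) := by
    intro t
    induction t with
    | zero => simp only [map_zero]
    | add s t hs ht => simp only [map_add, hs, ht]
    | tmul x y =>
      rw [LinearMap.rTensor_tmul, TensorProduct.lid_tmul, map_smul, rRegDual_apply]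
      rfl
  rw [rRegDual_apply, rRegDual_apply β, h1, h2, Coalgebra.coassoc_apply]

/-- `adj` as a homomorphism of algebras. -/
def adjHom (p : ℕ) [Fact (2 ≤ p)] : Taft p →ₐ[ℂ] Module.End ℂ (Taft p) :=
  AlgHom.ofLinearMap (adj (Taft p))
    (by
      rw [adj, sweedler_apply, Bialgebra.comul_one, Algebra.TensorProduct.one_def]
      ext a
      change 1 * (a * HopfAlgebra.antipode ℂ 1) = a
      rw [HopfAlgebra.antipode_one, mul_one, one_mul])
    (fun x y => by
      rw [adj]
      refine sweedler_apply_mul _ _ (Bialgebra.comul_mul x y) fun a b a' b' => ?_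
      ext n
      change a * a' * (n * HopfAlgebra.antipode ℂ (b * b')) =
        a * (a' * (n * HopfAlgebra.antipode ℂ b') * HopfAlgebra.antipode ℂ b)
      rw [HopfAlgebra.antipode_mul_antidistrib]
      simp only [mul_assoc])

/-- `actB` as a homomorphism of algebras. -/
def actBHom (p : ℕ) [Fact (2 ≤ p)] : Taft p →ₐ[ℂ] Module.End ℂ (DualTensor (Taft p)) :=
  AlgHom.ofLinearMap (actB (Taft p))
    (by
      rw [actB, sweedler_apply, Bialgebra.comul_one, Algebra.TensorProduct.one_def]
      ext ν n : 3
      change lReg _ 1 ν ⊗ₜ adjHom p 1 n = ν ⊗ₜ n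
      rw [lReg_one, map_one]
      rfl)
    (fun x y => by
      rw [actB]
      refine sweedler_apply_mul _ _ (Bialgebra.comul_mul x y) fun a b a' b' => ?_
      ext ν n : 3
      change lReg _ (a * a') ν ⊗ₜ adjHom p (b * b') n =
        lReg _ a (lReg _ a' ν) ⊗ₜ adjHom p b (adjHom p b' n)
      rw [lReg_mul, map_mul]
      rfl)

/-- `dualAdj` as a homomorphism of algebras. -/
def dualAdjHom (p : ℕ) [Fact (2 ≤ p)] : Dl p →ₐ[ℂ] Module.End ℂ (Dl p) :=
  AlgHom.ofLinearMap (dualAdj (Taft p))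
    (by
      rw [dualAdj, sweedler_apply, dualComul_one, Algebra.TensorProduct.one_def]
      refine LinearMap.ext fun a => ?_
      change (1 * a * dualAntipodeInv _ (1 : Dl p) : Dl p) = a
      rw [dualAntipodeInv_one, mul_one, one_mul])
    (fun x y => by
      rw [dualAdj]
      refine sweedler_apply_mul _ _ (dualComul_mul x y) fun a b a' b' => ?_
      refine LinearMap.ext fun n => ?_
      change (b * b' * n * dualAntipodeInv _ (a * a' : Dl p) : Dl p) =
        b * (b' * n * dualAntipodeInv _ a') * dualAntipodeInv _ a
      rw [dualAntipodeInv_mul]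
      simp only [mul_assoc])

/-- `actDual` as a homomorphism of algebras. -/
def actDualHom (p : ℕ) [Fact (2 ≤ p)] : Dl p →ₐ[ℂ] Module.End ℂ (DualTensor (Taft p)) :=
  AlgHom.ofLinearMap (actDual (Taft p))
    (by
      rw [actDual, sweedler_apply, dualComul_one, Algebra.TensorProduct.one_def]
      ext ν n : 3
      change dualAdjHom p 1 ν ⊗ₜ rRegDual _ (dualAntipodeInv _ (1 : Dl p)) n = ν ⊗ₜ n
      rw [dualAntipodeInv_one, rRegDual_one, map_one]
      rfl)
    (fun x y => by
      rw [actDual]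
      refine sweedler_apply_mul _ _ (dualComul_mul x y) fun a b a' b' => ?_
      ext ν n : 3
      change dualAdjHom p (b * b') ν ⊗ₜ rRegDual _ (dualAntipodeInv _ (a * a' : Dl p)) n =
        dualAdjHom p b (dualAdjHom p b' ν) ⊗ₜ
          rRegDual _ (dualAntipodeInv _ a) (rRegDual _ (dualAntipodeInv _ a') n)
      rw [dualAntipodeInv_mul, rRegDual_mul, map_mul]
      rfl)

/-! The action is inner in the Heisenberg double. -/

/-- Rewrites b ⇀ μ as ⟨μ″, b⟩ μ′, so that exchange relations in ℋ(B*) can be computed from the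
coproduct of μ. -/
lemma lReg_eq_dualComul (b : Taft p) (μ : Dl p) : lReg _ b μ =
    TensorProduct.rid ℂ (Dl p) (LinearMap.lTensor (Dl p) (Module.Dual.eval ℂ (Taft p) b)
      (dualComul (Taft p) μ)) := by
  ext x
  rw [lReg_apply, ← dualDistrib_dualComul]
  generalize dualComul (Taft p) μ = t
  induction t with
  | zero => simp
  | add s t hs ht => simp only [map_add, LinearMap.add_apply, hs, ht]
  | tmul a c => simp [mul_comm]

namespace HH

/-- `a μ = μ' (a ↼ μ'')` in the Heisenberg double. -/
lemma inr_mul_inl (a : Taft p) (μ : Dl p) : (heisTwist p).inr a * (heisTwist p).inl μ =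
    (heisTwist p).of (LinearMap.lTensor (Dl p) ((rRegDual (Taft p)).flip a)
      (dualComul (Taft p) μ)) := by
  have h : (heisTwist p).inr a * (heisTwist p).inl μ =
      (heisTwist p).of (heisLeft (Taft p) a (μ ⊗ₜ 1)) := by
    rw [SkewTwist.inr_apply, SkewTwist.inl_apply, SkewTwist.of_mul, SkewTwist.leftMul_tmul,
      SkewTwist.dualLeft_one, one_mul]
    rfl
  rw [h, heisLeft, sweedler_apply]
  congr 1
  have h2 : ∀ (s : Dl p ⊗[ℂ] Dl p) (t : Taft p ⊗[ℂ] Taft p),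
      LinearMap.lTensor (Dl p)
        ((LinearMap.flip (LinearMap.llcomp ℂ _ _ _ (TensorProduct.lid ℂ (Taft p)).toLinearMap ∘ₗ
          LinearMap.rTensorHom (Taft p)) t)) s =
      TensorProduct.lift ((TensorProduct.mk ℂ (Dl p) (Taft p)) ∘ₗ
        ((TensorProduct.rid ℂ (Dl p)).toLinearMap ∘ₗ
        (LinearMap.lTensorHom (Dl p) ∘ₗ Module.Dual.eval ℂ (Taft p)).flip s)) t := by
    intro s t
    induction t with
    | zero => simp
    | add t t' ht ht' => simp only [map_add, LinearMap.lTensor_add, LinearMap.add_apply, ht, ht']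
    | tmul x y =>
      induction s with
      | zero => simp
      | add s s' hs hs' =>
        simp only [map_add, hs, hs']
        simp
      | tmul u v => simp [TensorProduct.tmul_smul, TensorProduct.smul_tmul']
  refine Eq.trans ?_ (h2 _ (Coalgebra.comul (R := ℂ) a)).symm
  generalize Coalgebra.comul (R := ℂ) a = t
  induction t with
  | zero => simp
  | add t t' ht ht' => simp only [map_add, LinearMap.add_apply, ht, ht']
  | tmul x y =>
    change lReg _ x μ ⊗ₜ (y * 1) = _
    rw [mul_one, lReg_eq_dualComul]
    rfl

/-- `k⁻¹` -/
def kI (p : ℕ) [Fact (2 ≤ p)] : HH p := (heisTwist p).inr (kInv p)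
/-- `ϰ⁻¹` -/
def kapI (p : ℕ) [Fact (2 ≤ p)] : HH p := (heisTwist p).inl (kappaInv p)
/-- `ϰ⁻² F` -/
def N (p : ℕ) [Fact (2 ≤ p)] : HH p := (heisTwist p).inl (kappaInv p ^ 2 * Taft.F)

lemma k_mul_kI : k p * kI p = 1 := by rw [k, kI, ← map_mul, Taft.mul_kInv, map_one]
lemma kI_mul_k : kI p * k p = 1 := by rw [k, kI, ← map_mul, Taft.kInv_mul, map_one]
lemma kappa_mul_kapI : kappa p * kapI p = 1 := by
  rw [kappa, kapI, ← map_mul, Taft.mul_kappaInv, map_one]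
lemma kapI_mul_kappa : kapI p * kappa p = 1 := by
  rw [kappa, kapI, ← map_mul, Taft.kappaInv_mul, map_one]

lemma dualComul_kappaInv : dualComul (Taft p) (kappaInv p) = kappaInv p ⊗ₜ kappaInv p := by
  rw [kappaInv, ← dualComulHom_apply, map_pow, dualComulHom_apply, dualComul_kappa,
    Algebra.TensorProduct.tmul_pow]

lemma dualComul_N : dualComul (Taft p) (kappaInv p ^ 2 * Taft.F : Dl p) =
    (kappaInv p ^ 2) ⊗ₜ (kappaInv p ^ 2 * Taft.F) + (kappaInv p ^ 2 * Taft.F) ⊗ₜ 1 := by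
  rw [dualComul_mul, dualComul_F, sq, dualComul_mul, dualComul_kappaInv,
    Algebra.TensorProduct.tmul_mul_tmul, ← sq, mul_add, Algebra.TensorProduct.tmul_mul_tmul,
    Algebra.TensorProduct.tmul_mul_tmul, kappaInv_sq_mul, mul_one]

lemma inr_mul_kapI (a : Taft p) : (heisTwist p).inr a * kapI p =
    kapI p * (heisTwist p).inr (rRegDual (Taft p) (kappaInv p) a) := by
  rw [kapI, inr_mul_inl, dualComul_kappaInv, LinearMap.lTensor_tmul, LinearMap.flip_apply,
    SkewTwist.inl_mul_inr]

/-- The element ϰ⁻²F is −S*⁻¹(F), with coproduct ϰ⁻² ⊗ ϰ⁻²F + ϰ⁻²F ⊗ 1. Its commutator with a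
produces a ↼ ϰ⁻²F, the term through which F acts on the factor B. -/
lemma inr_mul_N (a : Taft p) : (heisTwist p).inr a * N p =
    kapI p ^ 2 * (heisTwist p).inr (rRegDual (Taft p) (kappaInv p ^ 2 * Taft.F : Dl p) a) +
      N p * (heisTwist p).inr a := by
  rw [N, inr_mul_inl, dualComul_N, map_add, LinearMap.lTensor_tmul, LinearMap.lTensor_tmul,
    LinearMap.flip_apply, LinearMap.flip_apply, rRegDual_one, map_add, ← SkewTwist.inl_mul_inr,
    ← SkewTwist.inl_mul_inr, map_pow]
  rfl

lemma F_eq : F p = kappa p ^ 2 * N p := by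
  rw [F, kappa, N, ← map_pow, ← map_mul, ← mul_assoc, kappa_sq_mul, one_mul]

lemma N_eq : N p = kapI p ^ 2 * F p := by
  rw [F, kapI, N, ← map_pow, ← map_mul]

lemma k_mul_kapI : k p * kapI p = qh p • (kapI p * k p) := by
  rw [k, kapI, SkewTwist.k_mul_inl, heisTwist_conj, lReg_k_kappaInv, map_smul, smul_mul_assoc]

lemma kapI_mul_kI : kapI p * kI p = qh p • (kI p * kapI p) := by
  have h : kI p * (k p * kapI p) * kI p = kI p * (qh p • (kapI p * k p)) * kI p := by
    rw [k_mul_kapI]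
  rwa [← mul_assoc, kI_mul_k, one_mul, mul_smul_comm, smul_mul_assoc, mul_assoc (kI p),
    mul_assoc (kapI p), k_mul_kI, mul_one] at h

lemma kapI_mul_kI_sq : kapI p * kI p ^ 2 = q p • (kI p ^ 2 * kapI p) := by
  rw [sq, ← mul_assoc, kapI_mul_kI, smul_mul_assoc, mul_assoc, kapI_mul_kI, mul_smul_comm,
    smul_smul, mul_assoc, ← sq, qh_sq]

lemma k_mul_N : k p * N p = N p * k p := by
  rw [N_eq, sq, ← mul_assoc, ← mul_assoc, k_mul_kapI, smul_mul_assoc, smul_mul_assoc,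
    mul_assoc (kapI p) (k p), k_mul_kapI, mul_smul_comm, smul_mul_assoc, smul_smul, ← mul_assoc,
    mul_assoc _ (k p), k_mul_F, mul_smul_comm, smul_smul, ← sq, qh_sq,
    mul_inv_cancel₀ (q_ne_zero p), one_smul, ← mul_assoc]

lemma N_mul_kI : N p * kI p = kI p * N p := by
  have h : kI p * (k p * N p) * kI p = kI p * (N p * k p) * kI p := by rw [k_mul_N]
  rwa [← mul_assoc, kI_mul_k, one_mul, mul_assoc (kI p), mul_assoc (N p), k_mul_kI, mul_one] at h

lemma E_mul_kapI : E p * kapI p = kapI p * E p := by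
  have h : kapI p * (E p * kappa p) * kapI p = kapI p * (kappa p * E p) * kapI p := by
    rw [E_mul_kappa]
  rw [← mul_assoc, mul_assoc _ (kappa p), kappa_mul_kapI, mul_one, ← mul_assoc, kapI_mul_kappa,
    one_mul] at h
  exact h.symm

lemma E_mul_N : E p * N p = N p * E p + (q p - (q p)⁻¹)⁻¹ • (kapI p ^ 2 * k p ^ 2) := by
  rw [N_eq, sq, ← mul_assoc, ← mul_assoc, E_mul_kapI, mul_assoc (kapI p) (E p), E_mul_kapI,
    ← mul_assoc, mul_assoc _ (E p), E_mul_F, mul_add, mul_smul_comm, ← mul_assoc]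

lemma k_mul_kappa_sq : k p * kappa p ^ 2 = (q p)⁻¹ • (kappa p ^ 2 * k p) := by
  rw [skew_mul_pow _ _ _ k_mul_kappa, inv_pow, qh_sq]

end HH

/-- `actBHom` on the Heisenberg double. -/
def heisActB (p : ℕ) [Fact (2 ≤ p)] : Taft p →ₐ[ℂ] Module.End ℂ (HH p) :=
  ((heisTwist p).of.conjAlgEquiv ℂ).toAlgHom.comp (actBHom p)

/-- `actDualHom` on the Heisenberg double. -/
def heisActDual (p : ℕ) [Fact (2 ≤ p)] : Dl p →ₐ[ℂ] Module.End ℂ (HH p) :=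
  ((heisTwist p).of.conjAlgEquiv ℂ).toAlgHom.comp (actDualHom p)

lemma heisActB_of (m : Taft p) (t : DualTensor (Taft p)) :
    heisActB p m ((heisTwist p).of t) = (heisTwist p).of (actB _ m t) := rfl

lemma heisActDual_of (μ : Dl p) (t : DualTensor (Taft p)) :
    heisActDual p μ ((heisTwist p).of t) = (heisTwist p).of (actDual _ μ t) := rfl

lemma adj_k (a : Taft p) : adj _ (k p) a = k p * (a * kInv p) := by
  rw [adj, sweedler_apply, comul_k, ← antipode_k]; rfl

lemma antipode_k_sq : HopfAlgebra.antipode ℂ (k p ^ 2) = kInv p ^ 2 := by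
  rw [sq, HopfAlgebra.antipode_mul_antidistrib, antipode_k, ← sq]

lemma adj_k_sq (a : Taft p) : adj _ (k p ^ 2) a = k p ^ 2 * (a * kInv p ^ 2) := by
  rw [adj, sweedler_apply, k_sq_comul, ← antipode_k_sq]; rfl

lemma adj_E (a : Taft p) : adj _ (E p) a = (E p * a - a * E p) * kInv p ^ 2 := by
  rw [adj, sweedler_apply, comul_E, map_add]
  change 1 * (a * HopfAlgebra.antipode ℂ (E p)) + E p * (a * HopfAlgebra.antipode ℂ (k p ^ 2)) = _
  rw [antipode_k_sq, antipode_E, one_mul, mul_neg, sub_mul, mul_assoc, mul_assoc]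
  abel

lemma heisActB_k (x : HH p) : heisActB p (k p) x = HH.k p * x * HH.kI p := by
  induction x using (heisTwist p).induction with
  | ha x y hx hy => rw [map_add, hx, hy, mul_add, add_mul]
  | h μ m =>
    have h : actB _ (k p) (μ ⊗ₜ m) = lReg _ (k p) μ ⊗ₜ (k p * (m * kInv p)) := by
      rw [actB, sweedler_apply, comul_k, ← adj_k]; rfl
    rw [SkewTwist.inl_mul_inr, heisActB_of, h, ← SkewTwist.inl_mul_inr, ← SkewTwist.inl_mul_inr,
      ← mul_assoc (HH.k p), HH.k, SkewTwist.k_mul_inl, map_mul, map_mul]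
    simp only [mul_assoc]
    rfl

/-- On μ # m the part E ⇀ μ is the exchange term of Eμ, and the adjoint action on m is a commutator
with E followed by k⁻². Together they form one commutator in ℋ(B*). -/
lemma heisActB_E (x : HH p) :
    heisActB p (E p) x = (HH.E p * x - x * HH.E p) * HH.kI p ^ 2 := by
  induction x using (heisTwist p).induction with
  | ha x y hx hy => rw [map_add, hx, hy, mul_add, add_mul, ← add_mul]; congr 1; abel
  | h μ m =>
    have h : actB _ (E p) (μ ⊗ₜ m) = μ ⊗ₜ ((E p * m - m * E p) * kInv p ^ 2) +
        lReg _ (E p) μ ⊗ₜ (k p ^ 2 * (m * kInv p ^ 2)) := by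
      rw [actB, sweedler_apply, comul_E, map_add, ← adj_E, ← adj_k_sq]
      change lReg _ 1 μ ⊗ₜ _ + _ = _
      rw [lReg_one]; rfl
    rw [SkewTwist.inl_mul_inr, heisActB_of, h, map_add, ← SkewTwist.inl_mul_inr,
      ← SkewTwist.inl_mul_inr, ← SkewTwist.inl_mul_inr, ← mul_assoc (HH.E p), HH.E,
      SkewTwist.E_mul_inl, heisTwist_derL, heisTwist_twist, heisTwist_derR, map_zero, zero_add,
      HH.kI]
    simp only [map_mul, map_sub, map_pow, sub_mul, mul_sub, add_mul, mul_assoc]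
    abel

lemma rRegDual_neg (μ : Dl p) (a : Taft p) : rRegDual (Taft p) (-μ) a = -rRegDual _ μ a := by
  rw [map_neg, LinearMap.neg_apply]

lemma heisActDual_kappa (x : HH p) :
    heisActDual p kappa x = HH.kappa p * x * HH.kapI p := by
  induction x using (heisTwist p).induction with
  | ha x y hx hy => rw [map_add, hx, hy, mul_add, add_mul]
  | h μ m =>
    have h1 : dualAdj (Taft p) kappa μ = (kappa * μ * kappaInv p : Dl p) := by
      rw [dualAdj, sweedler_apply, dualComul_kappa, ← dualAntipodeInv_kappa]; rfl
    have h : actDual _ kappa (μ ⊗ₜ m) =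
        (kappa * μ * kappaInv p : Dl p) ⊗ₜ rRegDual _ (kappaInv p) m := by
      rw [actDual, sweedler_apply, dualComul_kappa, ← h1, ← dualAntipodeInv_kappa]; rfl
    rw [SkewTwist.inl_mul_inr, heisActDual_of, h, ← SkewTwist.inl_mul_inr,
      ← SkewTwist.inl_mul_inr, mul_assoc (HH.kappa p), mul_assoc ((heisTwist p).inl μ),
      HH.inr_mul_kapI, map_mul, map_mul]
    simp only [mul_assoc]
    rfl

/-- The counterpart for F: the adjoint action on B* gives the commutator of ϰ⁻²F with μ, and
`inr_mul_N` supplies the part that acts on B. -/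
lemma heisActDual_F (x : HH p) :
    heisActDual p F x = HH.kappa p ^ 2 * (HH.N p * x - x * HH.N p) := by
  induction x using (heisTwist p).induction with
  | ha x y hx hy => rw [map_add, hx, hy, ← mul_add]; congr 1; rw [mul_add, add_mul]; abel
  | h μ m =>
    have h0 : dualAntipodeInv (Taft p) (kappa ^ 2 : Dl p) = kappaInv p ^ 2 := by
      rw [sq, dualAntipodeInv_mul, dualAntipodeInv_kappa, ← sq]
    have h1 : dualAdj (Taft p) F μ =
        (F * μ * 1 + kappa ^ 2 * μ * -(kappaInv p ^ 2 * F) : Dl p) := by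
      rw [dualAdj, sweedler_apply, dualComul_F, map_add]
      change (F * μ * dualAntipodeInv _ (1 : Dl p) + kappa ^ 2 * μ * dualAntipodeInv _ F : Dl p) = _
      rw [dualAntipodeInv_one, dualAntipodeInv_F]
    have h2 : dualAdj (Taft p) (kappa ^ 2) μ = (kappa ^ 2 * μ * kappaInv p ^ 2 : Dl p) := by
      rw [dualAdj, sweedler_apply, sq, dualComul_mul, dualComul_kappa,
        Algebra.TensorProduct.tmul_mul_tmul, ← sq, ← h0]; rfl
    have h : actDual _ F (μ ⊗ₜ m) = dualAdj (Taft p) F μ ⊗ₜ rRegDual _ 1 m +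
        dualAdj (Taft p) (kappa ^ 2) μ ⊗ₜ rRegDual _ (-(kappaInv p ^ 2 * F) : Dl p) m := by
      rw [actDual, sweedler_apply, dualComul_F, map_add]
      change dualAdj (Taft p) F μ ⊗ₜ rRegDual _ (dualAntipodeInv _ (1 : Dl p)) m +
        dualAdj (Taft p) (kappa ^ 2) μ ⊗ₜ rRegDual _ (dualAntipodeInv _ F) m = _
      rw [dualAntipodeInv_one, dualAntipodeInv_F]
    rw [SkewTwist.inl_mul_inr, heisActDual_of, h, map_add, ← SkewTwist.inl_mul_inr,
      ← SkewTwist.inl_mul_inr, ← SkewTwist.inl_mul_inr, mul_assoc ((heisTwist p).inl μ),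
      HH.inr_mul_N, rRegDual_one, rRegDual_neg, h1, h2]
    have hF : (heisTwist p).inl F = HH.kappa p ^ 2 * HH.N p := HH.F_eq
    have hN : (heisTwist p).inl (kappaInv p ^ 2 * F : Dl p) = HH.N p := rfl
    have hk : (heisTwist p).inl kappa = HH.kappa p := rfl
    have hk' : (heisTwist p).inl (kappaInv p) = HH.kapI p := rfl
    rw [map_add, map_mul _ _ (-(kappaInv p ^ 2 * F : Dl p)), map_neg, map_neg, hN, mul_one, map_mul,
      map_mul, map_mul, map_mul, map_pow, map_pow, hF, hk, hk']
    simp only [mul_add, add_mul, mul_sub, mul_neg, neg_mul, mul_assoc]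
    abel

/-- The action of the Drinfeld double on the Heisenberg double as a homomorphism of algebras. -/
def doubleActHom (p : ℕ) [Fact (2 ≤ p)] : DD p →ₐ[ℂ] Module.End ℂ (HH p) :=
  doubleLift (heisActDual p) (heisActB p)
    (by
      refine LinearMap.ext fun x => ?_
      simp only [Module.End.mul_apply, LinearMap.smul_apply, heisActB_k, heisActDual_F]
      have h1 : HH.kI p * HH.N p = HH.N p * HH.kI p := HH.N_mul_kI.symm
      simp only [mul_sub, sub_mul, mul_assoc, h1]
      simp only [← mul_assoc, HH.k_mul_kappa_sq]
      simp only [smul_mul_assoc, mul_assoc _ (HH.k p) (HH.N p), HH.k_mul_N, smul_sub]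
      simp only [mul_assoc])
    (by
      refine LinearMap.ext fun x => ?_
      simp only [Module.End.mul_apply, heisActB_k, heisActDual_kappa]
      simp only [mul_assoc, HH.kapI_mul_kI]
      simp only [← mul_assoc, HH.k_mul_kappa, smul_mul_assoc, mul_smul_comm, smul_smul]
      rw [mul_inv_cancel₀ (qh_ne_zero p), one_smul])
    (by
      refine LinearMap.ext fun x => ?_
      have h1 : heisActB p (k p) ^ 2 = heisActB p (k p) * heisActB p (k p) := sq _
      have h2 : heisActDual p kappa ^ 2 = heisActDual p kappa * heisActDual p kappa := sq _
      simp only [h1, h2, Module.End.mul_apply, LinearMap.smul_apply, LinearMap.add_apply,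
        LinearMap.sub_apply, heisActB_k, heisActB_E, heisActDual_F, heisActDual_kappa]
      have e1 : HH.kI p ^ 2 * HH.N p = HH.N p * HH.kI p ^ 2 := by
        rw [sq, mul_assoc, ← HH.N_mul_kI, ← mul_assoc, ← HH.N_mul_kI, mul_assoc]
      have e2 : HH.E p * HH.kappa p ^ 2 = HH.kappa p ^ 2 * HH.E p := by
        rw [sq, ← mul_assoc, HH.E_mul_kappa, mul_assoc, HH.E_mul_kappa, mul_assoc]
      have e3 : HH.kappa p ^ 2 * (HH.kapI p ^ 2 * HH.k p ^ 2) = HH.k p ^ 2 := by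
        rw [← mul_assoc, ← (show Commute (HH.kappa p) (HH.kapI p) from
          HH.kappa_mul_kapI.trans HH.kapI_mul_kappa.symm).mul_pow, HH.kappa_mul_kapI, one_pow,
          one_mul]
      have e4 : HH.kapI p ^ 2 * HH.k p ^ 2 * HH.kI p ^ 2 = HH.kapI p ^ 2 := by
        rw [mul_assoc, ← (show Commute (HH.k p) (HH.kI p) from
          HH.k_mul_kI.trans HH.kI_mul_k.symm).mul_pow, HH.k_mul_kI, one_pow, mul_one]
      -- The Jacobi identity for the commutators with E and N = ϰ⁻²F, where [E,N] = ϰ⁻²k²/(𝔮−𝔮⁻¹)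
      -- and ϰ² commutes with E. After right multiplication by k⁻² the extra term is k²xk⁻² −
      -- ϰ²xϰ⁻², up to the scalar.
      have key : HH.E p * (HH.kappa p ^ 2 * (HH.N p * x - x * HH.N p)) -
          HH.kappa p ^ 2 * (HH.N p * x - x * HH.N p) * HH.E p =
          HH.kappa p ^ 2 * (HH.N p * (HH.E p * x - x * HH.E p) -
            (HH.E p * x - x * HH.E p) * HH.N p) +
          (q p - (q p)⁻¹)⁻¹ • (HH.kappa p ^ 2 * (HH.kapI p ^ 2 * HH.k p ^ 2) * x -
            HH.kappa p ^ 2 * x * (HH.kapI p ^ 2 * HH.k p ^ 2)) := by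
        have h3 : (q p - (q p)⁻¹)⁻¹ • (HH.kapI p ^ 2 * HH.k p ^ 2) =
            HH.E p * HH.N p - HH.N p * HH.E p := by rw [HH.E_mul_N]; abel
        have h4 : (q p - (q p)⁻¹)⁻¹ • (HH.kappa p ^ 2 * (HH.kapI p ^ 2 * HH.k p ^ 2) * x -
            HH.kappa p ^ 2 * x * (HH.kapI p ^ 2 * HH.k p ^ 2)) =
            HH.kappa p ^ 2 * ((q p - (q p)⁻¹)⁻¹ • (HH.kapI p ^ 2 * HH.k p ^ 2)) * x -
            HH.kappa p ^ 2 * x * ((q p - (q p)⁻¹)⁻¹ • (HH.kapI p ^ 2 * HH.k p ^ 2)) := by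
          simp only [smul_sub, mul_smul_comm, smul_mul_assoc]
        rw [h4, h3, ← mul_assoc (HH.E p), e2]
        simp only [mul_sub, sub_mul, mul_assoc]
        abel
      have e5 : ∀ y, HH.kappa p ^ 2 * (HH.N p * y - y * HH.N p) * HH.kI p ^ 2 =
          HH.kappa p ^ 2 * (HH.N p * (y * HH.kI p ^ 2) - y * HH.kI p ^ 2 * HH.N p) := fun y => by
        simp only [mul_sub, sub_mul, mul_assoc, e1]
      rw [key, e3, add_mul, e5, smul_mul_assoc, sub_mul (HH.k p ^ 2 * x),
        mul_assoc (HH.kappa p ^ 2 * x), e4]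
      simp only [sq, mul_assoc])
    (by
      refine LinearMap.ext fun x => ?_
      simp only [Module.End.mul_apply, LinearMap.smul_apply, heisActB_E, heisActDual_kappa]
      have h : HH.E p * (HH.kappa p * x * HH.kapI p) - HH.kappa p * x * HH.kapI p * HH.E p =
          HH.kappa p * (HH.E p * x - x * HH.E p) * HH.kapI p := by
        rw [mul_sub, sub_mul, mul_assoc _ (HH.kapI p), ← HH.E_mul_kapI, mul_assoc (HH.kappa p) x,
          ← mul_assoc (HH.E p), HH.E_mul_kappa]
        simp only [mul_assoc]
      rw [h, mul_assoc, HH.kapI_mul_kI_sq, mul_smul_comm]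
      simp only [mul_assoc])

lemma doubleActHom_of (x y : DualTensor (Taft p)) :
    doubleActHom p ((doubleTwist p).of x) ((heisTwist p).of y) =
      (heisTwist p).of (doubleAct (Taft p) x y) := by
  induction x using TensorProduct.induction_on with
  | zero => simp only [map_zero, LinearMap.zero_apply]
  | add x x' hx hx' => simp only [map_add, LinearMap.add_apply, hx, hx']
  | tmul μ m =>
    rw [← SkewTwist.inl_mul_inr, doubleActHom, doubleLift, SkewTwist.lift_apply]
    rfl

lemma doubleActHom_inl (μ : Dl p) : doubleActHom p ((doubleTwist p).inl μ) = heisActDual p μ := by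
  have h := SkewTwist.linearLift_apply (doubleTwist p) (heisActDual p) (heisActB p) μ 1
  rw [map_one, map_one, mul_one, mul_one] at h
  exact h

lemma doubleActHom_inr (m : Taft p) : doubleActHom p ((doubleTwist p).inr m) = heisActB p m := by
  have h := SkewTwist.linearLift_apply (doubleTwist p) (heisActDual p) (heisActB p) 1 m
  rw [map_one, map_one, one_mul, one_mul] at h
  exact h

end Taft

/-! ### The subalgebra generated by `z`, `∂`, `λ` in the Heisenberg double -/

section
variable {A : Type*} [Ring A] [Algebra ℂ A] {x y y' : A} {c : ℂ}

lemma skew_inv_mul (hc : c ≠ 0) (h : y * x = c • (x * y)) (h₁ : y' * y = 1) (h₂ : y * y' = 1) :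
    y' * x = c⁻¹ • (x * y') := by
  have e : y' * (y * x) * y' = y' * (c • (x * y)) * y' := by rw [h]
  rw [← mul_assoc, h₁, one_mul, mul_smul_comm, smul_mul_assoc, mul_assoc, mul_assoc x, h₂,
    mul_one] at e
  rw [e, smul_smul, inv_mul_cancel₀ hc, one_smul]

lemma skew_mul_pow_eq (hc : c ≠ 0) (h : y * x = c • (x * y)) (n : ℕ) :
    ∃ b : ℂ, b ≠ 0 ∧ (x * y) ^ n = b • (x ^ n * y ^ n) := by
  induction n with
  | zero => exact ⟨1, one_ne_zero, by simp⟩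
  | succ n ih =>
    obtain ⟨b, hb, e⟩ := ih
    refine ⟨b * c ^ n, mul_ne_zero hb (pow_ne_zero _ hc), ?_⟩
    rw [pow_succ (x * y), e, smul_mul_assoc, mul_assoc, ← mul_assoc (y ^ n),
      skew_pow_mul c x y h, smul_mul_assoc, mul_smul_comm, smul_smul, pow_succ, pow_succ]
    simp only [mul_assoc]

lemma skew_pow_mul_pow (h : y * x = c • (x * y)) (m n : ℕ) :
    y ^ m * x ^ n = (c ^ n) ^ m • (x ^ n * y ^ m) :=
  skew_pow_mul _ _ _ (skew_mul_pow c x y h n) m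

end

namespace Taft
variable {p : ℕ}

/-- `𝔮^{1/4}` -/
def qq (p : ℕ) : ℂ := Complex.exp (Complex.I * Real.pi / (4 * p))

lemma qq_ne_zero : qq p ≠ 0 := Complex.exp_ne_zero _

lemma qq_sq : qq p ^ 2 = qh p := by
  rw [qh, qq, ← Complex.exp_nat_mul]; congr 1; push_cast; ring

variable [hp : Fact (2 ≤ p)]

lemma qq_pow : qq p ^ (8 * p) = 1 := by
  rw [show 8 * p = 2 * (4 * p) by ring, pow_mul, qq_sq, qh_pow]

namespace HH

/-- `z` -/
def genZ (p : ℕ) [Fact (2 ≤ p)] : HH p := (-(q p - (q p)⁻¹)) • (E p * kI p ^ 2)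
/-- `∂` -/
def genD (p : ℕ) [Fact (2 ≤ p)] : HH p := (q p - (q p)⁻¹) • F p
/-- `λ` -/
def genLam (p : ℕ) [Fact (2 ≤ p)] : HH p := qq p • (kappa p * k p)

lemma of_zHeis : (heisTwist p).of (zHeis p) = genZ p := by
  rw [zHeis, map_smul, genZ, E, kI, ← map_pow, ← map_mul]
  rfl

lemma of_dHeis : (heisTwist p).of (dHeis p) = genD p := by
  rw [dHeis, map_smul]
  rfl

lemma of_lamHeis : (heisTwist p).of (lamHeis p) = genLam p := by
  rw [lamHeis, map_smul, ← SkewTwist.inl_mul_inr]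
  rfl

lemma kI_mul_kappa : kI p * kappa p = qh p • (kappa p * kI p) := by
  simpa using skew_inv_mul (inv_ne_zero (qh_ne_zero p)) k_mul_kappa kI_mul_k k_mul_kI

lemma kI_mul_F : kI p * F p = q p • (F p * kI p) := by
  simpa using skew_inv_mul (inv_ne_zero (q_ne_zero p)) k_mul_F kI_mul_k k_mul_kI

lemma kI_mul_E : kI p * E p = (q p)⁻¹ • (E p * kI p) :=
  skew_inv_mul (q_ne_zero p) k_mul_E kI_mul_k k_mul_kI

lemma kI_sq_mul_F : kI p ^ 2 * F p = q p ^ 2 • (F p * kI p ^ 2) :=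
  skew_pow_mul _ _ _ kI_mul_F 2

lemma kI_sq_mul_E : kI p ^ 2 * E p = (q p)⁻¹ ^ 2 • (E p * kI p ^ 2) :=
  skew_pow_mul _ _ _ kI_mul_E 2

lemma kI_sq_mul_kappa : kI p ^ 2 * kappa p = q p • (kappa p * kI p ^ 2) := by
  rw [skew_pow_mul _ _ _ kI_mul_kappa 2, qh_sq]

lemma commute_k_kI : Commute (k p) (kI p) := k_mul_kI.trans kI_mul_k.symm

lemma k_sq_mul_kI_sq : k p ^ 2 * kI p ^ 2 = 1 := by
  rw [← commute_k_kI.mul_pow, k_mul_kI, one_pow]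

lemma kI_sq_mul_k_sq : kI p ^ 2 * k p ^ 2 = 1 := by
  rw [← commute_k_kI.symm.mul_pow, kI_mul_k, one_pow]

lemma genZ_pow : genZ p ^ p = 0 := by
  rw [genZ, smul_pow, skew_mul_pow_eq_zero _ _ _ kI_sq_mul_E p, smul_zero]
  rw [E, ← map_pow, Taft.E_pow, map_zero]

lemma genD_pow : genD p ^ p = 0 := by
  rw [genD, smul_pow, F, ← map_pow, Taft.F_pow, map_zero, smul_zero]

/-- In ℋ(B*) the commutator of E and F is a multiple of k²; the factor k⁻² in z turns it into a
scalar. -/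
lemma genD_mul_genZ : genD p * genZ p =
    (q p - (q p)⁻¹) • 1 + (q p ^ 2)⁻¹ • (genZ p * genD p) := by
  have hw := q_sub_inv_ne_zero p
  have h0 := q_ne_zero p
  have h : E p * kI p ^ 2 * F p = q p ^ 2 • (F p * (E p * kI p ^ 2)) +
      (q p ^ 2 * (q p - (q p)⁻¹)⁻¹) • 1 := by
    rw [mul_assoc, kI_sq_mul_F, mul_smul_comm, ← mul_assoc, E_mul_F, add_mul, smul_mul_assoc,
      k_sq_mul_kI_sq, smul_add, smul_smul, mul_assoc]
  rw [genD, genZ, smul_mul_smul_comm, smul_mul_smul_comm, h]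
  match_scalars <;> field_simp
  all_goals ring

lemma genLam_mul_genZ : genLam p * genZ p = genZ p * genLam p := by
  have h0 := q_ne_zero p
  have h1 : kappa p * k p * (E p * kI p ^ 2) = q p • (kappa p * E p * (k p * kI p ^ 2)) := by
    rw [mul_assoc, ← mul_assoc (k p), k_mul_E, smul_mul_assoc, mul_smul_comm]
    simp only [mul_assoc]
  have h2 : E p * kI p ^ 2 * (kappa p * k p) = q p • (kappa p * E p * (k p * kI p ^ 2)) := by
    rw [mul_assoc, ← mul_assoc (kI p ^ 2), kI_sq_mul_kappa, smul_mul_assoc, mul_smul_comm,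
      mul_assoc (kappa p), ← (commute_k_kI.pow_right 2).eq, ← mul_assoc, E_mul_kappa]
  rw [genLam, genZ, smul_mul_smul_comm, smul_mul_smul_comm, h1, h2, mul_comm (qq p)]

lemma genLam_mul_genD : genLam p * genD p = genD p * genLam p := by
  have h1 : kappa p * k p * F p = F p * (kappa p * k p) := by
    rw [mul_assoc, k_mul_F, mul_smul_comm, ← mul_assoc, kappa_mul_F, smul_mul_assoc, smul_smul,
      inv_mul_cancel₀ (q_ne_zero p), one_smul, mul_assoc]
  rw [genLam, genD, smul_mul_smul_comm, smul_mul_smul_comm, h1, mul_comm (qq p)]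

lemma genLam_pow_eq (n : ℕ) :
    genLam p ^ n = (qq p ^ (2 * n) * (qq p)⁻¹ ^ (n * n)) • (kappa p ^ n * k p ^ n) := by
  have h0 := qq_ne_zero (p := p)
  induction n with
  | zero => simp
  | succ n ih =>
    rw [pow_succ, ih, genLam, smul_mul_smul_comm, mul_assoc (kappa p ^ n), ← mul_assoc (k p ^ n),
      skew_pow_mul _ _ _ k_mul_kappa, smul_mul_assoc, mul_smul_comm, smul_smul, mul_assoc (kappa p),
      ← pow_succ, ← mul_assoc, ← pow_succ]
    congr 1
    rw [← qq_sq, show (n + 1) * (n + 1) = n * n + 2 * n + 1 by ring]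
    simp only [inv_pow, mul_add, pow_add, pow_mul]
    field_simp

/-- Reordering (ϰk)^{4p} into ϰ^{4p}k^{4p} produces −1, which the factor 𝔮^{1/4} compensates,
because its 4p-th power is −1. -/
lemma genLam_pow : genLam p ^ (4 * p) = 1 := by
  have h : (qq p ^ (8 * p)) ^ (2 * p) = 1 := by rw [qq_pow, one_pow]
  rw [genLam_pow_eq, kappa, k, ← map_pow, ← map_pow, Taft.kappa_pow, Taft.k_pow, map_one, map_one,
    one_mul, inv_pow, show 4 * p * (4 * p) = 8 * p * (2 * p) by ring, pow_mul _ (8 * p), h,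
    show 2 * (4 * p) = 8 * p by ring, qq_pow]
  simp

/-- The ordered monomials in `∂`, `z`, `λ` are multiples of basis elements. -/
lemma monomial_eq (b a n : ℕ) : ∃ c : ℂ, c ≠ 0 ∧ genD p ^ b * genZ p ^ a * genLam p ^ n =
    c • (heisTwist p).of ((Taft.F ^ b * Taft.kappa ^ n : Dl p) ⊗ₜ
      (Taft.E p ^ a * Taft.k p ^ (n + 2 * a * (4 * p - 1)))) := by
  have hw := q_sub_inv_ne_zero p
  have h0 := q_ne_zero p
  obtain ⟨c₁, hc₁, h₁⟩ := skew_mul_pow_eq (pow_ne_zero 2 (inv_ne_zero h0))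
    (kI_sq_mul_E (p := p)) a
  have hz : genZ p ^ a = ((-(q p - (q p)⁻¹)) ^ a * c₁) • (E p ^ a * kI p ^ (2 * a)) := by
    rw [genZ, smul_pow, h₁, smul_smul, ← pow_mul]
  have hcomm : genZ p ^ a * genLam p ^ n = genLam p ^ n * genZ p ^ a :=
    ((show Commute (genZ p) (genLam p) from genLam_mul_genZ.symm).pow_pow a n).eq
  refine ⟨(q p - (q p)⁻¹) ^ b * ((qq p ^ (2 * n) * (qq p)⁻¹ ^ (n * n)) *
    (((-(q p - (q p)⁻¹)) ^ a * c₁) * (q p ^ a) ^ n)), ?_, ?_⟩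
  · have := qq_ne_zero (p := p)
    have := neg_ne_zero.2 hw
    positivity
  · have e : k p ^ n * (E p ^ a * kI p ^ (2 * a)) =
        (q p ^ a) ^ n • (heisTwist p).inr (Taft.E p ^ a * Taft.k p ^ (n + 2 * a * (4 * p - 1))) := by
      rw [← mul_assoc, skew_pow_mul_pow k_mul_E, smul_mul_assoc, mul_assoc, k, kI, E,
        ← map_pow, ← map_pow, ← map_pow, ← map_mul, ← map_mul, kInv, ← pow_mul (Taft.k p) (4 * p - 1),
        ← pow_add, mul_comm (4 * p - 1)]
    rw [mul_assoc, hcomm, genLam_pow_eq, hz, genD, smul_pow, smul_mul_smul_comm, mul_assoc (_ ^ n),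
      e, mul_smul_comm (_ ^ n : ℂ), smul_smul, smul_mul_smul_comm, ← mul_assoc (F p ^ b),
      ← SkewTwist.inl_mul_inr, map_mul (heisTwist p).inl, map_pow, map_pow,
      mul_assoc (_ * _ : ℂ) (_ * _ : ℂ)]
    rfl

/-- The monomials are nonzero multiples of distinct basis vectors of B* ⊗ B: the exponents b and n
are read off from F^b ϰ^n and a from E^a, while the exponent of k carries no further information. -/
lemma linearIndependent_monomials : LinearIndependent ℂ
    fun x : (Fin p × Fin p) × Fin (4 * p) =>
      genD p ^ (x.1.1 : ℕ) * genZ p ^ (x.1.2 : ℕ) * genLam p ^ (x.2 : ℕ) := by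
  have hp0 := hp.out
  choose c hc h using fun b a n => monomial_eq (p := p) b a n
  let B := (((basis p).map (dualEquiv p).toLinearEquiv).tensorProduct (basis p)).map
    (heisTwist p).of
  let f : (Fin p × Fin p) × Fin (4 * p) → (Fin p × Fin (4 * p)) × (Fin p × Fin (4 * p)) := fun x =>
    ((x.1.1, x.2), (x.1.2, ⟨((x.2 : ℕ) + 2 * (x.1.2 : ℕ) * (4 * p - 1)) % (4 * p),
      Nat.mod_lt _ (by omega)⟩))
  have hf : Function.Injective f := by
    rintro ⟨⟨b, a⟩, n⟩ ⟨⟨b', a'⟩, n'⟩ h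
    simp only [f, Prod.mk.injEq] at h
    obtain ⟨⟨rfl, rfl⟩, rfl, -⟩ := h
    rfl
  convert (B.linearIndependent.comp f hf).units_smul
    (fun x => Units.mk0 (c x.1.1 x.1.2 x.2) (hc _ _ _)) using 1
  funext x
  rw [h]
  change _ = c x.1.1 x.1.2 x.2 • B (f x)
  congr 1
  simp only [B, f, Module.Basis.map_apply, Module.Basis.tensorProduct_apply]
  congr 2
  · exact (toDual_monomial _ _).symm.trans (congrArg (toDual p) (basis_apply (x.1.1, x.2)).symm)
  · rw [basis_apply]
    dsimp only
    conv_lhs => rw [← Nat.div_add_mod ((x.2 : ℕ) + 2 * (x.1.2 : ℕ) * (4 * p - 1)) (4 * p), pow_add,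
      pow_mul, Taft.k_pow, one_pow, one_mul]

/-- The homomorphism from `ℂ_𝔮[z,∂]` to the Heisenberg double. -/
def ofCq (p : ℕ) [Fact (2 ≤ p)] : Cq p →ₐ[ℂ] HH p :=
  Cq.lift (genZ p) (genD p) genZ_pow genD_pow genD_mul_genZ

/-- The homomorphism from `ℂ_𝔮[z,∂] ⊗ ℂ[λ]/(λ^{4p} - 1)` to the Heisenberg double. -/
def ofHqCyc (p : ℕ) [Fact (2 ≤ p)] : HqCyc p (4 * p) →ₐ[ℂ] HH p :=
  HqCyc.lift (ofCq p) (genLam p) genLam_pow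
    (by rw [ofCq, Cq.lift_z]; exact genLam_mul_genZ)
    (by rw [ofCq, Cq.lift_d]; exact genLam_mul_genD)

lemma ofHqCyc_z : ofHqCyc p HqCyc.z = genZ p := (HqCyc.lift_z ..).trans (Cq.lift_z ..)
lemma ofHqCyc_d : ofHqCyc p HqCyc.d = genD p := (HqCyc.lift_d ..).trans (Cq.lift_d ..)
lemma ofHqCyc_lam : ofHqCyc p HqCyc.lam = genLam p := HqCyc.lift_lam ..

end HH
end Taft

/-! ### Bases and dimensions of ℂ_𝔮[z,∂] and H_q sl(2) -/

namespace Cq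
variable (p : ℕ) [hp : Fact (2 ≤ p)]

/-- Solves `d_pow_mul_z` for z∂ⁿ; the spanning argument needs only that such coefficients exist. -/
lemma z_mul_d_pow (n : ℕ) : ∃ c₁ c₂ : ℂ, z p * d p ^ n = c₁ • (d p ^ n * z p) + c₂ • d p ^ (n - 1) := by
  have h0 := q_ne_zero p
  have h := (Cq.weyl p).d_pow_mul_z n
  change d p ^ n * z p = _ • d p ^ (n - 1) + _ • (z p * d p ^ n) at h
  refine ⟨q p ^ (2 * n), -(q p ^ (2 * n) * (qInt p n * q p ^ (1 - n : ℤ) * (q p - (q p)⁻¹))), ?_⟩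
  · rw [h, smul_add, smul_smul, smul_smul, ← mul_pow, mul_inv_cancel₀ h0, one_pow, one_smul]
    module

lemma span_monomials : Submodule.span ℂ
    (Set.range fun x : ℕ × ℕ => d p ^ x.1 * z p ^ x.2) = ⊤ := by
  set s := Submodule.span ℂ (Set.range fun x : ℕ × ℕ => d p ^ x.1 * z p ^ x.2) with hs
  have hmem : ∀ b a, d p ^ b * z p ^ a ∈ s := fun b a => Submodule.subset_span ⟨(b, a), rfl⟩
  have key : ∀ a x : Cq p, x ∈ s → a * x ∈ s := by
    intro a
    have ha : a ∈ Algebra.adjoin ℂ {z p, d p} := adjoin_eq_top ▸ Algebra.mem_top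
    induction ha using Algebra.adjoin_induction with
    | mem a ha =>
      intro x hx
      induction hx using Submodule.span_induction with
      | mem x hx =>
        obtain ⟨⟨b, n⟩, rfl⟩ := hx
        rcases ha with rfl | rfl
        · obtain ⟨c₁, c₂, h⟩ := z_mul_d_pow p b
          dsimp only
          rw [← mul_assoc, h, add_mul, smul_mul_assoc, smul_mul_assoc, mul_assoc, ← pow_succ']
          exact add_mem (Submodule.smul_mem _ _ (hmem _ _)) (Submodule.smul_mem _ _ (hmem _ _))
        · dsimp only
          rw [← mul_assoc, ← pow_succ']
          exact hmem _ _
      | zero => rw [mul_zero]; exact zero_mem _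
      | add x y _ _ hx hy => rw [mul_add]; exact add_mem hx hy
      | smul c x _ hx => rw [mul_smul_comm]; exact Submodule.smul_mem _ _ hx
    | algebraMap r =>
      intro x hx
      rw [← Algebra.smul_def]
      exact Submodule.smul_mem _ _ hx
    | add a b _ _ ha hb => intro x hx; rw [add_mul]; exact add_mem (ha x hx) (hb x hx)
    | mul a b _ _ ha hb => intro x hx; rw [mul_assoc]; exact ha _ (hb _ hx)
  refine top_le_iff.1 fun x _ => ?_
  simpa using key x 1 (by simpa using hmem 0 0)

lemma span_finite_monomials : Submodule.span ℂ
    (Set.range fun x : Fin p × Fin p => d p ^ (x.1 : ℕ) * z p ^ (x.2 : ℕ)) = ⊤ := by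
  rw [← top_le_iff, ← span_monomials, Submodule.span_le]
  rintro _ ⟨⟨b, a⟩, rfl⟩
  dsimp only
  by_cases hb : b < p
  · by_cases ha : a < p
    · exact Submodule.subset_span ⟨(⟨b, hb⟩, ⟨a, ha⟩), rfl⟩
    · rw [show a = p + (a - p) by omega, pow_add, z_pow, zero_mul, mul_zero]
      exact zero_mem _
  · rw [show b = p + (b - p) by omega, pow_add, d_pow, zero_mul, zero_mul]
    exact zero_mem _

/-- Pulled back from the independence in the Heisenberg double, restricted to the monomials without
λ. -/
lemma linearIndependent_monomials : LinearIndependent ℂ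
    fun x : Fin p × Fin p => d p ^ (x.1 : ℕ) * z p ^ (x.2 : ℕ) := by
  have h := Taft.HH.linearIndependent_monomials.comp
    (fun x : Fin p × Fin p => (x, (⟨0, by have := hp.out; omega⟩ : Fin (4 * p))))
    (fun x y h => (Prod.mk.inj h).1)
  refine LinearIndependent.of_comp (Taft.HH.ofCq p).toLinearMap ?_
  convert! h using 1
  funext x
  change Taft.HH.ofCq p (d p ^ (x.1 : ℕ) * z p ^ (x.2 : ℕ)) = _ * _ ^ 0
  rw [map_mul, map_pow, map_pow, pow_zero, mul_one, Taft.HH.ofCq, Cq.lift_z, Cq.lift_d]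

/-- The monomials `∂^b z^a`. -/
def basis : Module.Basis (Fin p × Fin p) ℂ (Cq p) :=
  .mk (linearIndependent_monomials p) (span_finite_monomials p).ge

lemma basis_apply (x : Fin p × Fin p) : basis p x = d p ^ (x.1 : ℕ) * z p ^ (x.2 : ℕ) :=
  Module.Basis.mk_apply ..

lemma finrank_eq : Module.finrank ℂ (Cq p) = p ^ 2 := by
  rw [Module.finrank_eq_card_basis (basis p), Fintype.card_prod, Fintype.card_fin, sq]

end Cq

namespace Cyc
variable (N : ℕ)

lemma natDegree_modulus : (Polynomial.X ^ N - 1 : Polynomial ℂ).natDegree = N :=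
  Polynomial.natDegree_X_pow_sub_C (n := N) (r := (1 : ℂ))

lemma modulus_ne_zero (hN : N ≠ 0) : (Polynomial.X ^ N - 1 : Polynomial ℂ) ≠ 0 :=
  (Polynomial.monic_X_pow_sub_C (1 : ℂ) hN).ne_zero

/-- The powers of `λ`. -/
def basis (hN : N ≠ 0) : Module.Basis (Fin N) ℂ (Cyc N) :=
  (AdjoinRoot.powerBasis (modulus_ne_zero N hN)).basis.reindex
    (finCongr ((AdjoinRoot.powerBasis_dim _).trans (natDegree_modulus N)))

lemma basis_apply (hN : N ≠ 0) (i : Fin N) : basis N hN i = AdjoinRoot.root _ ^ (i : ℕ) := by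
  rw [basis, Module.Basis.reindex_apply, PowerBasis.coe_basis]
  rfl

lemma finrank_eq (hN : N ≠ 0) : Module.finrank ℂ (Cyc N) = N := by
  rw [Module.finrank_eq_card_basis (basis N hN), Fintype.card_fin]

end Cyc

lemma Hq.finrank_eq (p : ℕ) [hp : Fact (2 ≤ p)] : Module.finrank ℂ (Hq p) = 2 * p ^ 3 := by
  rw [Module.finrank_tensorProduct, Cq.finrank_eq,
    Cyc.finrank_eq (2 * p) (by have := hp.out; omega)]
  ring

/-- The basis ∂^b z^a λⁿ goes to an independent family, so z, ∂, λ satisfy no relations in ℋ(B*)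
beyond the expected ones with λ^{4p} = 1. -/
lemma Taft.HH.ofHqCyc_injective (p : ℕ) [hp : Fact (2 ≤ p)] :
    Function.Injective (Taft.HH.ofHqCyc p) := by
  refine injective_of_linearIndependent_basis ((Cq.basis p).tensorProduct
    (Cyc.basis (4 * p) (by have := hp.out; omega))) (Taft.HH.ofHqCyc p).toLinearMap ?_
  convert! Taft.HH.linearIndependent_monomials (p := p) using 1
  funext x
  rw [Function.comp_apply, Module.Basis.tensorProduct_apply, Cq.basis_apply, Cyc.basis_apply]
  rw [AlgHom.toLinearMap_apply, Taft.HH.ofHqCyc, HqCyc.lift_tmul, map_mul, map_pow, map_pow, map_pow, Cyc.lift_root,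
    Taft.HH.ofCq, Cq.lift_z, Cq.lift_d]

/-! ### The truncation of the Heisenberg double -/

section
variable {A : Type*} [Ring A] [Algebra ℂ A]

/-- `x ↦ a x b` for `b a = 1`, `a b = 1`. -/
def conjHom (a b : A) (hba : b * a = 1) (hab : a * b = 1) : A →ₐ[ℂ] A :=
  AlgHom.ofLinearMap (LinearMap.mulLeft ℂ a ∘ₗ LinearMap.mulRight ℂ b)
    (by simp [hab])
    (fun x y => by
      change a * (x * y * b) = a * (x * b) * (a * (y * b))
      rw [mul_assoc a (x * b), mul_assoc x b, ← mul_assoc b, hba, one_mul, mul_assoc x])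

lemma conjHom_apply (a b : A) (hba : b * a = 1) (hab : a * b = 1) (x : A) :
    conjHom a b hba hab x = a * (x * b) := rfl

lemma conjHom_of_skew {a b : A} (hba : b * a = 1) (hab : a * b = 1) {x : A} {c : ℂ}
    (h : a * x = c • (x * a)) : conjHom a b hba hab x = c • x := by
  rw [conjHom_apply, ← mul_assoc, h, smul_mul_assoc, mul_assoc, hab, mul_one]

end

/-! ### The quotient from λ^{4p} = 1 to λ^{2p} = 1 -/

namespace HqCyc
variable (p : ℕ)

/-- The projection `λ^{2p} = 1`. -/
def proj : HqCyc p (4 * p) →ₐ[ℂ] Hq p :=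
  lift (Hq.incl p) (Hq.lam p)
    (by rw [show 4 * p = 2 * p * 2 by ring, pow_mul]
        exact (congrArg (· ^ 2) HqCyc.lam_pow).trans (one_pow 2))
    (HqCyc.lam_comm _) (HqCyc.lam_comm _)

lemma proj_z : proj p z = Hq.z p := lift_z ..
lemma proj_d : proj p d = Hq.d p := lift_d ..
lemma proj_lam : proj p lam = Hq.lam p := lift_lam ..

lemma proj_surjective : Function.Surjective (proj p) := by
  rw [← AlgHom.range_eq_top, ← top_le_iff, ← HqCyc.adjoin_eq_top (p := p) (N := 2 * p),
    Algebra.adjoin_le_iff]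
  rintro _ ((rfl | rfl) | rfl)
  · exact ⟨_, proj_z p⟩
  · exact ⟨_, proj_d p⟩
  · exact ⟨_, proj_lam p⟩

lemma lam_pow_comm (n : ℕ) (x : HqCyc p (4 * p)) : lam ^ n * x = x * lam ^ n :=
  ((show Commute lam x from lam_comm x).pow_left n).eq

/-- The idempotent `(1 + λ^{2p}) / 2`. -/
def idem : HqCyc p (4 * p) := (1 / 2 : ℂ) • (1 + lam ^ (2 * p))

lemma idem_comm (x : HqCyc p (4 * p)) : idem p * x = x * idem p := by
  rw [idem, smul_mul_assoc, mul_smul_comm, add_mul, mul_add, lam_pow_comm, one_mul, mul_one]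

lemma lam_pow_two_mul_idem : lam ^ (2 * p) * idem p = idem p := by
  rw [idem, mul_smul_comm, mul_add, mul_one, ← pow_add, show 2 * p + 2 * p = 4 * p by ring, lam_pow,
    add_comm]

lemma idem_mul_idem : idem p * idem p = idem p := by
  conv_lhs => enter [1]; rw [idem]
  rw [smul_mul_assoc, add_mul, one_mul, lam_pow_two_mul_idem, ← two_smul ℂ, smul_smul]
  norm_num

/-- `λ e + (1 - e)` for the idempotent `e`. -/
def lamLift : HqCyc p (4 * p) := lam * idem p + (1 - idem p)

/-- Powers are taken separately in the two factors cut out by the orthogonal idempotents e and 1 −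
e, with λ commuting with both. -/
lemma lamLift_pow_eq (n : ℕ) : lamLift p ^ n = lam ^ n * idem p + (1 - idem p) := by
  have he := idem_mul_idem p
  induction n with
  | zero => simp
  | succ n ih =>
    have h1 : lam ^ n * idem p * (lam * idem p) = lam ^ (n + 1) * idem p := by
      rw [mul_assoc, ← mul_assoc (idem p), idem_comm p lam, mul_assoc, he, ← mul_assoc, ← pow_succ]
    have h2 : lam ^ n * idem p * (1 - idem p) = 0 := by
      rw [mul_assoc, mul_sub, he, mul_one, sub_self, mul_zero]
    have h3 : (1 - idem p) * (lam * idem p) = 0 := by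
      rw [← idem_comm p lam, ← mul_assoc, sub_mul, he, one_mul, sub_self, zero_mul]
    have h4 : (1 - idem p) * (1 - idem p) = 1 - idem p := by
      rw [mul_sub, sub_mul _ _ (idem p), he, one_mul, sub_self, mul_one, sub_zero]
    rw [pow_succ, ih, lamLift, add_mul, mul_add, mul_add, h1, h2, h3, h4, add_zero, zero_add]

lemma lamLift_pow : lamLift p ^ (2 * p) = 1 := by
  rw [lamLift_pow_eq, lam_pow_two_mul_idem, add_sub_cancel]

lemma lamLift_comm (x : HqCyc p (4 * p)) : lamLift p * x = x * lamLift p := by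
  rw [lamLift, add_mul, mul_add, sub_mul, mul_sub, one_mul, mul_one, mul_assoc, idem_comm,
    ← mul_assoc, lam_comm, mul_assoc]

/-- A homomorphism which is a section of `proj` up to the idempotent. -/
def sectionHom : Hq p →ₐ[ℂ] HqCyc p (4 * p) :=
  lift Algebra.TensorProduct.includeLeft (lamLift p) (lamLift_pow p) (lamLift_comm p _)
    (lamLift_comm p _)

/-- Both sides become multiplicative in x because e is a central idempotent, and the lift of λ
agrees with λ after multiplication by e. -/
lemma idem_mul_section (x : HqCyc p (4 * p)) : idem p * sectionHom p (proj p x) = idem p * x := by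
  have hx : x ∈ Algebra.adjoin ℂ ({z, d} ∪ {lam}) := adjoin_eq_top (p := p) ▸ Algebra.mem_top
  induction hx using Algebra.adjoin_induction with
  | mem x hx =>
    rcases hx with (rfl | rfl) | rfl
    · rw [proj_z]; exact congrArg _ (lift_z ..)
    · rw [proj_d]; exact congrArg _ (lift_d ..)
    · rw [proj_lam]
      refine (congrArg _ (lift_lam ..)).trans ?_
      rw [lamLift, mul_add, mul_sub, mul_one, idem_mul_idem, sub_self, add_zero, ← mul_assoc,
        idem_comm, mul_assoc, idem_mul_idem]
  | algebraMap r => rw [AlgHom.commutes, AlgHom.commutes]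
  | add x y _ _ hx hy => rw [map_add, map_add, mul_add, mul_add, hx, hy]
  | mul x y _ _ hx hy =>
    rw [map_mul, map_mul, ← mul_assoc, hx, idem_comm, mul_assoc, hy, ← mul_assoc, ← idem_comm,
      mul_assoc]

lemma exists_eq_of_proj_eq_zero {x : HqCyc p (4 * p)} (hx : proj p x = 0) :
    ∃ y, x = (lam ^ (2 * p) - 1) * y := by
  have h := idem_mul_section p x
  rw [hx, map_zero, mul_zero, eq_comm] at h
  -- As ex = 0, one has x = (1 − e)x = −½(λ^{2p} − 1)x.
  refine ⟨(-1 / 2 : ℂ) • x, ?_⟩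
  have e : x = (1 - idem p) * x := by rw [sub_mul, one_mul, h, sub_zero]
  conv_lhs => rw [e, idem]
  rw [mul_smul_comm, ← smul_mul_assoc]
  congr 1
  module

end HqCyc

/-! ### The subalgebra generated by z, ∂, λ and its ideal -/

namespace Taft.HH
variable (p : ℕ) [hp : Fact (2 ≤ p)]

/-- `ofHqCyc` as a map to `B* ⊗ B`. -/
def toDT : HqCyc p (4 * p) →ₗ[ℂ] DualTensor (Taft p) :=
  (heisTwist p).of.symm.toLinearMap ∘ₗ (ofHqCyc p).toLinearMap

lemma of_toDT (y : HqCyc p (4 * p)) : (heisTwist p).of (toDT p y) = ofHqCyc p y :=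
  (heisTwist p).of.apply_symm_apply _

lemma toDT_injective : Function.Injective (toDT p) :=
  (heisTwist p).of.symm.injective.comp (ofHqCyc_injective p)

lemma toDT_one : toDT p 1 = dtOne (Taft p) :=
  (heisTwist p).of.injective ((of_toDT p 1).trans (map_one _))

lemma toDT_z : toDT p HqCyc.z = zHeis p :=
  (heisTwist p).of.injective (by rw [of_toDT, ofHqCyc_z, of_zHeis])

lemma toDT_d : toDT p HqCyc.d = dHeis p :=
  (heisTwist p).of.injective (by rw [of_toDT, ofHqCyc_d, of_dHeis])

lemma toDT_lam : toDT p HqCyc.lam = lamHeis p :=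
  (heisTwist p).of.injective (by rw [of_toDT, ofHqCyc_lam, of_lamHeis])

lemma toDT_mul (x y : HqCyc p (4 * p)) :
    toDT p (x * y) = heisMul (Taft p) (toDT p x) (toDT p y) :=
  (heisTwist p).of.injective (by rw [of_toDT, heisMul_eq, of_toDT, of_toDT, map_mul])

lemma range_toDT : LinearMap.range (toDT p) = heisSub p := by
  apply le_antisymm
  · refine le_sInf ?_
    rintro N ⟨h1, hs, hm⟩ _ ⟨y, rfl⟩
    have hy : y ∈ Algebra.adjoin ℂ ({HqCyc.z, HqCyc.d} ∪ {HqCyc.lam}) :=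
      HqCyc.adjoin_eq_top (p := p) ▸ Algebra.mem_top
    induction hy using Algebra.adjoin_induction with
    | mem y hy =>
      apply hs
      rcases hy with (rfl | rfl) | rfl
      · rw [toDT_z]; simp
      · rw [toDT_d]; simp
      · rw [toDT_lam]; simp
    | algebraMap r =>
      rw [Algebra.algebraMap_eq_smul_one, map_smul, toDT_one]
      exact N.smul_mem _ h1
    | add x y _ _ hx hy => rw [map_add]; exact N.add_mem hx hy
    | mul x y _ _ hx hy => rw [toDT_mul]; exact hm _ hx _ hy
  · refine sInf_le ⟨⟨1, toDT_one p⟩, ?_, ?_⟩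
    · rintro _ (rfl | rfl | rfl)
      · exact ⟨_, toDT_z p⟩
      · exact ⟨_, toDT_d p⟩
      · exact ⟨_, toDT_lam p⟩
    · rintro _ ⟨x, rfl⟩ _ ⟨y, rfl⟩
      exact ⟨x * y, toDT_mul p x y⟩

/-- The subalgebra generated by `z`, `∂`, `λ`. -/
def equivSub : HqCyc p (4 * p) ≃ₗ[ℂ] heisSub p :=
  (LinearEquiv.ofInjective _ (toDT_injective p)).trans (LinearEquiv.ofEq _ _ (range_toDT p))

lemma coe_equivSub (y : HqCyc p (4 * p)) : (equivSub p y : DualTensor (Taft p)) = toDT p y := rfl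

/-- The projection from the subalgebra generated by `z`, `∂`, `λ`. -/
def projSub : heisSub p →ₗ[ℂ] Hq p := (HqCyc.proj p).toLinearMap ∘ₗ (equivSub p).symm.toLinearMap

lemma projSub_equivSub (y : HqCyc p (4 * p)) : projSub p (equivSub p y) = HqCyc.proj p y :=
  congrArg (HqCyc.proj p) ((equivSub p).symm_apply_apply y)

lemma projSub_eq {a : heisSub p} {y : HqCyc p (4 * p)} (h : (a : DualTensor (Taft p)) = toDT p y) :
    projSub p a = HqCyc.proj p y := by
  rw [← projSub_equivSub]
  exact congrArg _ (Subtype.ext h)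

lemma iterate_heisMul (n : ℕ) :
    (heisMul (Taft p) (lamHeis p))^[n] (dtOne (Taft p)) = toDT p (HqCyc.lam ^ n) := by
  induction n with
  | zero => rw [pow_zero, toDT_one]; rfl
  | succ n ih => rw [Function.iterate_succ_apply', ih, pow_succ', toDT_mul, toDT_lam]

/-- The kernel of the projection is an ideal containing λ^{2p} − 1, and by
`exists_eq_of_proj_eq_zero` each of its elements is a multiple of λ^{2p} − 1. -/
lemma heisIdeal_eq : heisIdeal p = (LinearMap.ker (HqCyc.proj p).toLinearMap).map (toDT p) := by
  have hgen : (heisMul (Taft p) (lamHeis p))^[2 * p] (dtOne (Taft p)) - dtOne (Taft p) =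
      toDT p (HqCyc.lam ^ (2 * p) - 1) := by
    rw [iterate_heisMul, map_sub, toDT_one]
  apply le_antisymm
  · refine genIdeal_le ?_ ?_
    · rintro _ rfl
      refine ⟨_, ?_, hgen.symm⟩
      rw [SetLike.mem_coe, LinearMap.mem_ker, AlgHom.toLinearMap_apply, map_sub, map_pow, map_one,
        HqCyc.proj_lam, sub_eq_zero]
      exact HqCyc.lam_pow
    · rw [← range_toDT]
      rintro _ ⟨x, rfl⟩ _ ⟨y, hy, rfl⟩
      rw [SetLike.mem_coe, LinearMap.mem_ker, AlgHom.toLinearMap_apply] at hy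
      refine ⟨⟨x * y, ?_, toDT_mul ..⟩, ⟨y * x, ?_, toDT_mul ..⟩⟩
      · rw [SetLike.mem_coe, LinearMap.mem_ker, AlgHom.toLinearMap_apply, map_mul, hy, mul_zero]
      · rw [SetLike.mem_coe, LinearMap.mem_ker, AlgHom.toLinearMap_apply, map_mul, hy, zero_mul]
  · rintro _ ⟨x, hx, rfl⟩
    obtain ⟨y, rfl⟩ := HqCyc.exists_eq_of_proj_eq_zero p hx
    rw [toDT_mul]
    refine mem_genIdeal_mul (range_toDT p ▸ ⟨y, rfl⟩) (subset_genIdeal ?_)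
    exact hgen.symm

lemma ker_projSub :
    LinearMap.ker (projSub p) = (heisIdeal p).comap (heisSub p).subtype := by
  ext a
  obtain ⟨y, rfl⟩ := (equivSub p).surjective a
  rw [LinearMap.mem_ker, projSub_equivSub, Submodule.mem_comap, Submodule.subtype_apply,
    coe_equivSub, heisIdeal_eq, Submodule.mem_map]
  constructor
  · intro h; exact ⟨y, h, rfl⟩
  · rintro ⟨x, hx, h⟩
    rwa [← toDT_injective p h]

lemma projSub_mul (a b c : heisSub p)
    (h : (c : DualTensor (Taft p)) = heisMul (Taft p) a b) :
    projSub p c = projSub p a * projSub p b := by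
  obtain ⟨x, rfl⟩ := (equivSub p).surjective a
  obtain ⟨y, rfl⟩ := (equivSub p).surjective b
  rw [coe_equivSub, coe_equivSub, ← toDT_mul] at h
  rw [projSub_eq p h, map_mul, projSub_equivSub, projSub_equivSub]

/-! The coaction. -/

lemma heisCoact_kI : heisCoact p (kI p) = (doubleTwist p).inr (kInv p) ⊗ₜ kI p := by
  rw [kI, kInv, map_pow, map_pow, map_pow, ← Algebra.TensorProduct.tmul_pow]
  exact congrArg (· ^ _) heisCoact_k

/-- K⁻¹ has two representatives in 𝒟(B): the coaction of z produces k⁻² and that of ∂ produces ϰ².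
They agree in the quotient as inverses of K. -/
lemma mk_kInv : TruncDD.mk p ((doubleTwist p).inr (kInv p) ^ 2) = TruncDD.ofUq p (Uq.KInv p) := by
  have h1 : TruncDD.mk p ((doubleTwist p).inr (kInv p) ^ 2) * TruncDD.ofUq p (Uq.K p) = 1 := by
    rw [TruncDD.ofUq_K, ← map_pow (TruncDD.mk p), ← map_mul, DD.k, ← map_pow (doubleTwist p).inr,
      ← map_pow (doubleTwist p).inr, ← map_mul, kInv_sq_mul, map_one, map_one]
  have h2 : TruncDD.ofUq p (Uq.K p) * TruncDD.ofUq p (Uq.KInv p) = 1 := by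
    rw [← map_mul, Uq.mul_KInv, map_one]
  exact left_inv_eq_right_inv h1 h2

/-- All maps involved are algebra homomorphisms, so the elements y with such a t form a subalgebra,
and a witness for each generator suffices. -/
lemma coact_ofHqCyc (y : HqCyc p (4 * p)) : ∃ t : DD p ⊗[ℂ] HqCyc p (4 * p),
    Algebra.TensorProduct.map (AlgHom.id ℂ (DD p)) (ofHqCyc p) t = heisCoact p (ofHqCyc p y) ∧
    Algebra.TensorProduct.map (TruncDD.mk p) (HqCyc.proj p) t =
      Algebra.TensorProduct.map (TruncDD.ofUq p) (AlgHom.id ℂ (Hq p))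
        (Hq.coact p (HqCyc.proj p y)) := by
  have hy : y ∈ Algebra.adjoin ℂ ({HqCyc.z, HqCyc.d} ∪ {HqCyc.lam}) :=
    HqCyc.adjoin_eq_top (p := p) ▸ Algebra.mem_top
  induction hy using Algebra.adjoin_induction with
  | mem y hy =>
    rcases hy with (rfl | rfl) | rfl
    · refine ⟨(-(q p - (q p)⁻¹)) • (DD.E p * (doubleTwist p).inr (kInv p) ^ 2) ⊗ₜ 1 +
        ((doubleTwist p).inr (kInv p) ^ 2) ⊗ₜ HqCyc.z, ?_, ?_⟩
      · simp only [map_add, map_smul, Algebra.TensorProduct.map_tmul, AlgHom.id_apply, map_one,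
          ofHqCyc_z]
        rw [genZ, map_smul, map_mul, map_pow, heisCoact_E, heisCoact_kI,
          Algebra.TensorProduct.tmul_pow, add_mul, Algebra.TensorProduct.tmul_mul_tmul,
          Algebra.TensorProduct.tmul_mul_tmul, one_mul, k_sq_mul_kI_sq, smul_add, add_comm,
          TensorProduct.tmul_smul]
      · rw [HqCyc.proj_z, show Hq.coact p (Hq.z p) = coactZ (Hq.z p) from
          (Hq.weyl p).coact_z.trans (by
            change Uq.KInv p ⊗ₜ[ℂ] Hq.z p - _ = _
            rw [coactZ, neg_smul]; exact sub_eq_neg_add _ _), coactZ]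
        simp only [map_add, map_smul, Algebra.TensorProduct.map_tmul, AlgHom.id_apply, map_one,
          HqCyc.proj_z, mk_kInv, map_mul, TruncDD.ofUq_E]
    · refine ⟨(q p - (q p)⁻¹) • DD.F p ⊗ₜ 1 + (DD.kappa p ^ 2) ⊗ₜ HqCyc.d, ?_, ?_⟩
      · simp only [map_add, map_smul, Algebra.TensorProduct.map_tmul, AlgHom.id_apply, map_one,
          ofHqCyc_d]
        rw [genD, map_smul, heisCoact_F, smul_add, TensorProduct.tmul_smul]
      · rw [HqCyc.proj_d, show Hq.coact p (Hq.d p) = coactD (Hq.d p) from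
          (Hq.weyl p).coact_d.trans (by
            change Uq.KInv p ⊗ₜ[ℂ] Hq.d p + _ = _
            rw [coactD]; exact add_comm _ _), coactD]
        simp only [map_add, map_smul, Algebra.TensorProduct.map_tmul, AlgHom.id_apply, map_one,
          HqCyc.proj_d, map_pow, TruncDD.ofUq_F, TruncDD.ofUq_KInv]
    -- Before truncation λ is only coinvariant up to ϰk, which becomes 1 in the quotient.
    · refine ⟨DD.c p ⊗ₜ HqCyc.lam, ?_, ?_⟩
      · simp only [Algebra.TensorProduct.map_tmul, AlgHom.id_apply, ofHqCyc_lam]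
        rw [genLam, map_smul, map_mul, heisCoact_kappa, heisCoact_k,
          Algebra.TensorProduct.tmul_mul_tmul, TensorProduct.tmul_smul, DD.c]
      · rw [HqCyc.proj_lam, show Hq.coact p (Hq.lam p) = 1 ⊗ₜ Hq.lam p from
          (Hq.weyl p).coact_cent _ rfl, Algebra.TensorProduct.map_tmul,
          Algebra.TensorProduct.map_tmul, HqCyc.proj_lam, TruncDD.mk_c, map_one, AlgHom.id_apply]
  | algebraMap r =>
    exact ⟨algebraMap ℂ _ r, by simp only [AlgHom.commutes], by simp only [AlgHom.commutes]⟩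
  | add x y _ _ hx hy =>
    obtain ⟨s, hs, hs'⟩ := hx
    obtain ⟨t, ht, ht'⟩ := hy
    exact ⟨s + t, by rw [map_add, map_add, map_add, hs, ht],
      by rw [map_add, map_add, map_add, map_add, hs', ht']⟩
  | mul x y _ _ hx hy =>
    obtain ⟨s, hs, hs'⟩ := hx
    obtain ⟨t, ht, ht'⟩ := hy
    exact ⟨s * t, by rw [map_mul, map_mul, map_mul, hs, ht],
      by rw [map_mul, map_mul, map_mul, map_mul, hs', ht']⟩

lemma coact_compat (a : heisSub p) : ∃ t : DualTensor (Taft p) ⊗[ℂ] heisSub p,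
    (heisSub p).subtype.lTensor (DualTensor (Taft p)) t = doubleComul (Taft p) a ∧
    TensorProduct.map (truncIdeal p).mkQ (projSub p) t =
      (TruncDD.j p).rTensor (Hq p) (Hq.coact p (projSub p a)) := by
  obtain ⟨y, rfl⟩ := (equivSub p).surjective a
  obtain ⟨t, h1, h2⟩ := coact_ofHqCyc p y
  refine ⟨TensorProduct.map (doubleTwist p).of.symm.toLinearMap (equivSub p).toLinearMap t, ?_, ?_⟩
  · have hinj : Function.Injective (TensorProduct.map (doubleTwist p).of.toLinearMap
        (heisTwist p).of.toLinearMap) :=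
      (TensorProduct.congr (doubleTwist p).of (heisTwist p).of).injective
    apply hinj
    rw [← heisCoact_apply, coe_equivSub, of_toDT, ← h1]
    clear h1 h2
    induction t using TensorProduct.induction_on with
    | zero => simp only [map_zero]
    | add s t hs ht => simp only [map_add, hs, ht]
    | tmul a b => rfl
  · rw [projSub_equivSub]
    have e1 : TensorProduct.map (truncIdeal p).mkQ (projSub p)
        (TensorProduct.map (doubleTwist p).of.symm.toLinearMap (equivSub p).toLinearMap t) =
        (TruncDD.equiv p).toLinearMap.rTensor (Hq p)
          (Algebra.TensorProduct.map (TruncDD.mk p) (HqCyc.proj p) t) := by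
      clear h1 h2
      induction t using TensorProduct.induction_on with
      | zero => simp only [map_zero]
      | add s t hs ht => simp only [map_add, hs, ht]
      | tmul a b =>
        rw [TensorProduct.map_tmul, TensorProduct.map_tmul, Algebra.TensorProduct.map_tmul,
          LinearMap.rTensor_tmul]
        exact congrArg _ (projSub_equivSub p b)
    rw [e1, h2]
    generalize Hq.coact p (HqCyc.proj p y) = s
    induction s using TensorProduct.induction_on with
    | zero => simp only [map_zero]
    | add s t hs ht => simp only [map_add, hs, ht]
    | tmul a b => rfl

end Taft.HH

namespace Taft.HH
variable (p : ℕ) [hp : Fact (2 ≤ p)]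

/-! The action. -/

/-- The pairs of an element of the subalgebra generated by `z`, `∂`, `λ` and its projection. -/
def graph : Subalgebra ℂ (HH p × Hq p) := ((ofHqCyc p).prod (HqCyc.proj p)).range

lemma mem_graph (y : HqCyc p (4 * p)) : (ofHqCyc p y, HqCyc.proj p y) ∈ graph p := ⟨y, rfl⟩

lemma genZ_mem_graph : (genZ p, Hq.z p) ∈ graph p :=
  ⟨HqCyc.z, Prod.ext (ofHqCyc_z (p := p)) (HqCyc.proj_z p)⟩

lemma genD_mem_graph : (genD p, Hq.d p) ∈ graph p :=
  ⟨HqCyc.d, Prod.ext (ofHqCyc_d (p := p)) (HqCyc.proj_d p)⟩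

lemma genLam_mem_graph : (genLam p, Hq.lam p) ∈ graph p :=
  ⟨HqCyc.lam, Prod.ext (ofHqCyc_lam (p := p)) (HqCyc.proj_lam p)⟩

lemma map_mem_graph (f : HH p →ₐ[ℂ] HH p) (g : Hq p →ₐ[ℂ] Hq p)
    (hz : (f (genZ p), g (Hq.z p)) ∈ graph p) (hd : (f (genD p), g (Hq.d p)) ∈ graph p)
    (hl : (f (genLam p), g (Hq.lam p)) ∈ graph p) {x : HH p × Hq p} (hx : x ∈ graph p) :
    (f x.1, g x.2) ∈ graph p := by
  obtain ⟨y, rfl⟩ := hx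
  have h : (⊤ : Subalgebra ℂ (HqCyc p (4 * p))) ≤ (graph p).comap
      ((f.comp (ofHqCyc p)).prod (g.comp (HqCyc.proj p))) := by
    rw [← HqCyc.adjoin_eq_top, Algebra.adjoin_le_iff]
    rintro _ ((rfl | rfl) | rfl)
    · change (f (ofHqCyc p _), g (HqCyc.proj p _)) ∈ graph p
      rwa [ofHqCyc_z, HqCyc.proj_z]
    · change (f (ofHqCyc p _), g (HqCyc.proj p _)) ∈ graph p
      rwa [ofHqCyc_d, HqCyc.proj_d]
    · change (f (ofHqCyc p _), g (HqCyc.proj p _)) ∈ graph p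
      rwa [ofHqCyc_lam, HqCyc.proj_lam]
  exact h (Algebra.mem_top (x := y))

lemma kappa_sq_mul_kapI_sq : kappa p ^ 2 * kapI p ^ 2 = 1 := by
  rw [← (show Commute (kappa p) (kapI p) from
    kappa_mul_kapI.trans kapI_mul_kappa.symm).mul_pow, kappa_mul_kapI, one_pow]

lemma kapI_sq_mul_kappa_sq : kapI p ^ 2 * kappa p ^ 2 = 1 := by
  rw [← (show Commute (kapI p) (kappa p) from
    kapI_mul_kappa.trans kappa_mul_kapI.symm).mul_pow, kapI_mul_kappa, one_pow]

/-- `x ↦ k² x k⁻²` -/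
def conjK : HH p →ₐ[ℂ] HH p := conjHom (k p ^ 2) (kI p ^ 2) kI_sq_mul_k_sq k_sq_mul_kI_sq

/-- `x ↦ ϰ² x ϰ⁻²` -/
def conjKappa : HH p →ₐ[ℂ] HH p :=
  conjHom (kappa p ^ 2) (kapI p ^ 2) (kapI_sq_mul_kappa_sq p) (kappa_sq_mul_kapI_sq p)

lemma conjK_genZ : conjK p (genZ p) = q p ^ 2 • genZ p := by
  refine conjHom_of_skew _ _ ?_
  rw [genZ, mul_smul_comm, ← mul_assoc, skew_pow_mul _ _ _ k_mul_E, smul_mul_assoc, mul_assoc,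
    (commute_k_kI.pow_pow 2 2).eq, ← mul_assoc, smul_mul_assoc, smul_comm]

lemma conjK_genD : conjK p (genD p) = (q p ^ 2)⁻¹ • genD p := by
  refine conjHom_of_skew _ _ ?_
  rw [genD, mul_smul_comm, skew_pow_mul _ _ _ k_mul_F, smul_mul_assoc, smul_comm, inv_pow]

lemma conjK_genLam : conjK p (genLam p) = (q p)⁻¹ • genLam p := by
  refine conjHom_of_skew _ _ ?_
  rw [genLam, mul_smul_comm, ← mul_assoc, skew_pow_mul _ _ _ k_mul_kappa, smul_mul_assoc,
    mul_assoc, ((Commute.refl (k p)).pow_left 2).eq, ← mul_assoc, smul_mul_assoc, smul_comm,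
    inv_pow, qh_sq]

lemma kappa_mul_kI : kappa p * kI p = (qh p)⁻¹ • (kI p * kappa p) := by
  rw [kI_mul_kappa, smul_smul, inv_mul_cancel₀ (qh_ne_zero p), one_smul]

lemma kappa_mul_k : kappa p * k p = qh p • (k p * kappa p) := by
  rw [k_mul_kappa, smul_smul, mul_inv_cancel₀ (qh_ne_zero p), one_smul]

lemma kappa_sq_mul_kI_sq : kappa p ^ 2 * kI p ^ 2 = (q p ^ 2)⁻¹ • (kI p ^ 2 * kappa p ^ 2) := by
  rw [skew_pow_mul_pow (kappa_mul_kI p), inv_pow, qh_sq, inv_pow]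

lemma conjKappa_genZ : conjKappa p (genZ p) = (q p ^ 2)⁻¹ • genZ p := by
  refine conjHom_of_skew _ _ ?_
  have h : kappa p ^ 2 * E p = E p * kappa p ^ 2 :=
    ((show Commute (kappa p) (E p) from E_mul_kappa.symm).pow_left 2).eq
  rw [genZ, mul_smul_comm, ← mul_assoc, h, mul_assoc, kappa_sq_mul_kI_sq, mul_smul_comm,
    ← mul_assoc, smul_mul_assoc, smul_comm]

lemma conjKappa_genD : conjKappa p (genD p) = q p ^ 2 • genD p := by
  refine conjHom_of_skew _ _ ?_
  rw [genD, mul_smul_comm, skew_pow_mul _ _ _ kappa_mul_F, smul_mul_assoc, smul_comm]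

lemma conjKappa_genLam : conjKappa p (genLam p) = q p • genLam p := by
  refine conjHom_of_skew _ _ ?_
  rw [genLam, mul_smul_comm, ← mul_assoc, ((Commute.refl (kappa p)).pow_left 2).eq, mul_assoc,
    skew_pow_mul _ _ _ (kappa_mul_k p), mul_smul_comm, smul_mul_assoc, ← mul_assoc, smul_comm,
    qh_sq]

/-- Conjugation by k² scales z, ∂, λ by the same factors as κ; likewise conjugation by ϰ²
corresponds to κ⁻¹. -/
lemma conjK_mem_graph {x : HH p × Hq p} (hx : x ∈ graph p) :
    (conjK p x.1, (Hq.weyl p).kap x.2) ∈ graph p := by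
  refine map_mem_graph p _ _ ?_ ?_ ?_ hx
  · rw [conjK_genZ, show (Hq.weyl p).kap (Hq.z p) = _ from Hq.scale_z _ _ _ (q_inv_pow p)]
    exact (graph p).smul_mem (genZ_mem_graph p) _
  · rw [conjK_genD, show (Hq.weyl p).kap (Hq.d p) = _ from Hq.scale_d _ _ _ (q_inv_pow p)]
    exact (graph p).smul_mem (genD_mem_graph p) _
  · rw [conjK_genLam, show (Hq.weyl p).kap (Hq.lam p) = _ from Hq.scale_lam _ _ _ (q_inv_pow p)]
    exact (graph p).smul_mem (genLam_mem_graph p) _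

lemma conjKappa_mem_graph {x : HH p × Hq p} (hx : x ∈ graph p) :
    (conjKappa p x.1, (Hq.weyl p).kapInv x.2) ∈ graph p := by
  refine map_mem_graph p _ _ ?_ ?_ ?_ hx
  · rw [conjKappa_genZ, show (Hq.weyl p).kapInv (Hq.z p) = _ from Hq.scale_z _ _ _ (q_pow p)]
    exact (graph p).smul_mem (genZ_mem_graph p) _
  · rw [conjKappa_genD, show (Hq.weyl p).kapInv (Hq.d p) = _ from Hq.scale_d _ _ _ (q_pow p), inv_inv]
    exact (graph p).smul_mem (genD_mem_graph p) _
  · rw [conjKappa_genLam, show (Hq.weyl p).kapInv (Hq.lam p) = _ from Hq.scale_lam _ _ _ (q_pow p)]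
    exact (graph p).smul_mem (genLam_mem_graph p) _

lemma doubleActHom_k_sq (x : HH p) : doubleActHom p (DD.k p ^ 2) x = conjK p x := by
  rw [map_pow, sq, Module.End.mul_apply, DD.k, doubleActHom_inr, heisActB_k, heisActB_k, conjK,
    conjHom_apply, sq, sq]
  simp only [mul_assoc]

/-- Substituting Ek⁻² = −z/(𝔮−𝔮⁻¹) into (Ex − xE)k⁻² gives the inner formula that defines E on H_q
sl(2), with conjugation by k² in place of κ. -/
lemma doubleActHom_E (x : HH p) : doubleActHom p (DD.E p) x =
    (q p - (q p)⁻¹)⁻¹ • (x * genZ p - genZ p * conjK p x) := by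
  have hw := q_sub_inv_ne_zero p
  rw [DD.E, doubleActHom_inr, heisActB_E, genZ, conjK, conjHom_apply, smul_mul_assoc,
    mul_smul_comm, ← smul_sub, smul_smul, mul_neg, inv_mul_cancel₀ hw, mul_assoc (E p),
    ← mul_assoc (kI p ^ 2), kI_sq_mul_k_sq, one_mul, neg_smul, one_smul, neg_sub, sub_mul, mul_assoc,
    mul_assoc]

/-- Distributing ϰ² over the commutator with ϰ⁻²F leaves Fx − (ϰ²xϰ⁻²)F, the inner formula for F
with conjugation by ϰ² in place of κ⁻¹. -/
lemma doubleActHom_F (x : HH p) : doubleActHom p (DD.F p) x =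
    (q p - (q p)⁻¹)⁻¹ • (genD p * x - conjKappa p x * genD p) := by
  have hw := q_sub_inv_ne_zero p
  rw [DD.F, doubleActHom_inl, heisActDual_F, genD, conjKappa, conjHom_apply, smul_mul_assoc,
    mul_smul_comm, ← smul_sub, smul_smul, inv_mul_cancel₀ hw, one_smul, mul_assoc (kappa p ^ 2),
    mul_assoc x, ← N_eq, mul_sub, ← mul_assoc (kappa p ^ 2) (N p), ← F_eq]

/-- ϰk acts by conjugation with a multiple of λ, and λ is central in the subalgebra. On the whole of
ℋ(B*) this argument is unavailable, which is why the action descends only on the subalgebra. -/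
lemma doubleActHom_c (y : HqCyc p (4 * p)) :
    doubleActHom p (DD.c p) (ofHqCyc p y) = ofHqCyc p y := by
  have h : kappa p * k p * ofHqCyc p y = ofHqCyc p y * (kappa p * k p) := by
    have h := congrArg (ofHqCyc p) (HqCyc.lam_comm y)
    rw [map_mul, map_mul, ofHqCyc_lam, genLam, smul_mul_assoc, mul_smul_comm] at h
    exact smul_right_injective _ qq_ne_zero h
  rw [DD.c, map_mul, Module.End.mul_apply, DD.k, DD.kappa, doubleActHom_inr, doubleActHom_inl,
    heisActB_k, heisActDual_kappa, ← mul_assoc, ← mul_assoc, h, mul_assoc _ (kappa p * k p),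
    mul_assoc (kappa p), k_mul_kI, mul_one, mul_assoc, kappa_mul_kapI, mul_one]

lemma doubleActHom_eq_of_mk_eq {x x' : DD p} (h : TruncDD.mk p x = TruncDD.mk p x')
    (y : HqCyc p (4 * p)) :
    doubleActHom p x (ofHqCyc p y) = doubleActHom p x' (ofHqCyc p y) := by
  have hx : x - x' ∈ DD.truncI p := by
    rw [← Ideal.Quotient.eq_zero_iff_mem]
    exact (map_sub (TruncDD.mk p) x x').trans (sub_eq_zero.2 h)
  have h0 := DD.map_eq_zero_of_mem
    ((doubleActHom p).toLinearMap.flip (ofHqCyc p y)) (fun x => by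
      rw [LinearMap.flip_apply, LinearMap.flip_apply, AlgHom.toLinearMap_apply,
        AlgHom.toLinearMap_apply, map_mul, Module.End.mul_apply, doubleActHom_c]) hx
  rw [map_sub, sub_eq_zero] at h0
  exact h0

/-- One well-chosen representative is built for each u, multiplicatively from E, k² and F.
Preserving the graph means both that the subalgebra is stable and that the projection intertwines
the two actions. -/
lemma exists_act_mem_graph (u : Uq p) : ∃ x : DD p, TruncDD.mk p x = TruncDD.ofUq p u ∧
    ∀ a ∈ graph p, (doubleActHom p x a.1, (Hq.weyl p).yd.act u a.2) ∈ graph p := by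
  have hu : u ∈ Algebra.adjoin ℂ {Uq.E p, Uq.K p, Uq.F p} := Uq.adjoin_eq_top ▸ Algebra.mem_top
  induction hu using Algebra.adjoin_induction with
  | mem u hu =>
    rcases hu with rfl | rfl | rfl
    · refine ⟨DD.E p, (TruncDD.ofUq_E).symm, fun a ha => ?_⟩
      rw [doubleActHom_E]
      simp only [WeylAlgebra.yd, WeylAlgebra.act_E, WeylAlgebra.opE_apply]
      exact (graph p).smul_mem (sub_mem (mul_mem ha (genZ_mem_graph p))
        (mul_mem (genZ_mem_graph p) (conjK_mem_graph p ha))) _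
    · refine ⟨DD.k p ^ 2, by rw [TruncDD.ofUq_K, map_pow], fun a ha => ?_⟩
      rw [doubleActHom_k_sq]
      simp only [WeylAlgebra.yd, WeylAlgebra.act_K, AlgHom.toLinearMap_apply]
      exact conjK_mem_graph p ha
    · refine ⟨DD.F p, (TruncDD.ofUq_F).symm, fun a ha => ?_⟩
      rw [doubleActHom_F]
      simp only [WeylAlgebra.yd, WeylAlgebra.act_F, WeylAlgebra.opF_apply]
      exact (graph p).smul_mem (sub_mem (mul_mem (genD_mem_graph p) ha)
        (mul_mem (conjKappa_mem_graph p ha) (genD_mem_graph p))) _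
  | algebraMap r =>
    refine ⟨algebraMap ℂ _ r, by rw [AlgHom.commutes, AlgHom.commutes], fun a ha => ?_⟩
    rw [AlgHom.commutes, AlgHom.commutes]
    exact (graph p).smul_mem ha r
  | add u v _ _ hu hv =>
    obtain ⟨x, hx, hx'⟩ := hu
    obtain ⟨y, hy, hy'⟩ := hv
    refine ⟨x + y, by rw [map_add, map_add, hx, hy], fun a ha => ?_⟩
    rw [map_add, map_add]
    exact add_mem (hx' a ha) (hy' a ha)
  | mul u v _ _ hu hv =>
    obtain ⟨x, hx, hx'⟩ := hu
    obtain ⟨y, hy, hy'⟩ := hv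
    refine ⟨x * y, by rw [map_mul, map_mul, hx, hy], fun a ha => ?_⟩
    rw [map_mul, map_mul]
    exact hx' _ (hy' a ha)

lemma act_compat (u : Uq p) (x : DualTensor (Taft p)) (hx : (truncIdeal p).mkQ x = TruncDD.j p u)
    (a : heisSub p) : ∃ c : heisSub p, (c : DualTensor (Taft p)) = doubleAct (Taft p) x a ∧
      projSub p c = (Hq.weyl p).yd.act u (projSub p a) := by
  obtain ⟨y, rfl⟩ := (equivSub p).surjective a
  obtain ⟨x', hx', h⟩ := exists_act_mem_graph p u
  obtain ⟨y', hy'⟩ := h _ (mem_graph p y)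
  have h1 : ofHqCyc p y' = doubleActHom p x' (ofHqCyc p y) := congrArg Prod.fst hy'
  have h2 : HqCyc.proj p y' = (Hq.weyl p).yd.act u (HqCyc.proj p y) := congrArg Prod.snd hy'
  refine ⟨equivSub p y', ?_, by rw [projSub_equivSub, projSub_equivSub, h2]⟩
  apply (heisTwist p).of.injective
  rw [← doubleActHom_of, coe_equivSub, coe_equivSub, of_toDT, of_toDT, h1]
  -- Any other representative x differs by an element of the ideal, which acts as zero on the
  -- subalgebra.
  exact doubleActHom_eq_of_mk_eq p (hx'.trans ((TruncDD.mkQ_eq_j_iff u x).1 hx).symm) y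

end Taft.HH

/-- `(U_q sl(2), H_q sl(2))` as a truncation of the Drinfeld and Heisenberg doubles. -/
def truncation (p : ℕ) [Fact (2 ≤ p)] : Truncation p (Hq.weyl p).yd where
  j := TruncDD.j p
  j_injective := TruncDD.j_injective
  range_j := TruncDD.range_j
  j_one := TruncDD.j_one
  j_E := TruncDD.j_E
  j_F := TruncDD.j_F
  j_K := TruncDD.j_K
  j_mul := TruncDD.j_mul
  j_comul := TruncDD.j_comul
  j_counit := TruncDD.j_counit
  ρ := Taft.HH.projSub p
  ρ_surjective := (HqCyc.proj_surjective p).comp (Taft.HH.equivSub p).symm.surjective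
  ker_ρ := Taft.HH.ker_projSub p
  ρ_one _ h := (Taft.HH.projSub_eq p (h.trans (Taft.HH.toDT_one p).symm)).trans (map_one _)
  ρ_z _ h := (Taft.HH.projSub_eq p (h.trans (Taft.HH.toDT_z p).symm)).trans (HqCyc.proj_z p)
  ρ_d _ h := (Taft.HH.projSub_eq p (h.trans (Taft.HH.toDT_d p).symm)).trans (HqCyc.proj_d p)
  ρ_lam _ h := (Taft.HH.projSub_eq p (h.trans (Taft.HH.toDT_lam p).symm)).trans (HqCyc.proj_lam p)
  ρ_mul := Taft.HH.projSub_mul p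
  act_compat := Taft.HH.act_compat p
  coact_compat := Taft.HH.coact_compat p

end QHeis

end

theorem mainTheorem5 (p : ℕ) [Fact (2 ≤ p)] :
    Module.finrank ℂ (QHeis.Taft p) = 4 * p ^ 2 ∧
    Module.finrank ℂ (QHeis.Uq p) = 2 * p ^ 3 ∧
    Module.finrank ℂ (QHeis.Cq p) = p ^ 2 ∧
    Module.finrank ℂ (QHeis.Hq p) = 2 * p ^ 3 ∧
    ∃ Y : QHeis.YDModuleAlgebra (QHeis.Uq p) (QHeis.Hq p),
      QHeis.ExplicitFormulas p Y ∧
      (∀ Y' : QHeis.YDModuleAlgebra (QHeis.Uq p) (QHeis.Hq p),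
        QHeis.ExplicitFormulas p Y' → Y' = Y) ∧
      Y.BraidedCommutative ∧
      Nonempty (QHeis.Truncation p Y) ∧
      ∃ Z : QHeis.YDModuleAlgebra (QHeis.Uq p) (QHeis.Cq p),
        (∀ u x, QHeis.Hq.incl p (Z.act u x) = Y.act u (QHeis.Hq.incl p x)) ∧
        (∀ x, (QHeis.Hq.incl p).toLinearMap.lTensor (QHeis.Uq p) (Z.coact x) =
          Y.coact (QHeis.Hq.incl p x)) ∧
        Z.BraidedCommutative := by
  refine ⟨QHeis.Taft.finrank_eq, QHeis.Uq.finrank_eq, QHeis.Cq.finrank_eq p,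
    QHeis.Hq.finrank_eq p, (QHeis.Hq.weyl p).yd, QHeis.Hq.explicitFormulas p,
    fun Y' h => h.eq (QHeis.Hq.explicitFormulas p), (QHeis.Hq.weyl p).yd_braidedCommutative,
    ⟨QHeis.truncation p⟩, (QHeis.Cq.weyl p).yd, QHeis.Hq.act_incl p, fun x => ?_,
    (QHeis.Cq.weyl p).yd_braidedCommutative⟩
  exact (QHeis.Hq.coact_incl p x).symm
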